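/- Let $Q=(V,E)$ be a quiver with finitely many edges (loops and multiple edges allowed), with a fixed total order on $E$. Write $\alpha(e),\beta(e)$ for the tail and head of $e\in E$, and let $\overline E=E\sqcup E^\vee$, where $e^\vee$ is the adjoint edge, $\alpha(e^\vee)=\beta(e)$, $\beta(e^\vee)=\alpha(e)$. Let $\mathbf d:V\to\mathbb Z_{\ge 0}$ be a dimension vector. For a commutative ring $k$ and a unit $q\in k^\times$, let $R^v$ be the matrix on $k^{d_v}\otimes k^{d_v}$ with entries $$(R^v)^{ij}_{kl}=q^{\delta_{ij}}\delta_{ik}\delta_{jl}+(q-q^{-1})\theta(i-j)\,\delta_{il}\delta_{jk},\qquad \theta(n)=1\text{ if }n>0,\ 0\text{ otherwise},$$ (upper indices: rows, lower indices: columns). For $u,v\in V$ let $R^{u,v}$ be the matrix on $k^{d_u}\otimes k^{d_v}$ equal to $R^v$ if $u=v$ and to the identity if $u\ne v$. Put $(R_{21})^{ij}_{kl}=R^{ji}_{lk}$ and $\Omega=\sum_{i,j}E^i_j\otimes E^j_i$ (the flip). Let $\mathcal D_q=\mathcal D_q(\operatorname{Mat}_{\mathbf d}(Q))$ be the $k$-algebra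 with generators $a(e)^i_j$ and $\partial(e)^j_i$ for $e\in E$, $1\le i\le d_{\alpha(e)}$, $1\le j\le d_{\beta(e)}$. Form the matrices $A^e=(a(e)^i_j)$ and $D^e=(\partial(e)^j_i)$, write $X^e=A^e$ and $X^{e^\vee}=D^e$, and put $X_1=X\otimes \mathrm{id}$, $X_2=\mathrm{id}\otimes X$. The relations, read entry by entry, are the following. * For $x\in\overline E$, $v=\alpha(x)$, $w=\beta(x)$: if $v\neq w$, $R^vX^x_2X^x_1=X^x_1X^x_2R^w_{21}$; if $v=w$, $R^v_{21}X^x_1R^vX^x_2=X^x_2R^v_{21}X^x_1R^v$. * For $e\in E$, $v=\alpha(e)$, $w=\beta(e)$: if $v\ne w$, $D^e_2(R^v)^{-1}A^e_1=A^e_1R^wD^e_2+\Omega$; if $v=w$, $R^v_{21}D^e_1R^vA^e_2=A^e_2R^v_{21}D^e_1(R^v_{21})^{-1}$. * For $e<f$ in $E$, $y\in\{e,e^\vee\}$ and $x\in\{f,f^\vee\}$: $$X^x_1\,R^{\beta(x),\alpha(y)}\,X^y_2=R^{\alpha(x),\alpha(y)}\,X^y_2\,(R^{\alpha(x),\beta(y)})^{-1}\,X^x_1\,R^{\beta(x),\beta(y)}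 .$$ A *standard monomial* is a product $a_I\partial_J$ with $a_I=a(e_1)^{m_1}_{n_1}\cdots a(e_r)^{m_r}_{n_r}$ and $\partial_J=\partial(f_1)^{o_1}_{p_1}\cdots\partial(f_s)^{o_s}_{p_s}$, where the list $I$ of triples $(e_i,m_i,n_i)$ and the list $J$ of triples $(f_i,o_i,p_i)$ are weakly increasing for the lexicographic order. Let $\operatorname{Mat}_{\mathbf d}(Q)=\prod_{e\in E}\operatorname{Mat}(\mathbb C^{d_{\alpha(e)}},\mathbb C^{d_{\beta(e)}})$ with coordinates $x(e)^i_j$, and let $\mathcal D(\operatorname{Mat}_{\mathbf d}(Q))$ be its algebra of polynomial differential operators. **Theorem.** $\mathcal D_q$ is a flat deformation of $\mathcal D(\operatorname{Mat}_{\mathbf d}(Q))$ with a PBW basis of standard monomials, in the following sense. 1. For every $q\in\mathbb C^\times$ (and $k=\mathbb C$), the standard monomials $a_I\partial_J$ ($I,J$ ordered) form a basis of the vector space $\mathcal D_q$. 2. The algebra $\mathcal D_q$ over $k=\mathbb C[q,q^{-1}]$ is a free $\mathbb C[q,q^{-1}]$-module with basis the standard monomials. For each $q_0\in\mathbb C^\times$,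 setting $q=q_0$ gives a surjective ring homomorphism from it onto the algebra $\mathcal D_{q_0}$ over $\mathbb C$, which sends generators to the corresponding generators and whose kernel is generated by $q-q_0$. 3. The standard monomials with $a(e)^i_j=x(e)^i_j$ and $\partial(e)^j_i=\partial/\partial x(e)^i_j$ form a basis of $\mathcal D(\operatorname{Mat}_{\mathbf d}(Q))$. 4. If $Q$ has no loops, then $a(e)^i_j\mapsto x(e)^i_j$, $\partial(e)^j_i\mapsto\partial/\partial x(e)^i_j$ defines an isomorphism of algebras from $\mathcal D_1$ (the case $k=\mathbb C$, $q=1$) to $\mathcal D(\operatorname{Mat}_{\mathbf d}(Q))$. For an arbitrary $Q$, let $Q'$ be the quiver of the edges that are not loops and $Q''$ the quiver of the loops. Then $\mathcal D_1\cong\mathcal D(\operatorname{Mat}_{\mathbf d}(Q'))\otimes_{\mathbb C}\mathcal O(T^*\operatorname{Mat}_{\mathbf d}(Q''))$ as algebras, by the isomorphism that sends $a(e)^i_j$, $\partial(e)^j_i$ to $x(e)^i_j$, $\partial/\partial x(e)^i_j$ if $e$ is not a loop, and to $x(e)^i_j$ and its conjugate momentum if $e$ is a loop. -/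

import Mathlib

open scoped TensorProduct Kronecker LaurentPolynomial

noncomputable section

namespace QuiverDq

/-- A quiver with vertex set `V` and edge set `E`; `tail e` and `head e` are the tail
`α(e)` and the head `β(e)` of the edge `e`. -/
structure EdgeQuiver (V E : Type*) where
  tail : E → V
  head : E → V

namespace EdgeQuiver

variable {V E : Type*} (Q : EdgeQuiver V E)

/-- Tail of an edge of the doubled quiver: `Sum.inl e` stands for `e` and `Sum.inr e` for the
adjoint edge `e^∨`, which runs in the opposite direction. -/
def src : E ⊕ E → V
  | Sum.inl e => Q.tail e
  | Sum.inr e => Q.head e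

/-- Head of an edge of the doubled quiver. -/
def tgt : E ⊕ E → V
  | Sum.inl e => Q.head e
  | Sum.inr e => Q.tail e

end EdgeQuiver

/-- The edge of the quiver that underlies an edge of the doubled quiver. -/
def underlying {E : Type*} : E ⊕ E → E
  | Sum.inl e => e
  | Sum.inr e => e

/-! ### The R-matrix -/

section RMatrix

variable {k : Type*} [CommRing k]

/-- `R^{ij}_{kl} = q^{δ_ij} δ_ik δ_jl + (q - q⁻¹) θ(i - j) δ_il δ_jk`. -/
def rCoeff (q : kˣ) (i j k' l : ℕ) : k :=
  (if i = k' ∧ j = l then (if i = j then (q : k) else 1) else 0) +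
    (if j < i ∧ i = l ∧ j = k' then (q : k) - ((q⁻¹ : kˣ) : k) else 0)

/-- `(R⁻¹)^{ij}_{kl} = q^{-δ_ij} δ_ik δ_jl - (q - q⁻¹) θ(i - j) δ_il δ_jk`. -/
def rInvCoeff (q : kˣ) (i j k' l : ℕ) : k :=
  (if i = k' ∧ j = l then (if i = j then ((q⁻¹ : kˣ) : k) else 1) else 0) -
    (if j < i ∧ i = l ∧ j = k' then (q : k) - ((q⁻¹ : kˣ) : k) else 0)

variable {V : Type*} [DecidableEq V] (d : V → ℕ)

/-- The matrix `R` acting on `k^{d u} ⊗ k^{d v}`: it is the R-matrix `R^v` of `gl_{d v}` if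
`u = v`, and the identity if `u ≠ v` (representations that sit at different vertices
braid trivially). The row index is the upper pair `(i, j)`, the column index the lower one. -/
def matR (q : kˣ) (u v : V) :
    Matrix (Fin (d u) × Fin (d v)) (Fin (d u) × Fin (d v)) k :=
  Matrix.of fun r c =>
    if u = v then rCoeff q r.1 r.2 c.1 c.2 else if r = c then 1 else 0

/-- The matrix `R⁻¹`, with the same convention for `u ≠ v`. -/
def matRInv (q : kˣ) (u v : V) :
    Matrix (Fin (d u) × Fin (d v)) (Fin (d u) × Fin (d v)) k :=
  Matrix.of fun r c =>
    if u = v then rInvCoeff q r.1 r.2 c.1 c.2 else if r = c then 1 else 0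

/-- `R_21`, that is `(R_21)^{ij}_{kl} = R^{ji}_{lk}`. -/
def matR21 (q : kˣ) (u v : V) :
    Matrix (Fin (d u) × Fin (d v)) (Fin (d u) × Fin (d v)) k :=
  (matR d q v u).submatrix Prod.swap Prod.swap

/-- `(R_21)⁻¹ = (R⁻¹)_21`. -/
def matR21Inv (q : kˣ) (u v : V) :
    Matrix (Fin (d u) × Fin (d v)) (Fin (d u) × Fin (d v)) k :=
  (matRInv d q v u).submatrix Prod.swap Prod.swap

end RMatrix

/-! ### The braided quiver differential operator algebra -/

section Algebra

variable {V E : Type*} [DecidableEq V] [LinearOrder E] (Q : EdgeQuiver V E) (d : V → ℕ)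

/-- The generators: a pair of indices for every edge of the doubled quiver. The generator
`⟨Sum.inl e, i, j⟩` is `a(e)^i_j` and `⟨Sum.inr e, k, l⟩` is `∂(e)^k_l`. -/
abbrev Gen : Type _ := Σ x : E ⊕ E, Fin (d (Q.src x)) × Fin (d (Q.tgt x))

variable {k : Type*} [CommRing k]

variable (k) in
/-- The matrix of free generators of the edge `x` of the doubled quiver, with rows indexed by
the tail and columns by the head. -/
def genMat (x : E ⊕ E) :
    Matrix (Fin (d (Q.src x))) (Fin (d (Q.tgt x))) (FreeAlgebra k (Gen Q d)) :=
  Matrix.of fun i j => FreeAlgebra.ι k (⟨x, i, j⟩ : Gen Q d)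

variable (k) in
/-- `A_1 = A ⊗ id`, where the identity has size `m`. -/
def gen1 (x : E ⊕ E) (m : ℕ) : Matrix (Fin (d (Q.src x)) × Fin m)
    (Fin (d (Q.tgt x)) × Fin m) (FreeAlgebra k (Gen Q d)) :=
  genMat Q d k x ⊗ₖ (1 : Matrix (Fin m) (Fin m) (FreeAlgebra k (Gen Q d)))

variable (k) in
/-- `A_2 = id ⊗ A`, where the identity has size `m`. -/
def gen2 (x : E ⊕ E) (m : ℕ) : Matrix (Fin m × Fin (d (Q.src x)))
    (Fin m × Fin (d (Q.tgt x))) (FreeAlgebra k (Gen Q d)) :=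
  (1 : Matrix (Fin m) (Fin m) (FreeAlgebra k (Gen Q d))) ⊗ₖ genMat Q d k x

variable (k) in
/-- `A_1^e`, with entries `a(e)^i_j`. -/
def matA1 (e : E) (m : ℕ) : Matrix (Fin (d (Q.tail e)) × Fin m)
    (Fin (d (Q.head e)) × Fin m) (FreeAlgebra k (Gen Q d)) :=
  gen1 Q d k (Sum.inl e) m

variable (k) in
/-- `A_2^e`, with entries `a(e)^i_j`. -/
def matA2 (e : E) (m : ℕ) : Matrix (Fin m × Fin (d (Q.tail e)))
    (Fin m × Fin (d (Q.head e))) (FreeAlgebra k (Gen Q d)) :=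
  gen2 Q d k (Sum.inl e) m

variable (k) in
/-- `D_1^e`, with entries `∂(e)^i_j`. -/
def matD1 (e : E) (m : ℕ) : Matrix (Fin (d (Q.head e)) × Fin m)
    (Fin (d (Q.tail e)) × Fin m) (FreeAlgebra k (Gen Q d)) :=
  gen1 Q d k (Sum.inr e) m

variable (k) in
/-- `D_2^e`, with entries `∂(e)^i_j`. -/
def matD2 (e : E) (m : ℕ) : Matrix (Fin m × Fin (d (Q.head e)))
    (Fin m × Fin (d (Q.tail e))) (FreeAlgebra k (Gen Q d)) :=
  gen2 Q d k (Sum.inr e) m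

/-- A scalar matrix, seen as a matrix over the free algebra. -/
def scal {m n : Type*} (M : Matrix m n k) : Matrix m n (FreeAlgebra k (Gen Q d)) :=
  M.map (algebraMap k (FreeAlgebra k (Gen Q d)))

variable (k) in
/-- `Ω = ∑ E^i_j ⊗ E^j_i`, the flip of the two tensor factors. -/
def flipMat (m n : ℕ) : Matrix (Fin m × Fin n) (Fin n × Fin m) (FreeAlgebra k (Gen Q d)) :=
  Matrix.of fun r c => if r.1 = c.2 ∧ r.2 = c.1 then 1 else 0

/-- The defining relations, each one read entry by entry (row `r`, column `c`).
With `v`, `w` the tail and head of the edge in question they are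

* `edge`: `R^v A_2 A_1 = A_1 A_2 R_21^w`, on an edge of the doubled quiver that is not a loop;
* `loop`: `R_21^v A_1 R^v A_2 = A_2 R_21^v A_1 R^v` on a loop of the doubled quiver;
* `cross_edge`: `D_2 (R^v)⁻¹ A_1 = A_1 R^w D_2 + Ω` if `e` is not a loop;
* `cross_loop`: `R_21^v D_1 R^v A_2 = A_2 R_21^v D_1 (R_21^v)⁻¹` if `e` is a loop;
* `braided`: for edges `y`, `x` of the doubled quiver that lie over `e < f` respectively,
  `A^x_1 R A^y_2 = R A^y_2 R⁻¹ A^x_1 R`, where the four scalar matrices belong to the pairs of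
  vertices `(head x, tail y)`, `(tail x, tail y)`, `(tail x, head y)`, `(head x, head y)`, and
  each of them is the identity unless the two vertices of its pair coincide. Inserting the
  possible coincidences gives the relations between two edges that have no common vertex
  (`A^f_1 A^e_2 = A^e_2 A^f_1`), that are parallel (`A^f_1 A^e_2 = R^v A^e_2 A^f_1 R^w`),
  opposite (`A^f_1 R^v A^e_2 = A^e_2 (R^w)⁻¹ A^f_1`), composable, loops, and so on. -/
inductive Rel (q : kˣ) : FreeAlgebra k (Gen Q d) → FreeAlgebra k (Gen Q d) → Prop
  | edge (x : E ⊕ E) (h : Q.src x ≠ Q.tgt x)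
      (r : Fin (d (Q.src x)) × Fin (d (Q.src x)))
      (c : Fin (d (Q.tgt x)) × Fin (d (Q.tgt x))) :
      Rel q
        ((scal Q d (matR d q (Q.src x) (Q.src x)) * gen2 Q d k x (d (Q.src x)) *
          gen1 Q d k x (d (Q.tgt x))) r c)
        ((gen1 Q d k x (d (Q.src x)) * gen2 Q d k x (d (Q.tgt x)) *
          scal Q d (matR21 d q (Q.tgt x) (Q.tgt x))) r c)
  | loop (x : E ⊕ E) (h : Q.src x = Q.tgt x)
      (r : Fin (d (Q.src x)) × Fin (d (Q.src x)))
      (c : Fin (d (Q.tgt x)) × Fin (d (Q.tgt x))) :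
      Rel q
        ((scal Q d (matR21 d q (Q.src x) (Q.src x)) * gen1 Q d k x (d (Q.src x)) *
          scal Q d (matR d q (Q.tgt x) (Q.src x)) * gen2 Q d k x (d (Q.tgt x))) r c)
        ((gen2 Q d k x (d (Q.src x)) * scal Q d (matR21 d q (Q.src x) (Q.tgt x)) *
          gen1 Q d k x (d (Q.tgt x)) * scal Q d (matR d q (Q.tgt x) (Q.tgt x))) r c)
  | cross_edge (e : E) (h : Q.tail e ≠ Q.head e)
      (r : Fin (d (Q.tail e)) × Fin (d (Q.head e)))
      (c : Fin (d (Q.head e)) × Fin (d (Q.tail e))) :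
      Rel q
        ((matD2 Q d k e (d (Q.tail e)) *
          scal Q d (matRInv d q (Q.tail e) (Q.tail e)) *
          matA1 Q d k e (d (Q.tail e))) r c)
        ((matA1 Q d k e (d (Q.head e)) *
          scal Q d (matR d q (Q.head e) (Q.head e)) *
          matD2 Q d k e (d (Q.head e)) +
          flipMat Q d k (d (Q.tail e)) (d (Q.head e))) r c)
  | cross_loop (e : E) (h : Q.tail e = Q.head e)
      (r : Fin (d (Q.head e)) × Fin (d (Q.tail e)))
      (c : Fin (d (Q.tail e)) × Fin (d (Q.head e))) :
      Rel q
        ((scal Q d (matR21 d q (Q.head e) (Q.tail e)) *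
          matD1 Q d k e (d (Q.tail e)) *
          scal Q d (matR d q (Q.tail e) (Q.tail e)) *
          matA2 Q d k e (d (Q.tail e))) r c)
        ((matA2 Q d k e (d (Q.head e)) *
          scal Q d (matR21 d q (Q.head e) (Q.head e)) *
          matD1 Q d k e (d (Q.head e)) *
          scal Q d (matR21Inv d q (Q.tail e) (Q.head e))) r c)
  | braided (x y : E ⊕ E) (h : underlying y < underlying x)
      (r : Fin (d (Q.src x)) × Fin (d (Q.src y)))
      (c : Fin (d (Q.tgt x)) × Fin (d (Q.tgt y))) :
      Rel q
        ((gen1 Q d k x (d (Q.src y)) * scal Q d (matR d q (Q.tgt x) (Q.src y)) *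
          gen2 Q d k y (d (Q.tgt x))) r c)
        ((scal Q d (matR d q (Q.src x) (Q.src y)) * gen2 Q d k y (d (Q.src x)) *
          scal Q d (matRInv d q (Q.src x) (Q.tgt y)) * gen1 Q d k x (d (Q.tgt y)) *
          scal Q d (matR d q (Q.tgt x) (Q.tgt y))) r c)

/-- The braided quiver differential operator algebra `D_q(Mat_d(Q))` over `k`, for a unit `q`
of `k`: the quotient of the free algebra by the two-sided ideal of the relations. -/
abbrev Dq (q : kˣ) : Type _ := RingQuot (Rel Q d q)

/-- The generator `a(e)^i_j` of `D_q(Mat_d(Q))`. -/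
def aGen (q : kˣ) (e : E) (i : Fin (d (Q.tail e))) (j : Fin (d (Q.head e))) : Dq Q d q :=
  RingQuot.mkAlgHom k (Rel Q d q) (FreeAlgebra.ι k (⟨Sum.inl e, i, j⟩ : Gen Q d))

/-- The generator `∂(e)^i_j` of `D_q(Mat_d(Q))`. -/
def dGen (q : kˣ) (e : E) (i : Fin (d (Q.head e))) (j : Fin (d (Q.tail e))) : Dq Q d q :=
  RingQuot.mkAlgHom k (Rel Q d q) (FreeAlgebra.ι k (⟨Sum.inr e, i, j⟩ : Gen Q d))

end Algebra

/-! ### Standard monomials -/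

section Monomials

variable {E : Type*}

/-- Triples `(e, m, n)` with `m < rows e` and `n < cols e`. -/
abbrev Triple (rows cols : E → ℕ) : Type _ := Σ e : E, Fin (rows e) × Fin (cols e)

/-- The lexicographic order on triples. -/
def Triple.LE [LinearOrder E] {rows cols : E → ℕ} (x y : Triple rows cols) : Prop :=
  x.1 < y.1 ∨ (x.1 = y.1 ∧ ((x.2.1 : ℕ) < (y.2.1 : ℕ) ∨
    ((x.2.1 : ℕ) = (y.2.1 : ℕ) ∧ (x.2.2 : ℕ) ≤ (y.2.2 : ℕ))))

/-- Ordered lists of triples. -/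
abbrev OrderedList [LinearOrder E] (rows cols : E → ℕ) : Type _ :=
  {L : List (Triple rows cols) // L.Pairwise Triple.LE}

/-- The pairs `(I, J)` that index the standard monomials `a_I ∂_J`. -/
abbrev StdIndex {V : Type*} [LinearOrder E] (Q : EdgeQuiver V E) (d : V → ℕ) : Type _ :=
  OrderedList (fun e => d (Q.tail e)) (fun e => d (Q.head e)) ×
    OrderedList (fun e => d (Q.head e)) (fun e => d (Q.tail e))

/-- The monomial `a_I ∂_J` in an algebra `A` with given elements `a(e)^i_j` and `∂(e)^i_j`. -/
def stdMonomial {V : Type*} [LinearOrder E] (Q : EdgeQuiver V E) (d : V → ℕ) {A : Type*}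
    [Monoid A]
    (a : ∀ e : E, Fin (d (Q.tail e)) → Fin (d (Q.head e)) → A)
    (D : ∀ e : E, Fin (d (Q.head e)) → Fin (d (Q.tail e)) → A) (s : StdIndex Q d) : A :=
  (s.1.1.map fun x => a x.1 x.2.1 x.2.2).prod * (s.2.1.map fun x => D x.1 x.2.1 x.2.2).prod

end Monomials

/-! ### Differential operators on an affine space -/

section Classical

/-- The algebra of polynomial differential operators on the affine space with coordinates
indexed by `σ`: the subalgebra of the linear endomorphisms of `ℂ[x_s : s ∈ σ]` that is generated
by the multiplications by the coordinates and by the partial derivatives. -/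
def diffOps (σ : Type*) : Subalgebra ℂ (Module.End ℂ (MvPolynomial σ ℂ)) :=
  Algebra.adjoin ℂ
    (Set.range (fun s : σ => LinearMap.mulLeft ℂ (MvPolynomial.X s : MvPolynomial σ ℂ)) ∪
      Set.range (fun s : σ =>
        ((MvPolynomial.pderiv s : Derivation ℂ (MvPolynomial σ ℂ) (MvPolynomial σ ℂ)) :
          MvPolynomial σ ℂ →ₗ[ℂ] MvPolynomial σ ℂ)))

/-- Multiplication by the coordinate `x_s`. -/
def mulX {σ : Type*} (s : σ) : diffOps σ :=
  ⟨LinearMap.mulLeft ℂ (MvPolynomial.X s : MvPolynomial σ ℂ),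
    Algebra.subset_adjoin (Or.inl ⟨s, rfl⟩)⟩

/-- The partial derivative `∂/∂x_s`. -/
def partialX {σ : Type*} (s : σ) : diffOps σ :=
  ⟨((MvPolynomial.pderiv s : Derivation ℂ (MvPolynomial σ ℂ) (MvPolynomial σ ℂ)) :
      MvPolynomial σ ℂ →ₗ[ℂ] MvPolynomial σ ℂ),
    Algebra.subset_adjoin (Or.inr ⟨s, rfl⟩)⟩

variable {V E : Type*} (Q : EdgeQuiver V E) (d : V → ℕ)

/-- The coordinates `a(e)^i_j` of the affine space `Mat_d(Q)`. -/
abbrev Coord : Type _ := Triple (fun e => d (Q.tail e)) (fun e => d (Q.head e))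

/-- The coordinates that belong to edges which are not loops. -/
abbrev EdgeCoord : Type _ := {c : Coord Q d // Q.tail c.1 ≠ Q.head c.1}

/-- The coordinates that belong to loops. -/
abbrev LoopCoord : Type _ := {c : Coord Q d // Q.tail c.1 = Q.head c.1}

/-- The polynomial functions on the cotangent bundle of the loop part of `Mat_d(Q)`:
`Sum.inl c` is the coordinate `c`, `Sum.inr c` is the conjugate momentum. -/
abbrev LoopCotangent : Type _ := MvPolynomial (LoopCoord Q d ⊕ LoopCoord Q d) ℂ

end Classical

/-- The unit `q` of the ring `ℂ[q, q⁻¹]`. -/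
def qUnit : (ℂ[T;T⁻¹])ˣ where
  val := LaurentPolynomial.T 1
  inv := LaurentPolynomial.T (-1)
  val_inv := by rw [← LaurentPolynomial.T_add]; simp
  inv_val := by rw [← LaurentPolynomial.T_add]; simp

end QuiverDq

end

/-!
The relations of `D_q` are triangular. Solved for a product of two generators in the wrong order,
they express it by products in the right order and by products that are smaller in a well-founded
sense, over every ring and for every unit `q`. Hence the standard monomials always span
(`span_stdMonomial`), and what has to be shown is their independence.

*Independence at `q = 1`.* There all R-matrices are identities. The generators of an edge that is
not a loop act by multiplications and partial derivatives, those of a loop commute with everything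
else. The operators by which standard monomials act are distinguished by their symbols
(`eq_zero_of_sum_stdSymbol`). Together with spanning, this gives the isomorphisms of the fibre at
`q = 1` with the classical algebras (`exists_algEquiv_diffOps`, `exists_algEquiv_classicalFibre`).
The classical basis of differential operators is the case of a quiver with disjoint edges
(`exists_basis_diffOps`).

*Quivers without loops over `ℂ[q, q⁻¹]`.* Let `t = q - 1`. A relation between the standard
monomials reduces at `q = 1` to the trivial one, so its coefficients are divisible by `t`; the
danger is that the quotient by `t` is no longer a relation, that is, `t`-torsion. The images of
torsion elements form a two-sided ideal in the fibre at `q = 1`, which is a Weyl algebra, hence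
simple (`one_mem_of_ideal`). If this ideal were not zero, it would contain `1`, and then an
element of the form `1 + t y` would be torsion. This is excluded by a linear functional on `D_q` with value `1` at `1`
(`map_eq_zero_of_torsion`).

*The functional.* It is the vacuum expectation value of a representation
(`exists_functional_of_loopless`). For a single edge, the quantized coordinate ring of the matrices
carries derivations with a twisted Leibniz rule. They are read off from a block triangular
representation of this ring (`edgeRel_blockX`, `frtD_mul`), and the Hecke and Yang–Baxter equations
show that they satisfy the relations of the momenta (`edgeRel_frtD`, `crossEdgeRel_of_leibniz`). For
several edges, the algebra of each edge acts on its own tensor factor. The braided commutation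
between the factors comes from dressing: the matrices of an edge are conjugated by the operators
that braid the earlier factors with the vertices. These L-operators satisfy the exchange relations,
and they are invertible because they are triangular with diagonal entries from a torus
(`exists_dressing_lOp`, `PartialModel.exists_insert`).

*Loops.* The functional is not available for quivers with loops. A loop is instead replaced by a
path of two edges through an auxiliary vertex, both for its coordinates and for its momenta. The
products of the matrices along these paths satisfy the reflection equation and the cross relation of
a loop, which gives a homomorphism `splitHom` into the algebra of a quiver without loops. The images
of the standard monomials are independent at `q = 1` (`linearIndependent_split`). Torsion is
already controlled in the target, so the coefficients of a relation are divisible by all powers of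
`t` and vanish (`linearIndependent_stdMon`).

*All fibres.* A basis over `ℂ[q, q⁻¹]` gives a basis of every fibre by change of scalars
(`linearIndependent_fibre`), and the kernel of a specialization is read off from the coefficients
(`exists_fibre`).
-/


noncomputable section

set_option linter.unusedSectionVars false

namespace QuiverDq

open Matrix

/-! ### Matrices on two tensor factors -/

section Legs

variable {k : Type*} [CommRing k] {B : Type*} [Ring B] [Algebra k B]
variable {a a' b p p' s : Type*}

/-- `X ⊗ id`, acting on the first of two tensor factors. -/
def leg1 (p : Type*) [DecidableEq p] (X : Matrix a b B) : Matrix (a × p) (b × p) B :=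
  X ⊗ₖ (1 : Matrix p p B)

/-- `id ⊗ X`, acting on the second of two tensor factors. -/
def leg2 (p : Type*) [DecidableEq p] (X : Matrix a b B) : Matrix (p × a) (p × b) B :=
  (1 : Matrix p p B) ⊗ₖ X

/-- A matrix of scalars, over a `k`-algebra. -/
def sc (B : Type*) [Ring B] [Algebra k B] (M : Matrix a b k) : Matrix a b B :=
  M.map (algebraMap k B)

/-- Interchange of the two tensor factors, for rows and columns. -/
def sw (M : Matrix (a × p) (b × p') B) : Matrix (p × a) (p' × b) B :=
  M.submatrix Prod.swap Prod.swap

lemma leg1_apply [DecidableEq p] (X : Matrix a b B) (r c) :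
    leg1 p X r c = if r.2 = c.2 then X r.1 c.1 else 0 := by
  simp [leg1, Matrix.one_apply]

lemma leg2_apply [DecidableEq p] (X : Matrix a b B) (r c) :
    leg2 p X r c = if r.1 = c.1 then X r.2 c.2 else 0 := by
  simp [leg2, Matrix.one_apply]

@[simp] lemma sc_apply (M : Matrix a b k) (i j) : sc B M i j = algebraMap k B (M i j) := rfl

@[simp] lemma sw_apply (M : Matrix (a × p) (b × p') B) (r c) :
    sw M r c = M (r.2, r.1) (c.2, c.1) := rfl

@[simp] lemma sw_sw (M : Matrix (a × p) (b × p') B) : sw (sw M) = M := rfl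

lemma sw_mul {q q' : Type*} [Fintype b] [Fintype p'] (M : Matrix (a × p) (b × p') B)
    (N : Matrix (b × p') (q × q') B) : sw (M * N) = sw M * sw N := by
  ext r c
  simp only [sw_apply, Matrix.mul_apply, Fintype.sum_prod_type]
  rw [Finset.sum_comm]

lemma sw_leg1 [DecidableEq p] (X : Matrix a b B) : sw (leg1 p X) = leg2 p X := by
  ext r c; simp [leg1_apply, leg2_apply]

lemma sw_leg2 [DecidableEq p] (X : Matrix a b B) : sw (leg2 p X) = leg1 p X := by
  ext r c; simp [leg1_apply, leg2_apply]

lemma sw_one [DecidableEq a] [DecidableEq p] : sw (1 : Matrix (a × p) (a × p) B) = 1 := by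
  ext r c
  simp only [sw_apply, Matrix.one_apply, Prod.ext_iff]
  congr 1; simp [and_comm]

lemma sw_sc (M : Matrix (a × p) (b × p') k) : sw (sc B M) = sc B (sw M) := rfl

lemma leg1_mul [Fintype b] [Fintype p] [DecidableEq p] (X : Matrix a b B) (Y : Matrix b s B) :
    leg1 p (X * Y) = leg1 p X * leg1 p Y := by
  ext r c
  simp only [leg1_apply, Matrix.mul_apply, Fintype.sum_prod_type]
  simp [ite_mul, mul_ite]

lemma leg2_mul [Fintype b] [Fintype p] [DecidableEq p] (X : Matrix a b B) (Y : Matrix b s B) :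
    leg2 p (X * Y) = leg2 p X * leg2 p Y := by
  rw [← sw_leg1, leg1_mul, sw_mul, sw_leg1, sw_leg1]

@[simp] lemma leg1_one [DecidableEq a] [DecidableEq p] :
    leg1 p (1 : Matrix a a B) = 1 := by
  simp [leg1]

@[simp] lemma leg2_one [DecidableEq a] [DecidableEq p] :
    leg2 p (1 : Matrix a a B) = 1 := by
  simp [leg2]

lemma leg1_mul_leg2_apply [Fintype b] [Fintype p] [DecidableEq p] [DecidableEq b]
    (X : Matrix a b B) (Y : Matrix p p' B) (r c) :
    (leg1 p X * leg2 b Y) r c = X r.1 c.1 * Y r.2 c.2 := by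
  simp only [leg1_apply, leg2_apply, Matrix.mul_apply, Fintype.sum_prod_type]
  simp [ite_mul, mul_ite]

lemma leg2_mul_leg1_apply [Fintype a] [Fintype p'] [DecidableEq p'] [DecidableEq a]
    (X : Matrix a b B) (Y : Matrix p p' B) (r c) :
    (leg2 a Y * leg1 p' X) r c = Y r.2 c.2 * X r.1 c.1 := by
  simp only [leg1_apply, leg2_apply, Matrix.mul_apply, Fintype.sum_prod_type]
  simp [ite_mul, mul_ite]

lemma leg_comm [Fintype a] [Fintype b] [Fintype p] [Fintype p'] [DecidableEq p] [DecidableEq b]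
    [DecidableEq p'] [DecidableEq a] {X : Matrix a b B} {Y : Matrix p p' B}
    (h : ∀ i j i' j', X i j * Y i' j' = Y i' j' * X i j) :
    leg1 p X * leg2 b Y = leg2 a Y * leg1 p' X := by
  ext r c
  rw [leg1_mul_leg2_apply, leg2_mul_leg1_apply, h]

/-- Converse of `leg_comm`. -/
lemma comm_of_leg_comm [Fintype a] [Fintype b] [Fintype p] [Fintype p'] [DecidableEq p]
    [DecidableEq b] [DecidableEq p'] [DecidableEq a] {X : Matrix a b B} {Y : Matrix p p' B}
    (h : leg1 p X * leg2 b Y = leg2 a Y * leg1 p' X) (i j i' j') :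
    X i j * Y i' j' = Y i' j' * X i j := by
  have := congrFun (congrFun h (i, i')) (j, j')
  rwa [leg1_mul_leg2_apply, leg2_mul_leg1_apply] at this

lemma sc_mul [Fintype b] (M : Matrix a b k) (N : Matrix b s k) :
    sc B (M * N) = sc B M * sc B N := by
  simp [sc, Matrix.map_mul]

@[simp] lemma sc_one [DecidableEq a] : sc B (1 : Matrix a a k) = 1 := by
  simp [sc]

/-- Rewriting with `A * B = C * D` inside a right-associated product. -/
lemma reassoc {m n n' o p : Type*} [Fintype n] [Fintype n'] [Fintype o]
    {A : Matrix m n B} {A' : Matrix n o B} {C : Matrix m n' B} {D : Matrix n' o B}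
    (h : A * A' = C * D) (Z : Matrix o p B) : A * (A' * Z) = C * (D * Z) := by
  rw [← Matrix.mul_assoc, h, Matrix.mul_assoc]

lemma reassoc_one {m n p : Type*} [Fintype n] [Fintype m] [DecidableEq m]
    {A : Matrix m n B} {A' : Matrix n m B}
    (h : A * A' = 1) (Z : Matrix m p B) : A * (A' * Z) = Z := by
  rw [← Matrix.mul_assoc, h, Matrix.one_mul]

variable {B' : Type*} [Ring B'] [Algebra k B']

lemma leg1_map [DecidableEq p] (X : Matrix a b B) (f : B →+* B') :
    (leg1 p X).map f = leg1 p (X.map f) := by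
  ext r c; simp [leg1_apply, apply_ite f]

lemma leg2_map [DecidableEq p] (X : Matrix a b B) (f : B →+* B') :
    (leg2 p X).map f = leg2 p (X.map f) := by
  ext r c; simp [leg2_apply, apply_ite f]

lemma sc_map (M : Matrix a b k) (f : B →ₐ[k] B') : (sc B M).map f = sc B' M := by
  ext r c; simp

end Legs

/-! ### The R-matrix -/

section R

variable {k : Type*} [CommRing k] (q : kˣ)

/-- The sum over the lower indices of the R-matrix has at most two terms. -/
lemma sum_rCoeff {M : Type*} [AddCommGroup M] [Module k M] {n : ℕ} (i j : Fin n)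
    (F : Fin n → Fin n → M) :
    ∑ x : Fin n, ∑ y : Fin n, rCoeff q i j x y • F x y =
      (if i = j then (q : k) else 1) • F i j +
        (if j < i then (q : k) - ((q⁻¹ : kˣ) : k) else 0) • F j i := by
  simp only [rCoeff, add_smul, Finset.sum_add_distrib, ite_smul, zero_smul]
  congr 1
  · rw [Finset.sum_eq_single i, Finset.sum_eq_single j]
    · simp [Fin.ext_iff]
    · intro y _ hy; rw [if_neg]; rintro ⟨-, h⟩; exact hy (Fin.ext h.symm)
    · simp
    · intro x _ hx; apply Finset.sum_eq_zero; intro y _; rw [if_neg]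
      rintro ⟨h, -⟩; exact hx (Fin.ext h.symm)
    · simp
  · rw [Finset.sum_eq_single j, Finset.sum_eq_single i]
    · simp
    · intro y _ hy; rw [if_neg]; rintro ⟨-, h, -⟩; exact hy (Fin.ext h.symm)
    · simp
    · intro x _ hx; apply Finset.sum_eq_zero; intro y _; rw [if_neg]
      rintro ⟨-, -, h⟩; exact hx (Fin.ext h.symm)
    · simp

/-- The Yang–Baxter equation `R_12 R_13 R_23 = R_23 R_13 R_12` for one vertex, entry by entry. -/
lemma ybe_rCoeff {n : ℕ} (a b c a' b' c' : Fin n) :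
    ∑ x : Fin n, ∑ y : Fin n, rCoeff q a b x y * ∑ z : Fin n,
        rCoeff q x c a' z * rCoeff q y z b' c' =
      ∑ y : Fin n, ∑ z : Fin n, rCoeff q b c y z * ∑ x : Fin n,
        rCoeff q a z x c' * rCoeff q x y a' b' := by
  have h1 : ∀ x y : Fin n, ∑ z : Fin n, rCoeff q x c a' z * rCoeff q y z b' c' =
      (if x = c then (q : k) else 1) * (if x = a' then rCoeff q y c b' c' else 0) +
      (if c < x then (q : k) - ((q⁻¹ : kˣ) : k) else 0) *
        (if c = a' then rCoeff q y x b' c' else 0) := by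
    intro x y
    have := sum_rCoeff q x c (fun x' z : Fin n => if x' = a' then rCoeff q y z b' c' else 0)
    simp only [smul_eq_mul] at this
    rw [← this, Finset.sum_comm]
    simp
  have h2 : ∀ y z : Fin n, ∑ x : Fin n, rCoeff q a z x c' * rCoeff q x y a' b' =
      (if a = z then (q : k) else 1) * (if z = c' then rCoeff q a y a' b' else 0) +
      (if z < a then (q : k) - ((q⁻¹ : kˣ) : k) else 0) *
        (if a = c' then rCoeff q z y a' b' else 0) := by
    intro y z
    have := sum_rCoeff q a z (fun x z' : Fin n => if z' = c' then rCoeff q x y a' b' else 0)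
    simp only [smul_eq_mul] at this
    rw [← this]
    simp
  simp only [h1, h2]
  have e1 := sum_rCoeff q a b (fun x y : Fin n =>
    (if x = c then (q : k) else 1) * (if x = a' then rCoeff q y c b' c' else 0) +
      (if c < x then (q : k) - ((q⁻¹ : kˣ) : k) else 0) *
        (if c = a' then rCoeff q y x b' c' else 0))
  have e2 := sum_rCoeff q b c (fun y z : Fin n =>
    (if a = z then (q : k) else 1) * (if z = c' then rCoeff q a y a' b' else 0) +
      (if z < a then (q : k) - ((q⁻¹ : kˣ) : k) else 0) *
        (if a = c' then rCoeff q z y a' b' else 0))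
  simp only [smul_eq_mul] at e1 e2
  rw [e1, e2]
  clear e1 e2 h1 h2
  have hr : ∀ i j k' l : Fin n, rCoeff q (i : ℕ) j k' l =
    (if i = j then (q : k) else 1) * ((if i = k' then 1 else 0) * (if j = l then 1 else 0)) +
    (if j < i then (q : k) - ((q⁻¹ : kˣ) : k) else 0) *
      ((if j = k' then 1 else 0) * (if i = l then 1 else 0)) := by
    intro i j k' l
    simp only [rCoeff, Fin.lt_def, Fin.ext_iff, mul_ite, mul_one, mul_zero, ite_and]
    congr 1
    · by_cases h1 : (i : ℕ) = j <;> by_cases h2 : (i : ℕ) = k' <;> by_cases h3 : (j : ℕ) = l <;>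
        simp only [h1, h2, h3, if_true, if_false, ite_self]
    · by_cases h1 : (j : ℕ) < i <;> by_cases h2 : (i : ℕ) = l <;> by_cases h3 : (j : ℕ) = k' <;>
        simp only [h1, h2, h3, if_true, if_false, ite_self]
  have hi : ∀ (P : Prop) [Decidable P] (x : k),
      (if P then x else 0) = x * (if P then 1 else 0) := by
    intro P _ x; split_ifs <;> simp
  have hq : (q : k) * ((q⁻¹ : kˣ) : k) = 1 := by simp
  generalize ((q⁻¹ : kˣ) : k) = q' at *
  rw [hi (a = a') (rCoeff q (b : ℕ) c b' c'), hi (c = a') (rCoeff q (b : ℕ) a b' c'), hi (b = a'),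
    hi (c = a') (rCoeff q (a : ℕ) b b' c'), hi (c = c'), hi (a = c') (rCoeff q (c : ℕ) b a' b'),
    hi (b = c'),
    hi (a = c') (rCoeff q (b : ℕ) c a' b')]
  simp only [hr]
  obtain ⟨δ, hδ⟩ : ∃ δ : Fin n → Fin n → k, ∀ i j, (if i = j then (1 : k) else 0) = δ i j :=
    ⟨_, fun _ _ => rfl⟩
  simp only [hδ]
  clear hr hi hδ
  rcases lt_trichotomy a b with h | h | h <;> rcases lt_trichotomy b c with h' | h' | h' <;>
    rcases lt_trichotomy a c with h'' | h'' | h'' <;>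
    first
    | (exfalso; omega)
    | (subst_vars
       simp only [lt_irrefl, if_true, if_false, *, ne_of_lt, ne_of_gt, not_lt_of_gt]
       grind)

/-- The sum over the upper indices of the R-matrix. -/
lemma sum_rCoeff' {M : Type*} [AddCommGroup M] [Module k M] {n : ℕ} (i j : Fin n)
    (F : Fin n → Fin n → M) :
    ∑ x : Fin n, ∑ y : Fin n, rCoeff q x y i j • F x y =
      (if i = j then (q : k) else 1) • F i j +
        (if i < j then (q : k) - ((q⁻¹ : kˣ) : k) else 0) • F j i := by
  have hs : ∀ x y : Fin n, rCoeff q (x : ℕ) y i j = rCoeff q (j : ℕ) i y x := by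
    intro x y
    simp only [rCoeff]
    grind
  simp only [hs]
  rw [Finset.sum_comm, sum_rCoeff q j i (fun x y => F y x)]
  simp only [eq_comm]

variable {V : Type*} [DecidableEq V] (d : V → ℕ)

lemma matR_self (u : V) (i j x y) : matR d q u u (i, j) (x, y) = rCoeff q i j x y := by
  simp [matR]

lemma matRInv_self (u : V) (i j x y) : matRInv d q u u (i, j) (x, y) = rInvCoeff q i j x y := by
  simp [matRInv]

variable {d}

lemma matR_of_ne {u v : V} (h : u ≠ v) : matR d q u v = 1 := by
  ext r c; simp [matR, h, Matrix.one_apply]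

lemma matRInv_of_ne {u v : V} (h : u ≠ v) : matRInv d q u v = 1 := by
  ext r c; simp [matRInv, h, Matrix.one_apply]

variable (d)

lemma matR_one (u v : V) : matR d (1 : kˣ) u v = 1 := by
  by_cases h : u = v
  · subst h
    ext ⟨i, j⟩ ⟨x, y⟩
    simp [matR_self, rCoeff, Matrix.one_apply, Fin.ext_iff]
  · exact matR_of_ne _ h

lemma matRInv_one (u v : V) : matRInv d (1 : kˣ) u v = 1 := by
  by_cases h : u = v
  · subst h
    ext ⟨i, j⟩ ⟨x, y⟩
    simp [matRInv_self, rInvCoeff, Matrix.one_apply, Fin.ext_iff]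
  · exact matRInv_of_ne _ h

lemma matR_mul_matRInv (u v : V) : matR d q u v * matRInv d q u v = 1 := by
  by_cases h : u = v
  · subst h
    ext ⟨i, j⟩ ⟨x, y⟩
    have := sum_rCoeff q i j (fun s t => matRInv d q u u (s, t) (x, y))
    simp only [smul_eq_mul] at this
    simp only [Matrix.mul_apply, Fintype.sum_prod_type, matR_self, this]
    simp only [matRInv_self, rInvCoeff, Matrix.one_apply, Prod.ext_iff, Fin.ext_iff, Fin.lt_def]
    have hq : (q : k) * ((q⁻¹ : kˣ) : k) = 1 := by simp
    generalize ((q⁻¹ : kˣ) : k) = q' at *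
    grind
  · rw [matR_of_ne _ h, matRInv_of_ne _ h, Matrix.one_mul]

lemma matRInv_mul_matR (u v : V) : matRInv d q u v * matR d q u v = 1 :=
  mul_eq_one_comm.mp (matR_mul_matRInv q d u v)

/-- The Yang–Baxter equation `R_12 R_13 R_23 = R_23 R_13 R_12`, entry by entry, for three
vertices that may or may not coincide. -/
lemma ybe_matR (u v w : V) (a a' : Fin (d u)) (b b' : Fin (d v)) (c c' : Fin (d w)) :
    ∑ x, ∑ y, matR d q u v (a, b) (x, y) * ∑ z,
        matR d q u w (x, c) (a', z) * matR d q v w (y, z) (b', c') =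
      ∑ y, ∑ z, matR d q v w (b, c) (y, z) * ∑ x,
        matR d q u w (a, z) (x, c') * matR d q u v (x, y) (a', b') := by
  by_cases h1 : u = v
  · subst h1
    by_cases h2 : u = w
    · subst h2
      simp only [matR_self]
      exact ybe_rCoeff q a b c a' b' c'
    · simp [matR_of_ne _ h2, Matrix.one_apply, ite_and]
  · by_cases h2 : u = w
    · subst h2
      simp [matR_of_ne _ h1, matR_of_ne _ (Ne.symm h1), Matrix.one_apply, ite_and]
    · by_cases h3 : v = w
      · subst h3
        simp [matR_of_ne _ h1, Matrix.one_apply, ite_and]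
      · simp [matR_of_ne _ h1, matR_of_ne _ h2, matR_of_ne _ h3, Matrix.one_apply, ite_and]
        split_ifs <;> rfl

section Action

variable {B : Type*} [Ring B] [Algebra k B] {s : Type*}

lemma sc_mul_apply {a b : Type*} [Fintype b] (M : Matrix a b k) (N : Matrix b s B) (i j) :
    (sc B M * N) i j = ∑ x, M i x • N x j := by
  simp [Matrix.mul_apply, Algebra.smul_def]

lemma mul_sc_apply {a b : Type*} [Fintype a] (M : Matrix a b k) (N : Matrix s a B) (i j) :
    (N * sc B M) i j = ∑ x, M x j • N i x := by
  simp [Matrix.mul_apply, Algebra.smul_def, Algebra.commutes]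

lemma sc_matR_mul_apply (u : V) (M : Matrix (Fin (d u) × Fin (d u)) s B) (i j c) :
    (sc B (matR d q u u) * M) (i, j) c = (if i = j then (q : k) else 1) • M (i, j) c +
      (if j < i then (q : k) - ((q⁻¹ : kˣ) : k) else 0) • M (j, i) c := by
  rw [sc_mul_apply, Fintype.sum_prod_type]
  simp only [matR_self]
  exact sum_rCoeff q i j (fun x y => M (x, y) c)

lemma mul_sc_matR21_apply (u : V) (M : Matrix s (Fin (d u) × Fin (d u)) B) (r i j) :
    (M * sc B (matR21 d q u u)) r (i, j) = (if i = j then (q : k) else 1) • M r (i, j) +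
      (if j < i then (q : k) - ((q⁻¹ : kˣ) : k) else 0) • M r (j, i) := by
  rw [mul_sc_apply, Fintype.sum_prod_type, Finset.sum_comm]
  simp only [matR21, Matrix.submatrix_apply, Prod.swap, matR_self]
  rw [sum_rCoeff' q j i (fun x y => M r (y, x))]
  simp only [eq_comm]

end Action

lemma matR21_eq (u v : V) : matR21 d q u v = sw (matR d q v u) := rfl

lemma matR21Inv_eq (u v : V) : matR21Inv d q u v = sw (matRInv d q v u) := rfl

variable (B : Type*) [Ring B] [Algebra k B]

lemma scR_inv (u v : V) : sc B (matR d q u v) * sc B (matRInv d q u v) = 1 := by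
  rw [← sc_mul, matR_mul_matRInv, sc_one]

lemma scRInv_mul (u v : V) : sc B (matRInv d q u v) * sc B (matR d q u v) = 1 := by
  rw [← sc_mul, matRInv_mul_matR, sc_one]

lemma scR21_inv (u v : V) : sc B (matR21 d q u v) * sc B (matR21Inv d q u v) = 1 := by
  rw [← sc_mul, matR21_eq, matR21Inv_eq, ← sw_mul, matR_mul_matRInv, sw_one, sc_one]

lemma scR21Inv_mul (u v : V) : sc B (matR21Inv d q u v) * sc B (matR21 d q u v) = 1 := by
  rw [← sc_mul, matR21_eq, matR21Inv_eq, ← sw_mul, matRInv_mul_matR, sw_one, sc_one]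

/-- The R-matrix on `k^{d v} ⊗ k^{d u}`, seen as a matrix of size `d u` with entries in the
matrices of size `d v` over `B`. -/
def tMat (v u : V) : Matrix (Fin (d u)) (Fin (d u)) (Matrix (Fin (d v)) (Fin (d v)) B) :=
  Matrix.of fun a c => Matrix.of fun i x => algebraMap k B (matR d q v u (i, a) (x, c))

/-- The inverse of `tMat`. -/
def tMatInv (v u : V) : Matrix (Fin (d u)) (Fin (d u)) (Matrix (Fin (d v)) (Fin (d v)) B) :=
  Matrix.of fun a c => Matrix.of fun i x => algebraMap k B (matRInv d q v u (i, a) (x, c))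

lemma tMat_mul_inv (v u : V) : tMat q d B v u * tMatInv q d B v u = 1 := by
  ext a c i x
  have := congrFun (congrFun (matR_mul_matRInv q d v u) (i, a)) (x, c)
  simp only [Matrix.mul_apply, Fintype.sum_prod_type] at this
  rw [Matrix.mul_apply, Matrix.sum_apply]
  simp only [tMat, tMatInv, Matrix.of_apply, Matrix.mul_apply, ← map_mul, ← map_sum]
  rw [Finset.sum_comm, this]
  simp only [Matrix.one_apply, Prod.ext_iff]
  by_cases h : a = c <;> by_cases h' : i = x <;>
    simp [h, h', Matrix.one_apply]

lemma tMatInv_mul (v u : V) : tMatInv q d B v u * tMat q d B v u = 1 := by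
  ext a c i x
  have := congrFun (congrFun (matRInv_mul_matR q d v u) (i, a)) (x, c)
  simp only [Matrix.mul_apply, Fintype.sum_prod_type] at this
  rw [Matrix.mul_apply, Matrix.sum_apply]
  simp only [tMat, tMatInv, Matrix.of_apply, Matrix.mul_apply, ← map_mul, ← map_sum]
  rw [Finset.sum_comm, this]
  simp only [Matrix.one_apply, Prod.ext_iff]
  by_cases h : a = c <;> by_cases h' : i = x <;>
    simp [h, h', Matrix.one_apply]

/-- The Yang–Baxter equation, read as an exchange relation between the matrices `tMat`. -/
lemma tMat_exchange (v u w : V) :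
    sc (Matrix (Fin (d v)) (Fin (d v)) B) (matR d q u w) * leg2 _ (tMat q d B v w) *
        leg1 _ (tMat q d B v u) =
      leg1 _ (tMat q d B v u) * leg2 _ (tMat q d B v w) * sc _ (matR d q u w) := by
  ext ⟨a, b⟩ ⟨c, e⟩ i x
  have := ybe_matR q d v u w i x a c b e
  rw [Matrix.mul_assoc, sc_mul_apply, mul_sc_apply, Matrix.sum_apply, Matrix.sum_apply]
  simp only [Matrix.smul_apply, leg2_mul_leg1_apply, leg1_mul_leg2_apply]
  simp only [Matrix.mul_apply, tMat, Matrix.of_apply, ← map_mul, ← map_sum, Algebra.smul_def]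
  congr 1
  simp only [Fintype.sum_prod_type]
  calc _ = _ := ?_
    _ = _ := this.symm
    _ = _ := ?_
  · refine Finset.sum_congr rfl fun y _ => Finset.sum_congr rfl fun z _ => ?_
    congr 1
  · simp only [Finset.mul_sum]
    rw [Finset.sum_comm]
    refine Finset.sum_congr rfl fun y _ => ?_
    rw [Finset.sum_comm]
    refine Finset.sum_congr rfl fun z _ => Finset.sum_congr rfl fun t _ => ?_
    ring

end R

/-! ### Families of matrices that satisfy the defining relations -/

section Sat

variable {V E : Type*} [DecidableEq V] [LinearOrder E] (Q : EdgeQuiver V E) (d : V → ℕ)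
variable {k : Type*} [CommRing k] (q : kˣ) {B : Type*} [Ring B] [Algebra k B]

/-- The flip `k^m ⊗ k^n → k^n ⊗ k^m` over a `k`-algebra. -/
def flipB (B : Type*) [Ring B] (m n : ℕ) : Matrix (Fin m × Fin n) (Fin n × Fin m) B :=
  Matrix.of fun r c => if r.1 = c.2 ∧ r.2 = c.1 then 1 else 0

/-- `R X_2 X_1 = X_1 X_2 R_21`. -/
def EdgeRel (u w : V) (X : Matrix (Fin (d u)) (Fin (d w)) B) : Prop :=
  sc B (matR d q u u) * leg2 (Fin (d u)) X * leg1 (Fin (d w)) X =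
    leg1 (Fin (d u)) X * leg2 (Fin (d w)) X * sc B (matR21 d q w w)

/-- The reflection equation `R_21 X_1 R X_2 = X_2 R_21 X_1 R`. -/
def LoopRel (u w : V) (X : Matrix (Fin (d u)) (Fin (d w)) B) : Prop :=
  sc B (matR21 d q u u) * leg1 (Fin (d u)) X * sc B (matR d q w u) * leg2 (Fin (d w)) X =
    leg2 (Fin (d u)) X * sc B (matR21 d q u w) * leg1 (Fin (d w)) X * sc B (matR d q w w)

/-- `D_2 R⁻¹ A_1 = A_1 R D_2 + Ω`. -/
def CrossEdgeRel (u w : V) (A : Matrix (Fin (d u)) (Fin (d w)) B)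
    (D : Matrix (Fin (d w)) (Fin (d u)) B) : Prop :=
  leg2 (Fin (d u)) D * sc B (matRInv d q u u) * leg1 (Fin (d u)) A =
    leg1 (Fin (d w)) A * sc B (matR d q w w) * leg2 (Fin (d w)) D + flipB B (d u) (d w)

/-- `R_21 D_1 R A_2 = A_2 R_21 D_1 R_21⁻¹`. -/
def CrossLoopRel (u w : V) (A : Matrix (Fin (d u)) (Fin (d w)) B)
    (D : Matrix (Fin (d w)) (Fin (d u)) B) : Prop :=
  sc B (matR21 d q w u) * leg1 (Fin (d u)) D * sc B (matR d q u u) * leg2 (Fin (d u)) A =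
    leg2 (Fin (d w)) A * sc B (matR21 d q w w) * leg1 (Fin (d w)) D * sc B (matR21Inv d q u w)

/-- The braided commutation `X_1 R Y_2 = R Y_2 R⁻¹ X_1 R` of two matrices that sit on arrows
`u → u'` and `v → v'`. -/
def BraidRel (u u' v v' : V) (X : Matrix (Fin (d u)) (Fin (d u')) B)
    (Y : Matrix (Fin (d v)) (Fin (d v')) B) : Prop :=
  leg1 (Fin (d v)) X * sc B (matR d q u' v) * leg2 (Fin (d u')) Y =
    sc B (matR d q u v) * leg2 (Fin (d u)) Y * sc B (matRInv d q u v') * leg1 (Fin (d v')) X *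
      sc B (matR d q u' v')

variable {d} in
/-- A family of matrices over a `k`-algebra, one for every edge of the doubled quiver, that
satisfies the defining relations. -/
structure Sat (X : ∀ x : E ⊕ E, Matrix (Fin (d (Q.src x))) (Fin (d (Q.tgt x))) B) : Prop where
  edge : ∀ x, Q.src x ≠ Q.tgt x → EdgeRel d q (Q.src x) (Q.tgt x) (X x)
  loop : ∀ x, Q.src x = Q.tgt x → LoopRel d q (Q.src x) (Q.tgt x) (X x)
  cross_edge : ∀ e, Q.tail e ≠ Q.head e →
    CrossEdgeRel d q (Q.tail e) (Q.head e) (X (Sum.inl e)) (X (Sum.inr e))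
  cross_loop : ∀ e, Q.tail e = Q.head e →
    CrossLoopRel d q (Q.tail e) (Q.head e) (X (Sum.inl e)) (X (Sum.inr e))
  braided : ∀ x y, underlying y < underlying x →
    BraidRel d q (Q.src x) (Q.tgt x) (Q.src y) (Q.tgt y) (X x) (X y)

variable {Q d q}
variable {X : ∀ x : E ⊕ E, Matrix (Fin (d (Q.src x))) (Fin (d (Q.tgt x))) B}

lemma genMat_map (x : E ⊕ E) :
    (genMat Q d k x).map (FreeAlgebra.lift k (fun g : Gen Q d => X g.1 g.2.1 g.2.2)) = X x := by
  ext i j; simp [genMat]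

lemma gen1_map' (f : FreeAlgebra k (Gen Q d) →ₐ[k] B) (x : E ⊕ E) (m : ℕ) :
    (gen1 Q d k x m).map f = leg1 (Fin m) ((genMat Q d k x).map f) :=
  leg1_map _ (f : FreeAlgebra k (Gen Q d) →+* B)

lemma gen2_map' (f : FreeAlgebra k (Gen Q d) →ₐ[k] B) (x : E ⊕ E) (m : ℕ) :
    (gen2 Q d k x m).map f = leg2 (Fin m) ((genMat Q d k x).map f) :=
  leg2_map _ (f : FreeAlgebra k (Gen Q d) →+* B)

lemma scal_map' (f : FreeAlgebra k (Gen Q d) →ₐ[k] B) {m n : Type*} (M : Matrix m n k) :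
    (scal Q d M).map f = sc B M := by
  ext i j; simp [scal]

lemma flipMat_map' (f : FreeAlgebra k (Gen Q d) →ₐ[k] B) (m n : ℕ) :
    (flipMat Q d k m n).map f = flipB B m n := by
  ext i j
  simp only [flipMat, flipB, Matrix.map_apply, Matrix.of_apply]
  split_ifs <;> simp

lemma matA1_map (f : FreeAlgebra k (Gen Q d) →ₐ[k] B) (e : E) (m : ℕ)
    {Y : Matrix (Fin (d (Q.tail e))) (Fin (d (Q.head e))) B}
    (hY : (genMat Q d k (Sum.inl e)).map f = Y) : (matA1 Q d k e m).map f = leg1 (Fin m) Y := by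
  subst hY; exact gen1_map' f _ _

lemma matA2_map (f : FreeAlgebra k (Gen Q d) →ₐ[k] B) (e : E) (m : ℕ)
    {Y : Matrix (Fin (d (Q.tail e))) (Fin (d (Q.head e))) B}
    (hY : (genMat Q d k (Sum.inl e)).map f = Y) : (matA2 Q d k e m).map f = leg2 (Fin m) Y := by
  subst hY; exact gen2_map' f _ _

lemma matD1_map (f : FreeAlgebra k (Gen Q d) →ₐ[k] B) (e : E) (m : ℕ)
    {Y : Matrix (Fin (d (Q.head e))) (Fin (d (Q.tail e))) B}
    (hY : (genMat Q d k (Sum.inr e)).map f = Y) : (matD1 Q d k e m).map f = leg1 (Fin m) Y := by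
  subst hY; exact gen1_map' f _ _

lemma matD2_map (f : FreeAlgebra k (Gen Q d) →ₐ[k] B) (e : E) (m : ℕ)
    {Y : Matrix (Fin (d (Q.head e))) (Fin (d (Q.tail e))) B}
    (hY : (genMat Q d k (Sum.inr e)).map f = Y) : (matD2 Q d k e m).map f = leg2 (Fin m) Y := by
  subst hY; exact gen2_map' f _ _

lemma free_map_mul {m n o : Type*} [Fintype n] (f : FreeAlgebra k (Gen Q d) →ₐ[k] B)
    (M : Matrix m n (FreeAlgebra k (Gen Q d))) (N : Matrix n o (FreeAlgebra k (Gen Q d))) :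
    (M * N).map f = M.map f * N.map f :=
  Matrix.map_mul

/-- A family that satisfies the relations, as an algebra homomorphism. -/
def Sat.lift (h : Sat Q q X) : Dq Q d q →ₐ[k] B :=
  RingQuot.liftAlgHom k ⟨FreeAlgebra.lift k (fun g : Gen Q d => X g.1 g.2.1 g.2.2), by
    intro a b hab
    induction hab with
    | edge x hx r c =>
      have := h.edge x hx
      unfold EdgeRel at this
      replace this := congrFun (congrFun this r) c
      rw [← Matrix.map_apply (f := FreeAlgebra.lift k _),
        ← Matrix.map_apply (f := FreeAlgebra.lift k _)]
      simpa only [free_map_mul, gen1_map', gen2_map', scal_map', genMat_map] using this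
    | loop x hx r c =>
      have := h.loop x hx
      unfold LoopRel at this
      replace this := congrFun (congrFun this r) c
      rw [← Matrix.map_apply (f := FreeAlgebra.lift k _),
        ← Matrix.map_apply (f := FreeAlgebra.lift k _)]
      simpa only [free_map_mul, gen1_map', gen2_map', scal_map', genMat_map] using this
    | cross_edge e hx r c =>
      have := h.cross_edge e hx
      unfold CrossEdgeRel at this
      replace this := congrFun (congrFun this r) c
      rw [← Matrix.map_apply (f := FreeAlgebra.lift k _),
        ← Matrix.map_apply (f := FreeAlgebra.lift k _),
        Matrix.map_add _ (map_add _)]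
      simpa only [free_map_mul, matA1_map _ _ _ (genMat_map (X := X) _),
        matA2_map _ _ _ (genMat_map (X := X) _), matD1_map _ _ _ (genMat_map (X := X) _),
        matD2_map _ _ _ (genMat_map (X := X) _), scal_map', flipMat_map'] using this
    | cross_loop e hx r c =>
      have := h.cross_loop e hx
      unfold CrossLoopRel at this
      replace this := congrFun (congrFun this r) c
      rw [← Matrix.map_apply (f := FreeAlgebra.lift k _),
        ← Matrix.map_apply (f := FreeAlgebra.lift k _)]
      simpa only [free_map_mul, matA1_map _ _ _ (genMat_map (X := X) _),
        matA2_map _ _ _ (genMat_map (X := X) _), matD1_map _ _ _ (genMat_map (X := X) _),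
        matD2_map _ _ _ (genMat_map (X := X) _), scal_map', flipMat_map'] using this
    | braided x y hx r c =>
      have := h.braided x y hx
      unfold BraidRel at this
      replace this := congrFun (congrFun this r) c
      rw [← Matrix.map_apply (f := FreeAlgebra.lift k _),
        ← Matrix.map_apply (f := FreeAlgebra.lift k _)]
      simpa only [free_map_mul, gen1_map', gen2_map', scal_map', genMat_map] using this⟩

variable (Q d q) in
/-- The matrix of generators of `D_q` that belongs to an edge of the doubled quiver. -/
def genX (x : E ⊕ E) : Matrix (Fin (d (Q.src x))) (Fin (d (Q.tgt x))) (Dq Q d q) :=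
  Matrix.of fun i j => RingQuot.mkAlgHom k (Rel Q d q) (FreeAlgebra.ι k (⟨x, i, j⟩ : Gen Q d))

@[simp] lemma Sat.lift_genX (h : Sat Q q X) (x i j) : h.lift (genX Q d q x i j) = X x i j := by
  simp [Sat.lift, genX]

variable (Q d q) in
lemma sat_genX : Sat Q q (genX Q d q) := by
  have hg : ∀ x, (genMat Q d k x).map (RingQuot.mkAlgHom k (Rel Q d q)) = genX Q d q x :=
    fun x => rfl
  constructor
  · intro x hx; ext r c
    have := RingQuot.mkAlgHom_rel k (Rel.edge (q := q) (d := d) x hx r c)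
    rw [← Matrix.map_apply (f := RingQuot.mkAlgHom k _),
      ← Matrix.map_apply (f := RingQuot.mkAlgHom k _)] at this
    simpa only [free_map_mul, gen1_map', gen2_map', scal_map', hg] using this
  · intro x hx; ext r c
    have := RingQuot.mkAlgHom_rel k (Rel.loop (q := q) (d := d) x hx r c)
    rw [← Matrix.map_apply (f := RingQuot.mkAlgHom k _),
      ← Matrix.map_apply (f := RingQuot.mkAlgHom k _)] at this
    simpa only [free_map_mul, gen1_map', gen2_map', scal_map', hg] using this
  · intro x hx; ext r c
    have := RingQuot.mkAlgHom_rel k (Rel.cross_edge (q := q) (d := d) x hx r c)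
    rw [← Matrix.map_apply (f := RingQuot.mkAlgHom k _),
      ← Matrix.map_apply (f := RingQuot.mkAlgHom k _), Matrix.map_add _ (map_add _)] at this
    simpa only [free_map_mul, matA1_map _ _ _ (hg _), matA2_map _ _ _ (hg _),
      matD1_map _ _ _ (hg _), matD2_map _ _ _ (hg _), scal_map', flipMat_map'] using this
  · intro x hx; ext r c
    have := RingQuot.mkAlgHom_rel k (Rel.cross_loop (q := q) (d := d) x hx r c)
    rw [← Matrix.map_apply (f := RingQuot.mkAlgHom k _),
      ← Matrix.map_apply (f := RingQuot.mkAlgHom k _)] at this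
    simpa only [free_map_mul, matA1_map _ _ _ (hg _), matA2_map _ _ _ (hg _),
      matD1_map _ _ _ (hg _), matD2_map _ _ _ (hg _), scal_map', flipMat_map'] using this
  · intro x y hx; ext r c
    have := RingQuot.mkAlgHom_rel k (Rel.braided (q := q) (d := d) x y hx r c)
    rw [← Matrix.map_apply (f := RingQuot.mkAlgHom k _),
      ← Matrix.map_apply (f := RingQuot.mkAlgHom k _)] at this
    simpa only [free_map_mul, gen1_map', gen2_map', scal_map', hg] using this

/-- Algebra homomorphisms from `D_q` are determined by their values on the generators. -/
lemma Dq.algHom_ext {f g : Dq Q d q →ₐ[k] B}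
    (h : ∀ x i j, f (genX Q d q x i j) = g (genX Q d q x i j)) : f = g := by
  apply RingQuot.ringQuot_ext'
  apply FreeAlgebra.hom_ext
  funext ⟨x, i, j⟩
  exact h x i j

/-- A subspace of `D_q` that contains `1` and is stable under left multiplication by the
generators is everything. -/
lemma Dq.eq_top_of_mul_mem (S : Submodule k (Dq Q d q)) (h1 : (1 : Dq Q d q) ∈ S)
    (hm : ∀ x i j, ∀ y ∈ S, genX Q d q x i j * y ∈ S) : S = ⊤ := by
  have key : ∀ z : FreeAlgebra k (Gen Q d), ∀ y ∈ S, RingQuot.mkAlgHom k (Rel Q d q) z * y ∈ S := by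
    intro z
    induction z using FreeAlgebra.induction with
    | grade0 r => intro y hy; rw [AlgHom.commutes, ← Algebra.smul_def]; exact S.smul_mem _ hy
    | grade1 g => intro y hy; obtain ⟨x, i, j⟩ := g; exact hm x i j y hy
    | mul a b ha hb => intro y hy; rw [map_mul, mul_assoc]; exact ha _ (hb _ hy)
    | add a b ha hb => intro y hy; rw [map_add, add_mul]; exact S.add_mem (ha _ hy) (hb _ hy)
  rw [eq_top_iff]
  rintro y -
  obtain ⟨z, rfl⟩ := RingQuot.mkAlgHom_surjective k (Rel Q d q) y
  simpa using key z 1 h1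

end Sat

/-! ### Straightening of words -/

section Words

variable {G : Type*}

/-- The number with digits `f s` in base `N`, the first letter being the most significant. -/
def codeval (N : ℕ) (f : G → ℕ) : List G → ℕ
  | [] => 0
  | s :: w => f s * N ^ w.length + codeval N f w

lemma codeval_append (N : ℕ) (f : G → ℕ) (p w : List G) :
    codeval N f (p ++ w) = codeval N f p * N ^ w.length + codeval N f w := by
  induction p with
  | nil => simp [codeval]
  | cons s p ih => simp only [List.cons_append, codeval, ih, List.length_append]; ring

/-- A smaller first letter of a subword of length two makes the code of the word smaller. -/
lemma codeval_lt {N : ℕ} {f : G → ℕ} (hN : ∀ s, f s < N) {s t u v : G} (h : f u < f s)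
    (p r : List G) : codeval N f (p ++ [u, v] ++ r) < codeval N f (p ++ [s, t] ++ r) := by
  have h0 : 0 < N := lt_of_le_of_lt (Nat.zero_le _) (hN s)
  have h1 : codeval N f [u, v] < codeval N f [s, t] := by
    simp only [codeval, List.length_cons, List.length_nil, pow_zero, zero_add, pow_one, mul_one,
      add_zero]
    have := hN v
    nlinarith
  simp only [codeval_append, List.length_cons, List.length_nil]
  have : 0 < N ^ r.length := pow_pos h0 _
  nlinarith

lemma codeval_eq {N : ℕ} {f : G → ℕ} {s t u v : G} (h : f u = f s) (h' : f v = f t)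
    (p r : List G) : codeval N f (p ++ [u, v] ++ r) = codeval N f (p ++ [s, t] ++ r) := by
  simp only [codeval_append, codeval, h, h', List.length_cons, List.length_nil]

lemma exists_bad_pair {le : G → G → Prop} : ∀ {w : List G}, ¬ w.IsChain le →
    ∃ p s t r, w = p ++ [s, t] ++ r ∧ ¬ le s t
  | [], h => absurd List.isChain_nil h
  | [a], h => absurd (List.isChain_singleton a) h
  | a :: c :: w, h => by
    by_cases hac : le a c
    · have : ¬ (c :: w).IsChain le := fun h' => h (List.isChain_cons_cons.mpr ⟨hac, h'⟩)
      obtain ⟨p, s, t, r, hw, hst⟩ := exists_bad_pair this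
      exact ⟨a :: p, s, t, r, by simp [hw], hst⟩
    · exact ⟨[], a, c, w, by simp, hac⟩

/-- The words that a product of two letters `s t` in the wrong order may be replaced with: shorter
words, words whose first letter lies in a lower block, and, if the blocks agree, words of higher
weight or of the same weight with a smaller first letter. -/
def SmallWord (b wt o : G → ℕ) (s t : G) (w : List G) : Prop :=
  w.length < 2 ∨ ∃ u v, w = [u, v] ∧ (b u < b s ∨ (b u = b s ∧ b v = b t ∧
    (wt s + wt t < wt u + wt v ∨ (wt u + wt v = wt s + wt t ∧ o u < o s))))

/-- If every product of two letters in the wrong order is a combination of smaller words, then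
all words are combinations of the ordered ones. A replacement decreases, in lexicographic order,
the length, the sequence of blocks, the deficit of weight and the sequence of the `o s`. -/
theorem word_mem_span_sorted {k A : Type*} [CommRing k] [Ring A] [Algebra k A] (g : G → A)
    (le : G → G → Prop) (b wt o : G → ℕ) (N : ℕ) (hb : ∀ s, b s < N) (hwt : ∀ s, wt s ≤ N)
    (ho : ∀ s, o s < N)
    (hred : ∀ s t, ¬ le s t → g s * g t ∈
      Submodule.span k {z | ∃ w, SmallWord b wt o s t w ∧ z = (w.map g).prod}) (w : List G) :
    (w.map g).prod ∈ Submodule.span k {z | ∃ w : List G, w.IsChain le ∧ z = (w.map g).prod} := by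
  let key : List G → ℕ ×ₗ ℕ ×ₗ ℕ ×ₗ ℕ := fun w =>
    toLex (w.length, toLex (codeval N b w, toLex (N * w.length - (w.map wt).sum, codeval N o w)))
  induction w using (InvImage.wf key wellFounded_lt).induction with
  | h w ih =>
  by_cases hw : w.IsChain le
  · exact Submodule.subset_span ⟨w, hw, rfl⟩
  · obtain ⟨p, s, t, r, rfl, hst⟩ := exists_bad_pair hw
    have hsum : ∀ w : List G, (w.map wt).sum ≤ N * w.length := by
      intro w
      induction w with
      | nil => simp
      | cons a w ih => simp only [List.map_cons, List.sum_cons, List.length_cons]; nlinarith [hwt a]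
    have hkey : ∀ w', SmallWord b wt o s t w' → key (p ++ w' ++ r) < key (p ++ [s, t] ++ r) := by
      rintro w' (hlen | ⟨u, v, rfl, h⟩)
      · apply Prod.Lex.toLex_lt_toLex.mpr
        left; simp; omega
      · apply Prod.Lex.toLex_lt_toLex.mpr
        right
        refine ⟨by simp, ?_⟩
        apply Prod.Lex.toLex_lt_toLex.mpr
        rcases h with h | ⟨h1, h2, h⟩
        · left; exact codeval_lt hb h p r
        · right
          refine ⟨codeval_eq h1 h2 p r, ?_⟩
          apply Prod.Lex.toLex_lt_toLex.mpr
          have e1 := hsum (p ++ [u, v] ++ r)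
          have e2 := hsum (p ++ [s, t] ++ r)
          simp only [List.map_append, List.sum_append, List.map_cons, List.map_nil, List.sum_cons,
            List.sum_nil, List.length_append, List.length_cons, List.length_nil,
            add_zero] at e1 e2 ⊢
          rcases h with h | ⟨h3, h4⟩
          · left; omega
          · right; exact ⟨by omega, codeval_lt ho h4 p r⟩
    let φ : A →ₗ[k] A := LinearMap.mulLeft k (p.map g).prod ∘ₗ LinearMap.mulRight k (r.map g).prod
    have hφ : (((p ++ [s, t] ++ r).map g).prod) = φ (g s * g t) := by
      simp [φ, mul_assoc]
    rw [hφ]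
    have h1 := Submodule.mem_map_of_mem (f := φ) (hred s t hst)
    rw [Submodule.map_span] at h1
    refine Submodule.span_le.mpr ?_ h1
    rintro _ ⟨_, ⟨w', hw', rfl⟩, rfl⟩
    have : φ (w'.map g).prod = ((p ++ w' ++ r).map g).prod := by simp [φ]
    rw [this]
    exact ih _ (hkey w' hw')

end Words

/-! ### Solving the relations for products in the wrong order -/

section Solve

variable {V : Type*} [DecidableEq V] (d : V → ℕ)
variable {k : Type*} [CommRing k] (q : kˣ) {B : Type*} [Ring B] [Algebra k B]

lemma sum_contract {M : Type*} [AddCommGroup M] [Module k M] {n : ℕ} (j x : Fin n)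
    (F : Fin n → Fin n → M) :
    ∑ m : Fin n, ∑ y : Fin n, rCoeff q m j x y • F m y =
      (if x = j then (q : k) else 1) • F x j +
        if j = x then ((q : k) - ((q⁻¹ : kˣ) : k)) • ∑ m with j < m, F m m else 0 := by
  simp only [rCoeff, add_smul, Finset.sum_add_distrib, ite_smul, zero_smul]
  congr 1
  · rw [Finset.sum_eq_single x, Finset.sum_eq_single j]
    · simp [Fin.ext_iff]
    · intro y _ hy; rw [if_neg]; rintro ⟨-, h⟩; exact hy (Fin.ext h.symm)
    · simp
    · intro m _ hm; apply Finset.sum_eq_zero; intro y _; rw [if_neg]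
      rintro ⟨h, -⟩; exact hm (Fin.ext h)
    · simp
  · split_ifs with h
    · subst h
      rw [Finset.smul_sum, Finset.sum_filter]
      refine Finset.sum_congr rfl fun m _ => ?_
      rw [Finset.sum_eq_single m]
      · simp
      · intro y _ hy; rw [if_neg]; rintro ⟨-, h, -⟩; exact hy (Fin.ext h.symm)
      · simp
    · refine Finset.sum_eq_zero fun m _ => Finset.sum_eq_zero fun y _ => ?_
      rw [if_neg]; rintro ⟨-, -, h'⟩; exact h (Fin.ext h')

lemma sum_contractInv {M : Type*} [AddCommGroup M] [Module k M] {n : ℕ} (i l : Fin n)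
    (F : Fin n → Fin n → M) :
    ∑ m : Fin n, ∑ y : Fin n, rInvCoeff q i m y l • F m y =
      (if i = l then ((q⁻¹ : kˣ) : k) else 1) • F l i -
        if i = l then ((q : k) - ((q⁻¹ : kˣ) : k)) • ∑ m with m < i, F m m else 0 := by
  simp only [rInvCoeff, sub_smul, Finset.sum_sub_distrib, ite_smul, zero_smul]
  congr 1
  · rw [Finset.sum_eq_single l, Finset.sum_eq_single i]
    · simp [Fin.ext_iff]
    · intro y _ hy; rw [if_neg]; rintro ⟨h, -⟩; exact hy (Fin.ext h.symm)
    · simp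
    · intro m _ hm; apply Finset.sum_eq_zero; intro y _; rw [if_neg]
      rintro ⟨-, h⟩; exact hm (Fin.ext h)
    · simp
  · split_ifs with h
    · subst h
      rw [← sub_smul, Finset.smul_sum, Finset.sum_filter]
      refine Finset.sum_congr rfl fun m _ => ?_
      rw [Finset.sum_eq_single m]
      · simp [sub_smul]
      · intro y _ hy; rw [if_neg]; rintro ⟨-, -, h⟩; exact hy (Fin.ext h.symm)
      · simp
    · refine Finset.sum_eq_zero fun m _ => Finset.sum_eq_zero fun y _ => ?_
      rw [if_neg]; rintro ⟨-, h', -⟩; exact h (Fin.ext h')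

/-- All entries of a matrix lie in a given subspace. -/
def EntriesIn {m n : Type*} (S : Submodule k B) (M : Matrix m n B) : Prop := ∀ r c, M r c ∈ S

variable {S : Submodule k B}

lemma EntriesIn.sc_mul {m n o : Type*} [Fintype n] {N : Matrix n o B} (h : EntriesIn S N)
    (M : Matrix m n k) : EntriesIn S (sc B M * N) := by
  intro r c
  rw [sc_mul_apply]
  exact Submodule.sum_mem _ fun x _ => S.smul_mem _ (h _ _)

lemma EntriesIn.mul_sc {m n o : Type*} [Fintype n] {N : Matrix m n B} (h : EntriesIn S N)
    (M : Matrix n o k) : EntriesIn S (N * sc B M) := by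
  intro r c
  rw [mul_sc_apply]
  exact Submodule.sum_mem _ fun x _ => S.smul_mem _ (h _ _)

lemma entriesIn_mul_sc_mul {m n o p : Type*} [Fintype n] [Fintype o] {P : Matrix m n B}
    {T : Matrix o p B} (M : Matrix n o k) (h : ∀ r z z' c, P r z * T z' c ∈ S) :
    EntriesIn S (P * sc B M * T) := by
  intro r c
  rw [Matrix.mul_assoc, Matrix.mul_apply]
  refine Submodule.sum_mem _ fun x _ => ?_
  rw [sc_mul_apply, Finset.mul_sum]
  refine Submodule.sum_mem _ fun y _ => ?_
  rw [mul_smul_comm]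
  exact S.smul_mem _ (h _ _ _ _)

lemma entriesIn_leg2_leg1 {a b c e f g : Type*} [DecidableEq f] [DecidableEq g] [Fintype b]
    [Fintype f] [Fintype g] [Fintype c] {Y : Matrix a b B} {X : Matrix c e B}
    (M : Matrix (f × b) (c × g) k) (h : ∀ i j i' j', Y i j * X i' j' ∈ S) :
    EntriesIn S (leg2 f Y * sc B M * leg1 g X) := by
  apply entriesIn_mul_sc_mul
  intro r z z' s
  rw [leg1_apply, leg2_apply]
  split_ifs <;> simp [h]

lemma entriesIn_leg1_leg2 {a b c e f g : Type*} [DecidableEq f] [DecidableEq g] [Fintype b]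
    [Fintype f] [Fintype g] [Fintype c] {Y : Matrix a b B} {X : Matrix c e B}
    (M : Matrix (b × f) (g × c) k) (h : ∀ i j i' j', Y i j * X i' j' ∈ S) :
    EntriesIn S (leg1 f Y * sc B M * leg2 g X) := by
  apply entriesIn_mul_sc_mul
  intro r z z' s
  rw [leg1_apply, leg2_apply]
  split_ifs <;> simp [h]

lemma leg1_sc_leg2_apply {a b c e : Type*} [DecidableEq b] [DecidableEq c] [Fintype b] [Fintype c]
    (X : Matrix a b B) (M : Matrix (b × c) (b × c) k) (Y : Matrix c e B) (i j x l) :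
    (leg1 c X * sc B M * leg2 b Y) (i, j) (x, l) =
      ∑ m, ∑ y, M (m, j) (x, y) • (X i m * Y y l) := by
  simp only [Matrix.mul_assoc, Matrix.mul_apply (M := leg1 c X), sc_mul_apply,
    Fintype.sum_prod_type, leg1_apply, leg2_apply]
  simp [Finset.mul_sum, ite_mul]

lemma leg2_sc_leg1_apply {a b c e : Type*} [DecidableEq b] [DecidableEq c] [Fintype b] [Fintype c]
    (Y : Matrix a b B) (M : Matrix (c × b) (c × b) k) (X : Matrix c e B) (i j x l) :
    (leg2 c Y * sc B M * leg1 b X) (i, j) (x, l) =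
      ∑ m, ∑ y, M (i, m) (y, l) • (Y j m * X y x) := by
  simp only [Matrix.mul_assoc, Matrix.mul_apply (M := leg2 c Y), sc_mul_apply,
    Fintype.sum_prod_type, leg1_apply, leg2_apply]
  simp [Finset.mul_sum, ite_mul]

/-- The contraction with the R-matrix between two matrices of generators is triangular, hence can
be undone. -/
lemma mul_mem_of_entriesIn_leg1 {u u' v v' : V} {X : Matrix (Fin (d u)) (Fin (d u')) B}
    {Y : Matrix (Fin (d v)) (Fin (d v')) B}
    (h : EntriesIn S (leg1 (Fin (d v)) X * sc B (matR d q u' v) * leg2 (Fin (d u')) Y))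
    (i j x l) : X i x * Y j l ∈ S := by
  by_cases huv : u' = v
  · subst huv
    have key : ∀ n : ℕ, ∀ j : Fin (d u'), d u' - j ≤ n → ∀ x, X i x * Y j l ∈ S := by
      intro n
      induction n with
      | zero => intro j hj; omega
      | succ n ih =>
        intro j hj x
        have h1 := h (i, j) (x, l)
        rw [leg1_sc_leg2_apply] at h1
        simp only [matR_self] at h1
        rw [sum_contract q j x (fun m y => X i m * Y y l)] at h1
        have h2 : (if j = x then ((q : k) - ((q⁻¹ : kˣ) : k)) • ∑ m with j < m, X i m * Y m l
            else 0) ∈ S := by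
          split_ifs
          · refine S.smul_mem _ (Submodule.sum_mem _ fun m hm => ih m ?_ m)
            have : j < m := by simpa using hm
            have := Fin.lt_def.mp this
            omega
          · exact S.zero_mem
        have h3 := (Submodule.add_mem_iff_left _ h2).mp h1
        split_ifs at h3
        · have := S.smul_mem ((q⁻¹ : kˣ) : k) h3
          rwa [smul_smul, Units.inv_mul, one_smul] at this
        · rwa [one_smul] at h3
    exact key _ j le_rfl x
  · rw [matR_of_ne _ huv, sc_one, Matrix.mul_one] at h
    have := h (i, j) (x, l)
    rwa [leg1_mul_leg2_apply] at this

/-- The analogue of `mul_mem_of_entriesIn_leg1` for the inverse of the R-matrix. -/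
lemma mul_mem_of_entriesIn_leg2 {u u' v v' : V} {X : Matrix (Fin (d u)) (Fin (d u')) B}
    {Y : Matrix (Fin (d v)) (Fin (d v')) B}
    (h : EntriesIn S (leg2 (Fin (d u)) Y * sc B (matRInv d q u v') * leg1 (Fin (d v')) X))
    (i j x l) : Y j l * X i x ∈ S := by
  by_cases huv : u = v'
  · subst huv
    have key : ∀ n : ℕ, ∀ i : Fin (d u), (i : ℕ) < n → ∀ l, Y j l * X i x ∈ S := by
      intro n
      induction n with
      | zero => intro j hj; omega
      | succ n ih =>
        intro i hi l
        have h1 := h (i, j) (x, l)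
        rw [leg2_sc_leg1_apply] at h1
        simp only [matRInv_self] at h1
        rw [sum_contractInv q i l (fun m y => Y j m * X y x)] at h1
        have h2 : (if i = l then ((q : k) - ((q⁻¹ : kˣ) : k)) • ∑ m with m < i, Y j m * X m x
            else 0) ∈ S := by
          split_ifs
          · refine S.smul_mem _ (Submodule.sum_mem _ fun m hm => ih m ?_ m)
            have : m < i := by simpa using hm
            have := Fin.lt_def.mp this
            omega
          · exact S.zero_mem
        have h3 := (Submodule.sub_mem_iff_left _ h2).mp h1
        split_ifs at h3
        · have := S.smul_mem (q : k) h3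
          rwa [smul_smul, Units.mul_inv, one_smul] at this
        · rwa [one_smul] at h3
    exact key _ i (Nat.lt_succ_self _) l
  · rw [matRInv_of_ne _ huv, sc_one, Matrix.mul_one] at h
    have := h (i, j) (x, l)
    rwa [leg2_mul_leg1_apply] at this

end Solve

lemma mul_congr_left {B a b c : Type*} [Ring B] [Fintype b] {M N : Matrix b c B} (h : M = N)
    (L : Matrix a b B) : L * M = L * N := by rw [h]

lemma mul_congr_right {B a b c : Type*} [Ring B] [Fintype b] {M N : Matrix a b B} (h : M = N)
    (L : Matrix b c B) : M * L = N * L := by rw [h]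

section SameEdge

variable {V : Type*} [DecidableEq V] (d : V → ℕ)
variable {k : Type*} [CommRing k] (q : kˣ) {B : Type*} [Ring B] [Algebra k B]
variable {S : Submodule k B}

/-- The relation of a non-loop, and the reflection equation of a loop, have the same shape
`R T_21 = T R_21`, where `T = X_1 X_2` and `T = X_1 R X_2`, respectively. Up to products of higher
weight the entries of `T` are the products of generators, so that the relation reorders them. -/
lemma mul_mem_of_exchange {u w : V} {X : Matrix (Fin (d u)) (Fin (d w)) B}
    {T : Matrix (Fin (d u) × Fin (d u)) (Fin (d w) × Fin (d w)) B}
    (hT : sc B (matR d q u u) * sw T = T * sc B (matR21 d q w w))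
    (hTX : ∀ (i j : Fin (d u)) (x l : Fin (d w)), ∃ ε : kˣ,
      T (i, j) (x, l) - (ε : k) • (X i x * X j l) ∈ Submodule.span k
        {z | ∃ (a : Fin (d u)) (b : Fin (d w)) (c : Fin (d u)) (e : Fin (d w)),
          (i + x + j + l : ℕ) < a + b + c + e ∧ z = X a b * X c e})
    (j : Fin (d u)) (x : Fin (d w)) (i : Fin (d u)) (l : Fin (d w))
    (hlt : (i : ℕ) < j ∨ ((i : ℕ) = j ∧ (l : ℕ) < x))
    (hS : ∀ (a : Fin (d u)) (b : Fin (d w)) (c : Fin (d u)) (e : Fin (d w)),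
      ((j + x + i + l : ℕ) < a + b + c + e ∨ ((a + b + c + e : ℕ) = j + x + i + l ∧
        ((a : ℕ) < j ∨ ((a : ℕ) = j ∧ (b : ℕ) < x)))) → X a b * X c e ∈ S) :
    X j x * X i l ∈ S := by
  have hhigh : ∀ W : ℕ, W = j + x + i + l → Submodule.span k
      {z | ∃ (a : Fin (d u)) (b : Fin (d w)) (c : Fin (d u)) (e : Fin (d w)),
        W < a + b + c + e ∧ z = X a b * X c e} ≤ S := by
    rintro W rfl
    rw [Submodule.span_le]
    rintro _ ⟨a, b, c, e, h, rfl⟩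
    exact hS a b c e (Or.inl h)
  have hto : ∀ (a : Fin (d u)) (b : Fin (d w)) (c : Fin (d u)) (e : Fin (d w)),
      (a + b + c + e : ℕ) = j + x + i + l → X a b * X c e ∈ S → T (a, c) (b, e) ∈ S := by
    intro a b c e hW h
    obtain ⟨ε, hε⟩ := hTX a c b e
    have := S.add_mem (hhigh _ hW hε) (S.smul_mem (ε : k) h)
    rwa [sub_add_cancel] at this
  have hfrom : T (j, i) (x, l) ∈ S → X j x * X i l ∈ S := by
    intro h
    obtain ⟨ε, hε⟩ := hTX j i x l
    have h1 := S.sub_mem h (hhigh _ rfl hε)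
    rw [sub_sub_cancel] at h1
    have := S.smul_mem ((ε⁻¹ : kˣ) : k) h1
    rwa [smul_smul, Units.inv_mul, one_smul] at this
  apply hfrom
  rcases hlt with h | ⟨h, h'⟩
  · have h1 := congrFun (congrFun hT (i, j)) (l, x)
    rw [sc_matR_mul_apply, mul_sc_matR21_apply] at h1
    have hij : i ≠ j := fun e => by rw [e] at h; exact lt_irrefl _ h
    have hji : ¬ j < i := fun e => lt_asymm (Fin.lt_def.mp e) h
    simp only [sw_apply, hij, hji, if_false, one_smul, zero_smul, add_zero] at h1
    rw [h1]
    refine S.add_mem (S.smul_mem _ (hto _ _ _ _ ?_ (hS _ _ _ _ ?_)))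
      (S.smul_mem _ (hto _ _ _ _ ?_ (hS _ _ _ _ ?_))) <;> omega
  · have hij : i = j := Fin.ext h
    subst hij
    have h1 := congrFun (congrFun hT (i, i)) (x, l)
    rw [sc_matR_mul_apply, mul_sc_matR21_apply] at h1
    have hxl : x ≠ l := fun e => by rw [e] at h'; exact lt_irrefl _ h'
    have hlx : l < x := h'
    simp only [sw_apply, hxl, hlx, if_false, if_true, lt_irrefl, one_smul, zero_smul,
      add_zero] at h1
    have h2 : T (i, i) (l, x) ∈ S := hto _ _ _ _ (by omega) (hS _ _ _ _ (by omega))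
    have h3 : T (i, i) (x, l) = (q : k) • T (i, i) (l, x) -
        ((q : k) - ((q⁻¹ : kˣ) : k)) • T (i, i) (l, x) := eq_sub_of_add_eq h1.symm
    rw [h3]
    exact S.sub_mem (S.smul_mem _ h2) (S.smul_mem _ h2)

lemma mul_mem_of_edgeRel {u w : V} {X : Matrix (Fin (d u)) (Fin (d w)) B}
    (hX : EdgeRel d q u w X)
    (j : Fin (d u)) (x : Fin (d w)) (i : Fin (d u)) (l : Fin (d w))
    (hlt : (i : ℕ) < j ∨ ((i : ℕ) = j ∧ (l : ℕ) < x))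
    (hS : ∀ (a : Fin (d u)) (b : Fin (d w)) (c : Fin (d u)) (e : Fin (d w)),
      ((j + x + i + l : ℕ) < a + b + c + e ∨ ((a + b + c + e : ℕ) = j + x + i + l ∧
        ((a : ℕ) < j ∨ ((a : ℕ) = j ∧ (b : ℕ) < x)))) → X a b * X c e ∈ S) :
    X j x * X i l ∈ S := by
  refine mul_mem_of_exchange d q (T := (leg1 (Fin (d u)) X * leg2 (Fin (d w)) X :
    Matrix (Fin (d u) × Fin (d u)) (Fin (d w) × Fin (d w)) B)) ?_ ?_ j x i l hlt hS
  · rw [sw_mul, sw_leg1, sw_leg2, ← Matrix.mul_assoc]; exact hX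
  · intro i j x l
    refine ⟨1, ?_⟩
    rw [leg1_mul_leg2_apply]
    simp

lemma mul_mem_of_loopRel {u w : V} (h : u = w) {X : Matrix (Fin (d u)) (Fin (d w)) B}
    (hX : LoopRel d q u w X)
    (j : Fin (d u)) (x : Fin (d w)) (i : Fin (d u)) (l : Fin (d w))
    (hlt : (i : ℕ) < j ∨ ((i : ℕ) = j ∧ (l : ℕ) < x))
    (hS : ∀ (a : Fin (d u)) (b : Fin (d w)) (c : Fin (d u)) (e : Fin (d w)),
      ((j + x + i + l : ℕ) < a + b + c + e ∨ ((a + b + c + e : ℕ) = j + x + i + l ∧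
        ((a : ℕ) < j ∨ ((a : ℕ) = j ∧ (b : ℕ) < x)))) → X a b * X c e ∈ S) :
    X j x * X i l ∈ S := by
  subst h
  refine mul_mem_of_exchange d q (T :=
    (leg1 (Fin (d u)) X * sc B (matR d q u u) * leg2 (Fin (d u)) X :
    Matrix (Fin (d u) × Fin (d u)) (Fin (d u) × Fin (d u)) B)) ?_ ?_
    j x i l hlt hS
  · have := congrArg sw hX
    simp only [sw_mul, sw_leg1, sw_leg2, sw_sc, matR21_eq, sw_sw] at this
    simp only [sw_mul, sw_leg1, sw_leg2, sw_sc, matR21_eq, ← Matrix.mul_assoc]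
    exact this
  · intro i j x l
    refine ⟨if x = j then q else 1, ?_⟩
    rw [leg1_sc_leg2_apply]
    simp only [matR_self]
    rw [sum_contract q j x (fun m y => X i m * X y l), apply_ite Units.val, Units.val_one,
      add_sub_cancel_left]
    split_ifs with hjx
    · subst hjx
      refine Submodule.smul_mem _ _ (Submodule.sum_mem _ fun m hm => Submodule.subset_span
        ⟨i, m, m, l, ?_, rfl⟩)
      have : j < m := by simpa using hm
      have := Fin.lt_def.mp this
      omega
    · exact Submodule.zero_mem _

end SameEdge

/-! ### The standard monomials span -/

section Span

variable {V E : Type*} [DecidableEq V] [LinearOrder E] (Q : EdgeQuiver V E) (d : V → ℕ)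
variable {k : Type*} [CommRing k] (q : kˣ)

/-- The product of the generators along a word. -/
def wordProd (w : List (Gen Q d)) : Dq Q d q := (w.map fun g => genX Q d q g.1 g.2.1 g.2.2).prod

/-- The rank of an edge of the doubled quiver: all edges come before all adjoint edges. -/
def blockRank (ρ : E → ℕ) (N : ℕ) : E ⊕ E → ℕ
  | Sum.inl e => ρ e
  | Sum.inr e => N + ρ e

/-- The order on the generators in which the standard monomials are increasing. -/
def genLE (ρ : E → ℕ) (N : ℕ) (s t : Gen Q d) : Prop :=
  blockRank ρ N s.1 < blockRank ρ N t.1 ∨ (blockRank ρ N s.1 = blockRank ρ N t.1 ∧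
    ((s.2.1 : ℕ) < t.2.1 ∨ ((s.2.1 : ℕ) = t.2.1 ∧ (s.2.2 : ℕ) ≤ t.2.2)))

variable {Q d}

/-- Products of generators of two different edges of the doubled quiver can be put in order: the
relation that involves both matrices is solved for the product in the wrong order, by inverting the
R-matrices. -/
lemma genX_mul_mem_of_block {ρ : E → ℕ} {N : ℕ}
    {x y : E ⊕ E} (hxy : blockRank ρ N y < blockRank ρ N x) {S : Submodule k (Dq Q d q)}
    (h1 : (1 : Dq Q d q) ∈ S)
    (hS : ∀ i j i' j', genX Q d q y i j * genX Q d q x i' j' ∈ S) (i j i' j') :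
    genX Q d q x i j * genX Q d q y i' j' ∈ S := by
  have sat := sat_genX Q d q
  rcases lt_trichotomy (underlying y) (underlying x) with h | h | h
  · have hb := sat.braided x y h
    apply mul_mem_of_entriesIn_leg1 d q
    rw [hb]
    apply EntriesIn.mul_sc
    rw [Matrix.mul_assoc, Matrix.mul_assoc]
    apply EntriesIn.sc_mul
    rw [← Matrix.mul_assoc]
    exact entriesIn_leg2_leg1 _ hS
  · obtain ⟨e, rfl, rfl⟩ : ∃ e, x = Sum.inr e ∧ y = Sum.inl e := by
      rcases x with x | x <;> rcases y with y | y <;> simp only [underlying] at h <;> subst h <;>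
        simp only [blockRank] at hxy
      · omega
      · omega
      · exact ⟨y, rfl, rfl⟩
      · omega
    by_cases hl : Q.tail e = Q.head e
    · have hb := sat.cross_loop e hl
      apply mul_mem_of_entriesIn_leg1 d q (u := Q.head e) (u' := Q.tail e) (v := Q.tail e)
        (v' := Q.head e)
      have h2 := mul_congr_left hb (sc (Dq Q d q) (matR21Inv d q (Q.head e) (Q.tail e)))
      simp only [Matrix.mul_assoc] at h2
      rw [reassoc_one (scR21Inv_mul q d _ _ _)] at h2
      rw [Matrix.mul_assoc, h2]
      apply EntriesIn.sc_mul
      rw [← Matrix.mul_assoc, ← Matrix.mul_assoc]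
      apply EntriesIn.mul_sc
      exact entriesIn_leg2_leg1 _ hS
    · have hb := sat.cross_edge e hl
      apply mul_mem_of_entriesIn_leg2 d q (u := Q.tail e) (u' := Q.head e) (v := Q.head e)
        (v' := Q.tail e)
      unfold CrossEdgeRel at hb
      rw [hb]
      intro r c
      refine S.add_mem (entriesIn_leg1_leg2 _ hS r c) ?_
      change (if r.1 = c.2 ∧ r.2 = c.1 then (1 : Dq Q d q) else 0) ∈ S
      split_ifs
      · exact h1
      · exact S.zero_mem
  · have hb := sat.braided y x h
    apply mul_mem_of_entriesIn_leg2 d q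
    unfold BraidRel at hb
    have h2 := mul_congr_left (mul_congr_right hb (sc (Dq Q d q) (matRInv d q (Q.tgt y) (Q.tgt x))))
      (sc (Dq Q d q) (matRInv d q (Q.src y) (Q.src x)))
    simp only [Matrix.mul_assoc] at h2
    rw [scR_inv, reassoc_one (scRInv_mul q d _ _ _), Matrix.mul_one] at h2
    rw [Matrix.mul_assoc, ← h2]
    apply EntriesIn.sc_mul
    rw [← Matrix.mul_assoc, ← Matrix.mul_assoc]
    apply EntriesIn.mul_sc
    exact entriesIn_leg1_leg2 _ hS

/-- Every word in the generators is a combination of increasing words. -/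
lemma wordProd_mem_span {ρ : E → ℕ} {N : ℕ} (hρ : StrictMono ρ) (hN : ∀ e, ρ e < N)
    {D : ℕ} (hD : ∀ x : E ⊕ E, d (Q.src x) ≤ D) (w : List (Gen Q d)) :
    wordProd Q d q w ∈ Submodule.span k
      {z | ∃ w : List (Gen Q d), w.IsChain (genLE Q d ρ N) ∧ z = wordProd Q d q w} := by
  have hD' : ∀ x : E ⊕ E, d (Q.tgt x) ≤ D := by
    rintro (e | e)
    · exact hD (Sum.inr e)
    · exact hD (Sum.inl e)
  have sat := sat_genX Q d q
  refine word_mem_span_sorted (fun g : Gen Q d => genX Q d q g.1 g.2.1 g.2.2) (genLE Q d ρ N)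
    (fun g => blockRank ρ N g.1) (fun g => (g.2.1 : ℕ) + g.2.2)
    (fun g => (g.2.1 : ℕ) * D + g.2.2) (N + N + D * D + D + D) ?_ ?_ ?_ ?_ w
  · rintro ⟨x | x, i, j⟩ <;> simp only [blockRank] <;> have := hN x <;> omega
  · rintro ⟨x, i, j⟩
    have := i.2; have := j.2; have := hD x; have := hD' x
    dsimp only; omega
  · rintro ⟨x, i, j⟩
    have := i.2; have := j.2; have := hD x; have := hD' x
    have : (i : ℕ) * D ≤ D * D := Nat.mul_le_mul_right _ (by omega)
    dsimp only; omega
  · rintro ⟨x, i, j⟩ ⟨y, i', j'⟩ hst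
    simp only [genLE, not_or, not_and, not_lt] at hst
    obtain ⟨hst1, hst2⟩ := hst
    rcases hst1.lt_or_eq with hb | hb
    · refine genX_mul_mem_of_block q hb ?_ ?_ i j i' j'
      · exact Submodule.subset_span ⟨[], Or.inl (by simp), by simp⟩
      · intro a b a' b'
        exact Submodule.subset_span ⟨[⟨y, a, b⟩, ⟨x, a', b'⟩], Or.inr ⟨_, _, rfl, Or.inl hb⟩,
          by simp⟩
    · have hxy : x = y := by
        rcases x with x | x <;> rcases y with y | y <;> simp only [blockRank] at hb
        · rw [hρ.injective hb]
        · have := hN x; omega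
        · have := hN y; omega
        · rw [hρ.injective (Nat.add_left_cancel hb)]
      subst hxy
      have hlt : (i' : ℕ) < i ∨ ((i' : ℕ) = i ∧ (j' : ℕ) < j) := by
        have := hst2 rfl
        omega
      have hS : ∀ (a : Fin (d (Q.src x))) (b : Fin (d (Q.tgt x))) (c : Fin (d (Q.src x)))
          (e : Fin (d (Q.tgt x))), ((i + j + i' + j' : ℕ) < a + b + c + e ∨
            ((a + b + c + e : ℕ) = i + j + i' + j' ∧
              ((a : ℕ) < i ∨ ((a : ℕ) = i ∧ (b : ℕ) < j)))) →
          genX Q d q x a b * genX Q d q x c e ∈ Submodule.span k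
            {z | ∃ w : List (Gen Q d), SmallWord (fun g => blockRank ρ N g.1)
              (fun g => (g.2.1 : ℕ) + g.2.2) (fun g => (g.2.1 : ℕ) * D + g.2.2)
              (⟨x, i, j⟩ : Gen Q d) ⟨x, i', j'⟩ w ∧
              z = (w.map fun g => genX Q d q g.1 g.2.1 g.2.2).prod} := by
        intro a b c e h
        refine Submodule.subset_span ⟨[⟨x, a, b⟩, ⟨x, c, e⟩],
          Or.inr ⟨_, _, rfl, Or.inr ⟨rfl, rfl, ?_⟩⟩,
          by simp⟩
        dsimp only
        rcases h with h | ⟨h, h'⟩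
        · left; omega
        · right
          refine ⟨by omega, ?_⟩
          rcases h' with h' | ⟨h', h''⟩
          · have := b.2; have := hD' x
            have : ((a : ℕ) + 1) * D ≤ i * D := Nat.mul_le_mul_right _ h'
            have : ((a : ℕ) + 1) * D = a * D + D := by ring
            omega
          · rw [h']; omega
      by_cases hl : Q.src x = Q.tgt x
      · exact mul_mem_of_loopRel d q hl (sat.loop x hl) i j i' j' hlt hS
      · exact mul_mem_of_edgeRel d q (sat.edge x hl) i j i' j' hlt hS

end Span

section Span

variable {V E : Type*} [DecidableEq V] [LinearOrder E] (Q : EdgeQuiver V E) (d : V → ℕ)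
variable {k : Type*} [CommRing k] (q : kˣ)

lemma genLE_trans (ρ : E → ℕ) (N : ℕ) {r s t : Gen Q d} (h : genLE Q d ρ N r s)
    (h' : genLE Q d ρ N s t) : genLE Q d ρ N r t := by
  unfold genLE at *
  omega

/-- The letter `a(e)^i_j` of a triple `(e, i, j)`. -/
def aLetter (t : Triple (fun e => d (Q.tail e)) (fun e => d (Q.head e))) : Gen Q d :=
  ⟨Sum.inl t.1, t.2⟩

/-- The letter `∂(e)^i_j` of a triple `(e, i, j)`. -/
def dLetter (t : Triple (fun e => d (Q.head e)) (fun e => d (Q.tail e))) : Gen Q d :=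
  ⟨Sum.inr t.1, t.2⟩

variable {Q d}

lemma exists_eq_append_of_pairwise {ρ : E → ℕ} {N : ℕ} (hN : ∀ e, ρ e < N) :
    ∀ w : List (Gen Q d), w.Pairwise (genLE Q d ρ N) →
      ∃ (I : List (Triple (fun e => d (Q.tail e)) (fun e => d (Q.head e))))
        (J : List (Triple (fun e => d (Q.head e)) (fun e => d (Q.tail e)))),
          w = I.map (aLetter Q d) ++ J.map (dLetter Q d)
  | [], _ => ⟨[], [], rfl⟩
  | ⟨Sum.inl e, p⟩ :: w, h => by
    obtain ⟨I, J, rfl⟩ := exists_eq_append_of_pairwise hN w (List.pairwise_cons.mp h).2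
    exact ⟨⟨e, p⟩ :: I, J, rfl⟩
  | ⟨Sum.inr e, p⟩ :: w, h => by
    obtain ⟨I, J, rfl⟩ := exists_eq_append_of_pairwise hN w (List.pairwise_cons.mp h).2
    rcases I with _ | ⟨t, I⟩
    · exact ⟨[], ⟨e, p⟩ :: J, rfl⟩
    · have h1 := (List.pairwise_cons.mp h).1 (aLetter Q d t) (by simp)
      have := hN t.1
      simp only [genLE, aLetter, blockRank] at h1
      omega

variable (Q d)

/-- The standard monomials span, over every commutative ring. -/
theorem span_stdMonomial [Finite E] :
    Submodule.span k (Set.range (stdMonomial Q d (aGen Q d q) (dGen Q d q))) = ⊤ := by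
  classical
  have := Fintype.ofFinite E
  let o := Fintype.orderIsoFinOfCardEq E rfl
  let ρ : E → ℕ := fun e => o.symm e
  have hρ : StrictMono ρ := fun a b h => Fin.lt_def.mp (o.symm.strictMono h)
  have hN : ∀ e, ρ e < Fintype.card E := fun e => (o.symm e).2
  obtain ⟨D, hD⟩ := (Set.finite_range fun x : E ⊕ E => d (Q.src x)).bddAbove
  have hD : ∀ x : E ⊕ E, d (Q.src x) ≤ D := fun x => hD ⟨x, rfl⟩
  have hsorted : Submodule.span k {z | ∃ w : List (Gen Q d),
      w.IsChain (genLE Q d ρ (Fintype.card E)) ∧ z = wordProd Q d q w} ≤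
        Submodule.span k (Set.range (stdMonomial Q d (aGen Q d q) (dGen Q d q))) := by
    rw [Submodule.span_le]
    rintro _ ⟨w, hw, rfl⟩
    have : IsTrans (Gen Q d) (genLE Q d ρ (Fintype.card E)) :=
      ⟨fun _ _ _ => genLE_trans Q d _ _⟩
    have hw := List.isChain_iff_pairwise.mp hw
    obtain ⟨I, J, rfl⟩ := exists_eq_append_of_pairwise hN w hw
    rw [List.pairwise_append, List.pairwise_map, List.pairwise_map] at hw
    refine Submodule.subset_span ⟨⟨⟨I, hw.1.imp ?_⟩, ⟨J, hw.2.1.imp ?_⟩⟩, ?_⟩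
    · intro s t h
      simp only [genLE, aLetter, blockRank, hρ.lt_iff_lt, hρ.injective.eq_iff] at h
      exact h
    · intro s t h
      simp only [genLE, dLetter, blockRank, add_lt_add_iff_left, add_right_inj, hρ.lt_iff_lt,
        hρ.injective.eq_iff] at h
      exact h
    · rw [wordProd, List.map_append, List.prod_append, List.map_map, List.map_map]
      rfl
  rw [eq_top_iff]
  refine le_trans ?_ hsorted
  intro y _
  obtain ⟨z, rfl⟩ := RingQuot.mkAlgHom_surjective k (Rel Q d q) y
  have key : ∀ z : FreeAlgebra k (Gen Q d), ∀ w, RingQuot.mkAlgHom k (Rel Q d q) z *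
      wordProd Q d q w ∈ Submodule.span k (Set.range (wordProd Q d q)) := by
    have aux : ∀ z : FreeAlgebra k (Gen Q d), (∀ w, RingQuot.mkAlgHom k (Rel Q d q) z *
      wordProd Q d q w ∈ Submodule.span k (Set.range (wordProd Q d q))) →
      ∀ y ∈ Submodule.span k (Set.range (wordProd Q d q)), RingQuot.mkAlgHom k (Rel Q d q) z *
        y ∈ Submodule.span k (Set.range (wordProd Q d q)) := by
      intro z hz y hy
      induction hy using Submodule.span_induction with
      | mem y hy => obtain ⟨w, rfl⟩ := hy; exact hz w
      | zero => simp
      | add y y' _ _ h h' => rw [mul_add]; exact Submodule.add_mem _ h h'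
      | smul c y _ h => rw [mul_smul_comm]; exact Submodule.smul_mem _ _ h
    intro z
    induction z using FreeAlgebra.induction with
    | grade0 r =>
      intro w
      rw [AlgHom.commutes, ← Algebra.smul_def]
      exact Submodule.smul_mem _ _ (Submodule.subset_span ⟨w, rfl⟩)
    | grade1 g =>
      intro w
      exact Submodule.subset_span ⟨g :: w, by simp [wordProd, genX]⟩
    | mul a b ha hb => intro w; rw [map_mul, mul_assoc]; exact aux a ha _ (hb w)
    | add a b ha hb => intro w; rw [map_add, add_mul]; exact Submodule.add_mem _ (ha w) (hb w)
  have := key z []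
  rw [show wordProd Q d q [] = 1 from rfl, mul_one] at this
  refine Submodule.span_le.mpr ?_ this
  rintro _ ⟨w, rfl⟩
  exact wordProd_mem_span q hρ hN hD w

end Span

/-! ### The quantized coordinate ring of a space of matrices -/

section Frt

variable {V : Type*} [DecidableEq V] (d : V → ℕ)
variable {k : Type*} [CommRing k] (q : kˣ) {B : Type*} [Ring B] [Algebra k B]

/-- The relation of an edge that is not a loop, entry by entry. -/
lemma edgeRel_iff {u w : V} (X : Matrix (Fin (d u)) (Fin (d w)) B) :
    EdgeRel d q u w X ↔ ∀ i i' x x',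
      (if i = i' then (q : k) else 1) • (X i' x' * X i x) +
        (if i' < i then (q : k) - ((q⁻¹ : kˣ) : k) else 0) • (X i x' * X i' x) =
      (if x = x' then (q : k) else 1) • (X i x * X i' x') +
        (if x' < x then (q : k) - ((q⁻¹ : kˣ) : k) else 0) • (X i x' * X i' x) := by
  unfold EdgeRel
  rw [← Matrix.ext_iff]
  constructor
  · intro h i i' x x'
    have := h (i, i') (x, x')
    rw [Matrix.mul_assoc, sc_matR_mul_apply, mul_sc_matR21_apply] at this
    simpa only [leg1_mul_leg2_apply, leg2_mul_leg1_apply] using this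
  · rintro h ⟨i, i'⟩ ⟨x, x'⟩
    rw [Matrix.mul_assoc, sc_matR_mul_apply, mul_sc_matR21_apply]
    simpa only [leg1_mul_leg2_apply, leg2_mul_leg1_apply] using h i i' x x'

/-- The Hecke relation in the form in which it makes the inhomogeneous terms cancel. -/
lemma exchange_of_hecke {M : Type*} [AddCommGroup M] [Module k M] {n m : ℕ}
    (t F : Fin n → Fin n → Fin m → Fin m → M)
    (hF : ∀ j j' l l', F j j' l l' = t j j' l l' +
      (if j = j' then (q : k) else 1) • (if l = l' then (q : k) else 1) • t j' j l' l +
      (if j = j' then (q : k) else 1) •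
        (if l' < l then (q : k) - ((q⁻¹ : kˣ) : k) else 0) • t j' j l l' +
      (if j < j' then (q : k) - ((q⁻¹ : kˣ) : k) else 0) •
        (if l = l' then (q : k) else 1) • t j j' l' l +
      (if j < j' then (q : k) - ((q⁻¹ : kˣ) : k) else 0) •
        (if l' < l then (q : k) - ((q⁻¹ : kˣ) : k) else 0) • t j j' l l') (j j' l l') :
    (if j = j' then (q : k) else 1) • F j j' l l' +
        (if j' < j then (q : k) - ((q⁻¹ : kˣ) : k) else 0) • F j' j l l' =
      (if l = l' then (q : k) else 1) • F j' j l' l +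
        (if l' < l then (q : k) - ((q⁻¹ : kˣ) : k) else 0) • F j' j l l' := by
  simp only [hF]
  have hq : (q : k) * ((q⁻¹ : kˣ) : k) = 1 := by simp
  generalize ((q⁻¹ : kˣ) : k) = q' at *
  clear hF
  rcases lt_trichotomy j j' with h | h | h <;> rcases lt_trichotomy l l' with h' | h' | h' <;>
    (try subst h) <;> (try subst h') <;>
    simp only [lt_irrefl, if_true, if_false, *, ne_of_lt, ne_of_gt, not_lt_of_gt] <;>
    match_scalars <;> grind

/-- The left-hand side of `EdgeRel`. -/
def edgeLHS (v w : V) (X : Matrix (Fin (d v)) (Fin (d w)) B) :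
    Matrix (Fin (d v) × Fin (d v)) (Fin (d w) × Fin (d w)) B :=
  sc B (matR d q v v) * leg2 (Fin (d v)) X * leg1 (Fin (d w)) X

/-- The right-hand side of `EdgeRel`. -/
def edgeRHS (v w : V) (X : Matrix (Fin (d v)) (Fin (d w)) B) :
    Matrix (Fin (d v) × Fin (d v)) (Fin (d w) × Fin (d w)) B :=
  leg1 (Fin (d v)) X * leg2 (Fin (d w)) X * sc B (matR21 d q w w)

variable {B' : Type*} [Ring B'] [Algebra k B']

lemma edgeLHS_map {v w : V} (X : Matrix (Fin (d v)) (Fin (d w)) B) (f : B →ₐ[k] B') :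
    (edgeLHS d q v w X).map f = edgeLHS d q v w (X.map f) := by
  have h1 := leg1_map (p := Fin (d w)) X (f : B →+* B')
  have h2 := leg2_map (p := Fin (d v)) X (f : B →+* B')
  rw [AlgHom.coe_toRingHom] at h1 h2
  rw [edgeLHS, edgeLHS, Matrix.map_mul, Matrix.map_mul, sc_map, h1, h2]

lemma edgeRHS_map {v w : V} (X : Matrix (Fin (d v)) (Fin (d w)) B) (f : B →ₐ[k] B') :
    (edgeRHS d q v w X).map f = edgeRHS d q v w (X.map f) := by
  have h1 := leg1_map (p := Fin (d v)) X (f : B →+* B')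
  have h2 := leg2_map (p := Fin (d w)) X (f : B →+* B')
  rw [AlgHom.coe_toRingHom] at h1 h2
  rw [edgeRHS, edgeRHS, Matrix.map_mul, Matrix.map_mul, sc_map, h1, h2]

variable (k) in
/-- The matrix of free generators. -/
def frtFree (v w : V) : Matrix (Fin (d v)) (Fin (d w)) (FreeAlgebra k (Fin (d v) × Fin (d w))) :=
  Matrix.of fun i j => FreeAlgebra.ι k (i, j)

/-- The relations of the quantized coordinate ring of the space of `d v × d w`-matrices. -/
inductive FrtRel (v w : V) : FreeAlgebra k (Fin (d v) × Fin (d w)) →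
    FreeAlgebra k (Fin (d v) × Fin (d w)) → Prop
  | mk (r : Fin (d v) × Fin (d v)) (c : Fin (d w) × Fin (d w)) :
    FrtRel v w (edgeLHS d q v w (frtFree d k v w) r c) (edgeRHS d q v w (frtFree d k v w) r c)

/-- The quantized coordinate ring of the space of `d v × d w`-matrices: the algebra generated by
the entries of one matrix, subject to `EdgeRel`. -/
abbrev Frt (v w : V) : Type _ := RingQuot (FrtRel d q v w)

/-- The matrix of generators. -/
def frtX (v w : V) : Matrix (Fin (d v)) (Fin (d w)) (Frt d q v w) :=
  (frtFree d k v w).map (RingQuot.mkAlgHom k (FrtRel d q v w))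

lemma edgeRel_frtX (v w : V) : EdgeRel d q v w (frtX d q v w) := by
  change edgeLHS d q v w _ = edgeRHS d q v w _
  rw [frtX, ← edgeLHS_map, ← edgeRHS_map]
  ext r c
  exact RingQuot.mkAlgHom_rel k (FrtRel.mk (q := q) (d := d) (v := v) (w := w) r c)

variable {d q}

/-- Matrices that satisfy `EdgeRel` are homomorphisms from the quantized coordinate ring. -/
def frtLift {v w : V} {Y : Matrix (Fin (d v)) (Fin (d w)) B} (h : EdgeRel d q v w Y) :
    Frt d q v w →ₐ[k] B :=
  RingQuot.liftAlgHom k ⟨FreeAlgebra.lift k (fun p : Fin (d v) × Fin (d w) => Y p.1 p.2), by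
    intro a b hab
    have hg : (frtFree d k v w).map
        (FreeAlgebra.lift k (fun p : Fin (d v) × Fin (d w) => Y p.1 p.2)) = Y := by
      ext i j; simp [frtFree]
    obtain ⟨r, c⟩ := hab
    rw [← Matrix.map_apply (f := FreeAlgebra.lift k _),
      ← Matrix.map_apply (f := FreeAlgebra.lift k _), edgeLHS_map, edgeRHS_map, hg]
    exact congrFun (congrFun h r) c⟩

@[simp] lemma frtLift_frtX {v w : V} {Y : Matrix (Fin (d v)) (Fin (d w)) B}
    (h : EdgeRel d q v w Y) (i j) : frtLift h (frtX d q v w i j) = Y i j := by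
  simp [frtLift, frtX, frtFree]

lemma Frt.eq_top_of_mul_mem {v w : V} (S : Submodule k (Frt d q v w)) (h1 : 1 ∈ S)
    (hm : ∀ i j, ∀ y ∈ S, frtX d q v w i j * y ∈ S) : S = ⊤ := by
  have key : ∀ z : FreeAlgebra k (Fin (d v) × Fin (d w)), ∀ y ∈ S,
      RingQuot.mkAlgHom k (FrtRel d q v w) z * y ∈ S := by
    intro z
    induction z using FreeAlgebra.induction with
    | grade0 r => intro y hy; rw [AlgHom.commutes, ← Algebra.smul_def]; exact S.smul_mem _ hy
    | grade1 g => intro y hy; obtain ⟨i, j⟩ := g; exact hm i j y hy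
    | mul a b ha hb => intro y hy; rw [map_mul, mul_assoc]; exact ha _ (hb _ hy)
    | add a b ha hb => intro y hy; rw [map_add, add_mul]; exact S.add_mem (ha _ hy) (hb _ hy)
  rw [eq_top_iff]
  rintro y -
  obtain ⟨z, rfl⟩ := RingQuot.mkAlgHom_surjective k (FrtRel d q v w) y
  simpa using key z 1 h1

end Frt

/-! ### q-difference operators on the quantized coordinate ring -/

section Gauge

variable {V : Type*} [DecidableEq V] (d : V → ℕ)
variable {k : Type*} [CommRing k] (q : kˣ) {B : Type*} [Ring B] [Algebra k B]

/-- `EdgeRel` is preserved by multiplication with matrices that satisfy exchange relations. -/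
lemma EdgeRel.gauge {v w : V} {X : Matrix (Fin (d v)) (Fin (d w)) B} (hX : EdgeRel d q v w X)
    {T : Matrix (Fin (d v)) (Fin (d v)) B} {S : Matrix (Fin (d w)) (Fin (d w)) B}
    (hT : sc B (matR d q v v) * leg2 (Fin (d v)) T * leg1 (Fin (d v)) T =
      leg1 (Fin (d v)) T * leg2 (Fin (d v)) T * sc B (matR d q v v))
    (hS : sc B (matR21 d q w w) * leg2 (Fin (d w)) S * leg1 (Fin (d w)) S =
      leg1 (Fin (d w)) S * leg2 (Fin (d w)) S * sc B (matR21 d q w w))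
    (hTX : ∀ i j i' j', T i j * X i' j' = X i' j' * T i j)
    (hSX : ∀ i j i' j', S i j * X i' j' = X i' j' * S i j)
    (hTS : ∀ i j i' j', T i j * S i' j' = S i' j' * T i j) :
    EdgeRel d q v w (T * X * S) := by
  unfold EdgeRel at *
  simp only [leg1_mul, leg2_mul, Matrix.mul_assoc] at *
  have e1 := leg_comm hTS
  have e2 := leg_comm hTX
  have e3 := leg_comm (fun i j i' j' => (hSX i' j' i j).symm)
  have f1 := leg_comm (fun i j i' j' => (hTS i' j' i j).symm)
  have f2 := leg_comm (fun i j i' j' => (hTX i' j' i j).symm)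
  have f3 := leg_comm hSX
  rw [reassoc e1.symm, reassoc e2.symm, reassoc e3.symm, ← Matrix.mul_assoc (leg2 _ T),
    ← Matrix.mul_assoc (sc B _), hT]
  simp only [Matrix.mul_assoc]
  rw [← Matrix.mul_assoc (leg2 _ X), ← Matrix.mul_assoc (sc B _), hX]
  simp only [Matrix.mul_assoc]
  rw [hS, reassoc f3.symm, ← reassoc f2, ← reassoc f1]

end Gauge

section Difference

variable {V : Type*} [DecidableEq V] (d : V → ℕ)
variable {k : Type*} [CommRing k] (q : kˣ) (v w : V)

lemma sum_rCoeff_left {M : Type*} [AddCommGroup M] [Module k M] {n : ℕ} (i j l : Fin n)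
    (F : Fin n → M) :
    ∑ x : Fin n, rCoeff q i j x l • F x =
      (if j = l then (if i = j then (q : k) else 1) • F i else 0) +
        (if i = l then (if j < i then (q : k) - ((q⁻¹ : kˣ) : k) else 0) • F j else 0) := by
  have := sum_rCoeff q i j (fun x y => if y = l then F x else 0)
  simpa using this

lemma sum_rCoeff_left' {M : Type*} [AddCommGroup M] [Module k M] {n : ℕ} (i j l : Fin n)
    (F : Fin n → M) :
    ∑ x : Fin n, rCoeff q x l i j • F x =
      (if j = l then (if i = j then (q : k) else 1) • F i else 0) +
        (if i = l then (if i < j then (q : k) - ((q⁻¹ : kˣ) : k) else 0) • F j else 0) := by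
  have := sum_rCoeff' q i j (fun x y => if y = l then F x else 0)
  simpa using this

lemma sum_sum_rCoeff {M : Type*} [AddCommGroup M] [Module k M] {n m : ℕ} (F : Fin n → Fin m → M)
    (i i' l : Fin n) (x x' j : Fin m) :
    (∑ p : Fin n, rCoeff q i' i p l • ∑ s : Fin m, rCoeff q s j x' x • F p s) +
        (if i' = l ∧ j = x' then F i x else 0) =
      (if i' = l then if j = x' then F i x else 0 else 0) +
      (if i = i' then (q : k) else 1) • (if x = x' then (q : k) else 1) •
        (if i = l then if j = x then F i' x' else 0 else 0) +
      (if i = i' then (q : k) else 1) • (if x' < x then (q : k) - ((q⁻¹ : kˣ) : k) else 0) •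
        (if i = l then if j = x' then F i' x else 0 else 0) +
      (if i < i' then (q : k) - ((q⁻¹ : kˣ) : k) else 0) • (if x = x' then (q : k) else 1) •
        (if i' = l then if j = x then F i x' else 0 else 0) +
      (if i < i' then (q : k) - ((q⁻¹ : kˣ) : k) else 0) •
        (if x' < x then (q : k) - ((q⁻¹ : kˣ) : k) else 0) •
        (if i' = l then if j = x' then F i x else 0 else 0) := by
  simp only [sum_rCoeff_left']
  rw [sum_rCoeff_left q i' i l (fun p => _)]
  have hi : ∀ (P : Prop) [Decidable P] (y : M),
      (if P then y else 0) = (if P then (1 : k) else 0) • y := by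
    intro P _ y; split_ifs <;> simp
  simp only [eq_comm (a := x) (b := j), eq_comm (a := x') (b := j), eq_comm (a := i') (b := i),
    eq_comm (a := x') (b := x), ite_and, hi,
    smul_smul]
  match_scalars <;> by_cases h3 : i' = l <;> by_cases h5 : j = x' <;>
    (try simp only [h3, h5, if_true, if_false]) <;> ring

/-- The matrices `R^{is}_{pl}`, as scalar matrices in the second factor. -/
def braidRow : Matrix (Fin (d v)) (Fin (d v))
    (Matrix (Fin (d w) × Fin (d v)) (Fin (d w) × Fin (d v)) (Frt d q v w)) :=
  Matrix.of fun i p => leg2 (Fin (d w))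
    (sc (Frt d q v w) (Matrix.of fun l s => matR d q v v (i, s) (p, l)))

/-- The matrices `R^{mj}_{kn}`, as scalar matrices in the first factor. -/
def braidCol : Matrix (Fin (d w)) (Fin (d w))
    (Matrix (Fin (d w) × Fin (d v)) (Fin (d w) × Fin (d v)) (Frt d q v w)) :=
  Matrix.of fun m x => leg1 (Fin (d v))
    (sc (Frt d q v w) (Matrix.of fun j n => matR d q w w (m, j) (x, n)))

/-- The generators, as diagonal matrices. -/
def diagX : Matrix (Fin (d v)) (Fin (d w))
    (Matrix (Fin (d w) × Fin (d v)) (Fin (d w) × Fin (d v)) (Frt d q v w)) :=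
  (frtX d q v w).map (Matrix.scalar (Fin (d w) × Fin (d v)))

/-- The generators acting on the tensor product of the quantized coordinate ring with the space
spanned by the derivations, by way of the braiding. -/
def braidX : Matrix (Fin (d v)) (Fin (d w))
    (Matrix (Fin (d w) × Fin (d v)) (Fin (d w) × Fin (d v)) (Frt d q v w)) :=
  braidRow d q v w * diagX d q v w * braidCol d q v w

lemma smul_leg2_sc {B : Type*} [Ring B] [Algebra k B] {a p : Type*} [DecidableEq p]
    (r : k) (M : Matrix a a k) : r • leg2 p (sc B M) = leg2 p (sc B (r • M)) := by
  ext i j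
  simp only [leg2_apply, sc_apply, Matrix.smul_apply, smul_eq_mul, map_mul]
  split_ifs
  · rw [Algebra.smul_def]
  · simp

lemma smul_leg1_sc {B : Type*} [Ring B] [Algebra k B] {a p : Type*} [DecidableEq p]
    (r : k) (M : Matrix a a k) : r • leg1 p (sc B M) = leg1 p (sc B (r • M)) := by
  ext i j
  simp only [leg1_apply, sc_apply, Matrix.smul_apply, smul_eq_mul, map_mul]
  split_ifs
  · rw [Algebra.smul_def]
  · simp

lemma sum_leg2_sc {B : Type*} [Ring B] [Algebra k B] {a p ι : Type*} [DecidableEq p]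
    (s : Finset ι) (M : ι → Matrix a a k) :
    ∑ x ∈ s, leg2 p (sc B (M x)) = leg2 p (sc B (∑ x ∈ s, M x)) := by
  ext i j
  simp only [leg2_apply, sc_apply, Matrix.sum_apply, map_sum]
  split_ifs
  · rfl
  · simp

lemma sum_leg1_sc {B : Type*} [Ring B] [Algebra k B] {a p ι : Type*} [DecidableEq p]
    (s : Finset ι) (M : ι → Matrix a a k) :
    ∑ x ∈ s, leg1 p (sc B (M x)) = leg1 p (sc B (∑ x ∈ s, M x)) := by
  ext i j
  simp only [leg1_apply, sc_apply, Matrix.sum_apply, map_sum]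
  split_ifs
  · rfl
  · simp

/-- The Yang–Baxter equation for the families of scalar matrices `R^{is}_{pl}`. -/
lemma ybe_row (i i' p p' : Fin (d v)) :
    ∑ x : Fin (d v) × Fin (d v), matR d q v v (i, i') x •
      ((Matrix.of fun l s => matR d q v v (x.2, s) (p', l)) *
        (Matrix.of fun l s => matR d q v v (x.1, s) (p, l)) : Matrix (Fin (d v)) (Fin (d v)) k) =
    ∑ x : Fin (d v) × Fin (d v), matR d q v v x (p, p') •
      ((Matrix.of fun l s => matR d q v v (i, s) (x.1, l)) *
        (Matrix.of fun l s => matR d q v v (i', s) (x.2, l)) :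
          Matrix (Fin (d v)) (Fin (d v)) k) := by
  ext l s
  have := ybe_matR q d v v v i p i' p' s l
  simp only [Matrix.sum_apply, Matrix.smul_apply, Matrix.mul_apply, Matrix.of_apply,
    Fintype.sum_prod_type, smul_eq_mul]
  calc _ = _ := ?_
    _ = _ := this
    _ = _ := ?_
  · refine Finset.sum_congr rfl fun y _ => Finset.sum_congr rfl fun z _ => ?_
    congr 1
    exact Finset.sum_congr rfl fun t _ => mul_comm _ _
  · simp only [Finset.mul_sum]
    refine Eq.trans ((Finset.sum_congr rfl fun y _ => Finset.sum_comm).trans Finset.sum_comm) ?_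
    refine Finset.sum_congr rfl fun y _ => Finset.sum_congr rfl fun z _ =>
      Finset.sum_congr rfl fun t _ => ?_
    ring

/-- The Yang–Baxter equation for the families of scalar matrices `R^{mj}_{kn}`. -/
lemma ybe_col (i i' p p' : Fin (d w)) :
    ∑ x : Fin (d w) × Fin (d w), matR21 d q w w (i, i') x •
      ((Matrix.of fun j n => matR d q w w (x.2, j) (p', n)) *
        (Matrix.of fun j n => matR d q w w (x.1, j) (p, n)) : Matrix (Fin (d w)) (Fin (d w)) k) =
    ∑ x : Fin (d w) × Fin (d w), matR21 d q w w x (p, p') •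
      ((Matrix.of fun j n => matR d q w w (i, j) (x.1, n)) *
        (Matrix.of fun j n => matR d q w w (i', j) (x.2, n)) :
          Matrix (Fin (d w)) (Fin (d w)) k) := by
  ext j n
  have := ybe_matR q d w w w i' p' i p j n
  simp only [Matrix.sum_apply, Matrix.smul_apply, Matrix.mul_apply, Matrix.of_apply,
    Fintype.sum_prod_type, smul_eq_mul, matR21, Matrix.submatrix_apply, Prod.swap]
  calc _ = _ := ?_
    _ = _ := this
    _ = _ := ?_
  · rw [Finset.sum_comm]
  · simp only [Finset.mul_sum]
    refine Finset.sum_congr rfl fun y _ => ?_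
    rw [Finset.sum_comm]
    refine Finset.sum_congr rfl fun z _ => Finset.sum_congr rfl fun t _ => ?_
    ring

lemma braidRow_exchange : sc _ (matR d q v v) * leg2 (Fin (d v)) (braidRow d q v w) *
      leg1 (Fin (d v)) (braidRow d q v w) =
    leg1 (Fin (d v)) (braidRow d q v w) * leg2 (Fin (d v)) (braidRow d q v w) *
      sc _ (matR d q v v) := by
  refine Matrix.ext fun ⟨a, b⟩ ⟨c, e⟩ => ?_
  rw [Matrix.mul_assoc, sc_mul_apply, mul_sc_apply]
  simp only [leg2_mul_leg1_apply, leg1_mul_leg2_apply, braidRow, Matrix.of_apply, ← leg2_mul,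
    ← sc_mul, smul_leg2_sc, sum_leg2_sc]
  rw [ybe_row]

lemma braidCol_exchange : sc _ (matR21 d q w w) * leg2 (Fin (d w)) (braidCol d q v w) *
      leg1 (Fin (d w)) (braidCol d q v w) =
    leg1 (Fin (d w)) (braidCol d q v w) * leg2 (Fin (d w)) (braidCol d q v w) *
      sc _ (matR21 d q w w) := by
  refine Matrix.ext fun ⟨a, b⟩ ⟨c, e⟩ => ?_
  rw [Matrix.mul_assoc, sc_mul_apply, mul_sc_apply]
  simp only [leg2_mul_leg1_apply, leg1_mul_leg2_apply, braidCol, Matrix.of_apply, ← leg1_mul,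
    ← sc_mul, smul_leg1_sc, sum_leg1_sc]
  rw [ybe_col]

lemma edgeRel_diagX : EdgeRel d q v w (diagX d q v w) := by
  have h := edgeRel_frtX d q v w
  rw [edgeRel_iff] at h ⊢
  intro i i' x x'
  have := congrArg (Matrix.scalar (Fin (d w) × Fin (d v))) (h i i' x x')
  have hs : ∀ (r : k) (a : Frt d q v w), Matrix.scalar (Fin (d w) × Fin (d v)) (r • a) =
      r • Matrix.scalar (Fin (d w) × Fin (d v)) a := by
    intro r a; simp [Matrix.scalar_apply, ← Matrix.diagonal_smul]
  simp only [map_add, hs, map_mul] at this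
  exact this

lemma commute_scalar_of_sc {B n : Type*} [Ring B] [Algebra k B] [Fintype n] [DecidableEq n]
    (M : Matrix n n k) (a : B) :
    sc B M * Matrix.scalar n a = Matrix.scalar n a * sc B M := by
  ext i j
  simp [Matrix.scalar_apply, Algebra.commutes]

lemma braidRow_eq_sc (i p) : braidRow d q v w i p = sc _ (leg2 (Fin (d w))
      (Matrix.of fun l s => matR d q v v (i, s) (p, l) : Matrix (Fin (d v)) (Fin (d v)) k)) := by
  ext r c
  simp only [braidRow, leg2_apply, Matrix.of_apply, sc_apply]
  split_ifs <;> simp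

lemma braidCol_eq_sc (m x) : braidCol d q v w m x = sc _ (leg1 (Fin (d v))
      (Matrix.of fun j n => matR d q w w (m, j) (x, n) : Matrix (Fin (d w)) (Fin (d w)) k)) := by
  ext r c
  simp only [braidCol, leg1_apply, Matrix.of_apply, sc_apply]
  split_ifs <;> simp

lemma braidX_apply (i x) (j n : Fin (d w)) (l s : Fin (d v)) :
    braidX d q v w i x (j, l) (n, s) = ∑ p, matR d q v v (i, s) (p, l) •
      ∑ m, matR d q w w (m, j) (x, n) • frtX d q v w p m := by
  simp only [braidX, Matrix.mul_apply (M := braidRow d q v w * diagX d q v w),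
    Matrix.mul_apply (M := braidRow d q v w), Finset.sum_mul, Matrix.sum_apply, Finset.smul_sum]
  rw [Finset.sum_comm]
  refine Finset.sum_congr rfl fun p _ => Finset.sum_congr rfl fun m _ => ?_
  rw [braidRow_eq_sc, braidCol_eq_sc, diagX, Matrix.map_apply, Matrix.mul_assoc,
    ← commute_scalar_of_sc, ← Matrix.mul_assoc, ← sc_mul, Matrix.scalar_apply,
    Matrix.mul_diagonal, sc_apply, leg2_mul_leg1_apply, ← Algebra.smul_def, Matrix.of_apply,
    Matrix.of_apply, mul_smul]

lemma edgeRel_braidX : EdgeRel d q v w (braidX d q v w) := by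
  refine (edgeRel_diagX d q v w).gauge d q (braidRow_exchange d q v w)
    (braidCol_exchange d q v w) ?_ ?_ ?_
  · intro i j i' j'
    rw [braidRow_eq_sc]; exact commute_scalar_of_sc _ _
  · intro i j i' j'
    rw [braidCol_eq_sc]; exact commute_scalar_of_sc _ _
  · intro i j i' j'
    rw [braidRow_eq_sc, braidCol_eq_sc, ← sc_mul, ← sc_mul, leg_comm (fun _ _ _ _ => mul_comm _ _)]

/-- The generators acting on the sum of the derivations (first summand) and the quantized
coordinate ring (second summand). -/
def blockX : Matrix (Fin (d v)) (Fin (d w)) (Matrix ((Fin (d w) × Fin (d v)) ⊕ Unit)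
    ((Fin (d w) × Fin (d v)) ⊕ Unit) (Frt d q v w)) :=
  Matrix.of fun i x => Matrix.fromBlocks (braidX d q v w i x)
    (Matrix.of fun p _ => if i = p.2 ∧ p.1 = x then 1 else 0) 0
    (Matrix.of fun _ _ => frtX d q v w i x)

lemma edgeRel_blockX : EdgeRel d q v w (blockX d q v w) := by
  have h1 := (edgeRel_iff d q _).mp (edgeRel_braidX d q v w)
  have h2 := (edgeRel_iff d q _).mp (edgeRel_frtX d q v w)
  rw [edgeRel_iff]
  intro i i' x x'
  simp only [blockX, Matrix.of_apply, Matrix.fromBlocks_multiply, Matrix.fromBlocks_smul,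
    Matrix.fromBlocks_add, Matrix.mul_zero, Matrix.zero_mul, add_zero, zero_add, smul_zero]
  congr 1
  · exact h1 i i' x x'
  · ext ⟨j, l⟩ u
    have key := exchange_of_hecke q
      (fun i i' x x' => if i' = l then (if j = x' then frtX d q v w i x else 0) else 0)
      (fun i i' x x' => (∑ p, matR d q v v (i', i) (p, l) •
        ∑ m, matR d q w w (m, j) (x', x) • frtX d q v w p m) +
          if i' = l ∧ j = x' then frtX d q v w i x else 0) ?_ i i' x x'
    · simp only [Matrix.add_apply, Matrix.smul_apply, Matrix.mul_apply, Finset.univ_unique,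
        Finset.sum_singleton, Matrix.of_apply, Fintype.sum_prod_type, braidX_apply]
      simpa [ite_and] using key
    · intro i i' x x'
      simp only [matR_self]
      exact sum_sum_rCoeff q (fun i x => frtX d q v w i x) i i' l x x' j
  · ext u u'
    have := h2 i i' x x'
    simp only [Matrix.add_apply, Matrix.smul_apply, Matrix.mul_apply, Finset.univ_unique,
      Finset.sum_singleton, Matrix.of_apply]
    exact this

end Difference

section Derivation

variable {V : Type*} [DecidableEq V] (d : V → ℕ)
variable {k : Type*} [CommRing k] (q : kˣ) (v w : V)

/-- The block triangular representation on `blockX`. -/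
def blockHom : Frt d q v w →ₐ[k] Matrix ((Fin (d w) × Fin (d v)) ⊕ Unit)
    ((Fin (d w) × Fin (d v)) ⊕ Unit) (Frt d q v w) :=
  frtLift (edgeRel_blockX d q v w)

/-- The lower right block is the identity, because the block triangular matrix of a generator has
the generator itself there. -/
lemma blockHom_inr (y : Frt d q v w) : blockHom d q v w y (Sum.inr ()) (Sum.inr ()) = y := by
  let S : Submodule k (Frt d q v w) :=
    { carrier := {y | (∀ p, blockHom d q v w y (Sum.inr ()) (Sum.inl p) = 0) ∧
        blockHom d q v w y (Sum.inr ()) (Sum.inr ()) = y}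
      add_mem' := by
        rintro a b ⟨h1, h2⟩ ⟨h3, h4⟩
        exact ⟨fun p => by rw [map_add, Matrix.add_apply, h1, h3, add_zero],
          by rw [map_add, Matrix.add_apply, h2, h4]⟩
      zero_mem' := by simp
      smul_mem' := by
        rintro c a ⟨h1, h2⟩
        exact ⟨fun p => by rw [map_smul, Matrix.smul_apply, h1, smul_zero],
          by rw [map_smul, Matrix.smul_apply, h2]⟩ }
  have hS : S = ⊤ := by
    apply Frt.eq_top_of_mul_mem
    · exact ⟨fun p => by simp, by simp⟩
    · rintro i j y ⟨h1, h2⟩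
      refine ⟨fun p => ?_, ?_⟩ <;>
      simp [blockHom, Matrix.mul_apply, blockX, Fintype.sum_sum_type]
      · exact mul_eq_zero_of_right _ (h1 p)
      · congr 1
  have : y ∈ S := hS ▸ Submodule.mem_top
  exact this.2

/-- The linear endomorphisms of the quantized coordinate ring. -/
abbrev FrtEnd : Type _ := Module.End k (Frt d q v w)

/-- The derivations of the quantized coordinate ring, up to normalization. -/
def frtD : Matrix (Fin (d w)) (Fin (d v)) (FrtEnd d q v w) :=
  Matrix.of fun j l =>
    { toFun := fun y => blockHom d q v w y (Sum.inl (j, l)) (Sum.inr ())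
      map_add' := by intros; rw [map_add, Matrix.add_apply]
      map_smul' := by intros; rw [map_smul, Matrix.smul_apply]; rfl }

lemma frtD_apply (j l) (y : Frt d q v w) :
    frtD d q v w j l y = blockHom d q v w y (Sum.inl (j, l)) (Sum.inr ()) := rfl

lemma frtD_one (j l) : frtD d q v w j l 1 = 0 := by
  simp [frtD_apply]

/-- Multiplication by the generators. -/
def frtMul : Matrix (Fin (d v)) (Fin (d w)) (FrtEnd d q v w) :=
  (frtX d q v w).map (Algebra.lmul k (Frt d q v w))

lemma frtMul_apply (i x) (y : Frt d q v w) :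
    frtMul d q v w i x y = frtX d q v w i x * y := rfl

lemma edgeRel_frtMul : EdgeRel d q v w (frtMul d q v w) := by
  have h := edgeRel_frtX d q v w
  change edgeLHS d q v w _ = edgeRHS d q v w _ at h ⊢
  rw [frtMul, ← edgeLHS_map, ← edgeRHS_map, h]

/-- The twisted Leibniz rule. -/
lemma frtD_mul (i x j l) : frtD d q v w j l * frtMul d q v w i x =
    (if i = l ∧ j = x then 1 else 0) + ∑ s, ∑ p, matR d q v v (i, s) (p, l) •
      ∑ n, ∑ m, matR d q w w (m, j) (x, n) • (frtMul d q v w p m * frtD d q v w n s) := by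
  ext y
  simp only [Module.End.mul_apply, frtMul_apply, LinearMap.add_apply, LinearMap.sum_apply,
    LinearMap.smul_apply, frtD_apply, map_mul]
  rw [add_comm]
  simp only [blockHom, frtLift_frtX, Matrix.mul_apply, Fintype.sum_sum_type, blockX,
    Matrix.of_apply, Matrix.fromBlocks_apply₁₁, Matrix.fromBlocks_apply₁₂, Fintype.sum_prod_type,
    Finset.univ_unique, Finset.sum_singleton]
  congr 1
  · rw [Finset.sum_comm]
    simp only [braidX_apply, Finset.sum_mul, smul_mul_assoc, Finset.smul_sum]
    refine Finset.sum_congr rfl fun s _ => ?_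
    rw [Finset.sum_comm]
  · have := blockHom_inr d q v w y
    rw [blockHom] at this
    split_ifs
    · rw [one_mul]; exact this
    · rw [zero_mul]; rfl

end Derivation

section Smul

variable {B : Type*} [Ring B] {a b c p : Type*}

lemma leg1_smul [DecidableEq p] (r : B) (X : Matrix a b B) :
    leg1 p (r • X) = r • leg1 p X := by
  ext i j; simp [leg1_apply]

lemma leg2_smul [DecidableEq p] (r : B) (X : Matrix a b B) :
    leg2 p (r • X) = r • leg2 p X := by
  ext i j; simp [leg2_apply]

lemma leg1_op_smul [DecidableEq p] (r : B) (X : Matrix a b B) :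
    leg1 p (MulOpposite.op r • X) = MulOpposite.op r • leg1 p X := by
  ext i j; simp [leg1_apply]

lemma leg2_op_smul [DecidableEq p] (r : B) (X : Matrix a b B) :
    leg2 p (MulOpposite.op r • X) = MulOpposite.op r • leg2 p X := by
  ext i j; simp [leg2_apply]

lemma leg1_add [DecidableEq p] (X Y : Matrix a b B) :
    leg1 p (X + Y) = leg1 p X + leg1 p Y := by
  ext i j; simp only [leg1_apply, Matrix.add_apply]; split_ifs <;> simp

lemma leg2_add [DecidableEq p] (X Y : Matrix a b B) :
    leg2 p (X + Y) = leg2 p X + leg2 p Y := by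
  ext i j; simp only [leg2_apply, Matrix.add_apply]; split_ifs <;> simp

lemma leg1_sum [DecidableEq p] {ι : Type*} (s : Finset ι) (X : ι → Matrix a b B) :
    leg1 p (∑ i ∈ s, X i) = ∑ i ∈ s, leg1 p (X i) := by
  ext i j; simp only [leg1_apply, Matrix.sum_apply]; split_ifs <;> simp

lemma leg2_sum [DecidableEq p] {ι : Type*} (s : Finset ι) (X : ι → Matrix a b B) :
    leg2 p (∑ i ∈ s, X i) = ∑ i ∈ s, leg2 p (X i) := by
  ext i j; simp only [leg2_apply, Matrix.sum_apply]; split_ifs <;> simp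

variable {p' : Type*}

lemma sw_smul (r : B) (M : Matrix (a × p) (b × p') B) : sw (r • M) = r • sw M := rfl

lemma sw_op_smul (r : B) (M : Matrix (a × p) (b × p') B) :
    sw (MulOpposite.op r • M) = MulOpposite.op r • sw M := rfl

lemma sw_add (M N : Matrix (a × p) (b × p') B) : sw (M + N) = sw M + sw N := rfl

lemma sw_sum {ι : Type*} (s : Finset ι) (M : ι → Matrix (a × p) (b × p') B) :
    sw (∑ i ∈ s, M i) = ∑ i ∈ s, sw (M i) := by
  ext r c; simp [Matrix.sum_apply]

lemma mul_smul_eq_op_smul_mul [Fintype b] (M : Matrix a b B) (r : B) (N : Matrix b c B) :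
    M * (r • N) = (MulOpposite.op r • M) * N := by
  ext i j; simp [Matrix.mul_apply, mul_assoc]

lemma op_smul_mul [Fintype b] (M : Matrix a b B) (r : B) (N : Matrix b c B) :
    MulOpposite.op r • (M * N) = M * (MulOpposite.op r • N) := by
  ext i j; simp [Matrix.mul_apply, mul_assoc, Finset.sum_mul]

variable {k : Type*} [CommRing k] [Algebra k B]

lemma sc_mul_smul [Fintype b] (M : Matrix a b k) (r : B) (N : Matrix b c B) :
    sc B M * (r • N) = r • (sc B M * N) := by
  ext i j; simp [Matrix.mul_apply, Finset.mul_sum, Algebra.left_comm]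

lemma op_smul_mul_sc [Fintype b] (M : Matrix a b B) (r : B) (N : Matrix b c k) :
    MulOpposite.op r • (M * sc B N) = (MulOpposite.op r • M) * sc B N := by
  ext i j; simp [Matrix.mul_apply, Finset.sum_mul, Algebra.right_comm]

lemma leg1_sc [DecidableEq p] (M : Matrix a b k) : leg1 p (sc B M) = sc B (leg1 p M) := by
  ext i j; simp only [leg1_apply, sc_apply]; split_ifs <;> simp

lemma leg2_sc [DecidableEq p] (M : Matrix a b k) : leg2 p (sc B M) = sc B (leg2 p M) := by
  ext i j; simp only [leg2_apply, sc_apply]; split_ifs <;> simp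

end Smul

section Products

variable {V : Type*} [DecidableEq V] (d : V → ℕ)
variable {k : Type*} [CommRing k] (q : kˣ) (v w : V)

lemma sc_sum {B : Type*} [Ring B] [Algebra k B] {a b ι : Type*} (s : Finset ι)
    (X : ι → Matrix a b k) : sc B (∑ i ∈ s, X i) = ∑ i ∈ s, sc B (X i) := by
  ext i j; simp [Matrix.sum_apply]

lemma leg2_sc_comm_leg1 {B : Type*} [Ring B] [Algebra k B] {a b c e : Type*} [Fintype a]
    [Fintype b] [Fintype c] [Fintype e] [DecidableEq a] [DecidableEq b] [DecidableEq c]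
    [DecidableEq e] (X : Matrix a b B) (N : Matrix c e k) :
    leg1 c X * leg2 b (sc B N) = leg2 a (sc B N) * leg1 e X :=
  leg_comm fun _ _ _ _ => (Algebra.commutes _ _).symm

lemma leg1_sc_comm_leg2 {B : Type*} [Ring B] [Algebra k B] {a b c e : Type*} [Fintype a]
    [Fintype b] [Fintype c] [Fintype e] [DecidableEq a] [DecidableEq b] [DecidableEq c]
    [DecidableEq e] (N : Matrix a b k) (X : Matrix c e B) :
    leg1 c (sc B N) * leg2 b X = leg2 a X * leg1 e (sc B N) :=
  leg_comm fun _ _ _ _ => Algebra.commutes _ _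

/-- The matrices `R^{mj}_{xn}`, with rows `j` and columns `n`. -/
def colS (m x : Fin (d w)) : Matrix (Fin (d w)) (Fin (d w)) k :=
  Matrix.of fun j n => matR d q w w (m, j) (x, n)

/-- The matrices `R^{is}_{pl}`, with rows `s` and columns `l`. -/
def rowP (i p : Fin (d v)) : Matrix (Fin (d v)) (Fin (d v)) k :=
  Matrix.of fun s l => matR d q v v (i, s) (p, l)

variable (k) in
/-- The matrix unit of `frtD` that a generator pairs with. -/
def unitE (i : Fin (d v)) (x : Fin (d w)) : Matrix (Fin (d w)) (Fin (d v)) k :=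
  Matrix.of fun j l => if i = l ∧ j = x then 1 else 0

/-- The Yang–Baxter equation for the matrices `colS`. -/
lemma ybe_colS (m' x : Fin (d w)) :
    matR d q w w * ∑ m, leg2 (Fin (d w)) (colS d q w m' m) * leg1 (Fin (d w)) (colS d q w m x) =
      (∑ m, leg1 (Fin (d w)) (colS d q w m' m) * leg2 (Fin (d w)) (colS d q w m x)) *
        matR d q w w := by
  ext ⟨j, j'⟩ ⟨n, n'⟩
  have := ybe_matR q d w w w m' x j n j' n'
  rw [Matrix.mul_apply, Matrix.mul_apply]
  simp only [Matrix.sum_apply, leg1_mul_leg2_apply, leg2_mul_leg1_apply, Fintype.sum_prod_type,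
    colS, Matrix.of_apply]
  calc _ = _ := ?_
    _ = _ := this.symm
    _ = _ := ?_
  · refine Finset.sum_congr rfl fun y _ => Finset.sum_congr rfl fun z _ => ?_
    congr 1
  · simp only [Finset.mul_sum, Finset.sum_mul]
    refine Eq.trans ?_
      ((Finset.sum_congr rfl fun y _ => Finset.sum_comm).trans Finset.sum_comm).symm
    refine Finset.sum_congr rfl fun y _ => Finset.sum_congr rfl fun z _ =>
      Finset.sum_congr rfl fun t _ => ?_
    ring

/-- The Yang–Baxter equation for the matrices `rowP`. -/
lemma ybe_rowP (i p' : Fin (d v)) :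
    (∑ p, leg1 (Fin (d v)) (rowP d q v p p') * leg2 (Fin (d v)) (rowP d q v i p)) *
        matR21 d q v v =
      matR21 d q v v * ∑ p, leg2 (Fin (d v)) (rowP d q v p p') * leg1 (Fin (d v)) (rowP d q v i p)
      := by
  ext ⟨s, s'⟩ ⟨t, t'⟩
  have := ybe_matR q d v v v i p' s' t' s t
  rw [Matrix.mul_apply, Matrix.mul_apply]
  simp only [Matrix.sum_apply, leg1_mul_leg2_apply, leg2_mul_leg1_apply, Fintype.sum_prod_type,
    rowP, Matrix.of_apply, matR21, Matrix.submatrix_apply, Prod.swap]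
  calc _ = _ := ?_
    _ = _ := this
    _ = _ := ?_
  · simp only [Finset.mul_sum, Finset.sum_mul]
    refine Finset.sum_comm.trans
      (((Finset.sum_congr rfl fun y _ => Finset.sum_comm).trans Finset.sum_comm).trans ?_)
    refine Finset.sum_congr rfl fun y _ => Finset.sum_congr rfl fun z _ =>
      Finset.sum_congr rfl fun t _ => ?_
    ring
  · rw [Finset.sum_comm]
    refine Finset.sum_congr rfl fun y _ => Finset.sum_congr rfl fun z _ => ?_
    congr 1
    exact Finset.sum_congr rfl fun t _ => mul_comm _ _

variable {B : Type*} [Ring B] [Algebra k B] (D : Matrix (Fin (d w)) (Fin (d v)) B)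
  (L : Matrix (Fin (d v)) (Fin (d w)) B)

/-- The twisted Leibniz rule between matrices of derivations and of generators. -/
def Leibniz : Prop := ∀ i x, MulOpposite.op (L i x) • D =
    sc B (unitE d k v w i x) + ∑ p, ∑ m, L p m •
      (sc B (colS d q w m x) * D * sc B (rowP d q v i p))

variable {D L}

/-- The twisted Leibniz rule, from its entries. -/
lemma Leibniz.of_apply (h : ∀ i x j l, D j l * L i x =
      (if i = l ∧ j = x then 1 else 0) + ∑ s, ∑ p, matR d q v v (i, s) (p, l) •
      ∑ n, ∑ m, matR d q w w (m, j) (x, n) • (L p m * D n s)) : Leibniz d q v w D L := by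
  intro i x
  ext j l
  rw [Matrix.smul_apply, MulOpposite.smul_eq_mul_unop, MulOpposite.unop_op, h,
    Matrix.add_apply]
  congr 1
  · simp only [unitE, sc_apply, Matrix.of_apply]; split_ifs <;> simp
  · simp only [Matrix.sum_apply, Matrix.smul_apply, mul_sc_apply, sc_mul_apply, colS, rowP,
      Matrix.of_apply, smul_eq_mul, Finset.mul_sum, Finset.smul_sum, mul_smul_comm]
    rw [Finset.sum_comm]
    refine Finset.sum_congr rfl fun p _ => ?_
    exact (Finset.sum_congr rfl fun y _ => Finset.sum_comm).trans Finset.sum_comm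

variable (D) in
/-- The part of lower order in `Leibniz.mul`. -/
def linPart (i : Fin (d v)) (x : Fin (d w)) :
    Matrix (Fin (d w) × Fin (d w)) (Fin (d v) × Fin (d v)) B :=
  leg2 (Fin (d w)) D * leg1 (Fin (d v)) (sc B (unitE d k v w i x)) +
    ∑ p, ∑ m, leg2 (Fin (d w)) (sc B (unitE d k v w p m)) * leg1 (Fin (d v))
      (sc B (colS d q w m x) * D * sc B (rowP d q v i p))

/-- Moving a generator past two derivations: the terms in which one of them differentiates it are
collected in `linPart`. -/
lemma Leibniz.mul (h : Leibniz d q v w D L) (i x) :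
    MulOpposite.op (L i x) • (leg2 (Fin (d w)) D * leg1 (Fin (d v)) D) =
      linPart d q v w D i x + ∑ p', ∑ m', L p' m' •
      (sc B (∑ m, leg2 (Fin (d w)) (colS d q w m' m) * leg1 (Fin (d w)) (colS d q w m x)) *
        (leg2 (Fin (d w)) D * leg1 (Fin (d v)) D) *
      sc B (∑ p, leg2 (Fin (d v)) (rowP d q v p p') * leg1 (Fin (d v)) (rowP d q v i p))) := by
  rw [op_smul_mul, ← leg1_op_smul, h, leg1_add, Matrix.mul_add, linPart, add_assoc]
  congr 1
  simp only [leg1_sum, leg1_smul, Matrix.mul_sum, mul_smul_eq_op_smul_mul, ← leg2_op_smul]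
  simp only [h _ _, leg2_add, Matrix.add_mul, Finset.sum_add_distrib]
  congr 1
  simp only [leg2_sum, leg2_smul, Matrix.sum_mul, sc_sum, Matrix.mul_sum, Finset.smul_sum,
    Matrix.smul_mul, leg1_mul, leg2_mul, sc_mul]
  refine ((Finset.sum_congr rfl fun p _ => Finset.sum_comm).trans Finset.sum_comm).trans ?_
  refine Finset.sum_congr rfl fun p' _ => ?_
  refine ((Finset.sum_congr rfl fun p _ => Finset.sum_comm).trans Finset.sum_comm).trans ?_
  refine Finset.sum_congr rfl fun m' _ => Finset.sum_congr rfl fun p _ =>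
    Finset.sum_congr rfl fun m _ => ?_
  congr 1
  have e1 := leg1_sc_comm_leg2 (colS d q w m x) D
  have e2 := leg2_sc_comm_leg1 D (rowP d q v p p')
  have e3 := leg_comm (X := sc B (colS d q w m x)) (Y := sc B (rowP d q v p p'))
    (fun _ _ _ _ => Algebra.commutes _ _)
  rw [← leg2_sc, ← leg1_sc, ← leg2_sc, ← leg1_sc]
  simp only [Matrix.mul_assoc]
  rw [← reassoc e3, reassoc e2.symm, ← reassoc e1]

lemma rCoeff_symm (i j x y : ℕ) : rCoeff q i j x y = rCoeff q y x j i := by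
  simp only [rCoeff]
  grind

variable (D) in
lemma linPart_apply (i x j j' l l') : linPart d q v w D i x (j, j') (l, l') =
    (∑ s : Fin (d v), rCoeff q l l' s i • ∑ n : Fin (d w), rCoeff q n x j j' • D n s) +
      if l = i ∧ x = j then D j' l' else 0 := by
  simp only [linPart, Matrix.add_apply, Matrix.sum_apply, leg2_mul_leg1_apply, mul_sc_apply,
    sc_mul_apply]
  rw [add_comm]
  congr 1
  · rw [Finset.sum_eq_single l', Finset.sum_eq_single j']
    · simp [unitE, colS, rowP, matR_self, rCoeff_symm q i, rCoeff_symm q j']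
    · intro m _ hm; simp [unitE, Ne.symm hm]
    · simp
    · intro p _ hp; simp [unitE, hp]
    · simp
  · simp only [unitE, sc_apply, Matrix.of_apply, eq_comm (a := i), eq_comm (a := j)]
    split_ifs <;> simp

variable (D) in
/-- The part of lower order satisfies the exchange relation of the derivations, by the Hecke
relation in the form of `exchange_of_hecke`. -/
lemma linPart_exchange (i x) : sc B (matR d q w w) * linPart d q v w D i x =
    sw (linPart d q v w D i x) * sc B (matR21 d q v v) := by
  ext ⟨j, j'⟩ ⟨l, l'⟩
  rw [sc_matR_mul_apply, mul_sc_matR21_apply]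
  simp only [sw_apply]
  refine exchange_of_hecke q (fun j j' l l' => if l = i then (if x = j then D j' l' else 0) else 0)
    (fun j j' l l' => linPart d q v w D i x (j, j') (l, l')) ?_ j j' l l'
  intro j j' l l'
  rw [linPart_apply, sum_sum_rCoeff q (fun s n => D n s) l' l i j' j x]
  simp only [eq_comm (a := l') (b := l), eq_comm (a := j') (b := j)]
  rw [smul_comm (if l = l' then (q : k) else 1) (if j = j' then (q : k) else 1),
    smul_comm (if l = l' then (q : k) else 1) (if j < j' then _ else _),
    smul_comm (if l' < l then _ else _) (if j = j' then _ else _),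
    smul_comm (if l' < l then _ else _) (if j < j' then _ else _)]
  abel

/-- The defect of the exchange relation between the derivations is itself multiplied by the
generators according to a twisted Leibniz rule without inhomogeneous part. -/
lemma Leibniz.defect (h : Leibniz d q v w D L) (i x) :
    MulOpposite.op (L i x) • (edgeLHS d q w v D - edgeRHS d q w v D) =
      ∑ p', ∑ m', L p' m' •
      (sc B (∑ m, leg1 (Fin (d w)) (colS d q w m' m) * leg2 (Fin (d w)) (colS d q w m x)) *
        (edgeLHS d q w v D - edgeRHS d q w v D) *
      sc B (∑ p, leg2 (Fin (d v)) (rowP d q v p p') * leg1 (Fin (d v)) (rowP d q v i p))) := by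
  have e1 : edgeLHS d q w v D =
      sc B (matR d q w w) * (leg2 (Fin (d w)) D * leg1 (Fin (d v)) D) := by
    rw [edgeLHS, Matrix.mul_assoc]
  have e2 : edgeRHS d q w v D =
      sw (leg2 (Fin (d w)) D * leg1 (Fin (d v)) D) * sc B (matR21 d q v v) := by
    rw [edgeRHS, sw_mul, sw_leg1, sw_leg2]
  have h1 := h.mul d q v w i x
  rw [smul_sub, e1, e2, op_smul_mul, op_smul_mul_sc, ← sw_op_smul, h1, sw_add, Matrix.mul_add,
    Matrix.add_mul, linPart_exchange, add_sub_add_left_eq_sub]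
  simp only [sw_sum, sw_smul, Matrix.mul_sum, Matrix.sum_mul, sc_mul_smul, Matrix.smul_mul,
    ← Finset.sum_sub_distrib, ← smul_sub]
  refine Finset.sum_congr rfl fun p' _ => Finset.sum_congr rfl fun m' _ => ?_
  congr 1
  rw [Matrix.mul_sub, Matrix.sub_mul, sw_mul, sw_mul, sw_sc, sw_sc, sw_sum, sw_sum]
  simp only [sw_mul, sw_leg1, sw_leg2, Matrix.mul_assoc]
  rw [← sc_mul, ybe_rowP]
  simp only [← Matrix.mul_assoc]
  rw [← sc_mul, ybe_colS, sc_mul, sc_mul]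
  simp only [Matrix.mul_assoc]

end Products

/-! ### The algebra of one edge that is not a loop -/

section OneEdge

variable {V : Type*} [DecidableEq V] (d : V → ℕ)
variable {k : Type*} [CommRing k] (q : kˣ) (v w : V)

/-- The derivations satisfy the exchange relation: the defect annihilates `1` and, by
`Leibniz.defect`, its kernel is stable under multiplication by the generators. -/
lemma edgeRel_frtD : EdgeRel d q w v (frtD d q v w) := by
  have hL : Leibniz d q v w (frtD d q v w) (frtMul d q v w) :=
    Leibniz.of_apply d q v w fun i x j l => frtD_mul d q v w i x j l
  have key : ∀ y : Frt d q v w, ∀ r c,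
      (edgeLHS d q w v (frtD d q v w) - edgeRHS d q w v (frtD d q v w)) r c y = 0 := by
    let S : Submodule k (Frt d q v w) := ⨅ r, ⨅ c, LinearMap.ker
      ((edgeLHS d q w v (frtD d q v w) - edgeRHS d q w v (frtD d q v w)) r c)
    have hmem : ∀ y, y ∈ S ↔ ∀ r c,
      (edgeLHS d q w v (frtD d q v w) - edgeRHS d q w v (frtD d q v w)) r c y = 0 := by
      intro y; simp only [S, Submodule.mem_iInf, LinearMap.mem_ker]
    have hS : S = ⊤ := by
      apply Frt.eq_top_of_mul_mem
      · rw [hmem]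
        rintro ⟨j, j'⟩ ⟨l, l'⟩
        rw [Matrix.sub_apply, edgeLHS, edgeRHS, Matrix.mul_assoc, sc_matR_mul_apply,
          mul_sc_matR21_apply]
        simp only [leg1_mul_leg2_apply, leg2_mul_leg1_apply, LinearMap.sub_apply,
          LinearMap.add_apply, LinearMap.smul_apply, Module.End.mul_apply, frtD_one, map_zero,
          smul_zero, add_zero, sub_zero]
      · intro i x y hy
        rw [hmem] at hy ⊢
        intro r c
        have h1 := congrArg (fun f : FrtEnd d q v w => f y)
          (congrFun (congrFun (hL.defect d q v w i x) r) c)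
        simp only [Matrix.smul_apply, MulOpposite.smul_eq_mul_unop, MulOpposite.unop_op,
          Module.End.mul_apply, frtMul_apply] at h1
        rw [h1]
        simp only [Matrix.sum_apply, Matrix.smul_apply, mul_sc_apply, sc_mul_apply,
          LinearMap.sum_apply, LinearMap.smul_apply, smul_eq_mul, Module.End.mul_apply, hy,
          smul_zero, Finset.sum_const_zero, map_zero]
    intro y
    exact (hmem y).mp (hS ▸ Submodule.mem_top)
  change edgeLHS d q w v _ = edgeRHS d q w v _
  rw [← sub_eq_zero]
  refine Matrix.ext fun r c => LinearMap.ext fun y => ?_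
  exact key y r c

variable {B : Type*} [Ring B] [Algebra k B]

lemma sum_contract_left {M : Type*} [AddCommGroup M] [Module k M] {n : ℕ} (i l : Fin n)
    (F : Fin n → Fin n → M) :
    ∑ s : Fin n, ∑ p : Fin n, rCoeff q i s p l • F p s =
      (if i = l then (q : k) else 1) • F i l +
        if i = l then ((q : k) - ((q⁻¹ : kˣ) : k)) • ∑ m with m < i, F m m else 0 := by
  simp only [rCoeff, add_smul, Finset.sum_add_distrib, ite_smul, zero_smul]
  congr 1
  · rw [Finset.sum_eq_single l, Finset.sum_eq_single i]
    · simp [Fin.ext_iff]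
    · intro y _ hy; rw [if_neg]; rintro ⟨h, -⟩; exact hy (Fin.ext h.symm)
    · simp
    · intro m _ hm; apply Finset.sum_eq_zero; intro y _; rw [if_neg]
      rintro ⟨-, h⟩; exact hm (Fin.ext h)
    · simp
  · split_ifs with h
    · subst h
      rw [Finset.smul_sum, Finset.sum_filter]
      refine Finset.sum_congr rfl fun m _ => ?_
      rw [Finset.sum_eq_single m]
      · simp
      · intro y _ hy; rw [if_neg]; rintro ⟨-, -, h⟩; exact hy (Fin.ext h.symm)
      · simp
    · refine Finset.sum_eq_zero fun m _ => Finset.sum_eq_zero fun y _ => ?_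
      rw [if_neg]; rintro ⟨-, h', -⟩; exact h (Fin.ext h')

/-- Normalizing by the powers `q^(2 m + 1)` turns the partial sums in the twisted Leibniz rule into
the partial sums in the cross relation, which contains `R⁻¹` in place of `R`. -/
lemma telescope {M : Type*} [AddCommGroup M] [Module k M] {n : ℕ} (U P : Fin n → M) (δ : M)
    (hP : ∀ m, P m = δ + ((q : k) • U m +
      ((q : k) - ((q⁻¹ : kˣ) : k)) • ∑ s with s < m, U s)) (i : ℕ) (hi : i ≤ n) :
    ((q : k) - ((q⁻¹ : kˣ) : k)) • ∑ m ∈ Finset.univ.filter (fun m : Fin n => (m : ℕ) < i),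
      ((q : k) ^ (2 * (m : ℕ) + 1)) • P m =
      (q : k) ^ (2 * i) • (δ + ((q : k) - ((q⁻¹ : kˣ) : k)) •
        ∑ m ∈ Finset.univ.filter (fun m : Fin n => (m : ℕ) < i), U m) -
        δ := by
  induction i with
  | zero => simp
  | succ i ih =>
    have hs : (Finset.univ.filter fun m : Fin n => (m : ℕ) < i + 1) =
        insert ⟨i, hi⟩ (Finset.univ.filter fun m : Fin n => (m : ℕ) < i) := by
      ext m; simp [Fin.ext_iff]; omega
    have hn : (⟨i, hi⟩ : Fin n) ∉ Finset.univ.filter fun m : Fin n => (m : ℕ) < i := by simp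
    rw [hs, Finset.sum_insert hn, Finset.sum_insert hn, smul_add, ih (by omega), hP]
    have : (Finset.univ.filter fun s : Fin n => s < ⟨i, hi⟩) =
      Finset.univ.filter fun m : Fin n => (m : ℕ) < i := rfl
    rw [this]
    have hq : (q : k) * ((q⁻¹ : kˣ) : k) = 1 := by simp
    generalize ((q⁻¹ : kˣ) : k) = q' at *
    dsimp only
    have e1 : (q : k) ^ (2 * i + 1) = (q : k) ^ (2 * i) * q := by ring
    have e2 : (q : k) ^ (2 * (i + 1)) = (q : k) ^ (2 * i) * q * q := by ring
    rw [e1, e2]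
    generalize (q : k) ^ (2 * i) = z
    match_scalars <;> grind

variable {v w} in
/-- Normalized derivations satisfy the cross relation. -/
lemma crossEdgeRel_of_leibniz {L : Matrix (Fin (d v)) (Fin (d w)) B}
    {D : Matrix (Fin (d w)) (Fin (d v)) B} (h : ∀ i x j l, D j l * L i x =
      (if i = l ∧ j = x then 1 else 0) + ∑ s, ∑ p, matR d q v v (i, s) (p, l) •
      ∑ n, ∑ m, matR d q w w (m, j) (x, n) • (L p m * D n s)) :
    CrossEdgeRel d q v w L (Matrix.of fun j l => (q : k) ^ (2 * (l : ℕ) + 1) • D j l) := by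
  ext ⟨i, j⟩ ⟨x, l⟩
  rw [leg2_sc_leg1_apply, Matrix.add_apply, leg1_sc_leg2_apply]
  simp only [matRInv_self, Matrix.of_apply, smul_mul_assoc, mul_smul_comm, flipB]
  rw [sum_contractInv q i l (fun m y => (q : k) ^ (2 * (m : ℕ) + 1) • (D j m * L y x))]
  have hZ : ∀ l : Fin (d v), ∑ m, ∑ y,
      matR d q w w (m, j) (x, y) • (q : k) ^ (2 * (l : ℕ) + 1) • (L i m * D y l)
      = (q : k) ^ (2 * (l : ℕ) + 1) • ∑ n, ∑ m, matR d q w w (m, j) (x, n) • (L i m * D n l) := by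
    intro l
    simp only [Finset.smul_sum]
    rw [Finset.sum_comm]
    simp only [smul_comm ((q : k) ^ (2 * (l : ℕ) + 1))]
  rw [hZ]
  simp only [matR_self] at h
  replace h : ∀ i l, _ := fun i l => h i x j l
  obtain ⟨Z, hZ'⟩ : ∃ Z : Fin (d v) → Fin (d v) → B, ∀ p s,
      ∑ n : Fin (d w), ∑ m : Fin (d w), rCoeff q m j x n • (L p m * D n s) = Z p s :=
    ⟨_, fun _ _ => rfl⟩
  simp only [matR_self, hZ'] at h ⊢
  simp only [sum_contract_left q _ _ Z] at h
  by_cases hil : i = l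
  · subst hil
    have ht := telescope q (fun m => Z m m) (fun m => D j m * L m x) (if j = x then 1 else 0)
      (fun m => by rw [h]; simp) i i.2.le
    have hlt : (Finset.univ.filter fun m : Fin (d v) => m < i) =
      Finset.univ.filter fun m : Fin (d v) => (m : ℕ) < i := rfl
    simp only [if_true, h i i, true_and, hlt] at ht ⊢
    rw [ht]
    have hq : (q : k) * ((q⁻¹ : kˣ) : k) = 1 := by simp
    generalize ((q⁻¹ : kˣ) : k) = q' at *
    have e1 : (q : k) ^ (2 * (i : ℕ) + 1) = (q : k) ^ (2 * (i : ℕ)) * q := by ring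
    rw [e1]
    generalize (q : k) ^ (2 * (i : ℕ)) = z
    match_scalars <;> grind
  · simp [hil, h]

variable {v w} in
lemma EdgeRel.smul_col {D : Matrix (Fin (d w)) (Fin (d v)) B} (h : EdgeRel d q w v D)
    (r : Fin (d v) → k) : EdgeRel d q w v (Matrix.of fun j l => r l • D j l) := by
  rw [edgeRel_iff] at h ⊢
  intro i i' x x'
  have := congrArg (fun z => (r x * r x') • z) (h i i' x x')
  simp only [Matrix.of_apply, smul_mul_smul_comm]
  simp only [mul_comm (r x') (r x)]
  simp only [smul_comm _ (r x * r x'), ← smul_add]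
  exact this

/-- The quiver with one edge. -/
def oneEdge : EdgeQuiver V Unit where
  tail _ := v
  head _ := w

variable {d v w} in
/-- A pair of matrices, as a family on the double of the quiver with one edge. -/
def edgeFam (A : Matrix (Fin (d v)) (Fin (d w)) B) (D : Matrix (Fin (d w)) (Fin (d v)) B) :
    ∀ x : Unit ⊕ Unit, Matrix (Fin (d ((oneEdge v w).src x))) (Fin (d ((oneEdge v w).tgt x))) B
  | Sum.inl _ => A
  | Sum.inr _ => D

variable {d q v w}

lemma sat_oneEdge (hvw : v ≠ w) {A : Matrix (Fin (d v)) (Fin (d w)) B}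
    {D : Matrix (Fin (d w)) (Fin (d v)) B} (hA : EdgeRel d q v w A) (hD : EdgeRel d q w v D)
    (hAD : CrossEdgeRel d q v w A D) : Sat (oneEdge v w) q (edgeFam A D) where
  edge := by
    rintro (x | x) _
    · exact hA
    · exact hD
  loop := by
    rintro (x | x) h
    · exact absurd h hvw
    · exact absurd h hvw.symm
  cross_edge := fun e _ => hAD
  cross_loop := fun e h => absurd h hvw
  braided := fun x y h => absurd h (lt_irrefl _)

variable (d q) in
/-- The vacuum expectation value of the representation on the quantized coordinate ring. -/
lemma exists_functional_oneEdge (hvw : v ≠ w) :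
    ∃ ψ : Dq (oneEdge v w) d q →ₗ[k] k, ψ 1 = 1 := by
  have sat : Sat (oneEdge v w) q (edgeFam (frtMul d q v w)
      (Matrix.of fun j l => (q : k) ^ (2 * (l : ℕ) + 1) • frtD d q v w j l)) :=
    sat_oneEdge hvw (edgeRel_frtMul d q v w)
      ((edgeRel_frtD d q v w).smul_col d q fun l => (q : k) ^ (2 * (l : ℕ) + 1))
      (crossEdgeRel_of_leibniz d q fun i x j l => frtD_mul d q v w i x j l)
  have h0 : EdgeRel d q v w (0 : Matrix (Fin (d v)) (Fin (d w)) k) := by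
    rw [edgeRel_iff]; intros; simp
  refine ⟨(frtLift h0).toLinearMap ∘ₗ LinearMap.applyₗ (1 : Frt d q v w) ∘ₗ
    sat.lift.toLinearMap, ?_⟩
  simp

end OneEdge

/-! ### Matrices that satisfy exchange relations -/

section Dressing

variable {V : Type*} [DecidableEq V] (d : V → ℕ)
variable {k : Type*} [CommRing k] (q : kˣ) {B : Type*} [Ring B] [Algebra k B]

/-- A family of invertible matrices, one for every vertex, that satisfies the exchange relations
`R T_2 T_1 = T_1 T_2 R`. At different vertices the R-matrix is trivial, and the relation says
that the entries commute. -/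
structure Dressing (T S : ∀ v, Matrix (Fin (d v)) (Fin (d v)) B) : Prop where
  rel : ∀ v w, sc B (matR d q v w) * leg2 (Fin (d v)) (T w) * leg1 (Fin (d w)) (T v) =
    leg1 (Fin (d w)) (T v) * leg2 (Fin (d v)) (T w) * sc B (matR d q v w)
  mul_inv : ∀ v, T v * S v = 1
  inv_mul : ∀ v, S v * T v = 1

lemma leg1_mul_one {a p : Type*} [Fintype a] [Fintype p] [DecidableEq a] [DecidableEq p]
    {T S : Matrix a a B} (h : T * S = 1) : leg1 p T * leg1 p S = 1 := by
  rw [← leg1_mul, h, leg1_one]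

lemma leg2_mul_one {a p : Type*} [Fintype a] [Fintype p] [DecidableEq a] [DecidableEq p]
    {T S : Matrix a a B} (h : T * S = 1) : leg2 p T * leg2 p S = 1 := by
  rw [← leg2_mul, h, leg2_one]

/-- Two matrices whose entries commute with each other. -/
def EntriesCommute {a b c e : Type*} (X : Matrix a b B) (Y : Matrix c e B) : Prop :=
  ∀ i j i' j', X i j * Y i' j' = Y i' j' * X i j

lemma EntriesCommute.symm {a b c e : Type*} {X : Matrix a b B} {Y : Matrix c e B}
    (h : EntriesCommute X Y) : EntriesCommute Y X := fun i j i' j' => (h i' j' i j).symm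

lemma EntriesCommute.inv {a c e : Type*} [Fintype a] [DecidableEq a] [Fintype c] [Fintype e]
    [DecidableEq c] [DecidableEq e] {T S : Matrix a a B} {Y : Matrix c e B} (h1 : T * S = 1)
    (h2 : S * T = 1) (h : EntriesCommute T Y) : EntriesCommute S Y := by
  apply comm_of_leg_comm
  have e1 := leg_comm h
  have := mul_congr_left (mul_congr_right e1 (leg1 e S)) (leg1 c S)
  simp only [Matrix.mul_assoc] at this
  rw [reassoc_one (leg1_mul_one h2), leg1_mul_one h1, Matrix.mul_one] at this
  exact this.symm

variable {d q} {T S : ∀ v, Matrix (Fin (d v)) (Fin (d v)) B}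

lemma Dressing.comm (h : Dressing d q T S) {v w : V} (hvw : v ≠ w) :
    EntriesCommute (T v) (T w) := by
  apply comm_of_leg_comm
  have := h.rel v w
  rw [matR_of_ne _ hvw, sc_one, Matrix.one_mul, Matrix.mul_one] at this
  exact this.symm

lemma Dressing.comm_inv (h : Dressing d q T S) {v w : V} (hvw : v ≠ w) :
    EntriesCommute (T v) (S w) :=
  ((h.comm hvw.symm).inv (h.mul_inv w) (h.inv_mul w)).symm

/-- The exchange relation of the inverses. -/
lemma Dressing.rel_inv (h : Dressing d q T S) (v : V) :
    sc B (matR21 d q v v) * leg2 (Fin (d v)) (S v) * leg1 (Fin (d v)) (S v) =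
      leg1 (Fin (d v)) (S v) * leg2 (Fin (d v)) (S v) * sc B (matR21 d q v v) := by
  have e := h.rel v v
  have h1 := leg1_mul_one (p := Fin (d v)) (h.mul_inv v)
  have h2 := leg2_mul_one (p := Fin (d v)) (h.mul_inv v)
  have h3 := leg1_mul_one (p := Fin (d v)) (h.inv_mul v)
  have h4 := leg2_mul_one (p := Fin (d v)) (h.inv_mul v)
  have e2 := mul_congr_left (mul_congr_left (mul_congr_right (mul_congr_right e
    (leg1 (Fin (d v)) (S v))) (leg2 (Fin (d v)) (S v))) (leg1 (Fin (d v)) (S v)))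
    (leg2 (Fin (d v)) (S v))
  simp only [Matrix.mul_assoc] at e2
  rw [reassoc_one h1, h2, Matrix.mul_one, reassoc_one h3, reassoc_one h4] at e2
  have := congrArg sw e2
  simp only [sw_mul, sw_leg1, sw_leg2, sw_sc, ← matR21_eq, ← Matrix.mul_assoc] at this
  exact this.symm

/-- Dressing the matrix of an edge that is not a loop. -/
lemma Dressing.edgeRel (h : Dressing d q T S) {v w : V} (hvw : v ≠ w)
    {X : Matrix (Fin (d v)) (Fin (d w)) B} (hX : EdgeRel d q v w X)
    (hT : ∀ u, EntriesCommute (T u) X) : EdgeRel d q v w (T v * X * S w) :=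
  hX.gauge d q (h.rel v v) (h.rel_inv w) (hT v) ((hT w).inv (h.mul_inv w) (h.inv_mul w))
    (h.comm_inv hvw)

lemma flipB_leg1 {m n p : ℕ} (X : Matrix (Fin n) (Fin p) B) :
    leg2 (Fin m) X * flipB B m p = flipB B m n * leg1 (Fin m) X := by
  ext ⟨i, j⟩ ⟨x, y⟩
  simp only [Matrix.mul_apply, leg1_apply, leg2_apply, flipB, Matrix.of_apply,
    Fintype.sum_prod_type]
  simp [ite_and]

lemma flipB_leg2 {m n p : ℕ} (X : Matrix (Fin m) (Fin p) B) :
    leg1 (Fin n) X * flipB B p n = flipB B m n * leg2 (Fin n) X := by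
  ext ⟨i, j⟩ ⟨x, y⟩
  simp only [Matrix.mul_apply, leg1_apply, leg2_apply, flipB, Matrix.of_apply,
    Fintype.sum_prod_type]
  simp [ite_and]

/-- The exchange relation of a dressing and the inverses. -/
lemma Dressing.rel_mixed (h : Dressing d q T S) (v w : V) :
    leg2 (Fin (d v)) (S w) * sc B (matRInv d q v w) * leg1 (Fin (d w)) (T v) =
      leg1 (Fin (d w)) (T v) * sc B (matRInv d q v w) * leg2 (Fin (d v)) (S w) := by
  have e := h.rel v w
  have h2 := leg2_mul_one (p := Fin (d v)) (h.mul_inv w)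
  have h4 := leg2_mul_one (p := Fin (d v)) (h.inv_mul w)
  have e2 := mul_congr_left (mul_congr_left (mul_congr_right (mul_congr_right e
    (sc B (matRInv d q v w))) (leg2 (Fin (d v)) (S w))) (sc B (matRInv d q v w)))
    (leg2 (Fin (d v)) (S w))
  simp only [Matrix.mul_assoc] at e2
  rw [reassoc_one (scRInv_mul q d B v w), reassoc_one (scR_inv q d B v w), h2, Matrix.mul_one,
    reassoc_one h4] at e2
  simp only [Matrix.mul_assoc]
  exact e2.symm

lemma Dressing.rel_mixed' (h : Dressing d q T S) (v w : V) :
    leg2 (Fin (d v)) (T w) * sc B (matR d q v w) * leg1 (Fin (d w)) (S v) =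
      leg1 (Fin (d w)) (S v) * sc B (matR d q v w) * leg2 (Fin (d v)) (T w) := by
  have e2 := mul_congr_left (mul_congr_right (h.rel v w) (leg1 (Fin (d w)) (S v)))
    (leg1 (Fin (d w)) (S v))
  simp only [Matrix.mul_assoc] at e2
  rw [leg1_mul_one (h.mul_inv v), Matrix.mul_one, reassoc_one (leg1_mul_one (h.inv_mul v))] at e2
  simp only [Matrix.mul_assoc]
  exact e2.symm

/-- Dressing the pair of matrices of an edge that is not a loop. -/
lemma Dressing.crossEdgeRel (h : Dressing d q T S) {v w : V} (hvw : v ≠ w)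
    {A : Matrix (Fin (d v)) (Fin (d w)) B} {D : Matrix (Fin (d w)) (Fin (d v)) B}
    (hAD : CrossEdgeRel d q v w A D)
    (hA : ∀ u, EntriesCommute (T u) A) (hD : ∀ u, EntriesCommute (T u) D) :
    CrossEdgeRel d q v w (T v * A * S w) (T w * D * S v) := by
  have hA' := fun u => (hA u).inv (h.mul_inv u) (h.inv_mul u)
  have hD' := fun u => (hD u).inv (h.mul_inv u) (h.inv_mul u)
  have hSS : EntriesCommute (S v) (S w) := (h.comm_inv hvw).inv (h.mul_inv v) (h.inv_mul v)
  unfold CrossEdgeRel at *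
  have m1 := h.rel_mixed v v
  have m2 := h.rel_mixed' w w
  have c1 := leg_comm (hD v)
  have c2 := leg_comm (hA' v).symm
  have c3 := leg_comm (hA w).symm
  have c4 := leg_comm (hD' w)
  have c5 := leg_comm (h.comm hvw)
  have c6 := leg_comm hSS.symm
  have c7 := leg_comm (h.comm hvw)
  have f1 := flipB_leg1 (m := d v) (S w)
  have f2 := flipB_leg2 (n := d w) (S v)
  simp only [leg1_mul, leg2_mul, Matrix.mul_assoc] at *
  rw [← Matrix.mul_assoc (sc B (matRInv d q v v)), ← Matrix.mul_assoc (leg2 _ (S v)), m1]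
  simp only [Matrix.mul_assoc]
  rw [← reassoc c1, ← reassoc c2]
  rw [← Matrix.mul_assoc (sc B (matRInv d q v v)), ← Matrix.mul_assoc (leg2 _ D), hAD,
    Matrix.add_mul, Matrix.mul_add, Matrix.mul_add]
  congr 1
  · rw [← Matrix.mul_assoc (sc B (matR d q w w)) (leg2 _ (T w)),
      ← Matrix.mul_assoc (leg1 _ (S w)), ← m2]
    simp only [Matrix.mul_assoc]
    rw [reassoc c3, reassoc c5, reassoc c4, c6]
  · rw [← reassoc f2, reassoc_one (leg1_mul_one (h.mul_inv v)), ← f1,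
      reassoc_one (leg2_mul_one (h.mul_inv w))]

/-- Commuting dressings can be multiplied. -/
lemma Dressing.mul (h : Dressing d q T S) {T' S' : ∀ v, Matrix (Fin (d v)) (Fin (d v)) B}
    (h' : Dressing d q T' S') (hc : ∀ u v, EntriesCommute (T u) (T' v)) :
    Dressing d q (fun v => T v * T' v) (fun v => S' v * S v) where
  rel v w := by
    have e1 := h.rel v w
    have e2 := h'.rel v w
    have c1 := leg_comm (hc v w)
    have c2 := leg_comm (hc w v).symm
    simp only [leg1_mul, leg2_mul, Matrix.mul_assoc] at *
    rw [reassoc c2, ← reassoc c1, ← Matrix.mul_assoc (leg2 _ (T w)), ← Matrix.mul_assoc (sc B _),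
      e1]
    simp only [Matrix.mul_assoc]
    rw [e2]
  mul_inv v := by
    rw [Matrix.mul_assoc, reassoc_one (h'.mul_inv v), h.mul_inv]
  inv_mul v := by
    rw [Matrix.mul_assoc, reassoc_one (h.inv_mul v), h'.inv_mul]

variable {B' : Type*} [Ring B'] [Algebra k B']

lemma map_mul_algHom {a b c : Type*} [Fintype b] (f : B →ₐ[k] B') (M : Matrix a b B)
    (N : Matrix b c B) : (M * N).map f = M.map f * N.map f := Matrix.map_mul

lemma leg1_map' {a b p : Type*} [DecidableEq p] (X : Matrix a b B) (f : B →ₐ[k] B') :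
    (leg1 p X).map f = leg1 p (X.map f) := leg1_map X (f : B →+* B')

lemma leg2_map' {a b p : Type*} [DecidableEq p] (X : Matrix a b B) (f : B →ₐ[k] B') :
    (leg2 p X).map f = leg2 p (X.map f) := leg2_map X (f : B →+* B')

lemma Dressing.map (h : Dressing d q T S) (f : B →ₐ[k] B') :
    Dressing d q (fun v => (T v).map f) (fun v => (S v).map f) where
  rel v w := by
    have := congrArg (fun M : Matrix _ _ B => M.map f) (h.rel v w)
    simpa only [map_mul_algHom, leg1_map', leg2_map', sc_map] using this
  mul_inv v := by
    rw [← map_mul_algHom, h.mul_inv, Matrix.map_one _ (map_zero f) (map_one f)]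
  inv_mul v := by
    rw [← map_mul_algHom, h.inv_mul, Matrix.map_one _ (map_zero f) (map_one f)]

lemma EdgeRel.map {v w : V} {X : Matrix (Fin (d v)) (Fin (d w)) B} (h : EdgeRel d q v w X)
    (f : B →ₐ[k] B') : EdgeRel d q v w (X.map f) := by
  change edgeLHS d q v w _ = edgeRHS d q v w _ at h ⊢
  rw [← edgeLHS_map, ← edgeRHS_map, h]

lemma flipB_map (f : B →ₐ[k] B') (m n : ℕ) : (flipB B m n).map f = flipB B' m n := by
  ext i j
  simp only [flipB, Matrix.map_apply, Matrix.of_apply]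
  split_ifs <;> simp

lemma CrossEdgeRel.map {v w : V} {A : Matrix (Fin (d v)) (Fin (d w)) B}
    {D : Matrix (Fin (d w)) (Fin (d v)) B} (h : CrossEdgeRel d q v w A D)
    (f : B →ₐ[k] B') : CrossEdgeRel d q v w (A.map f) (D.map f) := by
  have := congrArg (fun M : Matrix _ _ B => M.map f) h
  rw [Matrix.map_add _ (map_add f)] at this
  simp only [map_mul_algHom, leg1_map', leg2_map', sc_map, flipB_map] at this
  exact this

lemma BraidRel.map {u u' v v' : V} {X : Matrix (Fin (d u)) (Fin (d u')) B}
    {Y : Matrix (Fin (d v)) (Fin (d v')) B} (h : BraidRel d q u u' v v' X Y)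
    (f : B →ₐ[k] B') : BraidRel d q u u' v v' (X.map f) (Y.map f) := by
  have := congrArg (fun M : Matrix _ _ B => M.map f) h
  simp only [map_mul_algHom, leg1_map', leg2_map', sc_map] at this
  exact this

end Dressing

/-! ### The dressing of the algebra of one edge -/

lemma pow_apply_eq_zero_of_lt {B : Type*} [Ring B] {n : ℕ} {N : Matrix (Fin n) (Fin n) B}
    (h : ∀ i j, i ≤ j → N i j = 0) (m : ℕ) (i j : Fin n) (hij : (i : ℕ) < j + m) :
    (N ^ m) i j = 0 := by
  induction m generalizing i j with
  | zero =>
    rw [pow_zero, Matrix.one_apply_ne]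
    rintro rfl
    omega
  | succ m ih =>
    rw [pow_succ, Matrix.mul_apply]
    refine Finset.sum_eq_zero fun x _ => ?_
    by_cases hx : x ≤ j
    · rw [h _ _ hx, mul_zero]
    · rw [ih, zero_mul]
      have := Fin.lt_def.mp (not_le.mp hx)
      omega

/-- A triangular matrix over a ring is invertible if its diagonal entries are. -/
lemma exists_inverse_of_triangular {B : Type*} [Ring B] {n : ℕ} {L : Matrix (Fin n) (Fin n) B}
    (h : ∀ i j, i < j → L i j = 0) (hu : ∀ i, IsUnit (L i i)) : ∃ S, L * S = 1 ∧ S * L = 1 := by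
  choose u hu using hu
  let D : Matrix (Fin n) (Fin n) B := Matrix.diagonal fun i => (u i : B)
  let D' : Matrix (Fin n) (Fin n) B := Matrix.diagonal fun i => ((u i)⁻¹ : Bˣ)
  have h1 : D * D' = 1 := by simp [D, D']
  have h2 : D' * D = 1 := by simp [D, D']
  have hN : ∀ i j, i ≤ j → (D' * L - 1) i j = 0 := by
    intro i j hij
    rw [Matrix.sub_apply, Matrix.diagonal_mul]
    rcases hij.lt_or_eq with hlt | rfl
    · rw [h _ _ hlt, Matrix.one_apply_ne hlt.ne, mul_zero, sub_zero]
    · rw [← hu, Units.inv_mul, Matrix.one_apply_eq, sub_self]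
  have hnil : IsNilpotent (D' * L - 1) :=
    ⟨n, by ext i j; exact pow_apply_eq_zero_of_lt hN n i j (by omega)⟩
  have hunit : IsUnit (D' * L) := by
    have := hnil.isUnit_one_add
    rwa [add_sub_cancel] at this
  have hL : IsUnit L := by
    have hD : IsUnit D := ⟨⟨D, D', h1, h2⟩, rfl⟩
    have := hD.mul hunit
    rwa [← mul_assoc, h1, one_mul] at this
  obtain ⟨v, rfl⟩ := hL
  exact ⟨(v⁻¹ : (Matrix (Fin n) (Fin n) B)ˣ), v.mul_inv, v.inv_mul⟩

section Torus

variable {V : Type*} [DecidableEq V] (d : V → ℕ)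
variable {k : Type*} [CommRing k] (q : kˣ) {B : Type*} [Ring B] [Algebra k B]

/-- The R-matrix preserves the weights: it has no entries apart from those of the identity and of
the flip. -/
lemma matR_swap_or (u v : V) {i x : Fin (d u)} {j y : Fin (d v)}
    (h : matR d q u v (i, j) (x, y) ≠ 0) :
    (i = x ∧ j = y) ∨ (u = v ∧ (i : ℕ) = y ∧ (j : ℕ) = x) := by
  by_cases huv : u = v
  · subst huv
    rw [matR_self, rCoeff] at h
    by_cases h1 : (i : ℕ) = x ∧ (j : ℕ) = y
    · exact Or.inl ⟨Fin.ext h1.1, Fin.ext h1.2⟩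
    · rw [if_neg h1, zero_add] at h
      by_cases h2 : (j : ℕ) < i ∧ (i : ℕ) = y ∧ (j : ℕ) = x
      · exact Or.inr ⟨rfl, h2.2⟩
      · rw [if_neg h2] at h; exact absurd rfl h
  · rw [matR_of_ne q huv, Matrix.one_apply] at h
    left
    by_contra h'
    apply h
    rw [if_neg]
    rintro ⟨⟩
    exact h' ⟨rfl, rfl⟩

lemma matR_eq_zero_of_lt (u v : V) {i x : Fin (d u)} {j y : Fin (d v)} (h : i < x) :
    matR d q u v (i, j) (x, y) = 0 := by
  by_cases huv : u = v
  · subst huv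
    have := Fin.lt_def.mp h
    rw [matR_self, rCoeff, if_neg (by omega), if_neg (by omega), add_zero]
  · rw [matR_of_ne q huv, Matrix.one_apply_ne]
    rintro ⟨⟩; exact lt_irrefl _ h

lemma matRInv_eq_zero_of_lt (u v : V) {i x : Fin (d u)} {j y : Fin (d v)} (h : i < x) :
    matRInv d q u v (i, j) (x, y) = 0 := by
  by_cases huv : u = v
  · subst huv
    have := Fin.lt_def.mp h
    rw [matRInv_self, rInvCoeff, if_neg (by omega), if_neg (by omega), sub_zero]
  · rw [matRInv_of_ne q huv, Matrix.one_apply_ne]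
    rintro ⟨⟩; exact lt_irrefl _ h

/-- The weight of the `s`-th basis vector at the vertex `u`, relative to the `i`-th one at `v`. -/
def weight (v : V) (i : Fin (d v)) (u : V) (s : Fin (d u)) : kˣ :=
  if u = v ∧ (s : ℕ) = i then q else 1

lemma matR_diag (v u : V) (i : Fin (d v)) (s p : Fin (d u)) :
    matR d q v u (i, s) (i, p) = if s = p then (weight d q v i u s : k) else 0 := by
  by_cases huv : v = u
  · subst huv
    rw [matR_self, rCoeff, weight]
    by_cases h1 : s = p
    · subst h1
      by_cases h2 : (s : ℕ) = i
      · rw [h2]; simp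
      · rw [if_neg (by omega : ¬((s : ℕ) < i ∧ (i : ℕ) = s ∧ (s : ℕ) = i))]
        simp [h2, Ne.symm h2]
    · have : (s : ℕ) ≠ p := fun e => h1 (Fin.ext e)
      rw [if_neg (by omega), if_neg (by omega), if_neg h1, add_zero]
  · have hw : weight d q v i u s = 1 := if_neg (fun h => huv h.1.symm)
    rw [matR_of_ne q huv, hw, Matrix.one_apply]
    simp

lemma matRInv_diag (v u : V) (i : Fin (d v)) (s p : Fin (d u)) :
    matRInv d q v u (i, s) (i, p) =
      if s = p then (((weight d q v i u s)⁻¹ : kˣ) : k) else 0 := by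
  by_cases huv : v = u
  · subst huv
    rw [matRInv_self, rInvCoeff, weight]
    by_cases h1 : s = p
    · subst h1
      by_cases h2 : (s : ℕ) = i
      · rw [h2]; simp
      · rw [if_neg (by omega : ¬((s : ℕ) < i ∧ (i : ℕ) = s ∧ (s : ℕ) = i))]
        simp [h2, Ne.symm h2]
    · have : (s : ℕ) ≠ p := fun e => h1 (Fin.ext e)
      rw [if_neg (by omega), if_neg (by omega), if_neg h1, sub_zero]
  · have hw : weight d q v i u s = 1 := if_neg (fun h => huv h.1.symm)
    rw [matRInv_of_ne q huv, hw, Matrix.one_apply]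
    simp

variable (B) in
/-- Diagonal matrices of scalars. -/
lemma dressing_torus (g : ∀ u, Fin (d u) → kˣ)
    (hg : ∀ u (i j : Fin (d u)), (i : ℕ) = j → g u i = g u j) : Dressing d q
    (fun u => Matrix.diagonal fun i => algebraMap k B (g u i))
    (fun u => Matrix.diagonal fun i => algebraMap k B ((g u i)⁻¹ : kˣ)) where
  rel v w := by
    have e1 : leg2 (Fin (d v)) (Matrix.diagonal fun i => algebraMap k B (g w i)) =
        Matrix.diagonal fun p : Fin (d v) × Fin (d w) => algebraMap k B (g w p.2) := by
      ext ⟨i, j⟩ ⟨x, y⟩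
      simp only [leg2_apply, Matrix.diagonal_apply, Prod.mk.injEq]
      split_ifs <;> simp_all
    have e2 : leg1 (Fin (d w)) (Matrix.diagonal fun i => algebraMap k B (g v i)) =
        Matrix.diagonal fun p : Fin (d v) × Fin (d w) => algebraMap k B (g v p.1) := by
      ext ⟨i, j⟩ ⟨x, y⟩
      simp only [leg1_apply, Matrix.diagonal_apply, Prod.mk.injEq]
      split_ifs <;> simp_all
    rw [e1, e2, Matrix.mul_assoc, Matrix.diagonal_mul_diagonal, Matrix.diagonal_mul_diagonal]
    ext ⟨i, j⟩ ⟨x, y⟩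
    rw [Matrix.mul_diagonal, Matrix.diagonal_mul]
    simp only [sc_apply, ← map_mul]
    congr 1
    by_cases h : matR d q v w (i, j) (x, y) = 0
    · simp [h]
    · rcases matR_swap_or d q v w h with ⟨rfl, rfl⟩ | ⟨rfl, h1, h2⟩
      · ring
      · rw [hg v i y h1, hg v j x h2]; ring
  mul_inv u := by simp [Matrix.diagonal_mul_diagonal, ← map_mul]
  inv_mul u := by simp [Matrix.diagonal_mul_diagonal, ← map_mul]

end Torus

section EdgeDressing

variable {V : Type*} [DecidableEq V] (d : V → ℕ)
variable {k : Type*} [CommRing k] (q : kˣ)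

section DressHom

variable {d q} {B : Type*} [Ring B] [Algebra k B]
  {T S : ∀ v, Matrix (Fin (d v)) (Fin (d v)) B} {a b : V}

/-- Conjugation of a representation of the algebra of one edge by a dressing that commutes
with it. -/
def dressHom (hab : a ≠ b) (h : Dressing d q T S) (f : Dq (oneEdge a b) d q →ₐ[k] B)
    (hc : ∀ u x, EntriesCommute (T u) ((genX (oneEdge a b) d q x).map f)) :
    Dq (oneEdge a b) d q →ₐ[k] B :=
  have sat := sat_genX (oneEdge a b) d q
  (sat_oneEdge hab
    (h.edgeRel hab ((sat.edge (Sum.inl ()) hab).map f) fun u => hc u (Sum.inl ()))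
    (h.edgeRel hab.symm ((sat.edge (Sum.inr ()) hab.symm).map f) fun u => hc u (Sum.inr ()))
    (h.crossEdgeRel hab ((sat.cross_edge () hab).map f) (fun u => hc u (Sum.inl ()))
      fun u => hc u (Sum.inr ()))).lift

lemma dressHom_genX (hab : a ≠ b) (h : Dressing d q T S) (f : Dq (oneEdge a b) d q →ₐ[k] B)
    (hc : ∀ u x, EntriesCommute (T u) ((genX (oneEdge a b) d q x).map f)) (x s t) :
    dressHom hab h f hc (genX (oneEdge a b) d q x s t) =
      (T ((oneEdge a b).src x) * (genX (oneEdge a b) d q x).map f *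
        S ((oneEdge a b).tgt x)) s t := by
  rw [dressHom, Sat.lift_genX]
  rcases x with x | x <;> rfl

end DressHom

variable {a b : V} (hab : a ≠ b)

lemma dressing_tMat (B : Type*) [Ring B] [Algebra k B] (v : V) :
    Dressing d q (tMat q d B v) (tMatInv q d B v) where
  rel u w := tMat_exchange q d B v u w
  mul_inv u := tMat_mul_inv q d B v u
  inv_mul u := tMatInv_mul q d B v u

lemma tMat_comm_scalar {B : Type*} [Ring B] [Algebra k B] (v u : V) (i j) (y : B) :
    tMat q d B v u i j * Matrix.scalar (Fin (d v)) y =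
      Matrix.scalar (Fin (d v)) y * tMat q d B v u i j := by
  ext s t
  rw [Matrix.scalar_apply, Matrix.mul_diagonal, Matrix.diagonal_mul]
  exact Algebra.commutes _ _

lemma entriesCommute_tMat {B : Type*} [Ring B] [Algebra k B] {m n : Type*} (v u : V)
    (X : Matrix m n B) :
    EntriesCommute (tMat q d B v u) (X.map (Matrix.scalarAlgHom (Fin (d v)) k)) :=
  fun i j _ _ => tMat_comm_scalar d q v u i j _

/-- The conjugation by the R-matrix that braids `k^{d v}` past the algebra of one edge. -/
def lamHom (v : V) : Dq (oneEdge a b) d q →ₐ[k]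
    Matrix (Fin (d v)) (Fin (d v)) (Dq (oneEdge a b) d q) :=
  dressHom hab (dressing_tMat d q (Dq (oneEdge a b) d q) v) (Matrix.scalarAlgHom (Fin (d v)) k)
    fun u x => entriesCommute_tMat d q v u (genX (oneEdge a b) d q x)

lemma lamHom_genX (v : V) (x s t i j) :
    lamHom d q hab v (genX (oneEdge a b) d q x s t) i j =
      ∑ y, ∑ p, matR d q v ((oneEdge a b).src x) (i, s) (y, p) •
        ∑ m, matRInv d q v ((oneEdge a b).tgt x) (y, m) (j, t) • genX (oneEdge a b) d q x p m := by
  refine (congrFun (congrFun (dressHom_genX hab (dressing_tMat d q (Dq (oneEdge a b) d q) v)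
    (Matrix.scalarAlgHom (Fin (d v)) k)
    (fun u x => entriesCommute_tMat d q v u (genX (oneEdge a b) d q x)) x s t) i) j).trans ?_
  rw [Matrix.mul_assoc, Matrix.mul_apply, Matrix.sum_apply]
  simp only [Matrix.mul_apply (M := tMat _ _ _ _ _ _ _)]
  rw [Finset.sum_comm]
  refine Finset.sum_congr rfl fun y _ => Finset.sum_congr rfl fun p _ => ?_
  rw [Algebra.smul_def]
  congr 1
  rw [Matrix.mul_apply, Matrix.sum_apply]
  refine Finset.sum_congr rfl fun m _ => ?_
  rw [Matrix.map_apply]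
  change (Matrix.scalar (Fin (d v)) (genX (oneEdge a b) d q x p m) *
    tMatInv q d (Dq (oneEdge a b) d q) v ((oneEdge a b).tgt x) m t) y j = _
  rw [Matrix.scalar_apply, Matrix.diagonal_mul, Algebra.smul_def, Algebra.commutes]
  rfl

/-- The operators on the algebra of one edge that braid it with `k^{d v}`. -/
def lOp (v : V) : Matrix (Fin (d v)) (Fin (d v)) (Module.End k (Dq (oneEdge a b) d q)) :=
  Matrix.of fun i j =>
    { toFun := fun y => lamHom d q hab v y i j
      map_add' := fun y z => by rw [map_add]; rfl
      map_smul' := fun c y => by rw [map_smul]; rfl }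

variable (a b) in
/-- The left multiplications by the generators of the algebra of one edge. -/
def opX (x : Unit ⊕ Unit) : Matrix (Fin (d ((oneEdge a b).src x))) (Fin (d ((oneEdge a b).tgt x)))
    (Module.End k (Dq (oneEdge a b) d q)) :=
  (genX (oneEdge a b) d q x).map (Algebra.lmul k (Dq (oneEdge a b) d q))

lemma leg1_mul_apply' {B : Type*} [Ring B] {m n p c : Type*} [Fintype n] [Fintype p]
    [DecidableEq p] (X : Matrix m n B) (N : Matrix (n × p) c B) (i j) (z : c) :
    (leg1 p X * N) (i, j) z = ∑ x, X i x * N (x, j) z := by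
  simp [Matrix.mul_apply, leg1_apply, Fintype.sum_prod_type]

lemma mul_leg1_apply' {B : Type*} [Ring B] {m n p c : Type*} [Fintype n] [Fintype p]
    [DecidableEq p] (X : Matrix n m B) (N : Matrix c (n × p) B) (i j) (z : c) :
    (N * leg1 p X) z (i, j) = ∑ x, N z (x, j) * X x i := by
  simp [Matrix.mul_apply, leg1_apply, Fintype.sum_prod_type]

/-- The operators `lOp` move past the generators by conjugation with the R-matrix. -/
lemma lOp_cov (v : V) (x : Unit ⊕ Unit) :
    leg1 (Fin (d ((oneEdge a b).src x))) (lOp d q hab v) * leg2 (Fin (d v)) (opX d q a b x) =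
      sc (Module.End k (Dq (oneEdge a b) d q)) (matR d q v ((oneEdge a b).src x)) *
        leg2 (Fin (d v)) (opX d q a b x) *
        sc (Module.End k (Dq (oneEdge a b) d q)) (matRInv d q v ((oneEdge a b).tgt x)) *
        leg1 (Fin (d ((oneEdge a b).tgt x))) (lOp d q hab v) := by
  have key : ∀ i s j t, (sc (Module.End k (Dq (oneEdge a b) d q))
      (matR d q v ((oneEdge a b).src x)) * leg2 (Fin (d v)) (opX d q a b x) *
        sc (Module.End k (Dq (oneEdge a b) d q)) (matRInv d q v ((oneEdge a b).tgt x)))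
        (i, s) (j, t) =
      Algebra.lmul k (Dq (oneEdge a b) d q)
        (lamHom d q hab v (genX (oneEdge a b) d q x s t) i j) := by
    intro i s j t
    rw [Matrix.mul_assoc, sc_mul_apply, Fintype.sum_prod_type, lamHom_genX, map_sum]
    refine Finset.sum_congr rfl fun y _ => ?_
    rw [map_sum]
    refine Finset.sum_congr rfl fun p _ => ?_
    rw [map_smul, map_sum]
    congr 1
    rw [mul_sc_apply, Fintype.sum_prod_type]
    simp only [leg2_apply, map_smul]
    simp [opX]
  refine Matrix.ext fun ⟨i, s⟩ ⟨j, t⟩ => ?_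
  rw [leg1_mul_leg2_apply, mul_leg1_apply']
  simp only [key]
  apply LinearMap.ext
  intro z
  refine Eq.trans ?_ (LinearMap.sum_apply (M := Dq (oneEdge a b) d q) Finset.univ _ z).symm
  change lamHom d q hab v (_ * z) i j = _
  rw [map_mul, Matrix.mul_apply]
  rfl

/-- Triangularity of the R-matrix passes from the generators to the whole algebra. -/
lemma lamHom_triangular (v : V) (z : Dq (oneEdge a b) d q) (i j : Fin (d v)) (hij : i < j) :
    lamHom d q hab v z i j = 0 := by
  let S : Submodule k (Dq (oneEdge a b) d q) :=
    { carrier := {z | ∀ i j, i < j → lamHom d q hab v z i j = 0}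
      zero_mem' := fun i j _ => by rw [map_zero]; rfl
      add_mem' := fun {x y} hx hy i j h => by
        rw [map_add, Matrix.add_apply, hx i j h, hy i j h, add_zero]
      smul_mem' := fun c x hx i j h => by
        rw [map_smul, Matrix.smul_apply, hx i j h, smul_zero] }
  have hS : S = ⊤ := by
    refine Dq.eq_top_of_mul_mem S (fun i j h => ?_) fun x s t y hy i j h => ?_
    · rw [map_one, Matrix.one_apply_ne h.ne]
    · rw [map_mul, Matrix.mul_apply]
      refine Finset.sum_eq_zero fun m _ => ?_
      rcases lt_or_ge i m with h1 | h1
      · rw [lamHom_genX, Finset.sum_eq_zero, zero_mul]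
        refine fun n _ => Finset.sum_eq_zero fun p _ => ?_
        rcases lt_or_ge i n with h2 | h2
        · rw [matR_eq_zero_of_lt d q _ _ h2, zero_smul]
        · rw [Finset.sum_eq_zero, smul_zero]
          intro l _
          rw [matRInv_eq_zero_of_lt d q _ _ (h2.trans_lt h1), zero_smul]
      · rw [hy m j (h1.trans_lt h), mul_zero]
  exact (hS ▸ Submodule.mem_top : z ∈ S) i j hij

lemma entriesCommute_torus {B : Type*} [Ring B] [Algebra k B] {m n l : Type*} [DecidableEq l]
    (g : l → kˣ) (X : Matrix m n B) :
    EntriesCommute (Matrix.diagonal fun i => algebraMap k B (g i)) X := by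
  intro i j i' j'
  rw [Matrix.diagonal_apply]
  split_ifs
  · exact Algebra.commutes _ _
  · rw [zero_mul, mul_zero]

/-- The action of the torus by automorphisms of the algebra of one edge. -/
def torusHom (g : ∀ u, Fin (d u) → kˣ)
    (hg : ∀ u (i j : Fin (d u)), (i : ℕ) = j → g u i = g u j) :
    Dq (oneEdge a b) d q →ₐ[k] Dq (oneEdge a b) d q :=
  dressHom hab (dressing_torus d q (Dq (oneEdge a b) d q) g hg) (AlgHom.id k _)
    fun u _ => entriesCommute_torus (g u) _

lemma torusHom_genX (g : ∀ u, Fin (d u) → kˣ)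
    (hg : ∀ u (i j : Fin (d u)), (i : ℕ) = j → g u i = g u j) (x s t) :
    torusHom d q hab g hg (genX (oneEdge a b) d q x s t) =
      ((g _ s : k) * ((g _ t)⁻¹ : kˣ)) • genX (oneEdge a b) d q x s t := by
  rw [torusHom, dressHom_genX, Matrix.mul_diagonal, Matrix.diagonal_mul, Matrix.map_apply,
    ← Algebra.commutes, ← Algebra.smul_def, ← Algebra.smul_def, smul_smul, mul_comm]
  rfl

lemma torusHom_comp (g g' : ∀ u, Fin (d u) → kˣ) (hg hg') (h : ∀ u i, g u i * g' u i = 1) :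
    (torusHom d q hab g hg).comp (torusHom d q hab g' hg') = AlgHom.id k _ := by
  refine Dq.algHom_ext fun x s t => ?_
  rw [AlgHom.comp_apply, torusHom_genX, map_smul, torusHom_genX, smul_smul, AlgHom.id_apply]
  have h1 := eq_inv_of_mul_eq_one_right (h _ s)
  have h2 := eq_inv_of_mul_eq_one_right (h _ t)
  rw [h1, h2, inv_inv, mul_mul_mul_comm, ← Units.val_mul, ← Units.val_mul, inv_mul_cancel,
    mul_inv_cancel, Units.val_one, one_mul, one_smul]

/-- The diagonal entries of `lamHom` are automorphisms by elements of the torus, hence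
invertible. -/
lemma lamHom_diag (v : V) (z : Dq (oneEdge a b) d q) (i : Fin (d v)) :
    lamHom d q hab v z i i = torusHom d q hab (weight d q v i)
      (fun u s t h => by rw [weight, weight, h]) z := by
  let S : Submodule k (Dq (oneEdge a b) d q) :=
    { carrier := {z | lamHom d q hab v z i i = torusHom d q hab (weight d q v i)
        (fun u s t h => by rw [weight, weight, h]) z}
      zero_mem' := by rw [Set.mem_ofPred_eq, map_zero, map_zero]; rfl
      add_mem' := fun {x y} hx hy => by
        rw [Set.mem_ofPred_eq, map_add, map_add, Matrix.add_apply, hx, hy]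
      smul_mem' := fun c x hx => by
        rw [Set.mem_ofPred_eq, map_smul, map_smul, Matrix.smul_apply, hx] }
  have hS : S = ⊤ := by
    refine Dq.eq_top_of_mul_mem S ?_ fun x s t y hy => ?_
    · change _ = _
      rw [map_one, map_one, Matrix.one_apply_eq]
    · change _ = _
      rw [map_mul, map_mul, Matrix.mul_apply, Finset.sum_eq_single i, hy]
      · congr 1
        rw [lamHom_genX, torusHom_genX, Finset.sum_eq_single i]
        · simp only [matR_diag, matRInv_diag]
          simp [smul_smul]
        · intro n _ hn
          refine Finset.sum_eq_zero fun p _ => ?_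
          rcases lt_or_gt_of_ne hn with h2 | h2
          · rw [Finset.sum_eq_zero, smul_zero]
            intro l _
            rw [matRInv_eq_zero_of_lt d q _ _ h2, zero_smul]
          · rw [matR_eq_zero_of_lt d q _ _ h2, zero_smul]
        · simp
      · intro m _ hm
        rcases lt_or_gt_of_ne hm with h2 | h2
        · rw [lamHom_triangular d q hab v y m i h2, mul_zero]
        · rw [lamHom_triangular d q hab v _ i m h2, zero_mul]
      · simp
  exact (hS ▸ Submodule.mem_top : z ∈ S)

lemma exists_lOp_inverse (v : V) :
    ∃ S : Matrix (Fin (d v)) (Fin (d v)) (Module.End k (Dq (oneEdge a b) d q)),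
      lOp d q hab v * S = 1 ∧ S * lOp d q hab v = 1 := by
  refine exists_inverse_of_triangular (B := Module.End k (Dq (oneEdge a b) d q))
    (fun i j hij => ?_) fun i => ?_
  · apply LinearMap.ext
    intro z
    exact lamHom_triangular d q hab v z i j hij
  · have hw : ∀ (u : V) (s t : Fin (d u)), (s : ℕ) = t →
        weight d q v i u s = weight d q v i u t := fun u s t h => by rw [weight, weight, h]
    have h1 : lOp d q hab v i i = (torusHom d q hab (weight d q v i) hw).toLinearMap := by
      apply LinearMap.ext
      intro z
      exact lamHom_diag d q hab v z i
    rw [h1]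
    have h2 := torusHom_comp d q hab (weight d q v i) (fun u s => (weight d q v i u s)⁻¹) hw
      (fun u s t h => by rw [hw u s t h]) fun u i => mul_inv_cancel _
    have h3 := torusHom_comp d q hab (fun u s => (weight d q v i u s)⁻¹) (weight d q v i)
      (fun u s t h => by rw [hw u s t h]) hw fun u i => inv_mul_cancel _
    refine ⟨⟨(torusHom d q hab (weight d q v i) hw).toLinearMap,
      (torusHom d q hab (fun u s => (weight d q v i u s)⁻¹)
        (fun u s t h => by rw [hw u s t h])).toLinearMap, ?_, ?_⟩, rfl⟩
    · apply LinearMap.ext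
      intro z
      exact DFunLike.congr_fun h2 z
    · apply LinearMap.ext
      intro z
      exact DFunLike.congr_fun h3 z

section Exchange

variable (v w u : V)

/-- `R_13` on `(k^{d v} ⊗ k^{d w}) ⊗ k^{d u}`. -/
def t13 : Matrix ((Fin (d v) × Fin (d w)) × Fin (d u)) ((Fin (d v) × Fin (d w)) × Fin (d u)) k :=
  Matrix.of fun r c => if r.1.2 = c.1.2 then matR d q v u (r.1.1, r.2) (c.1.1, c.2) else 0

/-- `R_23` on `(k^{d v} ⊗ k^{d w}) ⊗ k^{d u}`. -/
def t23 : Matrix ((Fin (d v) × Fin (d w)) × Fin (d u)) ((Fin (d v) × Fin (d w)) × Fin (d u)) k :=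
  Matrix.of fun r c => if r.1.1 = c.1.1 then matR d q w u (r.1.2, r.2) (c.1.2, c.2) else 0

/-- `R_13⁻¹` on `(k^{d v} ⊗ k^{d w}) ⊗ k^{d u}`. -/
def t13Inv : Matrix ((Fin (d v) × Fin (d w)) × Fin (d u))
    ((Fin (d v) × Fin (d w)) × Fin (d u)) k :=
  Matrix.of fun r c => if r.1.2 = c.1.2 then matRInv d q v u (r.1.1, r.2) (c.1.1, c.2) else 0

/-- `R_23⁻¹` on `(k^{d v} ⊗ k^{d w}) ⊗ k^{d u}`. -/
def t23Inv : Matrix ((Fin (d v) × Fin (d w)) × Fin (d u))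
    ((Fin (d v) × Fin (d w)) × Fin (d u)) k :=
  Matrix.of fun r c => if r.1.1 = c.1.1 then matRInv d q w u (r.1.2, r.2) (c.1.2, c.2) else 0

lemma t13_mul_inv : t13 d q v w u * t13Inv d q v w u = 1 := by
  ext ⟨⟨i, j⟩, s⟩ ⟨⟨x, y⟩, t⟩
  have := congrFun (congrFun (matR_mul_matRInv q d v u) (i, s)) (x, t)
  simp only [Matrix.mul_apply, Fintype.sum_prod_type, t13, t13Inv, Matrix.of_apply,
    Matrix.one_apply, Prod.mk.injEq] at this ⊢
  rw [Finset.sum_congr rfl fun a _ => Finset.sum_eq_single_of_mem j (Finset.mem_univ _)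
    fun b _ hb => Finset.sum_eq_zero fun c _ => by rw [if_neg hb.symm, zero_mul]]
  by_cases h : j = y
  · simpa [h] using this
  · simp [h]

lemma t23_mul_inv : t23 d q v w u * t23Inv d q v w u = 1 := by
  ext ⟨⟨i, j⟩, s⟩ ⟨⟨x, y⟩, t⟩
  have := congrFun (congrFun (matR_mul_matRInv q d w u) (j, s)) (y, t)
  simp only [Matrix.mul_apply, Fintype.sum_prod_type, t23, t23Inv, Matrix.of_apply,
    Matrix.one_apply, Prod.mk.injEq] at this ⊢
  rw [Finset.sum_eq_single_of_mem i (Finset.mem_univ _) fun b _ hb => Finset.sum_eq_zero fun c _ =>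
    Finset.sum_eq_zero fun c _ => by rw [if_neg hb.symm, zero_mul]]
  by_cases h : i = x
  · simpa [h] using this
  · simp [h]

lemma t12_t13_t23 : leg1 (Fin (d u)) (matR d q v w) * t13 d q v w u * t23 d q v w u =
    t23 d q v w u * t13 d q v w u * leg1 (Fin (d u)) (matR d q v w) := by
  ext ⟨⟨i, j⟩, s⟩ ⟨⟨x, y⟩, t⟩
  have := ybe_matR q d v w u i x j y s t
  rw [Matrix.mul_assoc, Matrix.mul_assoc, leg1_mul_apply', Fintype.sum_prod_type]
  calc _ = _ := ?_
    _ = _ := this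
    _ = _ := ?_
  · refine Finset.sum_congr rfl fun m _ => Finset.sum_congr rfl fun n _ => ?_
    congr 1
    simp only [Matrix.mul_apply, Fintype.sum_prod_type, t13, t23, Matrix.of_apply]
    rw [Finset.sum_eq_single_of_mem x (Finset.mem_univ _) fun b _ hb => Finset.sum_eq_zero
      fun c _ => Finset.sum_eq_zero fun c _ => by rw [if_neg hb, mul_zero],
      Finset.sum_eq_single_of_mem n (Finset.mem_univ _) fun b _ hb =>
        Finset.sum_eq_zero fun c _ => by rw [if_neg hb.symm, zero_mul]]
    simp
  · rw [Matrix.mul_apply, Fintype.sum_prod_type, Fintype.sum_prod_type,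
      Finset.sum_eq_single_of_mem i (Finset.mem_univ _) fun b _ hb => Finset.sum_eq_zero
      fun c _ => Finset.sum_eq_zero fun c _ => by
        rw [t23, Matrix.of_apply, if_neg hb.symm, zero_mul]]
    refine Finset.sum_congr rfl fun m _ => Finset.sum_congr rfl fun n _ => ?_
    rw [mul_leg1_apply', Fintype.sum_prod_type]
    simp only [t23, t13, Matrix.of_apply, if_true]
    congr 1
    refine Finset.sum_congr rfl fun l _ => ?_
    rw [Finset.sum_eq_single_of_mem m (Finset.mem_univ _) fun b _ hb => by
      rw [if_neg hb.symm, zero_mul], if_pos rfl]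

lemma t12_t23Inv_t13Inv :
    leg1 (Fin (d u)) (matR d q v w) * t23Inv d q v w u * t13Inv d q v w u =
    t13Inv d q v w u * t23Inv d q v w u * leg1 (Fin (d u)) (matR d q v w) := by
  have h1 := mul_eq_one_comm.mp (t13_mul_inv d q v w u)
  have h2 := mul_eq_one_comm.mp (t23_mul_inv d q v w u)
  have e := mul_congr_left (mul_congr_left (mul_congr_right (mul_congr_right
    (t12_t13_t23 d q v w u) (t23Inv d q v w u)) (t13Inv d q v w u)) (t23Inv d q v w u))
    (t13Inv d q v w u)
  simp only [Matrix.mul_assoc] at e ⊢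
  rw [reassoc_one (t23_mul_inv d q v w u), t13_mul_inv, Matrix.mul_one, reassoc_one h2,
    reassoc_one h1] at e
  exact e.symm

lemma sum_t13 {B : Type*} [Ring B] [Algebra k B] {u' : V}
    (N : Matrix ((Fin (d v) × Fin (d w)) × Fin (d u)) ((Fin (d v) × Fin (d w)) × Fin (d u')) B)
    (i j s x y t) :
    (sc B (t13 d q v w u) * N * sc B (t13Inv d q v w u')) ((i, j), s) ((x, y), t) =
      ∑ a, ∑ p, matR d q v u (i, s) (a, p) • ∑ c, ∑ m, matRInv d q v u' (c, m) (x, t) •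
        N ((a, j), p) ((c, y), m) := by
  rw [Matrix.mul_assoc, sc_mul_apply, Fintype.sum_prod_type, Fintype.sum_prod_type]
  refine Finset.sum_congr rfl fun a _ => ?_
  rw [Finset.sum_eq_single_of_mem j (Finset.mem_univ _) fun b _ hb => Finset.sum_eq_zero
      fun c _ => by rw [t13, Matrix.of_apply, if_neg hb.symm, zero_smul]]
  refine Finset.sum_congr rfl fun p _ => ?_
  rw [t13, Matrix.of_apply, if_pos rfl, mul_sc_apply, Fintype.sum_prod_type,
    Fintype.sum_prod_type]
  congr 1
  refine Finset.sum_congr rfl fun a _ => ?_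
  rw [Finset.sum_eq_single_of_mem y (Finset.mem_univ _) fun b _ hb => Finset.sum_eq_zero
      fun c _ => by rw [t13Inv, Matrix.of_apply, if_neg hb, zero_smul]]
  refine Finset.sum_congr rfl fun p _ => ?_
  rw [t13Inv, Matrix.of_apply, if_pos rfl]

lemma sum_t23 {B : Type*} [Ring B] [Algebra k B] {u' : V}
    (N : Matrix ((Fin (d v) × Fin (d w)) × Fin (d u)) ((Fin (d v) × Fin (d w)) × Fin (d u')) B)
    (i j s x y t) :
    (sc B (t23 d q v w u) * N * sc B (t23Inv d q v w u')) ((i, j), s) ((x, y), t) =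
      ∑ a, ∑ p, matR d q w u (j, s) (a, p) • ∑ c, ∑ m, matRInv d q w u' (c, m) (y, t) •
        N ((i, a), p) ((x, c), m) := by
  rw [Matrix.mul_assoc, sc_mul_apply, Fintype.sum_prod_type, Fintype.sum_prod_type]
  rw [Finset.sum_eq_single_of_mem i (Finset.mem_univ _) fun b _ hb => Finset.sum_eq_zero
      fun c _ => Finset.sum_eq_zero fun c _ => by
        rw [t23, Matrix.of_apply, if_neg hb.symm, zero_smul]]
  refine Finset.sum_congr rfl fun a _ => Finset.sum_congr rfl fun p _ => ?_
  rw [t23, Matrix.of_apply, if_pos rfl, mul_sc_apply, Fintype.sum_prod_type,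
    Fintype.sum_prod_type]
  congr 1
  rw [Finset.sum_eq_single_of_mem x (Finset.mem_univ _) fun b _ hb => Finset.sum_eq_zero
      fun c _ => Finset.sum_eq_zero fun c _ => by
        rw [t23Inv, Matrix.of_apply, if_neg hb, zero_smul]]
  refine Finset.sum_congr rfl fun a _ => Finset.sum_congr rfl fun p _ => ?_
  rw [t23Inv, Matrix.of_apply, if_pos rfl]

end Exchange

section Exchange

variable (v w : V)

lemma lamHom_lamHom_genX (x : Unit ⊕ Unit) (s t i i' j j') :
    lamHom d q hab w (lamHom d q hab v (genX (oneEdge a b) d q x s t) i i') j j' =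
      (sc (Dq (oneEdge a b) d q) (t13 d q v w ((oneEdge a b).src x)) *
        (sc (Dq (oneEdge a b) d q) (t23 d q v w ((oneEdge a b).src x)) *
          leg2 (Fin (d v) × Fin (d w)) (genX (oneEdge a b) d q x) *
          sc (Dq (oneEdge a b) d q) (t23Inv d q v w ((oneEdge a b).tgt x))) *
        sc (Dq (oneEdge a b) d q) (t13Inv d q v w ((oneEdge a b).tgt x)))
        ((i, j), s) ((i', j'), t) := by
  have e : ∀ (y c : Fin (d v)) p m, (sc (Dq (oneEdge a b) d q) (t23 d q v w ((oneEdge a b).src x)) *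
          leg2 (Fin (d v) × Fin (d w)) (genX (oneEdge a b) d q x) *
          sc (Dq (oneEdge a b) d q) (t23Inv d q v w ((oneEdge a b).tgt x)))
          ((y, j), p) ((c, j'), m) =
        if y = c then lamHom d q hab w (genX (oneEdge a b) d q x p m) j j' else 0 := by
    intro y c p m
    rw [sum_t23]
    simp only [leg2_apply, Prod.mk.injEq, lamHom_genX]
    by_cases h : y = c
    · simp [h]
    · simp [h]
  rw [sum_t13]
  simp only [e]
  rw [lamHom_genX, map_sum, Matrix.sum_apply]
  refine Finset.sum_congr rfl fun y _ => ?_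
  rw [map_sum, Matrix.sum_apply]
  refine Finset.sum_congr rfl fun p _ => ?_
  rw [map_smul, Matrix.smul_apply, map_sum, Matrix.sum_apply]
  simp

lemma lamHom_lamHom_genX' (x : Unit ⊕ Unit) (s t i i' j j') :
    lamHom d q hab v (lamHom d q hab w (genX (oneEdge a b) d q x s t) j j') i i' =
      (sc (Dq (oneEdge a b) d q) (t23 d q v w ((oneEdge a b).src x)) *
        (sc (Dq (oneEdge a b) d q) (t13 d q v w ((oneEdge a b).src x)) *
          leg2 (Fin (d v) × Fin (d w)) (genX (oneEdge a b) d q x) *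
          sc (Dq (oneEdge a b) d q) (t13Inv d q v w ((oneEdge a b).tgt x))) *
        sc (Dq (oneEdge a b) d q) (t23Inv d q v w ((oneEdge a b).tgt x)))
        ((i, j), s) ((i', j'), t) := by
  have e : ∀ (y c : Fin (d w)) p m, (sc (Dq (oneEdge a b) d q) (t13 d q v w ((oneEdge a b).src x)) *
          leg2 (Fin (d v) × Fin (d w)) (genX (oneEdge a b) d q x) *
          sc (Dq (oneEdge a b) d q) (t13Inv d q v w ((oneEdge a b).tgt x)))
          ((i, y), p) ((i', c), m) =
        if y = c then lamHom d q hab v (genX (oneEdge a b) d q x p m) i i' else 0 := by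
    intro y c p m
    rw [sum_t13]
    simp only [leg2_apply, Prod.mk.injEq, lamHom_genX]
    by_cases h : y = c
    · simp [h]
    · simp [h]
  rw [sum_t23]
  simp only [e]
  rw [lamHom_genX, map_sum, Matrix.sum_apply]
  refine Finset.sum_congr rfl fun y _ => ?_
  rw [map_sum, Matrix.sum_apply]
  refine Finset.sum_congr rfl fun p _ => ?_
  rw [map_smul, Matrix.smul_apply, map_sum, Matrix.sum_apply]
  simp

/-- The braiding of `k^{d v} ⊗ k^{d w}` past the algebra of one edge, first with `k^{d v}` and then
with `k^{d w}`. -/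
def braidTwo (z : Dq (oneEdge a b) d q) :
    Matrix (Fin (d v) × Fin (d w)) (Fin (d v) × Fin (d w)) (Dq (oneEdge a b) d q) :=
  Matrix.of fun r c => lamHom d q hab w (lamHom d q hab v z r.1 c.1) r.2 c.2

/-- The braiding of `k^{d v} ⊗ k^{d w}` past the algebra of one edge, in the opposite order. -/
def braidTwo' (z : Dq (oneEdge a b) d q) :
    Matrix (Fin (d v) × Fin (d w)) (Fin (d v) × Fin (d w)) (Dq (oneEdge a b) d q) :=
  Matrix.of fun r c => lamHom d q hab v (lamHom d q hab w z r.2 c.2) r.1 c.1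

lemma braidTwo_mul (y z : Dq (oneEdge a b) d q) :
    braidTwo d q hab v w (y * z) = braidTwo d q hab v w y * braidTwo d q hab v w z := by
  ext ⟨i, j⟩ ⟨i', j'⟩
  simp only [braidTwo, Matrix.of_apply, Matrix.mul_apply, map_mul, map_sum, Matrix.sum_apply,
    Fintype.sum_prod_type]

lemma braidTwo'_mul (y z : Dq (oneEdge a b) d q) :
    braidTwo' d q hab v w (y * z) = braidTwo' d q hab v w y * braidTwo' d q hab v w z := by
  ext ⟨i, j⟩ ⟨i', j'⟩
  simp only [braidTwo', Matrix.of_apply, Matrix.mul_apply, map_mul, map_sum, Matrix.sum_apply,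
    Fintype.sum_prod_type]
  rw [Finset.sum_comm]

lemma conj_conj {B : Type*} [Ring B] {m n : Type*} [Fintype m] [Fintype n]
    {c p r : Matrix m m B} {c' p' r' : Matrix n n B} {X : Matrix m n B}
    (h1 : c * p * r = r * p * c) (h2 : c' * r' * p' = p' * r' * c') (h3 : c * X = X * c') :
    c * (p * (r * X * r') * p') = r * (p * X * p') * r' * c' := by
  simp only [Matrix.mul_assoc] at *
  rw [← h2, ← reassoc h3, ← Matrix.mul_assoc p r, ← Matrix.mul_assoc c, h1]
  simp only [Matrix.mul_assoc]

lemma braidTwo_genX (x : Unit ⊕ Unit) (s t) :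
    sc _ (matR d q v w) * braidTwo d q hab v w (genX (oneEdge a b) d q x s t) =
      braidTwo' d q hab v w (genX (oneEdge a b) d q x s t) * sc _ (matR d q v w) := by
  have e1 := congrArg (sc (Dq (oneEdge a b) d q)) (t12_t13_t23 d q v w ((oneEdge a b).src x))
  have e2 := congrArg (sc (Dq (oneEdge a b) d q))
    (t12_t23Inv_t13Inv d q v w ((oneEdge a b).tgt x))
  have c : ∀ u, sc (Dq (oneEdge a b) d q) (leg1 (Fin (d u)) (matR d q v w)) =
      leg1 (Fin (d u)) (sc (Dq (oneEdge a b) d q) (matR d q v w)) := by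
    intro u
    ext r c
    simp only [sc_apply, leg1_apply]
    split_ifs <;> simp
  have c3 := leg_comm (X := sc (Dq (oneEdge a b) d q) (matR d q v w))
    (Y := genX (oneEdge a b) d q x) fun i j i' j' => by rw [sc_apply]; exact Algebra.commutes _ _
  ext ⟨i, j⟩ ⟨i', j'⟩
  simp only [sc_mul, c] at e1 e2
  have e := conj_conj e1 e2 c3
  have := congrFun (congrFun e ((i, j), s)) ((i', j'), t)
  rw [leg1_mul_apply', mul_leg1_apply'] at this
  simp only [Fintype.sum_prod_type, ← lamHom_lamHom_genX d q hab,
    ← lamHom_lamHom_genX' d q hab] at this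
  simp only [Matrix.mul_apply, Fintype.sum_prod_type]
  exact this

/-- The exchange relation on the algebra of one edge: it holds on the generators by the
Yang–Baxter equation, and both sides are multiplicative. -/
lemma braidTwo_eq (z : Dq (oneEdge a b) d q) :
    sc _ (matR d q v w) * braidTwo d q hab v w z =
      braidTwo' d q hab v w z * sc _ (matR d q v w) := by
  let S : Submodule k (Dq (oneEdge a b) d q) :=
    { carrier := {z | sc _ (matR d q v w) * braidTwo d q hab v w z =
        braidTwo' d q hab v w z * sc _ (matR d q v w)}
      zero_mem' := by
        have e1 : braidTwo d q hab v w 0 = 0 := by ext; simp [braidTwo]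
        have e2 : braidTwo' d q hab v w 0 = 0 := by ext; simp [braidTwo']
        rw [Set.mem_ofPred_eq, e1, e2, Matrix.mul_zero, Matrix.zero_mul]
      add_mem' := fun {x y} hx hy => by
        have e1 : braidTwo d q hab v w (x + y) =
            braidTwo d q hab v w x + braidTwo d q hab v w y := by
          ext; simp [braidTwo]
        have e2 : braidTwo' d q hab v w (x + y) =
            braidTwo' d q hab v w x + braidTwo' d q hab v w y := by
          ext; simp [braidTwo']
        rw [Set.mem_ofPred_eq, e1, e2, Matrix.mul_add, Matrix.add_mul, hx, hy]
      smul_mem' := fun c x hx => by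
        have e1 : braidTwo d q hab v w (c • x) = c • braidTwo d q hab v w x := by
          ext; simp [braidTwo]
        have e2 : braidTwo' d q hab v w (c • x) = c • braidTwo' d q hab v w x := by
          ext; simp [braidTwo']
        rw [Set.mem_ofPred_eq, e1, e2, Matrix.mul_smul, Matrix.smul_mul, hx] }
  have hS : S = ⊤ := by
    refine Dq.eq_top_of_mul_mem S ?_ fun x s t y hy => ?_
    · have e1 : braidTwo d q hab v w 1 = 1 := by
        ext ⟨i, j⟩ ⟨i', j'⟩
        by_cases h1 : i = i' <;> by_cases h2 : j = j' <;> simp [braidTwo, h1, h2, Matrix.one_apply]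
      have e2 : braidTwo' d q hab v w 1 = 1 := by
        ext ⟨i, j⟩ ⟨i', j'⟩
        by_cases h1 : i = i' <;> by_cases h2 : j = j' <;> simp [braidTwo', h1, h2, Matrix.one_apply]
      change _ = _
      rw [e1, e2, Matrix.one_mul, Matrix.mul_one]
    · change _ = _
      rw [braidTwo_mul, braidTwo'_mul, ← Matrix.mul_assoc, braidTwo_genX, Matrix.mul_assoc,
        show _ = _ from hy, Matrix.mul_assoc]
  exact (hS ▸ Submodule.mem_top : z ∈ S)

/-- The exchange relations between the operators that braid the algebra of one edge with
`k^{d v}` and with `k^{d w}`. -/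
lemma lOp_rel :
    sc (Module.End k (Dq (oneEdge a b) d q)) (matR d q v w) *
        leg2 (Fin (d v)) (lOp d q hab w) * leg1 (Fin (d w)) (lOp d q hab v) =
      leg1 (Fin (d w)) (lOp d q hab v) * leg2 (Fin (d v)) (lOp d q hab w) *
        sc (Module.End k (Dq (oneEdge a b) d q)) (matR d q v w) := by
  refine Matrix.ext fun ⟨i, j⟩ ⟨i', j'⟩ => ?_
  rw [Matrix.mul_assoc, sc_mul_apply, mul_sc_apply]
  simp only [leg2_mul_leg1_apply, leg1_mul_leg2_apply]
  apply LinearMap.ext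
  intro z
  have := congrFun (congrFun (braidTwo_eq d q hab v w z) (i, j)) (i', j')
  rw [sc_mul_apply, mul_sc_apply] at this
  rw [LinearMap.sum_apply, LinearMap.sum_apply]
  exact this

end Exchange

lemma exists_dressing_lOp : ∃ S : ∀ v, Matrix (Fin (d v)) (Fin (d v))
    (Module.End k (Dq (oneEdge a b) d q)), Dressing d q (lOp d q hab) S := by
  choose S h1 h2 using exists_lOp_inverse d q hab
  exact ⟨S, lOp_rel d q hab, h1, h2⟩

end EdgeDressing

/-! ### A representation of the algebra of a quiver without loops -/

section Model

variable {V : Type*} [DecidableEq V] {d : V → ℕ}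
variable {k : Type*} [CommRing k] {q : kˣ}

section Covariance

variable {B : Type*} [Ring B] [Algebra k B] {T S : ∀ v, Matrix (Fin (d v)) (Fin (d v)) B}

variable (d q) in
/-- The covariance `T_1 Y_2 = R Y_2 R⁻¹ T_1` of the matrix of an arrow `v → w` under the matrix
`T` of a vertex `u`. -/
def Covariant (u v w : V) (T : Matrix (Fin (d u)) (Fin (d u)) B)
    (Y : Matrix (Fin (d v)) (Fin (d w)) B) : Prop :=
  leg1 (Fin (d v)) T * leg2 (Fin (d u)) Y =
    sc B (matR d q u v) * leg2 (Fin (d u)) Y * sc B (matRInv d q u w) * leg1 (Fin (d w)) T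

lemma Covariant.map {B' : Type*} [Ring B'] [Algebra k B'] {u v w : V}
    {T : Matrix (Fin (d u)) (Fin (d u)) B} {Y : Matrix (Fin (d v)) (Fin (d w)) B}
    (h : Covariant d q u v w T Y) (f : B →ₐ[k] B') :
    Covariant d q u v w (T.map f) (Y.map f) := by
  have := congrArg (fun M : Matrix _ _ B => M.map f) h
  simp only [map_mul_algHom, leg1_map', leg2_map', sc_map] at this
  exact this

lemma Covariant.inv {u v w : V} {T S : Matrix (Fin (d u)) (Fin (d u)) B}
    {Y : Matrix (Fin (d v)) (Fin (d w)) B} (h : Covariant d q u v w T Y) (h1 : T * S = 1)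
    (h2 : S * T = 1) :
    leg1 (Fin (d v)) S * (sc B (matR d q u v) * leg2 (Fin (d u)) Y) =
      leg2 (Fin (d u)) Y * (leg1 (Fin (d w)) S * sc B (matR d q u w)) := by
  have e := mul_congr_left (mul_congr_right (mul_congr_right h (leg1 (Fin (d w)) S))
    (sc B (matR d q u w))) (leg1 (Fin (d v)) S)
  simp only [Matrix.mul_assoc] at e
  rw [reassoc_one (leg1_mul_one h2), reassoc_one (leg1_mul_one h1), scRInv_mul,
    Matrix.mul_one] at e
  exact e.symm

/-- A dressed matrix braids with a covariant one. -/
lemma Dressing.braidRel (h : Dressing d q T S) {u u' v v' : V}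
    {N : Matrix (Fin (d u)) (Fin (d u')) B} {Y : Matrix (Fin (d v)) (Fin (d v')) B}
    (hY : ∀ u, Covariant d q u v v' (T u) Y) (hN : EntriesCommute N Y) :
    BraidRel d q u u' v v' (T u * N * S u') Y := by
  have e1 := hY u
  have e2 := (hY u').inv (h.mul_inv u') (h.inv_mul u')
  have e3 := leg_comm hN
  unfold BraidRel Covariant at *
  simp only [leg1_mul, Matrix.mul_assoc] at *
  rw [e2, reassoc e3, ← Matrix.mul_assoc (leg1 _ (T u)), e1]
  simp only [Matrix.mul_assoc]

/-- Dressing a covariant matrix and its vertex matrix by `T` preserves the covariance. -/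
lemma Dressing.covariant (h : Dressing d q T S) {u v w : V}
    {L : Matrix (Fin (d u)) (Fin (d u)) B} {N : Matrix (Fin (d v)) (Fin (d w)) B}
    (hN : Covariant d q u v w L N) (hTN : ∀ u, EntriesCommute (T u) N)
    (hTL : ∀ u, EntriesCommute (T u) L) :
    Covariant d q u v w (T u * L) (T v * N * S w) := by
  have e1 := h.rel u v
  have e2 := h.rel_mixed u w
  have e3 := leg_comm (hTN u)
  have e4 := leg_comm (hTL v).symm
  have e5 := leg_comm ((hTL w).inv (h.mul_inv w) (h.inv_mul w)).symm
  unfold Covariant at *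
  simp only [leg1_mul, leg2_mul, Matrix.mul_assoc] at *
  rw [reassoc e4, ← Matrix.mul_assoc (leg1 _ L), hN]
  simp only [Matrix.mul_assoc]
  rw [e5, ← Matrix.mul_assoc (leg2 _ (T v)), ← Matrix.mul_assoc (leg1 _ (T u)), ← e1]
  simp only [Matrix.mul_assoc]
  rw [reassoc e3, ← Matrix.mul_assoc (sc B _) (leg2 _ (S w)), ← Matrix.mul_assoc (leg1 _ (T u)),
    ← e2]
  simp only [Matrix.mul_assoc]

lemma Covariant.mul {u v w : V} {T L : Matrix (Fin (d u)) (Fin (d u)) B}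
    {Y : Matrix (Fin (d v)) (Fin (d w)) B} (h : Covariant d q u v w T Y)
    (hL : EntriesCommute L Y) : Covariant d q u v w (T * L) Y := by
  have e := leg_comm hL
  unfold Covariant at *
  simp only [leg1_mul, Matrix.mul_assoc] at *
  rw [e, ← Matrix.mul_assoc (leg1 _ T), h]
  simp only [Matrix.mul_assoc]

end Covariance

variable {E : Type*} [LinearOrder E] (Q : EdgeQuiver V E)

/-- A family of matrices that satisfies the relations of the edges in `s`, together with a
dressing under which it is covariant. -/
structure PartialModel (q : kˣ) (s : Finset E) {B : Type*} [Ring B] [Algebra k B]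
    (T S : ∀ v, Matrix (Fin (d v)) (Fin (d v)) B)
    (X : ∀ x : E ⊕ E, Matrix (Fin (d (Q.src x))) (Fin (d (Q.tgt x))) B) : Prop where
  dressing : Dressing d q T S
  cov : ∀ x, underlying x ∈ s → ∀ u, Covariant d q u (Q.src x) (Q.tgt x) (T u) (X x)
  edge : ∀ x, underlying x ∈ s → EdgeRel d q (Q.src x) (Q.tgt x) (X x)
  cross : ∀ e ∈ s, CrossEdgeRel d q (Q.tail e) (Q.head e) (X (Sum.inl e)) (X (Sum.inr e))
  braided : ∀ x y, underlying x ∈ s → underlying y ∈ s → underlying y < underlying x →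
    BraidRel d q (Q.src x) (Q.tgt x) (Q.src y) (Q.tgt y) (X x) (X y)

variable {Q} {B : Type*} [Ring B] [Algebra k B]
  {T S : ∀ v, Matrix (Fin (d v)) (Fin (d v)) B}
  {X : ∀ x : E ⊕ E, Matrix (Fin (d (Q.src x))) (Fin (d (Q.tgt x))) B}

lemma PartialModel.map {s : Finset E} {B' : Type*} [Ring B'] [Algebra k B']
    (h : PartialModel Q q s T S X) (f : B →ₐ[k] B') :
    PartialModel Q q s (fun v => (T v).map f) (fun v => (S v).map f) (fun x => (X x).map f) where
  dressing := h.dressing.map f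
  cov x hx u := (h.cov x hx u).map f
  edge x hx := (h.edge x hx).map f
  cross e he := (h.cross e he).map f
  braided x y hx hy hxy := (h.braided x y hx hy hxy).map f

lemma exists_update {ι : Type*} [DecidableEq ι] {β : ι → Type*} (f : ∀ i, β i) {a b : ι}
    (hab : a ≠ b) (x : β a) (y : β b) :
    ∃ g : ∀ i, β i, g a = x ∧ g b = y ∧ ∀ c, c ≠ a → c ≠ b → g c = f c := by
  refine ⟨Function.update (Function.update f a x) b y, ?_, ?_, ?_⟩
  · rw [Function.update_of_ne hab, Function.update_self]
  · rw [Function.update_self]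
  · intro c h1 h2
    rw [Function.update_of_ne h2, Function.update_of_ne h1]

/-- Adding a last edge `e`: the matrices of `e` have to be covariant under a second dressing `L`
that commutes with the given data. -/
lemma PartialModel.exists_insert {s : Finset E} (h : PartialModel Q q s T S X) {e : E}
    (hs : ∀ f ∈ s, f < e) (he : Q.tail e ≠ Q.head e)
    {L L' : ∀ v, Matrix (Fin (d v)) (Fin (d v)) B} (hL : Dressing d q L L')
    {A : Matrix (Fin (d (Q.tail e))) (Fin (d (Q.head e))) B}
    {D : Matrix (Fin (d (Q.head e))) (Fin (d (Q.tail e))) B}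
    (hA : EdgeRel d q _ _ A) (hD : EdgeRel d q _ _ D) (hAD : CrossEdgeRel d q _ _ A D)
    (hLA : ∀ u, Covariant d q u _ _ (L u) A) (hLD : ∀ u, Covariant d q u _ _ (L u) D)
    (hTL : ∀ u v, EntriesCommute (T u) (L v)) (hTA : ∀ u, EntriesCommute (T u) A)
    (hTD : ∀ u, EntriesCommute (T u) D) (hXL : ∀ u x, EntriesCommute (L u) (X x))
    (hXA : ∀ x, EntriesCommute A (X x)) (hXD : ∀ x, EntriesCommute D (X x)) :
    ∃ X', PartialModel Q q (insert e s) (fun v => T v * L v) (fun v => L' v * S v) X' := by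
  obtain ⟨X', hl, hr, h'⟩ := exists_update X (a := Sum.inl e) (b := Sum.inr e) (by simp)
    (T (Q.tail e) * A * S (Q.head e)) (T (Q.head e) * D * S (Q.tail e))
  have hes : ∀ x : E ⊕ E, underlying x ∈ s → underlying x ≠ e := fun x hx he =>
    lt_irrefl _ (he ▸ hs _ hx)
  have ho : ∀ x, underlying x ∈ s → X' x = X x := by
    intro x hx
    have h1 := hes x hx
    refine h' x ?_ ?_
    · rintro rfl; exact h1 rfl
    · rintro rfl; exact h1 rfl
  have hcases : ∀ x : E ⊕ E, underlying x ∈ insert e s →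
      underlying x ∈ s ∨ x = Sum.inl e ∨ x = Sum.inr e := by
    rintro (x | x) hx
    · rcases Finset.mem_insert.mp hx with hx | hx
      · exact Or.inr (Or.inl (congrArg _ hx))
      · exact Or.inl hx
    · rcases Finset.mem_insert.mp hx with hx | hx
      · exact Or.inr (Or.inr (congrArg _ hx))
      · exact Or.inl hx
  refine ⟨X', h.dressing.mul hL hTL, ?_, ?_, ?_, ?_⟩
  · intro x hx u
    rcases hcases x hx with hx | rfl | rfl
    · rw [ho x hx]
      exact (h.cov x hx u).mul (hXL u x)
    · rw [hl]
      exact h.dressing.covariant (hLA u) hTA fun v => hTL v u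
    · rw [hr]
      exact h.dressing.covariant (hLD u) hTD fun v => hTL v u
  · intro x hx
    rcases hcases x hx with hx | rfl | rfl
    · rw [ho x hx]
      exact h.edge x hx
    · rw [hl]
      exact h.dressing.edgeRel he hA hTA
    · rw [hr]
      exact h.dressing.edgeRel he.symm hD hTD
  · intro f hf
    rcases Finset.mem_insert.mp hf with rfl | hf
    · rw [hl, hr]
      exact h.dressing.crossEdgeRel he hAD hTA hTD
    · rw [ho (Sum.inl f) hf, ho (Sum.inr f) hf]
      exact h.cross f hf
  · intro x y hx hy hxy
    rcases hcases y hy with hy | rfl | rfl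
    · rw [ho y hy]
      rcases hcases x hx with hx | rfl | rfl
      · rw [ho x hx]
        exact h.braided x y hx hy hxy
      · rw [hl]
        exact h.dressing.braidRel (h.cov y hy) (hXA y)
      · rw [hr]
        exact h.dressing.braidRel (h.cov y hy) (hXD y)
    all_goals
      exfalso
      rcases Finset.mem_insert.mp hx with hx | hx
      · rw [hx] at hxy; exact lt_irrefl _ hxy
      · exact lt_asymm hxy (hs _ hx)

end Model

section Model

universe u

variable {V E : Type*} [DecidableEq V] [LinearOrder E] (Q : EdgeQuiver V E) (d : V → ℕ)
variable {k : Type u} [CommRing k] (q : kˣ)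

variable {d q} in
/-- Passage from an algebra to its left multiplications. -/
lemma relations_lmul {W : Type*} [Ring W] [Algebra k W] {a b : V}
    {X : ∀ x : Unit ⊕ Unit,
      Matrix (Fin (d ((oneEdge a b).src x))) (Fin (d ((oneEdge a b).tgt x))) W}
    (hE : ∀ x, EdgeRel d q ((oneEdge a b).src x) ((oneEdge a b).tgt x) (X x))
    (hC : CrossEdgeRel d q a b (X (Sum.inl ())) (X (Sum.inr ())))
    {L : ∀ v, Matrix (Fin (d v)) (Fin (d v)) (Module.End k W)}
    (hL : ∀ x u, Covariant d q u ((oneEdge a b).src x) ((oneEdge a b).tgt x) (L u)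
      ((X x).map (Algebra.lmul k W))) :
    ∃ (A : Matrix (Fin (d a)) (Fin (d b)) (Module.End k W))
      (D : Matrix (Fin (d b)) (Fin (d a)) (Module.End k W)),
      EdgeRel d q a b A ∧ EdgeRel d q b a D ∧ CrossEdgeRel d q a b A D ∧
      (∀ u, Covariant d q u a b (L u) A) ∧ (∀ u, Covariant d q u b a (L u) D) :=
  ⟨(X (Sum.inl ())).map (Algebra.lmul k W), (X (Sum.inr ())).map (Algebra.lmul k W),
    (hE (Sum.inl ())).map (Algebra.lmul k W), (hE (Sum.inr ())).map (Algebra.lmul k W),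
    hC.map (Algebra.lmul k W), hL (Sum.inl ()), hL (Sum.inr ())⟩

variable {d q} in
/-- The action of the algebra of one edge on itself by left multiplication, and the operators that
braid it with the vertices. -/
lemma exists_edgeModel {a b : V} (hab : a ≠ b) :
    ∃ (B : Type u) (_ : Ring B) (_ : Algebra k B) (ψ : B →ₗ[k] k)
      (L L' : ∀ v, Matrix (Fin (d v)) (Fin (d v)) B)
      (A : Matrix (Fin (d a)) (Fin (d b)) B) (D : Matrix (Fin (d b)) (Fin (d a)) B),
      ψ 1 = 1 ∧ Dressing d q L L' ∧ EdgeRel d q a b A ∧ EdgeRel d q b a D ∧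
      CrossEdgeRel d q a b A D ∧ (∀ u, Covariant d q u a b (L u) A) ∧
      (∀ u, Covariant d q u b a (L u) D) := by
  obtain ⟨ψ, hψ⟩ := exists_functional_oneEdge d q hab
  obtain ⟨L', hL⟩ := exists_dressing_lOp d q hab
  have sat := sat_genX (oneEdge a b) d q
  have hE : ∀ x, EdgeRel d q ((oneEdge a b).src x) ((oneEdge a b).tgt x)
      (genX (oneEdge a b) d q x) := by
    rintro (x | x)
    · exact sat.edge _ hab
    · exact sat.edge _ hab.symm
  have hL' : ∀ x u, Covariant d q u ((oneEdge a b).src x) ((oneEdge a b).tgt x) (lOp d q hab u)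
      ((genX (oneEdge a b) d q x).map (Algebra.lmul k (Dq (oneEdge a b) d q))) :=
    fun x u => lOp_cov d q hab u x
  obtain ⟨A, D, h⟩ := relations_lmul hE (sat.cross_edge () hab) hL'
  exact ⟨Module.End k (Dq (oneEdge a b) d q), _, _,
    ψ ∘ₗ LinearMap.applyₗ (1 : Dq (oneEdge a b) d q), lOp d q hab, L', A, D, hψ, hL, h⟩

/-- Models exist for every finite set of edges: each new last edge acts on a further tensor factor,
and is dressed by the vertex matrices of the edges before it. -/
lemma exists_partialModel (hQ : ∀ e, Q.tail e ≠ Q.head e) (s : Finset E) :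
    ∃ (B : Type u) (_ : Ring B) (_ : Algebra k B) (ψ : B →ₗ[k] k)
      (T S : ∀ v, Matrix (Fin (d v)) (Fin (d v)) B)
      (X : ∀ x : E ⊕ E, Matrix (Fin (d (Q.src x))) (Fin (d (Q.tgt x))) B),
      ψ 1 = 1 ∧ PartialModel Q q s T S X := by
  induction s using Finset.induction_on_max with
  | empty =>
    refine ⟨k, inferInstance, inferInstance, LinearMap.id, fun _ => 1, fun _ => 1, fun _ => 0,
      rfl, ⟨⟨fun v w => ?_, fun v => Matrix.one_mul 1, fun v => Matrix.one_mul 1⟩, ?_, ?_, ?_, ?_⟩⟩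
    · simp [leg1_one, leg2_one]
    · intro x hx; simp at hx
    · intro x hx; simp at hx
    · intro x hx; simp at hx
    · intro x y hx; simp at hx
  | insert e s hs ih =>
    obtain ⟨B, _, _, ψ, T, S, X, hψ, h⟩ := ih
    obtain ⟨C, _, _, ψ', L, L', A, D, hψ', hL, hA, hD, hAD, hLA, hLD⟩ :=
      exists_edgeModel (d := d) (q := q) (hQ e)
    let i1 : B →ₐ[k] B ⊗[k] C := Algebra.TensorProduct.includeLeft
    let i2 : C →ₐ[k] B ⊗[k] C := Algebra.TensorProduct.includeRight
    have hc : ∀ {a b c e : Type} (M : Matrix a b B) (N : Matrix c e C),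
        EntriesCommute (M.map i1) (N.map i2) := by
      intro a b c e M N i j i' j'
      simp only [Matrix.map_apply]
      change (M i j ⊗ₜ[k] 1) * (1 ⊗ₜ[k] N i' j') = (1 ⊗ₜ[k] N i' j') * (M i j ⊗ₜ[k] 1)
      simp [Algebra.TensorProduct.tmul_mul_tmul]
    obtain ⟨X', h'⟩ := (h.map i1).exists_insert hs (hQ e) (hL.map i2) (hA.map i2) (hD.map i2)
      (hAD.map i2) (fun u => (hLA u).map i2) (fun u => (hLD u).map i2)
      (fun u v => hc _ _) (fun u => hc _ _) (fun u => hc _ _) (fun u x => (hc _ _).symm)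
      (fun x => (hc _ _).symm) (fun x => (hc _ _).symm)
    refine ⟨B ⊗[k] C, inferInstance, inferInstance,
      LinearMap.mul' k k ∘ₗ TensorProduct.map ψ ψ', _, _, X', ?_, h'⟩
    rw [Algebra.TensorProduct.one_def]
    simp [hψ, hψ']

/-- The algebra of a quiver without loops has a linear functional with value `1` at `1`. In
particular `1` is not annihilated by any nonzero scalar. The functional is the vacuum expectation
value in a model of all edges. -/
theorem exists_functional_of_loopless [Finite E] (hQ : ∀ e, Q.tail e ≠ Q.head e) :
    ∃ ψ : Dq Q d q →ₗ[k] k, ψ 1 = 1 := by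
  cases nonempty_fintype E
  obtain ⟨B, _, _, ψ, T, S, X, hψ, h⟩ := exists_partialModel Q d q hQ Finset.univ
  have sat : Sat Q q X :=
    { edge := fun x _ => h.edge x (Finset.mem_univ _)
      loop := by
        rintro (x | x) hx
        · exact absurd hx (hQ x)
        · exact absurd hx.symm (hQ x)
      cross_edge := fun e _ => h.cross e (Finset.mem_univ _)
      cross_loop := fun e he => absurd he (hQ e)
      braided := fun x y => h.braided x y (Finset.mem_univ _) (Finset.mem_univ _) }
  exact ⟨ψ ∘ₗ sat.lift.toLinearMap, by simp [hψ]⟩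

end Model

/-! ### Independence of differential operators -/

section Symbols

open MvPolynomial

variable {σ : Type*}

/-- The iterated partial derivative along a list of variables. -/
def dList (L : List σ) : Module.End ℂ (MvPolynomial σ ℂ) :=
  (L.map fun i => ((pderiv i : Derivation ℂ (MvPolynomial σ ℂ) (MvPolynomial σ ℂ)) :
    MvPolynomial σ ℂ →ₗ[ℂ] MvPolynomial σ ℂ)).prod

/-- The exponent of the monomial whose variables, with repetitions, are the entries of a list. -/
def cnt (L : List σ) : σ →₀ ℕ := (L.map fun i => Finsupp.single i 1).sum

@[simp] lemma cnt_nil : cnt ([] : List σ) = 0 := rfl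

@[simp] lemma cnt_cons (i : σ) (L : List σ) : cnt (i :: L) = Finsupp.single i 1 + cnt L := by
  simp [cnt]

lemma cnt_apply [DecidableEq σ] (L : List σ) (i : σ) : cnt L i = L.count i := by
  induction L with
  | nil => simp
  | cons j L ih =>
    rw [cnt_cons, Finsupp.add_apply, ih, List.count_cons, Finsupp.single_apply, add_comm]
    simp

lemma perm_of_cnt_eq {L L' : List σ} (h : cnt L = cnt L') : L.Perm L' := by
  classical
  rw [List.perm_iff_count]
  intro i
  rw [← cnt_apply, ← cnt_apply, h]

lemma prod_map_X (L : List σ) :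
    (L.map (X : σ → MvPolynomial σ ℂ)).prod = monomial (cnt L) 1 := by
  induction L with
  | nil => simp
  | cons i L ih =>
    rw [List.map_cons, List.prod_cons, ih, cnt_cons, X, monomial_mul, one_mul]

lemma dList_cons (i : σ) (L : List σ) (f : MvPolynomial σ ℂ) :
    dList (i :: L) f = pderiv i (dList L f) := by
  rw [dList, List.map_cons, List.prod_cons]
  rfl

/-- The derivative of a monomial along `L` is nonzero exactly if the exponents of `L` do not exceed
its own. -/
lemma dList_monomial (L : List σ) (K : σ →₀ ℕ) :
    ∃ c : ℂ, dList L (monomial K 1) = monomial (K - cnt L) c ∧ (c ≠ 0 ↔ cnt L ≤ K) := by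
  induction L with
  | nil => exact ⟨1, by simp [dList], by simp⟩
  | cons i L ih =>
    obtain ⟨c, h1, h2⟩ := ih
    refine ⟨c * ((K - cnt L) i : ℕ), ?_, ?_⟩
    · rw [dList_cons, h1, pderiv_monomial, tsub_tsub, cnt_cons, add_comm]
    · rw [mul_ne_zero_iff, h2, Nat.cast_ne_zero, Finsupp.tsub_apply, cnt_cons]
      constructor
      · rintro ⟨h, h'⟩ j
        by_cases hj : i = j
        · subst hj
          simp only [Finsupp.add_apply, Finsupp.single_eq_same]
          omega
        · simpa [Finsupp.single_eq_of_ne' hj] using h j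
      · intro h
        refine ⟨le_trans (by simp) h, ?_⟩
        have := h i
        simp only [Finsupp.add_apply, Finsupp.single_eq_same] at this
        omega

lemma degree_lt_degree {u v : σ →₀ ℕ} (h : u < v) : u.degree < v.degree := by
  obtain ⟨w, rfl⟩ := exists_add_of_le h.le
  rw [map_add, lt_add_iff_pos_right, Nat.pos_iff_ne_zero, Ne, Finsupp.degree_eq_zero_iff]
  rintro rfl
  simp at h

/-- Operators `x^u ∂^v` with different exponents are independent, also after a substitution in the
values. Applied to `x^v`, the operators `∂^w` with `w = v` give constants, those with `w < v` have
zero coefficients by induction on the degree of `v`, and the others vanish. -/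
lemma eq_zero_of_sum_symbol {ι ρ : Type*} (η : MvPolynomial σ ℂ →ₐ[ℂ] MvPolynomial ρ ℂ)
    (U : ι → List ρ) (L : ι → List σ)
    (hinj : ∀ s s', (U s).Perm (U s') → (L s).Perm (L s') → s = s') (c : ι →₀ ℂ)
    (h : ∀ f, c.sum (fun s a => a • (((U s).map X).prod * η (dList (L s) f))) = 0) : c = 0 := by
  classical
  have key : ∀ n : ℕ, ∀ s, (cnt (L s)).degree = n → c s = 0 := by
    intro n
    induction n using Nat.strong_induction_on with
    | _ n ih =>
      intro s hs
      obtain ⟨a, ha, hna⟩ := dList_monomial (L s) (cnt (L s))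
      have ha0 : a ≠ 0 := hna.mpr le_rfl
      have e := congrArg (coeff (cnt (U s))) (h (monomial (cnt (L s)) 1))
      rw [Finsupp.sum, coeff_sum, coeff_zero, Finset.sum_eq_single s] at e
      · rw [ha, tsub_self, prod_map_X, ← C_apply, show η (C a) = C a from η.commutes a, mul_comm,
          coeff_smul, coeff_C_mul, coeff_monomial, if_pos rfl, mul_one, smul_eq_mul] at e
        exact (mul_eq_zero.mp e).resolve_right ha0
      · intro t _ hts
        rw [coeff_smul]
        obtain ⟨b, hb, hnb⟩ := dList_monomial (L t) (cnt (L s))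
        by_cases hle : cnt (L t) ≤ cnt (L s)
        · rcases hle.eq_or_lt with heq | hlt
          · rw [hb, heq, tsub_self, prod_map_X, ← C_apply, show η (C b) = C b from η.commutes b,
              mul_comm, coeff_C_mul, coeff_monomial, if_neg, mul_zero, smul_zero]
            exact fun hu => hts (hinj t s (perm_of_cnt_eq hu) (perm_of_cnt_eq heq))
          · rw [ih _ (hs ▸ degree_lt_degree hlt) t rfl, zero_smul]
        · rw [hb, not_not.mp (mt hnb.mp hle), monomial_zero, map_zero, mul_zero, coeff_zero,
            smul_zero]
      · intro hs'
        rw [Finsupp.notMem_support_iff.mp hs', zero_smul, coeff_zero]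
  ext s
  exact key _ s rfl

end Symbols

section StdSymbols

variable {V E : Type*} [LinearOrder E] (Q : EdgeQuiver V E) (d : V → ℕ)

variable {Q d} in
/-- The transposition of the indices of a triple. -/
def transp (x : Triple (fun e => d (Q.head e)) (fun e => d (Q.tail e))) : Coord Q d :=
  ⟨x.1, x.2.2, x.2.1⟩

lemma transp_injective : Function.Injective (transp (Q := Q) (d := d)) := by
  rintro ⟨e, i, j⟩ ⟨e', i', j'⟩ h
  simp only [transp, Sigma.mk.injEq] at h
  obtain ⟨rfl, h⟩ := h
  simp only [heq_eq_eq, Prod.mk.injEq] at h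
  rw [h.1, h.2]

lemma Triple.LE_antisymm {rows cols : E → ℕ} {x y : Triple rows cols} (h : Triple.LE x y)
    (h' : Triple.LE y x) : x = y := by
  obtain ⟨e, i, j⟩ := x
  obtain ⟨e', i', j'⟩ := y
  have he : e = e' := by
    rcases h with h | h
    · rcases h' with h' | h'
      · exact absurd h (lt_asymm h')
      · exact h'.1.symm
    · exact h.1
  subst he
  simp only [Triple.LE, lt_irrefl, false_or, true_and] at h h'
  have h1 : i = i' := Fin.ext (by omega)
  have h2 : j = j' := Fin.ext (by omega)
  rw [h1, h2]

lemma OrderedList.eq_of_perm {rows cols : E → ℕ} {L L' : OrderedList rows cols}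
    (h : L.1.Perm L'.1) : L = L' :=
  Subtype.ext (h.eq_of_pairwise (fun _ _ _ _ => Triple.LE_antisymm) L.2 L'.2)

open Classical in
variable {Q d} in
/-- The variables of the polynomial coefficient of a standard monomial at `q = 1`: the coordinates
in `a_I` and the conjugate momenta that belong to the loops in `∂_J`. -/
def symX (s : StdIndex Q d) : List (Coord Q d ⊕ Coord Q d) :=
  s.1.1.map Sum.inl ++
    (s.2.1.filter fun x => Q.tail x.1 = Q.head x.1).map fun x => Sum.inr (transp x)

open Classical in
variable {Q d} in
/-- The variables along which a standard monomial at `q = 1` differentiates. -/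
def symD (s : StdIndex Q d) : List (Coord Q d) :=
  (s.2.1.filter fun x => ¬ Q.tail x.1 = Q.head x.1).map transp

/-- A standard monomial is determined by its symbol, up to the order of the variables. -/
lemma eq_of_perm_symbol {s s' : StdIndex Q d} (hX : (symX s).Perm (symX s'))
    (hD : (symD s).Perm (symD s')) : s = s' := by
  classical
  have h1 := hX.filterMap Sum.getLeft?
  have h2 := hX.filterMap Sum.getRight?
  simp only [symX, List.filterMap_append, List.filterMap_map] at h1 h2
  have e1 : ∀ L : List (Coord Q d), List.filterMap (Sum.getLeft? ∘ (Sum.inl : Coord Q d →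
      Coord Q d ⊕ Coord Q d)) L = L := fun L => by
    rw [show Sum.getLeft? ∘ (Sum.inl : Coord Q d → Coord Q d ⊕ Coord Q d) = some from rfl,
      List.filterMap_some]
  have e2 : ∀ L : List (Coord Q d), List.filterMap (Sum.getRight? ∘ (Sum.inl : Coord Q d →
      Coord Q d ⊕ Coord Q d)) L = [] := fun L => by
    rw [List.filterMap_eq_nil_iff]; intros; rfl
  have e3 : ∀ L : List (Triple (fun e => d (Q.head e)) fun e => d (Q.tail e)),
      List.filterMap (Sum.getLeft? ∘ fun x => (Sum.inr (transp x) : Coord Q d ⊕ Coord Q d)) L =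
        [] := fun L => by
    rw [List.filterMap_eq_nil_iff]; intros; rfl
  have e4 : ∀ L : List (Triple (fun e => d (Q.head e)) fun e => d (Q.tail e)),
      List.filterMap (Sum.getRight? ∘ fun x => (Sum.inr (transp x) : Coord Q d ⊕ Coord Q d)) L =
        L.map transp := fun L => by
    rw [show (Sum.getRight? ∘ fun x => (Sum.inr (transp x) : Coord Q d ⊕ Coord Q d)) =
      some ∘ transp from rfl, List.filterMap_eq_map]
  rw [e1, e1, e3, e3, List.append_nil, List.append_nil] at h1
  rw [e2, e2, e4, e4, List.nil_append, List.nil_append] at h2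
  have h3 := (List.map_perm_map_iff (transp_injective Q d)).mp h2
  have h4 := (List.map_perm_map_iff (transp_injective Q d)).mp hD
  refine Prod.ext (OrderedList.eq_of_perm h1) (OrderedList.eq_of_perm ?_)
  have p := fun L : List (Triple (fun e => d (Q.head e)) fun e => d (Q.tail e)) =>
    List.filter_append_perm (fun x => decide (Q.tail x.1 = Q.head x.1)) L
  refine (p s.2.1).symm.trans (((h3.append ?_).trans (p s'.2.1)))
  simpa using h4

open MvPolynomial in
/-- Standard monomials at `q = 1` are independent in each representation by differential
operators. -/
lemma eq_zero_of_sum_stdSymbol {σ : Type*}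
    (η : MvPolynomial σ ℂ →ₐ[ℂ] MvPolynomial (Coord Q d ⊕ Coord Q d) ℂ)
    (L : StdIndex Q d → List σ) (hL : ∀ s s', (L s).Perm (L s') → (symD s).Perm (symD s'))
    (c : StdIndex Q d →₀ ℂ)
    (h : ∀ f, c.sum (fun s a => a • (((symX s).map X).prod * η (dList (L s) f))) = 0) : c = 0 :=
  eq_zero_of_sum_symbol η symX L (fun _ _ h1 h2 => eq_of_perm_symbol Q d h1 (hL _ _ h2)) c h

open MvPolynomial Classical in
/-- A product of multiplications and partial derivatives, in which the multiplications that stand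
to the right of derivatives are by polynomials that they annihilate. -/
lemma prod_operators_apply {σ τ υ : Type*} (I : List τ) (J : List υ) (P : υ → Prop)
    (p : τ → MvPolynomial σ ℂ) (p' : υ → MvPolynomial σ ℂ) (κ : υ → σ)
    (hp' : ∀ x y, ¬ P x → P y → pderiv (κ x) (p' y) = 0)
    (F : τ → Module.End ℂ (MvPolynomial σ ℂ)) (G : υ → Module.End ℂ (MvPolynomial σ ℂ))
    (hF : ∀ x f, F x f = p x * f) (hG : ∀ x f, P x → G x f = p' x * f)
    (hG' : ∀ x f, ¬ P x → G x f = pderiv (κ x) f) (f : MvPolynomial σ ℂ) :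
    ((I.map F).prod * (J.map G).prod) f = (I.map p).prod * ((J.filter (P ·)).map p').prod *
      dList ((J.filter (¬ P ·)).map κ) f := by
  have h1 : ∀ g, (I.map F).prod g = (I.map p).prod * g := by
    intro g
    induction I with
    | nil => simp
    | cons x I ih =>
      rw [List.map_cons, List.prod_cons, Module.End.mul_apply, ih, hF, List.map_cons,
        List.prod_cons, mul_assoc]
  have h2 : (J.map G).prod f = ((J.filter (P ·)).map p').prod *
      dList ((J.filter (¬ P ·)).map κ) f := by
    induction J with
    | nil => simp [dList]
    | cons x J ih =>
      rw [List.map_cons, List.prod_cons, Module.End.mul_apply, ih]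
      by_cases hx : P x
      · rw [hG _ _ hx, List.filter_cons_of_pos (by simpa using hx),
          List.filter_cons_of_neg (by simpa using hx), List.map_cons, List.prod_cons, mul_assoc]
      · rw [hG' _ _ hx, List.filter_cons_of_neg (by simpa using hx),
          List.filter_cons_of_pos (by simpa using hx), List.map_cons, dList_cons,
          Derivation.leibniz]
        have h0 : pderiv (κ x) ((J.filter (P ·)).map p').prod = 0 := by
          clear ih
          induction J with
          | nil => simp
          | cons y J ih =>
            by_cases hy : P y
            · rw [List.filter_cons_of_pos (by simpa using hy), List.map_cons, List.prod_cons,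
                Derivation.leibniz, ih, hp' x y hx hy, smul_zero, smul_zero, add_zero]
            · rwa [List.filter_cons_of_neg (by simpa using hy)]
        rw [h0, smul_zero, add_zero, smul_eq_mul]
  rw [Module.End.mul_apply, h1, h2, mul_assoc]

end StdSymbols

/-! ### The algebra of differential operators -/

section Weyl

open MvPolynomial

variable {σ : Type*}

lemma mulX_apply (s : σ) (f : MvPolynomial σ ℂ) : (mulX s).1 f = X s * f := rfl

lemma partialX_apply (s : σ) (f : MvPolynomial σ ℂ) : (partialX s).1 f = pderiv s f := rfl

lemma diffOps_ext {P Q : diffOps σ} (h : ∀ f, P.1 f = Q.1 f) : P = Q :=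
  Subtype.ext (LinearMap.ext h)

lemma diffOps_mul_apply (P Q : diffOps σ) (f) : (P * Q).1 f = P.1 (Q.1 f) := rfl

lemma diffOps_add_apply (P Q : diffOps σ) (f) : (P + Q).1 f = P.1 f + Q.1 f := rfl

lemma diffOps_one_apply (f : MvPolynomial σ ℂ) : (1 : diffOps σ).1 f = f := rfl

lemma diffOps_zero_apply (f : MvPolynomial σ ℂ) : (0 : diffOps σ).1 f = 0 := rfl

lemma mulX_comm (s t : σ) : mulX s * mulX t = mulX t * mulX s :=
  diffOps_ext fun f => by
    simp only [diffOps_mul_apply, mulX_apply]; ring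

lemma partialX_comm (s t : σ) : partialX s * partialX t = partialX t * partialX s :=
  diffOps_ext fun f => by
    simp only [diffOps_mul_apply, partialX_apply]
    have h : ⁅(pderiv s : Derivation ℂ (MvPolynomial σ ℂ) (MvPolynomial σ ℂ)),
        (pderiv t : Derivation ℂ (MvPolynomial σ ℂ) (MvPolynomial σ ℂ))⁆ = 0 := by
      classical
      refine MvPolynomial.derivation_ext fun i => ?_
      rw [Derivation.commutator_apply, pderiv_X, pderiv_X, Pi.single_apply, Pi.single_apply]
      split_ifs <;> simp
    have := DFunLike.congr_fun h f
    rwa [Derivation.commutator_apply, Derivation.zero_apply, sub_eq_zero] at this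

lemma partialX_mul_mulX [DecidableEq σ] (s t : σ) :
    partialX s * mulX t = mulX t * partialX s + if s = t then 1 else 0 :=
  diffOps_ext fun f => by
    by_cases h : s = t
    · rw [if_pos h]
      rw [diffOps_add_apply, diffOps_mul_apply, diffOps_mul_apply, diffOps_one_apply,
        partialX_apply, mulX_apply, mulX_apply, partialX_apply, Derivation.leibniz,
        h, pderiv_X_self, smul_eq_mul, smul_eq_mul, mul_one]
    · rw [if_neg h]
      rw [diffOps_add_apply, diffOps_mul_apply, diffOps_mul_apply, diffOps_zero_apply,
        partialX_apply, mulX_apply, mulX_apply, partialX_apply, Derivation.leibniz,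
        pderiv_X_of_ne (Ne.symm h), smul_zero, smul_eq_mul]

section Order

variable {A : Type*} [Ring A] (x : σ → A)

/-- The commutator of two elements of a ring. -/
def comm (P P' : A) : A := P * P' - P' * P

lemma comm_zero (P : A) : comm 0 P = 0 := by rw [comm, zero_mul, mul_zero, sub_zero]

lemma comm_eq_iff {P P' c : A} : comm P P' = c ↔ P * P' = P' * P + c := sub_eq_iff_eq_add'

lemma comm_eq_zero_iff {P P' : A} : comm P P' = 0 ↔ P * P' = P' * P := sub_eq_zero

/-- Elements of order at most `n` with respect to a family `x`: the commutators with `n + 1`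
members of the family vanish. -/
def HasOrder : ℕ → A → Prop
  | 0, P => ∀ s, comm P (x s) = 0
  | n + 1, P => ∀ s, HasOrder n (comm P (x s))

variable {x}

lemma hasOrder_zero (n : ℕ) : HasOrder x n 0 := by
  induction n with
  | zero => intro s; exact comm_zero _
  | succ n ih => intro s; rwa [comm_zero]

lemma HasOrder.succ {n : ℕ} {P : A} (h : HasOrder x n P) : HasOrder x (n + 1) P := by
  induction n generalizing P with
  | zero => intro s; rw [h s]; exact hasOrder_zero 0
  | succ n ih => intro s; exact ih (h s)

lemma HasOrder.mono {n m : ℕ} {P : A} (h : HasOrder x n P) (hnm : n ≤ m) : HasOrder x m P := by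
  induction m, hnm using Nat.le_induction with
  | base => exact h
  | succ m _ ih => exact ih.succ

lemma HasOrder.add {n : ℕ} {P P' : A} (h : HasOrder x n P) (h' : HasOrder x n P') :
    HasOrder x n (P + P') := by
  have e : ∀ (P P' : A) (s), comm (P + P') (x s) =
      comm P (x s) + comm P' (x s) := fun P P' s => by
    rw [comm, comm, comm, add_mul, mul_add]; abel
  induction n generalizing P P' with
  | zero => intro s; rw [e, h s, h' s, add_zero]
  | succ n ih => intro s; rw [e]; exact ih (h s) (h' s)

lemma HasOrder.mul {N n m : ℕ} (hN : n + m ≤ N) {P P' : A} (h : HasOrder x n P)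
    (h' : HasOrder x m P') : HasOrder x N (P * P') := by
  have e : ∀ (P P' : A) (s), comm (P * P') (x s) =
      P * comm P' (x s) + comm P (x s) * P' := fun P P' s => by
    rw [comm, comm, comm, mul_sub, sub_mul]; simp only [mul_assoc]; abel
  induction N generalizing n m P P' with
  | zero =>
    obtain rfl : n = 0 := by omega
    obtain rfl : m = 0 := by omega
    intro s
    rw [e, h s, h' s, mul_zero, zero_mul, add_zero]
  | succ N ih =>
    intro s
    rw [e]
    refine HasOrder.add ?_ ?_
    · cases m with
      | zero => rw [h' s, mul_zero]; exact hasOrder_zero N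
      | succ m => exact ih (by omega) h (h' s)
    · cases n with
      | zero => rw [h s, zero_mul]; exact hasOrder_zero N
      | succ n => exact ih (by omega) (h s) h'

end Order

lemma diffOps_comm_apply (P P' : diffOps σ) (f) :
    (comm P P').1 f = P.1 (P'.1 f) - P'.1 (P.1 f) := rfl

/-- Every differential operator has finite order. -/
lemma exists_hasOrder (P : diffOps σ) : ∃ n, HasOrder mulX n P := by
  obtain ⟨P, hP⟩ := P
  induction hP using Algebra.adjoin_induction with
  | mem x hx =>
    rcases hx with ⟨t, rfl⟩ | ⟨t, rfl⟩
    · exact ⟨0, fun s => comm_eq_zero_iff.mpr (mulX_comm t s)⟩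
    · classical
      have e : ∀ s : σ, comm (partialX t) (mulX s) = if t = s then 1 else 0 :=
        fun s => comm_eq_iff.mpr (partialX_mul_mulX t s)
      have h1 : HasOrder mulX 1 (partialX t) := by
        intro s r
        rw [e]
        split_ifs
        · exact comm_eq_zero_iff.mpr (by rw [one_mul, mul_one])
        · exact comm_zero _
      exact ⟨1, h1⟩
  | algebraMap r => exact ⟨0, fun s => comm_eq_zero_iff.mpr (Algebra.commutes r (mulX s))⟩
  | add x y hx hy h1 h2 =>
    obtain ⟨n, hn⟩ := h1
    obtain ⟨m, hm⟩ := h2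
    exact ⟨max n m, (hn.mono (le_max_left _ _)).add (hm.mono (le_max_right _ _))⟩
  | mul x y hx hy h1 h2 =>
    obtain ⟨n, hn⟩ := h1
    obtain ⟨m, hm⟩ := h2
    exact ⟨n + m, hn.mul le_rfl hm⟩

/-- Differential operators of order zero are multiplications by polynomials. -/
lemma HasOrder.apply_eq {P : diffOps σ} (h : HasOrder mulX 0 P) (f : MvPolynomial σ ℂ) :
    P.1 f = P.1 1 * f := by
  induction f using MvPolynomial.induction_on with
  | C a =>
    rw [show (C a : MvPolynomial σ ℂ) = a • 1 by rw [smul_eq_C_mul, mul_one], map_smul]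
    rw [smul_eq_C_mul, smul_eq_C_mul, mul_one, mul_comm]
  | add f g hf hg => rw [map_add, hf, hg, mul_add]
  | mul_X f s hf =>
    have := DFunLike.congr_fun (congrArg Subtype.val (comm_eq_zero_iff.mp (h s))) f
    change P.1 (X s * f) = X s * P.1 f at this
    rw [mul_comm f, this, hf]; ring

/-- The algebra of differential operators is simple: the commutators of an element of a
two-sided ideal with the coordinates lower its order, and the commutators with the derivatives lower
the degree of a polynomial. -/
lemma one_mem_of_ideal (I : Set (diffOps σ)) (hI : ∀ P ∈ I, ∀ a, comm P a ∈ I)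
    (hI' : ∀ P ∈ I, ∀ a, comm a P ∈ I) (hs : ∀ P ∈ I, ∀ c : ℂ, c • P ∈ I) {P : diffOps σ}
    (hP : P ∈ I) (hP0 : P ≠ 0) : 1 ∈ I := by
  classical
  obtain ⟨g, hg0, hg⟩ : ∃ g : MvPolynomial σ ℂ, g ≠ 0 ∧ ∃ P ∈ I, ∀ f, P.1 f = g * f := by
    obtain ⟨n, hn⟩ := exists_hasOrder P
    induction n generalizing P with
    | zero =>
      refine ⟨P.1 1, fun h0 => hP0 (diffOps_ext fun f => ?_), P, hP, hn.apply_eq⟩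
      rw [hn.apply_eq, h0, zero_mul]; rfl
    | succ n ih =>
      by_cases h : ∀ s, comm P (mulX s) = 0
      · have h' : HasOrder mulX 0 P := h
        refine ⟨P.1 1, fun h0 => hP0 (diffOps_ext fun f => ?_), P, hP, h'.apply_eq⟩
        rw [h'.apply_eq, h0, zero_mul]; rfl
      · push Not at h
        obtain ⟨s, hs⟩ := h
        exact ih (hI P hP _) hs (hn s)
  obtain ⟨n, hn⟩ : ∃ n, g.totalDegree ≤ n := ⟨_, le_rfl⟩
  induction n generalizing g with
  | zero =>
    obtain ⟨P, hP, hPg⟩ := hg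
    rw [totalDegree_eq_zero_iff_eq_C.mp (Nat.le_zero.mp hn)] at hPg hg0
    have ha : coeff 0 g ≠ 0 := fun h => hg0 (by rw [h, C_0])
    have : (1 : diffOps σ) = (coeff 0 g)⁻¹ • P := diffOps_ext fun f => by
      change f = (coeff 0 g)⁻¹ • P.1 f
      rw [hPg, ← smul_eq_C_mul, smul_smul, inv_mul_cancel₀ ha, one_smul]
    rw [this]
    exact hs P hP _
  | succ n ih =>
    obtain ⟨P, hP, hPg⟩ := hg
    by_cases h : ∀ s, pderiv s g = 0
    · refine ih g hg0 ⟨P, hP, hPg⟩ ?_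
      suffices h0 : g = C (coeff 0 g) by rw [h0, totalDegree_C]; exact Nat.zero_le n
      ext m
      rw [coeff_C]
      split_ifs with hm
      · rw [hm]
      · obtain ⟨s, hs⟩ : ∃ s, m s ≠ 0 := by
          by_contra! hc
          exact hm (Finsupp.ext hc).symm
        have e := congrArg (coeff (m - Finsupp.single s 1)) (h s)
        have e' : m - Finsupp.single s 1 + Finsupp.single s 1 = m :=
          tsub_add_cancel_of_le (by rw [Finsupp.single_le_iff]; omega)
        rw [coeff_pderiv, e', coeff_zero] at e
        refine (mul_eq_zero.mp e).resolve_right ?_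
        exact Nat.cast_add_one_ne_zero _
    · push Not at h
      obtain ⟨s, hs⟩ := h
      refine ih _ hs ⟨comm (partialX s) P, hI' P hP _, fun f => ?_⟩ ?_
      · rw [diffOps_comm_apply, partialX_apply, partialX_apply, hPg, hPg, Derivation.leibniz,
          smul_eq_mul, smul_eq_mul]; ring
      · refine Finset.sup_le fun m hm => ?_
        rw [mem_support_iff, coeff_pderiv] at hm
        have h1 := le_totalDegree (mem_support_iff.mpr (left_ne_zero_of_mul hm))
        rw [Finsupp.sum_add_index' (fun _ => rfl) (fun _ _ _ => rfl),
          Finsupp.sum_single_index rfl] at h1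
        omega

lemma diffOps_eq_top_of_mem (S : Subalgebra ℂ (diffOps σ)) (hX : ∀ s, mulX s ∈ S)
    (hD : ∀ s, partialX s ∈ S) : S = ⊤ := by
  rw [eq_top_iff]
  rintro ⟨P, hP⟩ -
  induction hP using Algebra.adjoin_induction with
  | mem x hx =>
    rcases hx with ⟨t, rfl⟩ | ⟨t, rfl⟩
    · exact hX t
    · exact hD t
  | algebraMap r => exact S.algebraMap_mem r
  | add x y hx hy h1 h2 => exact S.add_mem h1 h2
  | mul x y hx hy h1 h2 => exact S.mul_mem h1 h2

end Weyl

section One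

variable {V E : Type*} [DecidableEq V] [LinearOrder E] {Q : EdgeQuiver V E} {d : V → ℕ}
variable {k : Type*} [CommRing k] {B : Type*} [Ring B] [Algebra k B]

lemma crossEdgeRel_one {u w : V} {A : Matrix (Fin (d u)) (Fin (d w)) B}
    {D : Matrix (Fin (d w)) (Fin (d u)) B} (h : ∀ i i' j j', D j i' * A i j' =
      A i j' * D j i' + if i = i' ∧ j = j' then 1 else 0) : CrossEdgeRel d (1 : kˣ) u w A D := by
  unfold CrossEdgeRel
  rw [matR_one, matRInv_one, sc_one, sc_one, Matrix.mul_one, Matrix.mul_one]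
  refine Matrix.ext fun ⟨i, j⟩ ⟨j', i'⟩ => ?_
  rw [Matrix.add_apply, leg2_mul_leg1_apply, leg1_mul_leg2_apply]
  exact h i i' j j'

/-- At `q = 1` the relations are commutation relations between the generators. -/
lemma sat_one {X : ∀ x : E ⊕ E, Matrix (Fin (d (Q.src x))) (Fin (d (Q.tgt x))) B}
    (hc : ∀ x y, (x = y ∨ underlying x ≠ underlying y ∨ Q.src x = Q.tgt x) →
      EntriesCommute (X x) (X y))
    (hD : ∀ e, Q.tail e ≠ Q.head e → ∀ (i i' : Fin (d (Q.tail e)))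
      (j j' : Fin (d (Q.head e))), X (Sum.inr e) j i' * X (Sum.inl e) i j' =
      X (Sum.inl e) i j' * X (Sum.inr e) j i' + if i = i' ∧ j = j' then 1 else 0) :
    Sat Q (1 : kˣ) X := by
  have m1 : ∀ u v, matR21 d (1 : kˣ) u v = 1 := fun u v => by
    rw [matR21_eq, matR_one, sw_one]
  have m2 : ∀ u v, matR21Inv d (1 : kˣ) u v = 1 := fun u v => by
    rw [matR21Inv_eq, matRInv_one, sw_one]
  constructor
  · intro x _
    unfold EdgeRel
    rw [matR_one, m1, sc_one, sc_one, Matrix.one_mul, Matrix.mul_one]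
    exact (leg_comm (hc x x (Or.inl rfl))).symm
  · intro x _
    unfold LoopRel
    simp only [matR_one, m1, sc_one, Matrix.one_mul, Matrix.mul_one]
    exact leg_comm (hc x x (Or.inl rfl))
  · intro e he
    exact crossEdgeRel_one (hD e he)
  · intro e he
    unfold CrossLoopRel
    simp only [matR_one, m1, m2, sc_one, Matrix.one_mul, Matrix.mul_one]
    exact leg_comm (hc (Sum.inr e) (Sum.inl e) (Or.inr (Or.inr he.symm)))
  · intro x y hxy
    unfold BraidRel
    simp only [matR_one, matRInv_one, sc_one, Matrix.one_mul, Matrix.mul_one]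
    exact leg_comm (hc x y (Or.inr (Or.inl hxy.ne')))

end One

/-! ### The fibre at `q = 1` of a quiver without loops -/

section Span

variable {V E : Type*} [DecidableEq V] [LinearOrder E] {Q : EdgeQuiver V E} {d : V → ℕ}
variable {k : Type*} [CommRing k] {q : kˣ}

variable (Q d q) in
/-- The standard monomials of `D_q`. -/
abbrev stdMon (s : StdIndex Q d) : Dq Q d q := stdMonomial Q d (aGen Q d q) (dGen Q d q) s

lemma exists_finsupp [Finite E] (x : Dq Q d q) :
    ∃ c : StdIndex Q d →₀ k, c.sum (fun s a => a • stdMon Q d q s) = x :=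
  Finsupp.mem_span_range_iff_exists_finsupp.mp (span_stdMonomial Q d q ▸ Submodule.mem_top)

/-- A linear map on `D_q` is injective if it is so on the standard monomials, since these span. -/
lemma injective_of_linearIndependent [Finite E] {A : Type*} [AddCommMonoid A] [Module k A]
    (f : Dq Q d q →ₗ[k] A) (h : LinearIndependent k fun s => f (stdMon Q d q s)) :
    Function.Injective f := by
  intro x y hxy
  obtain ⟨c, rfl⟩ := exists_finsupp x
  obtain ⟨c', rfl⟩ := exists_finsupp y
  rw [map_finsuppSum, map_finsuppSum] at hxy
  simp only [map_smul] at hxy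
  rw [h hxy]

lemma top_le_span_of_surjective [Finite E] {A : Type*} [AddCommMonoid A] [Module k A]
    (f : Dq Q d q →ₗ[k] A) (h : Function.Surjective f) :
    ⊤ ≤ Submodule.span k (Set.range fun s => f (stdMon Q d q s)) := by
  change ⊤ ≤ Submodule.span k (Set.range (f ∘ stdMon Q d q))
  rw [Set.range_comp, ← Submodule.map_span]
  change ⊤ ≤ Submodule.map f (Submodule.span k (Set.range (stdMonomial Q d _ _)))
  rw [span_stdMonomial, Submodule.map_top, LinearMap.range_eq_top.mpr h]

/-- Independence, tested by a family of linear maps. -/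
lemma linearIndependent_of_maps {ι α A M : Type*} [AddCommMonoid A] [Module k A]
    [AddCommGroup M] [Module k M] (Φ : α → A →ₗ[k] M) (m : ι → A)
    (h : ∀ c : ι →₀ k, (∀ f, c.sum (fun s a => a • Φ f (m s)) = 0) → c = 0) :
    LinearIndependent k m := by
  intro c c' hcc
  rw [← sub_eq_zero]
  refine h _ fun f => ?_
  have e : ∀ c, Finsupp.linearCombination k (fun s => Φ f (m s)) c =
      Φ f (Finsupp.linearCombination k m c) := fun c => by
    rw [Finsupp.linearCombination_apply, Finsupp.linearCombination_apply, map_finsuppSum]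
    simp only [map_smul]
  rw [← Finsupp.linearCombination_apply, map_sub, e, e, hcc, sub_self]

lemma map_stdMon {A F : Type*} [Monoid A] [FunLike F (Dq Q d q) A]
    [MonoidHomClass F (Dq Q d q) A] (f : F)
    (s : StdIndex Q d) : f (stdMon Q d q s) = stdMonomial Q d
      (fun e i j => f (aGen Q d q e i j)) (fun e i j => f (dGen Q d q e i j)) s := by
  rw [stdMon, stdMonomial, stdMonomial, map_mul, map_list_prod, map_list_prod, List.map_map,
    List.map_map]
  rfl

end Span

section Weyl

variable {V E : Type*} [DecidableEq V] [LinearOrder E] (Q : EdgeQuiver V E) (d : V → ℕ)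

/-- The multiplications by the coordinates of `Mat_d(Q)` and the partial derivatives. -/
def weylX : ∀ x : E ⊕ E, Matrix (Fin (d (Q.src x))) (Fin (d (Q.tgt x))) (diffOps (Coord Q d))
  | Sum.inl e => Matrix.of fun i j => mulX (⟨e, i, j⟩ : Coord Q d)
  | Sum.inr e => Matrix.of fun i j => partialX (⟨e, j, i⟩ : Coord Q d)

variable {Q d}

lemma partialX_mul_mulX_of_ne {σ : Type*} {s t : σ} (h : s ≠ t) :
    partialX s * mulX t = mulX t * partialX s := by
  classical
  rw [partialX_mul_mulX, if_neg h, add_zero]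

lemma entriesCommute_weylX {x y : E ⊕ E} (h : x = y ∨ underlying x ≠ underlying y) :
    EntriesCommute (weylX Q d x) (weylX Q d y) := by
  intro i j i' j'
  rcases x with e | e <;> rcases y with f | f
  · exact mulX_comm _ _
  · have hef : e ≠ f := by simpa [underlying] using h
    exact (partialX_mul_mulX_of_ne fun h => hef (congrArg Sigma.fst h).symm).symm
  · have hef : e ≠ f := by simpa [underlying] using h
    exact partialX_mul_mulX_of_ne fun h => hef (congrArg Sigma.fst h)
  · exact partialX_comm _ _

lemma sat_weylX (hQ : ∀ e, Q.tail e ≠ Q.head e) : Sat Q (1 : ℂˣ) (weylX Q d) := by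
  refine sat_one (fun x y h => entriesCommute_weylX ?_) fun e _ i i' j j' => ?_
  · rcases h with h | h | h
    · exact Or.inl h
    · exact Or.inr h
    · rcases x with e | e
      · exact absurd h (hQ e)
      · exact absurd h.symm (hQ e)
  · classical
    have := partialX_mul_mulX (⟨e, i', j⟩ : Coord Q d) ⟨e, i, j'⟩
    refine this.trans (congrArg₂ _ rfl ?_)
    by_cases h : i = i' ∧ j = j'
    · rw [if_pos h, if_pos (by rw [h.1, h.2])]
    · rw [if_neg h, if_neg]
      rintro ⟨⟩
      exact h ⟨rfl, rfl⟩

/-- The representation of `D_1` by differential operators, for a quiver without loops. -/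
def weylHom (hQ : ∀ e, Q.tail e ≠ Q.head e) : Dq Q d (1 : ℂˣ) →ₐ[ℂ] diffOps (Coord Q d) :=
  (sat_weylX hQ).lift

lemma weylHom_aGen (hQ : ∀ e, Q.tail e ≠ Q.head e) (e i j) :
    weylHom hQ (aGen Q d (1 : ℂˣ) e i j) = mulX (⟨e, i, j⟩ : Coord Q d) :=
  (sat_weylX hQ).lift_genX (Sum.inl e) i j

lemma weylHom_dGen (hQ : ∀ e, Q.tail e ≠ Q.head e) (e i j) :
    weylHom hQ (dGen Q d (1 : ℂˣ) e i j) = partialX (⟨e, j, i⟩ : Coord Q d) :=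
  (sat_weylX hQ).lift_genX (Sum.inr e) i j

lemma weylHom_surjective (hQ : ∀ e, Q.tail e ≠ Q.head e) :
    Function.Surjective (weylHom (d := d) hQ) := by
  rw [← AlgHom.range_eq_top]
  refine diffOps_eq_top_of_mem _ (fun s => ?_) fun s => ?_
  · exact ⟨_, weylHom_aGen hQ s.1 s.2.1 s.2.2⟩
  · exact ⟨_, weylHom_dGen hQ s.1 s.2.2 s.2.1⟩

lemma stdMon_weylHom (hQ : ∀ e, Q.tail e ≠ Q.head e) (s : StdIndex Q d) :
    weylHom hQ (stdMon Q d 1 s) = stdMonomial Q d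
      (fun e i j => mulX (⟨e, i, j⟩ : Coord Q d))
      (fun e i j => partialX (⟨e, j, i⟩ : Coord Q d)) s := by
  rw [map_stdMon]
  simp only [weylHom_aGen, weylHom_dGen]

open MvPolynomial in
lemma linearIndependent_weyl (hQ : ∀ e, Q.tail e ≠ Q.head e) :
    LinearIndependent ℂ fun s : StdIndex Q d => stdMonomial Q d
      (fun e i j => mulX (⟨e, i, j⟩ : Coord Q d))
      (fun e i j => partialX (⟨e, j, i⟩ : Coord Q d)) s := by
  classical
  let Φ : MvPolynomial (Coord Q d) ℂ →
      (diffOps (Coord Q d) →ₗ[ℂ] MvPolynomial (Coord Q d ⊕ Coord Q d) ℂ) := fun f =>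
    (rename Sum.inl).toLinearMap ∘ₗ LinearMap.applyₗ f ∘ₗ (diffOps (Coord Q d)).val.toLinearMap
  refine linearIndependent_of_maps Φ _ fun c hc => ?_
  refine eq_zero_of_sum_stdSymbol Q d (rename Sum.inl) symD (fun _ _ h => h) c fun f => ?_
  have h2 : ∀ (s : StdIndex Q d), rename (Sum.inl : _ → Coord Q d ⊕ Coord Q d)
      ((stdMonomial Q d (fun e i j => mulX (⟨e, i, j⟩ : Coord Q d))
      (fun e i j => partialX (⟨e, j, i⟩ : Coord Q d)) s).1 f) =
      ((symX s).map X).prod * rename Sum.inl (dList (symD s) f) := by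
    intro s
    have hJ : ∀ (e : E) (i : Decidable (Q.tail e = Q.head e)), @decide _ i = false :=
      fun e _ => decide_eq_false (hQ e)
    have h3 := prod_operators_apply (σ := Coord Q d) s.1.1 s.2.1
      (fun x => Q.tail x.1 = Q.head x.1) X (fun _ => 0)
      transp (fun _ _ _ _ => map_zero _) (fun x => (mulX x).1) (fun x => (partialX (transp x)).1)
      (fun _ _ => rfl) (fun x _ hx => absurd hx (hQ x.1)) (fun _ _ _ => rfl) f
    have h4 : (stdMonomial Q d (fun e i j => mulX (⟨e, i, j⟩ : Coord Q d))
      (fun e i j => partialX (⟨e, j, i⟩ : Coord Q d)) s).1 =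
      (s.1.1.map fun x => (mulX x).1).prod * (s.2.1.map fun x => (partialX (transp x)).1).prod := by
      refine Eq.trans (map_mul (diffOps (Coord Q d)).val _ _) ?_
      rw [map_list_prod, map_list_prod, List.map_map, List.map_map]
      rfl
    rw [h4, h3, symX, map_mul, map_mul, map_list_prod, List.map_map]
    simp only [hJ, List.filter_false, List.map_nil, List.prod_nil, map_one, mul_one,
      List.append_nil, List.map_map]
    congr 3
    funext x
    simp
  rw [← hc f]
  refine Finsupp.sum_congr fun s _ => ?_
  rw [← h2]
  rfl

variable (Q d) in
/-- The quiver in which every edge of `Q` has its own tail and its own head. It has no loops. -/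
def sepQuiver : EdgeQuiver (E ⊕ E) E where
  tail := Sum.inl
  head := Sum.inr

/-- The standard monomials form a basis of the algebra of differential operators, because it is
the fibre at `q = 1` for the quiver in which the edges are made disjoint. -/
lemma exists_basis_diffOps [Finite E] :
    ∃ b : Module.Basis (StdIndex Q d) ℂ (diffOps (Coord Q d)), ∀ s, b s = stdMonomial Q d
      (fun e i j => mulX (⟨e, i, j⟩ : Coord Q d))
      (fun e i j => partialX (⟨e, j, i⟩ : Coord Q d)) s := by
  let Q' : EdgeQuiver (E ⊕ E) E := sepQuiver
  let d' : E ⊕ E → ℕ := Sum.elim (fun e => d (Q.tail e)) fun e => d (Q.head e)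
  have hQ : ∀ e, Q'.tail e ≠ Q'.head e := fun e => Sum.inl_ne_inr
  have hli : LinearIndependent ℂ fun s : StdIndex Q' d' => stdMonomial Q' d'
      (fun e i j => mulX (⟨e, i, j⟩ : Coord Q' d'))
      (fun e i j => partialX (⟨e, j, i⟩ : Coord Q' d')) s := linearIndependent_weyl hQ
  have hsp := top_le_span_of_surjective (weylHom (d := d') hQ).toLinearMap (weylHom_surjective hQ)
  have hm : ∀ s, (weylHom (d := d') hQ).toLinearMap (stdMon Q' d' 1 s) = stdMonomial Q' d'
      (fun e i j => mulX (⟨e, i, j⟩ : Coord Q' d'))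
      (fun e i j => partialX (⟨e, j, i⟩ : Coord Q' d')) s := stdMon_weylHom hQ
  simp only [hm] at hsp
  exact ⟨Module.Basis.mk hli hsp, fun s => Module.Basis.mk_apply hli hsp s⟩

lemma linearIndependent_weylHom (hQ : ∀ e, Q.tail e ≠ Q.head e) :
    LinearIndependent ℂ fun s => weylHom (d := d) hQ (stdMon Q d 1 s) := by
  have h := linearIndependent_weyl (d := d) hQ
  rwa [← funext (stdMon_weylHom hQ)] at h

/-- For a quiver without loops, the fibre at `q = 1` is the algebra of differential operators. -/
lemma exists_algEquiv_diffOps [Finite E] (hQ : ∀ e, Q.tail e ≠ Q.head e) :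
    ∃ φ : Dq Q d (1 : ℂˣ) ≃ₐ[ℂ] diffOps (Coord Q d),
      (∀ e i j, φ (aGen Q d 1 e i j) = mulX (⟨e, i, j⟩ : Coord Q d)) ∧
      (∀ e i j, φ (dGen Q d 1 e i j) = partialX (⟨e, j, i⟩ : Coord Q d)) :=
  ⟨AlgEquiv.ofBijective (weylHom hQ) ⟨injective_of_linearIndependent (weylHom hQ).toLinearMap
    (linearIndependent_weylHom hQ), weylHom_surjective hQ⟩, weylHom_aGen hQ, weylHom_dGen hQ⟩

end Weyl

/-! ### Change of scalars -/

section Scalars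

variable {V : Type*} [DecidableEq V] {d : V → ℕ}
variable {k : Type*} [CommRing k] {q : kˣ}

lemma LoopRel.map {B B' : Type*} [Ring B] [Algebra k B] [Ring B'] [Algebra k B'] {v w : V}
    {X : Matrix (Fin (d v)) (Fin (d w)) B} (h : LoopRel d q v w X) (f : B →ₐ[k] B') :
    LoopRel d q v w (X.map f) := by
  have := congrArg (fun M : Matrix _ _ B => M.map f) h
  simp only [map_mul_algHom, leg1_map', leg2_map', sc_map] at this
  exact this

lemma CrossLoopRel.map {B B' : Type*} [Ring B] [Algebra k B] [Ring B'] [Algebra k B'] {v w : V}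
    {A : Matrix (Fin (d v)) (Fin (d w)) B} {D : Matrix (Fin (d w)) (Fin (d v)) B}
    (h : CrossLoopRel d q v w A D) (f : B →ₐ[k] B') :
    CrossLoopRel d q v w (A.map f) (D.map f) := by
  have := congrArg (fun M : Matrix _ _ B => M.map f) h
  simp only [map_mul_algHom, leg1_map', leg2_map', sc_map] at this
  exact this

variable {E : Type*} [LinearOrder E] {Q : EdgeQuiver V E}

lemma Sat.map {B B' : Type*} [Ring B] [Algebra k B] [Ring B'] [Algebra k B']
    {X : ∀ x : E ⊕ E, Matrix (Fin (d (Q.src x))) (Fin (d (Q.tgt x))) B} (h : Sat Q q X)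
    (f : B →ₐ[k] B') : Sat Q q fun x => (X x).map f where
  edge x hx := (h.edge x hx).map f
  loop x hx := (h.loop x hx).map f
  cross_edge e he := (h.cross_edge e he).map f
  cross_loop e he := (h.cross_loop e he).map f
  braided x y hxy := (h.braided x y hxy).map f

variable {k' : Type*} [CommRing k'] [Algebra k k']

variable (k') in
/-- The image of a unit under a change of scalars. -/
abbrev mapUnit (q : kˣ) : k'ˣ := Units.map (algebraMap k k' : k →* k') q

lemma matR_map (u v : V) : (matR d q u v).map (algebraMap k k') = matR d (mapUnit k' q) u v := by
  ext ⟨i, j⟩ ⟨x, y⟩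
  simp only [Matrix.map_apply, matR, Matrix.of_apply, rCoeff]
  split_ifs <;> simp [← map_inv]

lemma matRInv_map (u v : V) :
    (matRInv d q u v).map (algebraMap k k') = matRInv d (mapUnit k' q) u v := by
  ext ⟨i, j⟩ ⟨x, y⟩
  simp only [Matrix.map_apply, matRInv, Matrix.of_apply, rInvCoeff]
  split_ifs <;> simp [← map_inv]

lemma sc_tower {B : Type*} [Ring B] [Algebra k B] [Algebra k' B] [IsScalarTower k k' B]
    {m n : Type*} (M : Matrix m n k) : sc B (M.map (algebraMap k k')) = sc B M := by
  ext i j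
  simp only [sc_apply, Matrix.map_apply]
  exact (IsScalarTower.algebraMap_apply k k' B _).symm

/-- The relations over `k` and over a `k`-algebra `k'` agree. -/
lemma sat_tower {B : Type*} [Ring B] [Algebra k B] [Algebra k' B] [IsScalarTower k k' B]
    {X : ∀ x : E ⊕ E, Matrix (Fin (d (Q.src x))) (Fin (d (Q.tgt x))) B} :
    Sat Q (mapUnit k' q) X ↔ Sat Q q X := by
  have e1 : ∀ u v, sc B (matR d (mapUnit k' q) u v) = sc B (matR d q u v) := fun u v => by
    rw [← matR_map, sc_tower]
  have e2 : ∀ u v, sc B (matRInv d (mapUnit k' q) u v) = sc B (matRInv d q u v) := fun u v => by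
    rw [← matRInv_map, sc_tower]
  have e3 : ∀ u v, sc B (matR21 d (mapUnit k' q) u v) = sc B (matR21 d q u v) := fun u v => by
    rw [matR21_eq, matR21_eq, ← sw_sc, ← sw_sc, e1]
  have e4 : ∀ u v, sc B (matR21Inv d (mapUnit k' q) u v) = sc B (matR21Inv d q u v) :=
    fun u v => by
    rw [matR21Inv_eq, matR21Inv_eq, ← sw_sc, ← sw_sc, e2]
  constructor
  · intro h
    exact
      { edge := fun x hx => by
          have := h.edge x hx
          unfold EdgeRel at this ⊢
          rwa [e1, e3] at this
        loop := fun x hx => by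
          have := h.loop x hx
          unfold LoopRel at this ⊢
          rwa [e1, e1, e3, e3] at this
        cross_edge := fun e he => by
          have := h.cross_edge e he
          unfold CrossEdgeRel at this ⊢
          rwa [e1, e2] at this
        cross_loop := fun e he => by
          have := h.cross_loop e he
          unfold CrossLoopRel at this ⊢
          rwa [e1, e3, e3, e4] at this
        braided := fun x y hxy => by
          have := h.braided x y hxy
          unfold BraidRel at this ⊢
          rwa [e1, e1, e1, e2] at this }
  · intro h
    exact
      { edge := fun x hx => by
          have := h.edge x hx
          unfold EdgeRel at this ⊢
          rwa [e1, e3]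
        loop := fun x hx => by
          have := h.loop x hx
          unfold LoopRel at this ⊢
          rwa [e1, e1, e3, e3]
        cross_edge := fun e he => by
          have := h.cross_edge e he
          unfold CrossEdgeRel at this ⊢
          rwa [e1, e2]
        cross_loop := fun e he => by
          have := h.cross_loop e he
          unfold CrossLoopRel at this ⊢
          rwa [e1, e3, e3, e4]
        braided := fun x y hxy => by
          have := h.braided x y hxy
          unfold BraidRel at this ⊢
          rwa [e1, e1, e1, e2] }

section Fibre

variable (Q d q k')

/-- The specialization of the parameter along `k → k'`. -/
def fibreHom : Dq Q d q →ₐ[k] Dq Q d (mapUnit k' q) :=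
  (sat_tower.mp (sat_genX Q d (mapUnit k' q)) : Sat Q q (genX Q d (mapUnit k' q))).lift

lemma fibreHom_aGen (e i j) :
    fibreHom d q Q k' (aGen Q d q e i j) = aGen Q d (mapUnit k' q) e i j :=
  Sat.lift_genX _ (Sum.inl e) i j

lemma fibreHom_dGen (e i j) :
    fibreHom d q Q k' (dGen Q d q e i j) = dGen Q d (mapUnit k' q) e i j :=
  Sat.lift_genX _ (Sum.inr e) i j

lemma fibreHom_stdMon (s) : fibreHom d q Q k' (stdMon Q d q s) = stdMon Q d (mapUnit k' q) s := by
  rw [map_stdMon]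
  simp only [fibreHom_aGen, fibreHom_dGen]

lemma fibreHom_surjective [Finite E] (hk : Function.Surjective (algebraMap k k')) :
    Function.Surjective (fibreHom d q Q k') := by
  let S : Submodule k' (Dq Q d (mapUnit k' q)) :=
    { carrier := {y | ∃ x, fibreHom d q Q k' x = y}
      zero_mem' := ⟨0, map_zero _⟩
      add_mem' := by
        rintro _ _ ⟨x, rfl⟩ ⟨y, rfl⟩
        exact ⟨x + y, map_add _ _ _⟩
      smul_mem' := by
        rintro c _ ⟨x, rfl⟩
        obtain ⟨c, rfl⟩ := hk c
        exact ⟨c • x, by rw [map_smul, algebraMap_smul]⟩ }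
  have hS : ⊤ ≤ S := by
    rw [← span_stdMonomial Q d (mapUnit k' q), Submodule.span_le]
    rintro _ ⟨s, rfl⟩
    exact ⟨_, fibreHom_stdMon d q Q k' s⟩
  exact fun y => hS (Submodule.mem_top : y ∈ ⊤)

/-- The map from the algebra over `k'` to the base change of the algebra over `k`. -/
def baseChangeHom : Dq Q d (mapUnit k' q) →ₐ[k'] k' ⊗[k] Dq Q d q :=
  (sat_tower.mpr ((sat_genX Q d q).map
    (Algebra.TensorProduct.includeRight : Dq Q d q →ₐ[k] k' ⊗[k] Dq Q d q)) :
    Sat Q (mapUnit k' q) _).lift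

lemma baseChangeHom_aGen (e i j) :
    baseChangeHom d q Q k' (aGen Q d (mapUnit k' q) e i j) =
      Algebra.TensorProduct.includeRight (R := k) (A := k') (aGen Q d q e i j) :=
  Sat.lift_genX _ (Sum.inl e) i j

lemma baseChangeHom_dGen (e i j) :
    baseChangeHom d q Q k' (dGen Q d (mapUnit k' q) e i j) =
      Algebra.TensorProduct.includeRight (R := k) (A := k') (dGen Q d q e i j) :=
  Sat.lift_genX _ (Sum.inr e) i j

lemma baseChangeHom_stdMon (s) :
    baseChangeHom d q Q k' (stdMon Q d (mapUnit k' q) s) = 1 ⊗ₜ[k] stdMon Q d q s := by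
  rw [map_stdMon]
  simp only [baseChangeHom_aGen, baseChangeHom_dGen]
  exact (map_stdMon (Algebra.TensorProduct.includeRight (R := k) (A := k') (B := Dq Q d q)) s).symm

variable {Q d q k'}

/-- Independence of the standard monomials is preserved by changes of scalars: they are mapped to
the basis of the base change by `baseChangeHom`. -/
lemma linearIndependent_stdMon_of_basis (h : LinearIndependent k (stdMon Q d q)) [Finite E] :
    LinearIndependent k' (stdMon Q d (mapUnit k' q)) := by
  let b : Module.Basis (StdIndex Q d) k (Dq Q d q) :=
    Module.Basis.mk h (span_stdMonomial Q d q).ge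
  have hb := (b.baseChange k').linearIndependent
  have e : ⇑(b.baseChange k') = (baseChangeHom d q Q k').toLinearMap ∘
      stdMon Q d (mapUnit k' q) := by
    funext s
    rw [Module.Basis.baseChange_apply, Module.Basis.mk_apply]
    exact (baseChangeHom_stdMon d q Q k' s).symm
  rw [e] at hb
  exact hb.of_comp _

end Fibre

/-- The kernel of a specialization for which the images of the standard monomials remain
independent. -/
lemma exists_smul_eq_of_map_eq_zero [Finite E] {A : Type*} [AddCommGroup A] [Module k A]
    [Module k' A] [IsScalarTower k k' A] (f : Dq Q d q →ₗ[k] A)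
    (h : LinearIndependent k' fun s => f (stdMon Q d q s)) {t : k}
    (ht : ∀ c, algebraMap k k' c = 0 → t ∣ c) {x : Dq Q d q} (hx : f x = 0) :
    ∃ y, x = t • y := by
  obtain ⟨c, rfl⟩ := exists_finsupp x
  have h0 : ∀ s, algebraMap k k' (c s) = 0 := by
    rw [Finsupp.sum, map_sum] at hx
    simp only [map_smul] at hx
    simp only [← algebraMap_smul k' (_ : k) (f _)] at hx
    have := linearIndependent_iff'.mp h _ _ hx
    intro s
    by_cases hs : s ∈ c.support
    · exact this s hs
    · rw [Finsupp.notMem_support_iff.mp hs, map_zero]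
  choose g hg using fun s => ht _ (h0 s)
  refine ⟨∑ s ∈ c.support, g s • stdMon Q d q s, ?_⟩
  rw [Finset.smul_sum, Finsupp.sum]
  refine Finset.sum_congr rfl fun s _ => ?_
  rw [smul_smul, ← hg]

end Scalars

/-! ### The fibre at `q = 1` of a quiver with loops -/

section TensorAlgebra

variable {A C : Type*} [Semiring A] [Algebra ℂ A] [Semiring C] [Algebra ℂ C]

variable (C) in
/-- The inclusion of the first factor in a tensor product of algebras. -/
def incl₁ (a : A) : A ⊗[ℂ] C := a ⊗ₜ[ℂ] 1

variable (A) in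
/-- The inclusion of the second factor in a tensor product of algebras. -/
def incl₂ (c : C) : A ⊗[ℂ] C := 1 ⊗ₜ[ℂ] c

lemma incl₁_comm {a a' : A} (h : a * a' = a' * a) :
    incl₁ C a * incl₁ C a' = incl₁ C a' * incl₁ C a := by
  rw [incl₁, incl₁, Algebra.TensorProduct.tmul_mul_tmul, Algebra.TensorProduct.tmul_mul_tmul, h]

lemma incl₂_comm {c c' : C} (h : c * c' = c' * c) :
    incl₂ A c * incl₂ A c' = incl₂ A c' * incl₂ A c := by
  rw [incl₂, incl₂, Algebra.TensorProduct.tmul_mul_tmul, Algebra.TensorProduct.tmul_mul_tmul, h]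

lemma incl₁_comm_incl₂ (a : A) (c : C) : incl₁ C a * incl₂ A c = incl₂ A c * incl₁ C a := by
  rw [incl₁, incl₂, Algebra.TensorProduct.tmul_mul_tmul, Algebra.TensorProduct.tmul_mul_tmul,
    one_mul, one_mul, mul_one, mul_one]

lemma incl₁_mul_eq_add {a a' : A} {e : Prop} [Decidable e]
    (h : a * a' = a' * a + if e then 1 else 0) :
    incl₁ C a * incl₁ C a' = incl₁ C a' * incl₁ C a + if e then 1 else 0 := by
  rw [incl₁, incl₁, Algebra.TensorProduct.tmul_mul_tmul, Algebra.TensorProduct.tmul_mul_tmul, h,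
    TensorProduct.add_tmul, mul_one]
  split_ifs
  · rfl
  · rw [TensorProduct.zero_tmul]

lemma incl₁_mul_tmul (a a' : A) (c : C) : incl₁ C a * (a' ⊗ₜ[ℂ] c) = (a * a') ⊗ₜ[ℂ] c := by
  rw [incl₁, Algebra.TensorProduct.tmul_mul_tmul, one_mul]

lemma incl₂_mul_tmul (a : A) (c c' : C) : incl₂ A c * (a ⊗ₜ[ℂ] c') = a ⊗ₜ[ℂ] (c * c') := by
  rw [incl₂, Algebra.TensorProduct.tmul_mul_tmul, one_mul]

lemma tmul_mul_incl₁ (a a' : A) (c : C) : (a ⊗ₜ[ℂ] c) * incl₁ C a' = (a * a') ⊗ₜ[ℂ] c := by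
  rw [incl₁, Algebra.TensorProduct.tmul_mul_tmul, mul_one]

lemma tmul_mul_incl₂ (a : A) (c c' : C) : (a ⊗ₜ[ℂ] c) * incl₂ A c' = a ⊗ₜ[ℂ] (c * c') := by
  rw [incl₂, Algebra.TensorProduct.tmul_mul_tmul, mul_one]

lemma tensor_eq_top_of_mem (S : Subalgebra ℂ (A ⊗[ℂ] C))
    (hA : S.comap (Algebra.TensorProduct.includeLeft : A →ₐ[ℂ] A ⊗[ℂ] C) = ⊤)
    (hC : S.comap (Algebra.TensorProduct.includeRight : C →ₐ[ℂ] A ⊗[ℂ] C) = ⊤) : S = ⊤ := by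
  rw [eq_top_iff]
  rintro t -
  induction t with
  | zero => exact S.zero_mem
  | add x y hx hy => exact S.add_mem hx hy
  | tmul a c =>
    have h1 : a ∈ S.comap Algebra.TensorProduct.includeLeft := hA ▸ Algebra.mem_top
    have h2 : c ∈ S.comap Algebra.TensorProduct.includeRight := hC ▸ Algebra.mem_top
    have : incl₁ C a * incl₂ A c ∈ S := S.mul_mem h1 h2
    rwa [incl₁, tmul_mul_incl₂, one_mul] at this

end TensorAlgebra

section Cotangent

variable {V E : Type*} [DecidableEq V] [LinearOrder E] (Q : EdgeQuiver V E) (d : V → ℕ)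

/-- Differential operators in the directions of the edges that are not loops, tensored with
functions on the cotangent bundle in the directions of the loops. -/
abbrev ClassicalFibre : Type _ := diffOps (EdgeCoord Q d) ⊗[ℂ] LoopCotangent Q d

/-- The ring structure with the multiplication of `Algebra.TensorProduct.instSemiring`, so that the
algebra structure over `ℂ` is the one of the tensor product. -/
instance : Ring (ClassicalFibre Q d) := Algebra.semiringToRing ℂ

variable {Q d}

/-- The coordinate `c` in the classical fibre. -/
def coordF (c : Coord Q d) : ClassicalFibre Q d :=
  if h : Q.tail c.1 = Q.head c.1 then incl₂ _ (MvPolynomial.X (Sum.inl (⟨c, h⟩ : LoopCoord Q d)))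
  else incl₁ _ (mulX (⟨c, h⟩ : EdgeCoord Q d))

/-- The derivative along `c`, or the conjugate momentum of `c`, in the classical fibre. -/
def momF (c : Coord Q d) : ClassicalFibre Q d :=
  if h : Q.tail c.1 = Q.head c.1 then incl₂ _ (MvPolynomial.X (Sum.inr (⟨c, h⟩ : LoopCoord Q d)))
  else incl₁ _ (partialX (⟨c, h⟩ : EdgeCoord Q d))

lemma coordF_comm (c c' : Coord Q d) : coordF c * coordF c' = coordF c' * coordF c := by
  unfold coordF
  split_ifs
  · exact incl₂_comm (mul_comm _ _)
  · exact (incl₁_comm_incl₂ _ _).symm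
  · exact incl₁_comm_incl₂ _ _
  · exact incl₁_comm (mulX_comm _ _)

lemma momF_comm (c c' : Coord Q d) : momF c * momF c' = momF c' * momF c := by
  unfold momF
  split_ifs
  · exact incl₂_comm (mul_comm _ _)
  · exact (incl₁_comm_incl₂ _ _).symm
  · exact incl₁_comm_incl₂ _ _
  · exact incl₁_comm (partialX_comm _ _)

lemma momF_mul_coordF (c c' : Coord Q d)
    (h : Q.tail c.1 = Q.head c.1 ∨ Q.tail c'.1 = Q.head c'.1 ∨ c ≠ c') :
    momF c * coordF c' = coordF c' * momF c := by
  unfold momF coordF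
  split_ifs with h1 h2
  · exact incl₂_comm (mul_comm _ _)
  · exact (incl₁_comm_incl₂ _ _).symm
  · exact incl₁_comm_incl₂ _ _
  · refine incl₁_comm (partialX_mul_mulX_of_ne fun e => ?_)
    rcases h with h | h | h
    · exact h1 h
    · contradiction
    · exact h (congrArg Subtype.val e)

lemma momF_mul_coordF_edge [DecidableEq (Coord Q d)] (c c' : Coord Q d)
    (h : Q.tail c.1 ≠ Q.head c.1) (h' : Q.tail c'.1 ≠ Q.head c'.1) :
    momF c * coordF c' = coordF c' * momF c + if c = c' then 1 else 0 := by
  unfold momF coordF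
  rw [dif_neg h, dif_neg h']
  refine incl₁_mul_eq_add ((partialX_mul_mulX _ _).trans (congrArg₂ _ rfl ?_))
  refine if_congr ?_ rfl rfl
  rw [Subtype.mk.injEq]

variable (Q d) in
/-- The images of the generators of `D_1` in the classical fibre. -/
def classicalX : ∀ x : E ⊕ E,
    Matrix (Fin (d (Q.src x))) (Fin (d (Q.tgt x))) (ClassicalFibre Q d)
  | Sum.inl e => Matrix.of fun i j => coordF (⟨e, i, j⟩ : Coord Q d)
  | Sum.inr e => Matrix.of fun i j => momF (⟨e, j, i⟩ : Coord Q d)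

lemma entriesCommute_classicalX {x y : E ⊕ E}
    (h : x = y ∨ underlying x ≠ underlying y ∨ Q.src x = Q.tgt x) :
    EntriesCommute (classicalX Q d x) (classicalX Q d y) := by
  intro i j i' j'
  rcases x with e | e <;> rcases y with f | f
  · exact coordF_comm _ _
  · refine (momF_mul_coordF _ _ ?_).symm
    rcases h with h | h | h
    · cases h
    · exact Or.inr (Or.inr fun h' => h (congrArg Sigma.fst h').symm)
    · exact Or.inr (Or.inl h)
  · refine momF_mul_coordF _ _ ?_
    rcases h with h | h | h
    · cases h
    · exact Or.inr (Or.inr fun h' => h (congrArg Sigma.fst h'))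
    · exact Or.inl h.symm
  · exact momF_comm _ _

variable (Q d) in
lemma sat_classicalX : Sat Q (1 : ℂˣ) (classicalX Q d) := by
  refine sat_one (fun x y h => entriesCommute_classicalX h) fun e he i i' j j' => ?_
  classical
  refine (momF_mul_coordF_edge (⟨e, i', j⟩ : Coord Q d) ⟨e, i, j'⟩ he he).trans
    (congrArg₂ _ rfl ?_)
  by_cases h : i = i' ∧ j = j'
  · rw [if_pos h, if_pos (by rw [h.1, h.2])]
  · rw [if_neg h, if_neg]
    rintro ⟨⟩
    exact h ⟨rfl, rfl⟩

variable (Q d) in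
/-- The map from `D_1` to the classical fibre. -/
def classicalHom : Dq Q d (1 : ℂˣ) →ₐ[ℂ] ClassicalFibre Q d := (sat_classicalX Q d).lift

lemma classicalHom_aGen (e i j) :
    classicalHom Q d (aGen Q d (1 : ℂˣ) e i j) = coordF (⟨e, i, j⟩ : Coord Q d) :=
  (sat_classicalX Q d).lift_genX (Sum.inl e) i j

lemma classicalHom_dGen (e i j) :
    classicalHom Q d (dGen Q d (1 : ℂˣ) e i j) = momF (⟨e, j, i⟩ : Coord Q d) :=
  (sat_classicalX Q d).lift_genX (Sum.inr e) i j

lemma classicalHom_surjective : Function.Surjective (classicalHom Q d) := by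
  rw [← AlgHom.range_eq_top]
  have hc : ∀ c : Coord Q d, coordF c ∈ (classicalHom Q d).range :=
    fun c => ⟨_, classicalHom_aGen c.1 c.2.1 c.2.2⟩
  have hm : ∀ c : Coord Q d, momF c ∈ (classicalHom Q d).range :=
    fun c => ⟨_, classicalHom_dGen c.1 c.2.2 c.2.1⟩
  refine tensor_eq_top_of_mem _ (diffOps_eq_top_of_mem _ (fun s => ?_) fun s => ?_) ?_
  · have := hc s.1
    rwa [coordF, dif_neg s.2] at this
  · have := hm s.1
    rwa [momF, dif_neg s.2] at this
  · rw [eq_top_iff, ← MvPolynomial.adjoin_range_X, Algebra.adjoin_le_iff]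
    rintro _ ⟨s | s, rfl⟩
    · have := hc s.1
      rwa [coordF, dif_pos s.2] at this
    · have := hm s.1
      rwa [momF, dif_pos s.2] at this

open MvPolynomial

/-- The application of the first tensor factor to a polynomial `f`, multiplied by the second
factor, as a polynomial in all coordinates and momenta. -/
def evalF (f : MvPolynomial (EdgeCoord Q d) ℂ) :
    ClassicalFibre Q d →ₗ[ℂ] MvPolynomial (Coord Q d ⊕ Coord Q d) ℂ :=
  TensorProduct.lift ((LinearMap.mul ℂ (MvPolynomial (Coord Q d ⊕ Coord Q d) ℂ)).compl₁₂
    ((rename fun c : EdgeCoord Q d => Sum.inl c.1).toLinearMap ∘ₗ LinearMap.applyₗ f ∘ₗ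
      (diffOps (EdgeCoord Q d)).val.toLinearMap)
    (rename (Sum.map (Subtype.val : LoopCoord Q d → Coord Q d) Subtype.val)).toLinearMap)

lemma evalF_tmul (f P g) : evalF (Q := Q) (d := d) f (P ⊗ₜ[ℂ] g) =
    rename (fun c : EdgeCoord Q d => Sum.inl c.1) (P.1 f) *
      rename (Sum.map (Subtype.val : LoopCoord Q d → Coord Q d) Subtype.val) g := rfl

lemma evalF_coordF_mul (f) (c : Coord Q d) (t : ClassicalFibre Q d) :
    evalF f (coordF c * t) = X (Sum.inl c) * evalF f t := by
  induction t using TensorProduct.induction_on with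
  | zero => rw [mul_zero, map_zero, mul_zero]
  | add x y hx hy => rw [mul_add, map_add, hx, hy, map_add, mul_add]
  | tmul P g =>
    unfold coordF
    split_ifs with h
    · rw [incl₂_mul_tmul, evalF_tmul, evalF_tmul, map_mul, rename_X]
      exact mul_left_comm _ _ _
    · rw [incl₁_mul_tmul, evalF_tmul, evalF_tmul, diffOps_mul_apply, mulX_apply, map_mul,
        rename_X, mul_assoc]

lemma evalF_mul_momF_loop (f) (c : Coord Q d) (h : Q.tail c.1 = Q.head c.1)
    (t : ClassicalFibre Q d) : evalF f (t * momF c) = X (Sum.inr c) * evalF f t := by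
  induction t using TensorProduct.induction_on with
  | zero => rw [zero_mul, map_zero, mul_zero]
  | add x y hx hy => rw [add_mul, map_add, hx, hy, map_add, mul_add]
  | tmul P g =>
    rw [momF, dif_pos h, tmul_mul_incl₂, evalF_tmul, evalF_tmul,
      map_mul, rename_X, mul_comm (rename _ g)]
    exact mul_left_comm _ _ _

lemma evalF_mul_momF_edge (f) (c : EdgeCoord Q d)
    (t : ClassicalFibre Q d) : evalF f (t * momF c.1) = evalF (pderiv c f) t := by
  induction t using TensorProduct.induction_on with
  | zero => rw [zero_mul, map_zero, map_zero]
  | add x y hx hy => rw [add_mul, map_add, hx, hy, map_add]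
  | tmul P g =>
    rw [momF, dif_neg c.2, tmul_mul_incl₁, evalF_tmul, evalF_tmul,
      diffOps_mul_apply, partialX_apply]

open Classical in
variable (Q d) in
/-- The coordinate of a triple, if its edge is not a loop. -/
def edgePart (x : Triple (fun e => d (Q.head e)) fun e => d (Q.tail e)) :
    Option (EdgeCoord Q d) :=
  if h : Q.tail x.1 = Q.head x.1 then none else some ⟨transp x, h⟩

lemma map_edgePart (s : StdIndex Q d) :
    (s.2.1.filterMap (edgePart Q d)).map Subtype.val = symD s := by
  classical
  unfold symD
  induction s.2.1 with
  | nil => rfl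
  | cons x J ih =>
    by_cases h : Q.tail x.1 = Q.head x.1
    · rw [List.filterMap_cons_none (by rw [edgePart, dif_pos h]),
        List.filter_cons_of_neg (by simpa using h), ih]
    · rw [List.filterMap_cons_some (b := ⟨transp x, h⟩) (by rw [edgePart, dif_neg h]),
        List.filter_cons_of_pos (by simpa using h), List.map_cons, List.map_cons, ih]

lemma prod_map_symX {M : Type*} [Monoid M] (g : Coord Q d ⊕ Coord Q d → M) (s : StdIndex Q d) :
    ((symX s).map g).prod = (s.1.1.map fun c => g (Sum.inl c)).prod *
      ((s.2.1.filter fun x => Q.tail x.1 = Q.head x.1).map fun x =>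
        g (Sum.inr (transp x))).prod := by
  rw [symX, List.map_append, List.prod_append, List.map_map, List.map_map]
  simp only [Function.comp_def]
  congr!

lemma evalF_mul_prod (f) (t : ClassicalFibre Q d)
    (J : List (Triple (fun e => d (Q.head e)) fun e => d (Q.tail e))) :
    evalF f (t * (J.map fun x => momF (transp x)).prod) =
      ((J.filter fun x => Q.tail x.1 = Q.head x.1).map fun x =>
        (X (Sum.inr (transp x)) : MvPolynomial (Coord Q d ⊕ Coord Q d) ℂ)).prod *
      evalF (dList (J.filterMap (edgePart Q d)) f) t := by
  induction J generalizing t with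
  | nil => simp [dList]
  | cons x J ih =>
    rw [List.map_cons, List.prod_cons, ← mul_assoc, ih]
    by_cases h : Q.tail x.1 = Q.head x.1
    · rw [List.filterMap_cons_none (by rw [edgePart, dif_pos h]),
        List.filter_cons_of_pos (by simpa using h), evalF_mul_momF_loop _ _ h, List.map_cons,
        List.prod_cons]
      exact (mul_left_comm _ _ _).trans (mul_assoc _ _ _).symm
    · rw [List.filterMap_cons_some (b := ⟨transp x, h⟩) (by rw [edgePart, dif_neg h]),
        List.filter_cons_of_neg (by simpa using h), dList_cons]
      exact congrArg _ (evalF_mul_momF_edge _ ⟨transp x, h⟩ t)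

lemma evalF_one (f : MvPolynomial (EdgeCoord Q d) ℂ) :
    evalF f (1 : ClassicalFibre Q d) = rename (fun c : EdgeCoord Q d => Sum.inl c.1) f :=
  (evalF_tmul f 1 1).trans (by rw [map_one, mul_one, diffOps_one_apply])

lemma evalF_prod (f : MvPolynomial (EdgeCoord Q d) ℂ) (I : List (Coord Q d)) :
    evalF f (I.map coordF).prod = (I.map fun c => X (Sum.inl c)).prod *
      rename (fun c : EdgeCoord Q d => Sum.inl c.1) f := by
  induction I with
  | nil => rw [List.map_nil, List.map_nil, List.prod_nil, List.prod_nil, evalF_one, one_mul]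
  | cons c I ih =>
    rw [List.map_cons, List.prod_cons, evalF_coordF_mul, ih, List.map_cons, List.prod_cons,
      mul_assoc]

lemma evalF_classicalHom_stdMon (f) (s : StdIndex Q d) :
    evalF f (classicalHom Q d (stdMon Q d 1 s)) = ((symX s).map X).prod *
      rename (fun c : EdgeCoord Q d => Sum.inl c.1) (dList (s.2.1.filterMap (edgePart Q d)) f) := by
  classical
  have h : classicalHom Q d (stdMon Q d 1 s) =
      (s.1.1.map coordF).prod * (s.2.1.map fun x => momF (transp x)).prod := by
    rw [map_stdMon]
    simp only [classicalHom_aGen, classicalHom_dGen]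
    rfl
  rw [h, prod_map_symX, evalF_mul_prod, evalF_prod, mul_left_comm, mul_assoc]

variable (Q d) in
lemma linearIndependent_classicalHom :
    LinearIndependent ℂ fun s => classicalHom Q d (stdMon Q d 1 s) := by
  refine linearIndependent_of_maps evalF _ fun c hc => ?_
  refine eq_zero_of_sum_stdSymbol Q d (rename fun c : EdgeCoord Q d => Sum.inl c.1)
    (fun s => s.2.1.filterMap (edgePart Q d)) (fun s s' h => ?_) c fun f => ?_
  · rw [← map_edgePart, ← map_edgePart]
    exact h.map _
  · rw [← hc f]
    exact Finsupp.sum_congr fun s _ => congrArg _ (evalF_classicalHom_stdMon f s).symm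

variable (Q d) in
/-- The fibre at `q = 1` of an arbitrary quiver: `classicalHom` is bijective, because it is
surjective and maps the spanning standard monomials to independent elements. -/
lemma exists_algEquiv_classicalFibre [Finite E] :
    ∃ φ : Dq Q d (1 : ℂˣ) ≃ₐ[ℂ] diffOps (EdgeCoord Q d) ⊗[ℂ] LoopCotangent Q d,
      (∀ e i j, ∀ h : Q.tail e ≠ Q.head e, φ (aGen Q d 1 e i j) =
        mulX (⟨⟨e, i, j⟩, h⟩ : EdgeCoord Q d) ⊗ₜ[ℂ] 1) ∧
      (∀ e i j, ∀ h : Q.tail e ≠ Q.head e, φ (dGen Q d 1 e i j) =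
        partialX (⟨⟨e, j, i⟩, h⟩ : EdgeCoord Q d) ⊗ₜ[ℂ] 1) ∧
      (∀ e i j, ∀ h : Q.tail e = Q.head e, φ (aGen Q d 1 e i j) =
        1 ⊗ₜ[ℂ] MvPolynomial.X (Sum.inl (⟨⟨e, i, j⟩, h⟩ : LoopCoord Q d))) ∧
      (∀ e i j, ∀ h : Q.tail e = Q.head e, φ (dGen Q d 1 e i j) =
        1 ⊗ₜ[ℂ] MvPolynomial.X (Sum.inr (⟨⟨e, j, i⟩, h⟩ : LoopCoord Q d))) :=
  ⟨AlgEquiv.ofBijective (classicalHom Q d)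
    ⟨injective_of_linearIndependent (classicalHom Q d).toLinearMap
      (linearIndependent_classicalHom Q d), classicalHom_surjective⟩,
    fun e i j h => (classicalHom_aGen e i j).trans (dif_neg h),
    fun e i j h => (classicalHom_dGen e i j).trans (dif_neg h),
    fun e i j h => (classicalHom_aGen e i j).trans (dif_pos h),
    fun e i j h => (classicalHom_dGen e i j).trans (dif_pos h)⟩

end Cotangent

/-! ### Products of matrices of generators along paths -/

section Paths

variable {V : Type*} [DecidableEq V] {d : V → ℕ}
variable {k : Type*} [CommRing k] {q : kˣ} {B : Type*} [Ring B] [Algebra k B]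

/-- Braided commutation with a fixed matrix passes to composable products. -/
lemma BraidRel.mul_left {u u' u'' v v' : V} {X : Matrix (Fin (d u)) (Fin (d u')) B}
    {X' : Matrix (Fin (d u')) (Fin (d u'')) B} {Y : Matrix (Fin (d v)) (Fin (d v')) B}
    (h : BraidRel d q u u' v v' X Y) (h' : BraidRel d q u' u'' v v' X' Y) :
    BraidRel d q u u'' v v' (X * X') Y := by
  unfold BraidRel at *
  rw [leg1_mul, leg1_mul]
  simp only [Matrix.mul_assoc] at *
  rw [h', ← Matrix.mul_assoc (sc B (matR d q u' v)), ← Matrix.mul_assoc (leg1 _ X), h]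
  simp only [Matrix.mul_assoc]
  rw [reassoc_one (scR_inv q d B u' v')]

/-- Braided commutation of a fixed matrix passes to composable products. -/
lemma BraidRel.mul_right {u u' v v' v'' : V} {X : Matrix (Fin (d u)) (Fin (d u')) B}
    {Y : Matrix (Fin (d v)) (Fin (d v')) B} {Y' : Matrix (Fin (d v')) (Fin (d v'')) B}
    (h : BraidRel d q u u' v v' X Y) (h' : BraidRel d q u u' v' v'' X Y') :
    BraidRel d q u u' v v'' X (Y * Y') := by
  unfold BraidRel at *
  rw [leg2_mul, leg2_mul]
  simp only [Matrix.mul_assoc] at *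
  rw [← Matrix.mul_assoc (sc B (matR d q u' v)), ← Matrix.mul_assoc (leg1 _ X), h]
  simp only [Matrix.mul_assoc]
  rw [h', reassoc_one (scRInv_mul q d B u v')]

/-- Swapping the two legs of the relation of an edge. -/
lemma EdgeRel.swap {u w : V} {X : Matrix (Fin (d u)) (Fin (d w)) B} (h : EdgeRel d q u w X) :
    sc B (matR21 d q u u) * (leg1 (Fin (d u)) X * leg2 (Fin (d w)) X) =
      leg2 (Fin (d u)) X * (leg1 (Fin (d w)) X * sc B (matR d q w w)) := by
  have := congrArg sw h
  simp only [sw_mul, sw_sc, sw_leg1, sw_leg2, matR21_eq, sw_sw] at this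
  simpa only [Matrix.mul_assoc, matR21_eq] using this

/-- Swapping the two legs of a braided commutation. -/
lemma BraidRel.swap {u u' v v' : V} {X : Matrix (Fin (d u)) (Fin (d u')) B}
    {Y : Matrix (Fin (d v)) (Fin (d v')) B} (h : BraidRel d q u u' v v' X Y) :
    leg2 (Fin (d v)) X * (sc B (matR21 d q v u') * leg1 (Fin (d u')) Y) =
      sc B (matR21 d q v u) * (leg1 (Fin (d u)) Y * (sc B (matR21Inv d q v' u) *
        (leg2 (Fin (d v')) X * sc B (matR21 d q v' u')))) := by
  have := congrArg sw h
  simp only [sw_mul, sw_sc, sw_leg1, sw_leg2] at this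
  simpa only [Matrix.mul_assoc, matR21_eq, matR21Inv_eq] using this

lemma matR21_of_ne {u v : V} (h : u ≠ v) : matR21 d q u v = 1 := by
  rw [matR21_eq, matR_of_ne q h.symm, sw_one]

lemma matR21Inv_of_ne {u v : V} (h : u ≠ v) : matR21Inv d q u v = 1 := by
  rw [matR21Inv_eq, matRInv_of_ne q h.symm, sw_one]

/-- The reflection equation for the product of two opposite edges between `v` and `u`. -/
lemma loopRel_mul {u v : V} (huv : u ≠ v) {Y : Matrix (Fin (d v)) (Fin (d u)) B}
    {X : Matrix (Fin (d u)) (Fin (d v)) B} (hY : EdgeRel d q v u Y) (hX : EdgeRel d q u v X)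
    (hXY : BraidRel d q u v v u X Y) : LoopRel d q v v (Y * X) := by
  have h1 := hY.swap
  have h2 := hX.swap
  have h3 := hXY
  have h4 := hXY.swap
  unfold BraidRel at h3
  simp only [matR_of_ne q huv, matR_of_ne q huv.symm, matR21_of_ne huv, matR21_of_ne huv.symm,
    sc_one, Matrix.mul_one, Matrix.one_mul, Matrix.mul_assoc] at h3 h4
  unfold LoopRel
  simp only [leg1_mul, leg2_mul, Matrix.mul_assoc]
  rw [← Matrix.mul_assoc (sc B (matR d q v v)) (leg2 _ Y), ← Matrix.mul_assoc (leg1 _ X), h3,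
    ← Matrix.mul_assoc (sc B (matR21 d q v v)) (leg1 _ Y) (leg1 _ X * sc B (matR d q v v)),
    ← Matrix.mul_assoc (leg2 _ X), h4]
  simp only [Matrix.mul_assoc]
  rw [← h2, reassoc_one (scR21Inv_mul q d B u u), ← Matrix.mul_assoc (leg1 _ Y) (leg2 _ Y),
    ← Matrix.mul_assoc (sc B (matR21 d q v v)), h1]
  simp only [Matrix.mul_assoc]
  rw [reassoc_one (scR_inv q d B u u)]

/-- The cross relation of a loop, for products of pairs of opposite edges that join `v` to two
further vertices. -/
lemma crossLoopRel_mul {u u' v : V} (hu : u ≠ v) (hu' : u' ≠ v) (huu : u ≠ u')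
    {Y : Matrix (Fin (d v)) (Fin (d u)) B} {X : Matrix (Fin (d u)) (Fin (d v)) B}
    {Y' : Matrix (Fin (d v)) (Fin (d u')) B} {X' : Matrix (Fin (d u')) (Fin (d v)) B}
    (h1 : BraidRel d q u' v v u X' Y) (h2 : BraidRel d q v u v u' Y Y')
    (h3 : BraidRel d q u v v u' X Y') (h4 : BraidRel d q u v u' v X X') :
    CrossLoopRel d q v v (Y * X) (Y' * X') := by
  have h2 := h2.swap
  have h3 := h3.swap
  have h4 := h4.swap
  unfold BraidRel at h1
  simp only [matR_of_ne, matRInv_of_ne, matR21_of_ne, matR21Inv_of_ne, hu', hu.symm,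
    huu.symm, ne_eq, not_false_eq_true, sc_one, Matrix.mul_one, Matrix.one_mul,
    Matrix.mul_assoc] at h1 h2 h3 h4
  unfold CrossLoopRel
  simp only [leg1_mul, leg2_mul, Matrix.mul_assoc]
  rw [← Matrix.mul_assoc (sc B (matR d q v v)) (leg2 _ Y), ← Matrix.mul_assoc (leg1 _ X'), h1,
    ← Matrix.mul_assoc (sc B (matR21 d q v v)) (leg1 _ Y')
      (leg1 _ X' * sc B (matR21Inv d q v v)),
    ← Matrix.mul_assoc (leg2 _ X) (sc B (matR21 d q v v) * leg1 _ Y'), h3]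
  simp only [Matrix.mul_assoc]
  rw [reassoc h4]
  simp only [Matrix.mul_assoc]
  rw [scR21_inv q d B, Matrix.mul_one, reassoc h2]
  simp only [Matrix.mul_assoc]

end Paths

/-! ### Splitting the loops of a quiver -/

section Relabel

variable {V V' : Type*} [DecidableEq V] [DecidableEq V'] {f : V → V'} {d : V' → ℕ}
variable {k : Type*} [CommRing k] {q : kˣ} {B : Type*} [Ring B] [Algebra k B]

lemma matR_relabel (hf : Function.Injective f) (u v : V) :
    matR d q (f u) (f v) = matR (d ∘ f) q u v := by
  ext r c
  simp only [matR, Matrix.of_apply, hf.eq_iff, Function.comp_apply]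

lemma matRInv_relabel (hf : Function.Injective f) (u v : V) :
    matRInv d q (f u) (f v) = matRInv (d ∘ f) q u v := by
  ext r c
  simp only [matRInv, Matrix.of_apply, hf.eq_iff, Function.comp_apply]

lemma matR21_relabel (hf : Function.Injective f) (u v : V) :
    matR21 d q (f u) (f v) = matR21 (d ∘ f) q u v :=
  congrArg sw (matR_relabel hf v u)

lemma matR21Inv_relabel (hf : Function.Injective f) (u v : V) :
    matR21Inv d q (f u) (f v) = matR21Inv (d ∘ f) q u v :=
  congrArg sw (matRInv_relabel hf v u)

lemma EdgeRel.relabel (hf : Function.Injective f) {u w : V}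
    {X : Matrix (Fin (d (f u))) (Fin (d (f w))) B} (h : EdgeRel d q (f u) (f w) X) :
    EdgeRel (d ∘ f) q u w X := by
  unfold EdgeRel at *
  rw [← matR_relabel hf, ← matR21_relabel hf]
  exact h

lemma LoopRel.relabel (hf : Function.Injective f) {u w : V}
    {X : Matrix (Fin (d (f u))) (Fin (d (f w))) B} (h : LoopRel d q (f u) (f w) X) :
    LoopRel (d ∘ f) q u w X := by
  unfold LoopRel at *
  rw [← matR_relabel hf, ← matR_relabel hf, ← matR21_relabel hf, ← matR21_relabel hf]
  exact h

lemma CrossEdgeRel.relabel (hf : Function.Injective f) {u w : V}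
    {A : Matrix (Fin (d (f u))) (Fin (d (f w))) B} {D : Matrix (Fin (d (f w))) (Fin (d (f u))) B}
    (h : CrossEdgeRel d q (f u) (f w) A D) : CrossEdgeRel (d ∘ f) q u w A D := by
  unfold CrossEdgeRel at *
  rw [← matR_relabel hf, ← matRInv_relabel hf]
  exact h

lemma CrossLoopRel.relabel (hf : Function.Injective f) {u w : V}
    {A : Matrix (Fin (d (f u))) (Fin (d (f w))) B} {D : Matrix (Fin (d (f w))) (Fin (d (f u))) B}
    (h : CrossLoopRel d q (f u) (f w) A D) : CrossLoopRel (d ∘ f) q u w A D := by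
  unfold CrossLoopRel at *
  rw [← matR_relabel hf, ← matR21_relabel hf, ← matR21_relabel hf, ← matR21Inv_relabel hf]
  exact h

lemma BraidRel.relabel (hf : Function.Injective f) {u u' v v' : V}
    {X : Matrix (Fin (d (f u))) (Fin (d (f u'))) B}
    {Y : Matrix (Fin (d (f v))) (Fin (d (f v'))) B}
    (h : BraidRel d q (f u) (f u') (f v) (f v') X Y) : BraidRel (d ∘ f) q u u' v v' X Y := by
  unfold BraidRel at *
  rw [← matR_relabel hf, ← matR_relabel hf, ← matR_relabel hf, ← matRInv_relabel hf]
  exact h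

end Relabel

section Split

variable {V E : Type*} (Q : EdgeQuiver V E)

/-- The edges of the split quiver: the edges of `Q` that are not loops, and four edges for every
edge `e` of `Q`, which join the ends of `e` to two auxiliary vertices. -/
inductive SplitEdge
  | edge (e : E) (h : Q.tail e ≠ Q.head e)
  | outD (e : E)
  | outA (e : E)
  | inD (e : E)
  | inA (e : E)

/-- The position of an edge of the split quiver: its edge in `Q`, and its place among the edges
that come from this one. The relations of a loop are derived from the braided commutations in the
order `outD < outA < inD < inA`. -/
def SplitEdge.pos : SplitEdge Q → E ×ₗ Fin 5
  | edge e _ => toLex (e, 0)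
  | outD e => toLex (e, 1)
  | outA e => toLex (e, 2)
  | inD e => toLex (e, 3)
  | inA e => toLex (e, 4)

lemma SplitEdge.pos_injective : Function.Injective (SplitEdge.pos Q) := by
  rintro (⟨e, h⟩ | e | e | e | e) (⟨e', h'⟩ | e' | e' | e' | e') heq <;>
  · simp only [SplitEdge.pos, EmbeddingLike.apply_eq_iff_eq, Prod.mk.injEq] at heq
    obtain ⟨rfl, h⟩ := heq
    first
    | rfl
    | exact absurd h (by decide)

instance [LinearOrder E] : LinearOrder (SplitEdge Q) :=
  LinearOrder.lift' (SplitEdge.pos Q) (SplitEdge.pos_injective Q)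

instance [Finite E] : Finite (SplitEdge Q) :=
  Finite.of_injective (β := E × Fin 5) (fun x => ofLex (SplitEdge.pos Q x))
    fun _ _ h => SplitEdge.pos_injective Q (ofLex.injective h)

lemma SplitEdge.lt_iff [LinearOrder E] {x y : SplitEdge Q} :
    x < y ↔ SplitEdge.pos Q x < SplitEdge.pos Q y := Iff.rfl

/-- The split quiver: a loop `e` at `v` is replaced by edges `outA e`, `inA e` from `v` to an
auxiliary vertex and back, whose product plays the role of the coordinates, and edges `outD e`,
`inD e` through another auxiliary vertex for the conjugate momenta. It has no loops. -/
def splitQuiver : EdgeQuiver (V ⊕ E × Bool) (SplitEdge Q) where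
  tail
    | .edge e _ => Sum.inl (Q.tail e)
    | .outD e => Sum.inl (Q.head e)
    | .outA e => Sum.inl (Q.tail e)
    | .inD e => Sum.inr (e, true)
    | .inA e => Sum.inr (e, false)
  head
    | .edge e _ => Sum.inl (Q.head e)
    | .outD e => Sum.inr (e, true)
    | .outA e => Sum.inr (e, false)
    | .inD e => Sum.inl (Q.tail e)
    | .inA e => Sum.inl (Q.head e)

lemma splitQuiver_loopless (x : SplitEdge Q) : (splitQuiver Q).tail x ≠ (splitQuiver Q).head x := by
  rcases x with ⟨e, h⟩ | e | e | e | e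
  · exact fun h' => h (Sum.inl_injective h')
  all_goals simp [splitQuiver]

/-- The dimension vector of the split quiver. -/
def splitDim (d : V → ℕ) : V ⊕ E × Bool → ℕ
  | Sum.inl v => d v
  | Sum.inr (e, true) => d (Q.tail e)
  | Sum.inr (e, false) => d (Q.head e)

variable [DecidableEq V] [LinearOrder E] (d : V → ℕ) {k : Type*} [CommRing k] (q : kˣ)

/-- The algebra `D_q` of the split quiver. -/
abbrev SplitDq : Type _ := Dq (splitQuiver Q) (splitDim Q d) q

/-- The first factor of the matrix of coordinates of a loop. -/
def outA (e : E) : Matrix (Fin (splitDim Q d (Sum.inl (Q.tail e))))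
    (Fin (splitDim Q d (Sum.inr (e, false)))) (SplitDq Q d q) :=
  genX (splitQuiver Q) (splitDim Q d) q (Sum.inl (.outA e))

/-- The second factor of the matrix of coordinates of a loop. -/
def inA (e : E) : Matrix (Fin (splitDim Q d (Sum.inr (e, false))))
    (Fin (splitDim Q d (Sum.inl (Q.head e)))) (SplitDq Q d q) :=
  genX (splitQuiver Q) (splitDim Q d) q (Sum.inl (.inA e))

/-- The first factor of the matrix of momenta of a loop. -/
def outD (e : E) : Matrix (Fin (splitDim Q d (Sum.inl (Q.head e))))
    (Fin (splitDim Q d (Sum.inr (e, true)))) (SplitDq Q d q) :=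
  genX (splitQuiver Q) (splitDim Q d) q (Sum.inl (.outD e))

/-- The second factor of the matrix of momenta of a loop. -/
def inD (e : E) : Matrix (Fin (splitDim Q d (Sum.inr (e, true))))
    (Fin (splitDim Q d (Sum.inl (Q.tail e)))) (SplitDq Q d q) :=
  genX (splitQuiver Q) (splitDim Q d) q (Sum.inl (.inD e))

/-- The images of the matrices of generators of `D_q(Q)` in `D_q` of the split quiver. -/
def splitX : ∀ x : E ⊕ E, Matrix (Fin (splitDim Q d (Sum.inl (Q.src x))))
    (Fin (splitDim Q d (Sum.inl (Q.tgt x)))) (SplitDq Q d q)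
  | Sum.inl e => if h : Q.tail e = Q.head e then outA Q d q e * inA Q d q e
      else genX (splitQuiver Q) (splitDim Q d) q (Sum.inl (.edge e h))
  | Sum.inr e => if h : Q.tail e = Q.head e then outD Q d q e * inD Q d q e
      else genX (splitQuiver Q) (splitDim Q d) q (Sum.inr (.edge e h))

variable {Q d q}

lemma splitX_inl_loop {e : E} (h : Q.tail e = Q.head e) :
    splitX Q d q (Sum.inl e) = outA Q d q e * inA Q d q e := dif_pos h

lemma splitX_inr_loop {e : E} (h : Q.tail e = Q.head e) :
    splitX Q d q (Sum.inr e) = outD Q d q e * inD Q d q e := dif_pos h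

lemma splitX_inl_edge {e : E} (h : Q.tail e ≠ Q.head e) : splitX Q d q (Sum.inl e) =
    genX (splitQuiver Q) (splitDim Q d) q (Sum.inl (.edge e h)) := dif_neg h

lemma splitX_inr_edge {e : E} (h : Q.tail e ≠ Q.head e) : splitX Q d q (Sum.inr e) =
    genX (splitQuiver Q) (splitDim Q d) q (Sum.inr (.edge e h)) := dif_neg h

/-- Braided commutation with `splitX x` can be checked on the edges that make up `x`. -/
lemma braidRel_splitX_left {v v' : V ⊕ E × Bool} {x : E ⊕ E}
    {Y : Matrix (Fin (splitDim Q d v)) (Fin (splitDim Q d v')) (SplitDq Q d q)}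
    (h : ∀ z : SplitEdge Q ⊕ SplitEdge Q, (ofLex (SplitEdge.pos Q (underlying z))).1 =
      underlying x → BraidRel (splitDim Q d) q ((splitQuiver Q).src z) ((splitQuiver Q).tgt z) v v'
        (genX (splitQuiver Q) (splitDim Q d) q z) Y) :
    BraidRel (splitDim Q d) q (Sum.inl (Q.src x)) (Sum.inl (Q.tgt x)) v v' (splitX Q d q x) Y := by
  rcases x with e | e
  · by_cases he : Q.tail e = Q.head e
    · rw [splitX_inl_loop he]
      exact (h (Sum.inl (.outA e)) rfl).mul_left (h (Sum.inl (.inA e)) rfl)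
    · rw [splitX_inl_edge he]
      exact h (Sum.inl (.edge e he)) rfl
  · by_cases he : Q.tail e = Q.head e
    · rw [splitX_inr_loop he]
      exact (h (Sum.inl (.outD e)) rfl).mul_left (h (Sum.inl (.inD e)) rfl)
    · rw [splitX_inr_edge he]
      exact h (Sum.inr (.edge e he)) rfl

/-- Braided commutation with `splitX y` can be checked on the edges that make up `y`. -/
lemma braidRel_splitX_right {u u' : V ⊕ E × Bool} {y : E ⊕ E}
    {X : Matrix (Fin (splitDim Q d u)) (Fin (splitDim Q d u')) (SplitDq Q d q)}
    (h : ∀ z : SplitEdge Q ⊕ SplitEdge Q, (ofLex (SplitEdge.pos Q (underlying z))).1 =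
      underlying y → BraidRel (splitDim Q d) q u u' ((splitQuiver Q).src z) ((splitQuiver Q).tgt z)
        X (genX (splitQuiver Q) (splitDim Q d) q z)) :
    BraidRel (splitDim Q d) q u u' (Sum.inl (Q.src y)) (Sum.inl (Q.tgt y)) X (splitX Q d q y) := by
  rcases y with e | e
  · by_cases he : Q.tail e = Q.head e
    · rw [splitX_inl_loop he]
      exact (h (Sum.inl (.outA e)) rfl).mul_right (h (Sum.inl (.inA e)) rfl)
    · rw [splitX_inl_edge he]
      exact h (Sum.inl (.edge e he)) rfl
  · by_cases he : Q.tail e = Q.head e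
    · rw [splitX_inr_loop he]
      exact (h (Sum.inl (.outD e)) rfl).mul_right (h (Sum.inl (.inD e)) rfl)
    · rw [splitX_inr_edge he]
      exact h (Sum.inr (.edge e he)) rfl

lemma splitX_braided {x y : E ⊕ E} (h : underlying y < underlying x) :
    BraidRel (splitDim Q d) q (Sum.inl (Q.src x)) (Sum.inl (Q.tgt x)) (Sum.inl (Q.src y))
      (Sum.inl (Q.tgt y)) (splitX Q d q x) (splitX Q d q y) := by
  refine braidRel_splitX_left fun z hz => braidRel_splitX_right fun w hw => ?_
  refine (sat_genX (splitQuiver Q) (splitDim Q d) q).braided z w ?_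
  rw [SplitEdge.lt_iff, Prod.Lex.lt_iff]
  exact Or.inl (by rw [hz, hw]; exact h)

lemma splitX_pos_lt {e : E} {z w : SplitEdge Q} {i j : Fin 5}
    (hz : SplitEdge.pos Q z = toLex (e, i)) (hw : SplitEdge.pos Q w = toLex (e, j)) (h : i < j) :
    z < w := by
  rw [SplitEdge.lt_iff, Prod.Lex.lt_iff, hz, hw]
  exact Or.inr ⟨rfl, h⟩

/-- `loopRel_mul` for ends that are equal only propositionally. -/
lemma loopRel_congr {V : Type*} [DecidableEq V] {d : V → ℕ} {q : kˣ} {B : Type*} [Ring B]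
    [Algebra k B] {v w m : V} (hvw : v = w) (hm : m ≠ w)
    {Y : Matrix (Fin (d v)) (Fin (d m)) B} {X : Matrix (Fin (d m)) (Fin (d w)) B}
    (hY : EdgeRel d q v m Y) (hX : EdgeRel d q m w X) (hXY : BraidRel d q m w v m X Y) :
    LoopRel d q v w (Y * X) := by
  subst hvw
  exact loopRel_mul hm hY hX hXY

/-- `crossLoopRel_mul` for ends that are equal only propositionally. -/
lemma crossLoopRel_congr {V : Type*} [DecidableEq V] {d : V → ℕ} {q : kˣ} {B : Type*} [Ring B]
    [Algebra k B] {u u' v w : V} (hvw : v = w) (hu : u ≠ v) (hu' : u' ≠ v) (huu : u ≠ u')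
    {Y : Matrix (Fin (d v)) (Fin (d u)) B} {X : Matrix (Fin (d u)) (Fin (d w)) B}
    {Y' : Matrix (Fin (d w)) (Fin (d u')) B} {X' : Matrix (Fin (d u')) (Fin (d v)) B}
    (h1 : BraidRel d q u' v v u X' Y) (h2 : BraidRel d q v u w u' Y Y')
    (h3 : BraidRel d q u w w u' X Y') (h4 : BraidRel d q u w u' v X X') :
    CrossLoopRel d q v w (Y * X) (Y' * X') := by
  subst hvw
  exact crossLoopRel_mul hu hu' huu h1 h2 h3 h4

variable (Q d q) in
/-- The matrices `splitX` satisfy the relations of `Q`: for loops these are the relations of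
products of opposite edges, for pairs of different edges the braided commutation of products. -/
lemma sat_splitX : Sat Q (d := d) q (splitX Q d q) := by
  have hs := sat_genX (splitQuiver Q) (splitDim Q d) q
  have hf : Function.Injective (Sum.inl : V → V ⊕ E × Bool) := Sum.inl_injective
  have hb : ∀ z w, underlying w < underlying z →
      BraidRel (splitDim Q d) q _ _ _ _ (genX (splitQuiver Q) (splitDim Q d) q z)
        (genX (splitQuiver Q) (splitDim Q d) q w) := hs.braided
  constructor
  · rintro (e | e) he
    · rw [splitX_inl_edge he]
      exact (hs.edge (Sum.inl (.edge e he)) (splitQuiver_loopless Q _)).relabel hf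
    · rw [splitX_inr_edge he.symm]
      exact (hs.edge (Sum.inr (.edge e he.symm)) (splitQuiver_loopless Q _).symm).relabel hf
  · rintro (e | e) he
    · have he' : Q.tail e = Q.head e := he
      rw [splitX_inl_loop he']
      suffices h : LoopRel (splitDim Q d) q (Sum.inl (Q.tail e)) (Sum.inl (Q.head e))
        (outA Q d q e * inA Q d q e) from h.relabel hf
      refine loopRel_congr (congrArg Sum.inl he') Sum.inr_ne_inl ?_ ?_ ?_
      · exact hs.edge (Sum.inl (.outA e)) (splitQuiver_loopless Q _)
      · exact hs.edge (Sum.inl (.inA e)) (splitQuiver_loopless Q _)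
      · exact hb (Sum.inl (.inA e)) (Sum.inl (.outA e)) (splitX_pos_lt rfl rfl (by decide))
    · have he' : Q.tail e = Q.head e := he.symm
      rw [splitX_inr_loop he']
      suffices h : LoopRel (splitDim Q d) q (Sum.inl (Q.head e)) (Sum.inl (Q.tail e))
        (outD Q d q e * inD Q d q e) from h.relabel hf
      refine loopRel_congr (congrArg Sum.inl he'.symm) Sum.inr_ne_inl ?_ ?_ ?_
      · exact hs.edge (Sum.inl (.outD e)) (splitQuiver_loopless Q _)
      · exact hs.edge (Sum.inl (.inD e)) (splitQuiver_loopless Q _)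
      · exact hb (Sum.inl (.inD e)) (Sum.inl (.outD e)) (splitX_pos_lt rfl rfl (by decide))
  · intro e he
    rw [splitX_inl_edge he, splitX_inr_edge he]
    exact (hs.cross_edge (.edge e he) (splitQuiver_loopless Q _)).relabel hf
  · intro e he
    rw [splitX_inl_loop he, splitX_inr_loop he]
    suffices h : CrossLoopRel (splitDim Q d) q (Sum.inl (Q.tail e)) (Sum.inl (Q.head e))
      (outA Q d q e * inA Q d q e) (outD Q d q e * inD Q d q e) from h.relabel hf
    refine crossLoopRel_congr (congrArg Sum.inl he) Sum.inr_ne_inl Sum.inr_ne_inl (by simp)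
      ?_ ?_ ?_ ?_
    · exact hb (Sum.inl (.inD e)) (Sum.inl (.outA e)) (splitX_pos_lt rfl rfl (by decide))
    · exact hb (Sum.inl (.outA e)) (Sum.inl (.outD e)) (splitX_pos_lt rfl rfl (by decide))
    · exact hb (Sum.inl (.inA e)) (Sum.inl (.outD e)) (splitX_pos_lt rfl rfl (by decide))
    · exact hb (Sum.inl (.inA e)) (Sum.inl (.inD e)) (splitX_pos_lt rfl rfl (by decide))
  · intro x y hxy
    exact (splitX_braided hxy).relabel hf

variable (Q d q) in
/-- The homomorphism from `D_q` of a quiver to `D_q` of the split quiver. -/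
def splitHom : Dq Q d q →ₐ[k] SplitDq Q d q := (sat_splitX Q d q).lift

lemma splitHom_genX (x i j) : splitHom Q d q (genX Q d q x i j) = splitX Q d q x i j :=
  (sat_splitX Q d q).lift_genX x i j

lemma splitHom_aGen_loop {e : E} (h : Q.tail e = Q.head e) (i j) :
    splitHom Q d q (aGen Q d q e i j) = ∑ m, outA Q d q e i m * inA Q d q e m j :=
  (splitHom_genX (Sum.inl e) i j).trans (congrFun (congrFun (splitX_inl_loop h) i) j)

lemma splitHom_dGen_loop {e : E} (h : Q.tail e = Q.head e) (i j) :
    splitHom Q d q (dGen Q d q e i j) = ∑ m, outD Q d q e i m * inD Q d q e m j :=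
  (splitHom_genX (Sum.inr e) i j).trans (congrFun (congrFun (splitX_inr_loop h) i) j)

lemma splitHom_aGen_edge {e : E} (h : Q.tail e ≠ Q.head e) (i j) :
    splitHom Q d q (aGen Q d q e i j) =
      genX (splitQuiver Q) (splitDim Q d) q (Sum.inl (.edge e h)) i j :=
  (splitHom_genX (Sum.inl e) i j).trans (congrFun (congrFun (splitX_inl_edge h) i) j)

lemma splitHom_dGen_edge {e : E} (h : Q.tail e ≠ Q.head e) (i j) :
    splitHom Q d q (dGen Q d q e i j) =
      genX (splitQuiver Q) (splitDim Q d) q (Sum.inr (.edge e h)) i j :=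
  (splitHom_genX (Sum.inr e) i j).trans (congrFun (congrFun (splitX_inr_edge h) i) j)

end Split

/-! ### Standard monomials in the split quiver at `q = 1` -/

section SplitOne

variable {V E : Type*} [DecidableEq V] [LinearOrder E] (Q : EdgeQuiver V E) (d : V → ℕ)

/-- The coordinates of the split quiver. -/
abbrev SplitCoord : Type _ := Coord (splitQuiver Q) (splitDim Q d)

open MvPolynomial

/-- The representation of the algebra of the split quiver at `q = 1` on polynomials. -/
def splitRep : SplitDq Q d (1 : ℂˣ) →ₐ[ℂ] Module.End ℂ (MvPolynomial (SplitCoord Q d) ℂ) :=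
  (diffOps (SplitCoord Q d)).val.comp (weylHom (splitQuiver_loopless Q))

variable {Q d}

lemma splitRep_inl (z : SplitEdge Q) (i j) (f : MvPolynomial (SplitCoord Q d) ℂ) :
    splitRep Q d (genX (splitQuiver Q) (splitDim Q d) 1 (Sum.inl z) i j) f =
      X (⟨z, i, j⟩ : SplitCoord Q d) * f := by
  have h := weylHom_aGen (d := splitDim Q d) (splitQuiver_loopless Q) z i j
  exact DFunLike.congr_fun (congrArg Subtype.val h) f

lemma splitRep_inr (z : SplitEdge Q) (i j) (f : MvPolynomial (SplitCoord Q d) ℂ) :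
    splitRep Q d (genX (splitQuiver Q) (splitDim Q d) 1 (Sum.inr z) i j) f =
      pderiv (⟨z, j, i⟩ : SplitCoord Q d) f := by
  have h := weylHom_dGen (d := splitDim Q d) (splitQuiver_loopless Q) z i j
  exact DFunLike.congr_fun (congrArg Subtype.val h) f

variable (Q d) in
/-- The polynomial by which a coordinate acts on the polynomials of the split quiver. -/
def splitCoord (c : Coord Q d) : MvPolynomial (SplitCoord Q d) ℂ :=
  if h : Q.tail c.1 = Q.head c.1 then
    ∑ m : Fin (d (Q.head c.1)), X (⟨.outA c.1, c.2.1, m⟩ : SplitCoord Q d) *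
      X (⟨.inA c.1, m, c.2.2⟩ : SplitCoord Q d)
  else X (⟨.edge c.1 h, c.2.1, c.2.2⟩ : SplitCoord Q d)

variable (Q d) in
/-- The polynomial by which the conjugate momentum of a loop acts. -/
def splitMom (x : Triple (fun e => d (Q.head e)) fun e => d (Q.tail e)) :
    MvPolynomial (SplitCoord Q d) ℂ :=
  ∑ m : Fin (d (Q.tail x.1)), X (⟨.outD x.1, x.2.1, m⟩ : SplitCoord Q d) *
    X (⟨.inD x.1, m, x.2.2⟩ : SplitCoord Q d)

variable (Q d) in
/-- The coordinate along which the generator `∂(e)` of an edge that is not a loop differentiates.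
Loops are given the coordinates of `outA e`, so that the map is injective. -/
def splitDir (x : Triple (fun e => d (Q.head e)) fun e => d (Q.tail e)) : SplitCoord Q d :=
  if h : Q.tail x.1 = Q.head x.1 then ⟨.outA x.1, x.2.2, x.2.1⟩
  else ⟨.edge x.1 h, x.2.2, x.2.1⟩

lemma splitRep_aGen (c : Coord Q d) (f) :
    splitRep Q d (splitHom Q d 1 (aGen Q d 1 c.1 c.2.1 c.2.2)) f = splitCoord Q d c * f := by
  by_cases h : Q.tail c.1 = Q.head c.1
  · rw [splitHom_aGen_loop h, map_sum, LinearMap.sum_apply, splitCoord, dif_pos h,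
      Finset.sum_mul]
    refine Finset.sum_congr rfl fun m _ => ?_
    rw [map_mul, Module.End.mul_apply, mul_assoc]
    exact (splitRep_inl (.outA c.1) c.2.1 m _).trans
      (congrArg _ (splitRep_inl (.inA c.1) m c.2.2 f))
  · rw [splitHom_aGen_edge h, splitCoord, dif_neg h]
    exact splitRep_inl (.edge c.1 h) c.2.1 c.2.2 f

lemma splitRep_dGen_loop (x : Triple (fun e => d (Q.head e)) fun e => d (Q.tail e)) (f)
    (h : Q.tail x.1 = Q.head x.1) :
    splitRep Q d (splitHom Q d 1 (dGen Q d 1 x.1 x.2.1 x.2.2)) f = splitMom Q d x * f := by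
  rw [splitHom_dGen_loop h, map_sum, LinearMap.sum_apply, splitMom, Finset.sum_mul]
  refine Finset.sum_congr rfl fun m _ => ?_
  rw [map_mul, Module.End.mul_apply, mul_assoc]
  exact (splitRep_inl (.outD x.1) x.2.1 m _).trans
    (congrArg _ (splitRep_inl (.inD x.1) m x.2.2 f))

lemma splitRep_dGen_edge (x : Triple (fun e => d (Q.head e)) fun e => d (Q.tail e)) (f)
    (h : ¬ Q.tail x.1 = Q.head x.1) :
    splitRep Q d (splitHom Q d 1 (dGen Q d 1 x.1 x.2.1 x.2.2)) f = pderiv (splitDir Q d x) f := by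
  rw [splitHom_dGen_edge h, splitDir, dif_neg h]
  exact splitRep_inr (.edge x.1 h) x.2.1 x.2.2 f

variable (Q d) in
/-- The substitution that turns the factors `inA` and `inD` into identity matrices. -/
def splitEval : MvPolynomial (SplitCoord Q d) ℂ →ₐ[ℂ] MvPolynomial (Coord Q d ⊕ Coord Q d) ℂ :=
  aeval fun
    | ⟨.edge e _, i, j⟩ => X (Sum.inl (⟨e, i, j⟩ : Coord Q d))
    | ⟨.outA e, i, j⟩ => X (Sum.inl (⟨e, i, j⟩ : Coord Q d))
    | ⟨.outD e, i, j⟩ => X (Sum.inr (⟨e, j, i⟩ : Coord Q d))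
    | ⟨.inA _, i, j⟩ => if (i : ℕ) = j then 1 else 0
    | ⟨.inD _, i, j⟩ => if (i : ℕ) = j then 1 else 0

lemma splitEval_coord (c : Coord Q d) : splitEval Q d (splitCoord Q d c) = X (Sum.inl c) := by
  unfold splitCoord
  split_ifs with h
  · have : ∀ m : Fin (d (Q.head c.1)), splitEval Q d (X (⟨.outA c.1, c.2.1, m⟩ : SplitCoord Q d) *
      X (⟨.inA c.1, m, c.2.2⟩ : SplitCoord Q d)) =
        if m = c.2.2 then X (Sum.inl (⟨c.1, c.2.1, m⟩ : Coord Q d)) else 0 := by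
      intro m
      rw [map_mul, splitEval, aeval_X, aeval_X]
      refine (mul_ite _ _ _ _).trans ?_
      rw [mul_one, mul_zero]
      exact if_congr Fin.ext_iff.symm rfl rfl
    rw [map_sum, Finset.sum_congr rfl fun m _ => this m, Finset.sum_ite_eq' Finset.univ,
      if_pos (Finset.mem_univ _)]
  · rw [splitEval, aeval_X]

lemma splitEval_mom (x : Triple (fun e => d (Q.head e)) fun e => d (Q.tail e)) :
    splitEval Q d (splitMom Q d x) = X (Sum.inr (transp x)) := by
  have : ∀ m : Fin (d (Q.tail x.1)), splitEval Q d (X (⟨.outD x.1, x.2.1, m⟩ : SplitCoord Q d) *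
    X (⟨.inD x.1, m, x.2.2⟩ : SplitCoord Q d)) =
      if m = x.2.2 then X (Sum.inr (⟨x.1, m, x.2.1⟩ : Coord Q d)) else 0 := by
    intro m
    rw [map_mul, splitEval, aeval_X, aeval_X]
    refine (mul_ite _ _ _ _).trans ?_
    rw [mul_one, mul_zero]
    exact if_congr Fin.ext_iff.symm rfl rfl
  rw [splitMom, map_sum, Finset.sum_congr rfl fun m _ => this m, Finset.sum_ite_eq' Finset.univ,
    if_pos (Finset.mem_univ _)]
  rfl

variable (Q d) in
/-- A left inverse of `splitDir`. -/
def splitDirInv : SplitCoord Q d → Option (Triple (fun e => d (Q.head e)) fun e => d (Q.tail e))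
  | ⟨.edge e _, i, j⟩ => some ⟨e, j, i⟩
  | ⟨.outA e, i, j⟩ => some ⟨e, j, i⟩
  | _ => none

lemma splitDirInv_splitDir (x) : splitDirInv Q d (splitDir Q d x) = some x := by
  unfold splitDir
  split_ifs <;> rfl

lemma pderiv_splitMom (x y : Triple (fun e => d (Q.head e)) fun e => d (Q.tail e)) :
    pderiv (splitDir Q d x) (splitMom Q d y) = 0 := by
  have h1 : ∀ m, splitDir Q d x ≠ (⟨.outD y.1, y.2.1, m⟩ : SplitCoord Q d) := fun m h => by
    have := congrArg (splitDirInv Q d) h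
    rw [splitDirInv_splitDir] at this
    exact Option.some_ne_none _ this
  have h2 : ∀ m, splitDir Q d x ≠ (⟨.inD y.1, m, y.2.2⟩ : SplitCoord Q d) := fun m h => by
    have := congrArg (splitDirInv Q d) h
    rw [splitDirInv_splitDir] at this
    exact Option.some_ne_none _ this
  rw [splitMom, map_sum]
  refine Finset.sum_eq_zero fun m _ => ?_
  rw [Derivation.leibniz, pderiv_X_of_ne (h1 m).symm, pderiv_X_of_ne (h2 m).symm, smul_zero,
    smul_zero, add_zero]

lemma symD_eq (s : StdIndex Q d) :
    symD s = (s.2.1.filter fun x => ¬ Q.tail x.1 = Q.head x.1).map transp := by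
  unfold symD
  congr!

variable (Q d) in
/-- The operators by which the standard monomials act on the polynomials of the split quiver are
independent. -/
lemma linearIndependent_split :
    LinearIndependent ℂ fun s => splitRep Q d (splitHom Q d (1 : ℂˣ) (stdMon Q d 1 s)) := by
  let Φ : MvPolynomial (SplitCoord Q d) ℂ →
      (Module.End ℂ (MvPolynomial (SplitCoord Q d) ℂ) →ₗ[ℂ]
        MvPolynomial (Coord Q d ⊕ Coord Q d) ℂ) := fun f =>
    (splitEval Q d).toLinearMap ∘ₗ LinearMap.applyₗ f
  refine linearIndependent_of_maps Φ _ fun c hc => ?_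
  refine eq_zero_of_sum_stdSymbol Q d (splitEval Q d)
    (fun s => (s.2.1.filter fun x => ¬ Q.tail x.1 = Q.head x.1).map (splitDir Q d))
    (fun s s' h => ?_) c fun f => ?_
  · have h := (h.filterMap (splitDirInv Q d)).map transp
    rw [List.filterMap_map, List.filterMap_map,
      show splitDirInv Q d ∘ splitDir Q d = some from funext splitDirInv_splitDir,
      List.filterMap_some, List.filterMap_some] at h
    rwa [symD_eq, symD_eq]
  · rw [← hc f]
    refine Finsupp.sum_congr fun s _ => congrArg _ ?_
    have h0 : splitRep Q d (splitHom Q d (1 : ℂˣ) (stdMon Q d 1 s)) =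
        (s.1.1.map fun c => splitRep Q d (splitHom Q d 1 (aGen Q d 1 c.1 c.2.1 c.2.2))).prod *
        (s.2.1.map fun x => splitRep Q d (splitHom Q d 1 (dGen Q d 1 x.1 x.2.1 x.2.2))).prod := by
      rw [map_stdMon, stdMonomial, map_mul, map_list_prod, map_list_prod, List.map_map,
        List.map_map]
      rfl
    have h1 : splitRep Q d (splitHom Q d (1 : ℂˣ) (stdMon Q d 1 s)) f =
        (s.1.1.map (splitCoord Q d)).prod *
          ((s.2.1.filter fun x => Q.tail x.1 = Q.head x.1).map (splitMom Q d)).prod *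
          dList ((s.2.1.filter fun x => ¬ Q.tail x.1 = Q.head x.1).map (splitDir Q d)) f := by
      rw [h0]
      convert prod_operators_apply s.1.1 s.2.1 (fun x => Q.tail x.1 = Q.head x.1) (splitCoord Q d)
        (splitMom Q d) (splitDir Q d) (fun x y _ _ => pderiv_splitMom x y) _ _
        splitRep_aGen splitRep_dGen_loop splitRep_dGen_edge f
    have h2 : Φ f (splitRep Q d (splitHom Q d (1 : ℂˣ) (stdMon Q d 1 s))) =
        splitEval Q d (splitRep Q d (splitHom Q d (1 : ℂˣ) (stdMon Q d 1 s)) f) := rfl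
    rw [h2, h1, map_mul, map_mul, map_list_prod, map_list_prod, List.map_map, List.map_map,
      prod_map_symX]
    simp only [Function.comp_def, splitEval_coord, splitEval_mom]

end SplitOne

/-! ### Evaluation of Laurent polynomials -/

section Laurent

open LaurentPolynomial

/-- The evaluation at a nonzero complex number. -/
abbrev evalAt (z : ℂˣ) : ℂ[T;T⁻¹] →+* ℂ := eval₂ (RingHom.id ℂ) z

lemma evalAt_surjective (z : ℂˣ) : Function.Surjective (evalAt z) :=
  fun c => ⟨C c, eval₂_C _ _ c⟩

lemma evalAt_T_sub (z : ℂˣ) : evalAt z (T 1 - C (z : ℂ)) = 0 := by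
  rw [map_sub, evalAt, eval₂_C, eval₂_T, zpow_one, RingHom.id_apply, sub_self]

lemma dvd_of_evalAt_eq_zero {z : ℂˣ} {c : ℂ[T;T⁻¹]} (h : evalAt z c = 0) :
    T 1 - C (z : ℂ) ∣ c := by
  obtain ⟨n, f, hf⟩ := exists_T_pow c
  have h1 : Polynomial.eval (z : ℂ) f = 0 := by
    have := eval₂_toLaurent (RingHom.id ℂ) z f
    rw [hf, map_mul, show eval₂ (RingHom.id ℂ) z c = 0 from h, zero_mul] at this
    exact this.symm
  obtain ⟨g, hg⟩ := Polynomial.dvd_iff_isRoot.mpr h1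
  rw [← (isUnit_T (R := ℂ) n).dvd_mul_right, ← hf, hg, map_mul, map_sub, Polynomial.toLaurent_X,
    Polynomial.toLaurent_C]
  exact dvd_mul_right _ _

lemma isNoetherianRing_laurent : IsNoetherianRing ℂ[T;T⁻¹] :=
  IsLocalization.isNoetherianRing (Submonoid.powers (Polynomial.X : Polynomial ℂ)) _ inferInstance

lemma eq_zero_of_forall_pow_dvd {z : ℂˣ} {c : ℂ[T;T⁻¹]}
    (h : ∀ n : ℕ, (T 1 - C (z : ℂ)) ^ n ∣ c) : c = 0 := by
  have := isNoetherianRing_laurent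
  by_contra hc
  have hu : ¬ IsUnit (T 1 - C (z : ℂ)) := fun hu => by
    have := hu.map (evalAt z)
    rw [evalAt_T_sub] at this
    exact not_isUnit_zero this
  obtain ⟨n, hn⟩ := FiniteMultiplicity.of_not_isUnit hu hc
  exact hn (h _)

end Laurent

/-! ### Specializations -/

section Special

variable {V E : Type*} [DecidableEq V] [LinearOrder E] [Finite E] (Q : EdgeQuiver V E) (d : V → ℕ)

/-- The properties of `fibreHom`, for a surjective change of scalars. The value of the parameter in
`k'` is a variable, so that it can be a given unit that equals `mapUnit k' q` only
propositionally. -/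
lemma exists_specialization {k k' : Type*} [CommRing k] [CommRing k'] [Algebra k k']
    (hs : Function.Surjective (algebraMap k k')) {q : kˣ} {q' : k'ˣ} (hq : mapUnit k' q = q')
    {t : k} (ht : ∀ c, algebraMap k k' c = 0 → t ∣ c) :
    ∃ φ : Dq Q d q →+* Dq Q d q',
      (∀ f, φ (algebraMap k _ f) = algebraMap k' _ (algebraMap k k' f)) ∧
      (∀ e i j, φ (aGen Q d q e i j) = aGen Q d q' e i j) ∧
      (∀ e i j, φ (dGen Q d q e i j) = dGen Q d q' e i j) ∧ Function.Surjective φ ∧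
      (LinearIndependent k' (stdMon Q d q') → ∀ x, φ x = 0 → ∃ y, x = t • y) := by
  subst hq
  refine ⟨(fibreHom d q Q k').toRingHom, fun f => ?_, fibreHom_aGen d q Q k',
    fibreHom_dGen d q Q k', fibreHom_surjective d q Q k' hs, fun h x hx => ?_⟩
  · exact ((fibreHom d q Q k').commutes f).trans (IsScalarTower.algebraMap_apply k k' _ f)
  · have h' : LinearIndependent k' fun s => (fibreHom d q Q k').toLinearMap (stdMon Q d q s) := by
      have e : (fun s => (fibreHom d q Q k').toLinearMap (stdMon Q d q s)) =
        stdMon Q d (mapUnit k' q) := funext (fibreHom_stdMon d q Q k')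
      rwa [e]
    exact exists_smul_eq_of_map_eq_zero (fibreHom d q Q k').toLinearMap h' ht hx

/-- The fibre of the family over `ℂ[q, q⁻¹]` at a nonzero complex number. -/
lemma exists_fibre (z : ℂˣ) : ∃ φ : Dq Q d qUnit →+* Dq Q d z,
    (∀ f, φ (algebraMap ℂ[T;T⁻¹] _ f) = algebraMap ℂ _ (evalAt z f)) ∧
    (∀ e i j, φ (aGen Q d qUnit e i j) = aGen Q d z e i j) ∧
    (∀ e i j, φ (dGen Q d qUnit e i j) = dGen Q d z e i j) ∧ Function.Surjective φ ∧
    (LinearIndependent ℂ (stdMon Q d z) → ∀ x, φ x = 0 →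
      ∃ y, x = (LaurentPolynomial.T 1 - LaurentPolynomial.C (z : ℂ) : ℂ[T;T⁻¹]) • y) := by
  let _ : Algebra ℂ[T;T⁻¹] ℂ := (evalAt z).toAlgebra
  have hq : mapUnit ℂ qUnit = z := Units.ext (by
    change evalAt z (LaurentPolynomial.T 1) = z
    rw [evalAt, LaurentPolynomial.eval₂_T, zpow_one])
  exact exists_specialization Q d (evalAt_surjective z) hq fun c => dvd_of_evalAt_eq_zero

/-- Independence over `ℂ[q, q⁻¹]` is inherited by the fibres. -/
lemma linearIndependent_fibre (h : LinearIndependent ℂ[T;T⁻¹] (stdMon Q d qUnit)) (z : ℂˣ) :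
    LinearIndependent ℂ (stdMon Q d z) := by
  let _ : Algebra ℂ[T;T⁻¹] ℂ := (evalAt z).toAlgebra
  have hq : mapUnit ℂ qUnit = z := Units.ext (by
    change evalAt z (LaurentPolynomial.T 1) = z
    rw [evalAt, LaurentPolynomial.eval₂_T, zpow_one])
  have := linearIndependent_stdMon_of_basis (k' := ℂ) h
  rwa [hq] at this

end Special

/-! ### Torsion -/

section Torsion

/-- A homomorphism whose kernel consists of multiples of `t`, from an algebra over a domain that
has a normalized functional to a simple ring, kills the `t`-torsion: the images of the torsion
elements form an ideal, and if this ideal contained `1`, then an element `1 + t y` would be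
torsion. -/
lemma map_eq_zero_of_torsion {k D W : Type*} [CommRing k] [IsDomain k] [Ring D] [Algebra k D]
    [Ring W] [Algebra ℂ W]
    (hW : ∀ I : Set W, (∀ P ∈ I, ∀ a, comm P a ∈ I) → (∀ P ∈ I, ∀ a, comm a P ∈ I) →
      (∀ P ∈ I, ∀ c : ℂ, c • P ∈ I) → ∀ P ∈ I, P ≠ 0 → 1 ∈ I)
    {θ : D →+* W} (hθ : Function.Surjective θ) {t : k} (ht0 : t ≠ 0) (ht : ¬ IsUnit t)
    (hker : ∀ x, θ x = 0 → ∃ y, x = t • y) (ψ : D →ₗ[k] k) (hψ : ψ 1 = 1) {x : D} {r : ℕ}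
    (hx : t ^ r • x = 0) : θ x = 0 := by
  by_contra h0
  let I : Set W := {P | ∃ x : D, (∃ r : ℕ, t ^ r • x = 0) ∧ θ x = P}
  have h1 : (1 : W) ∈ I := by
    refine hW I ?_ ?_ ?_ _ ⟨x, ⟨r, hx⟩, rfl⟩ h0
    · rintro _ ⟨x, ⟨r, hx⟩, rfl⟩ a
      obtain ⟨a, rfl⟩ := hθ a
      refine ⟨comm x a, ⟨r, ?_⟩, ?_⟩
      · have e1 : t ^ r • (x * a) = 0 := by rw [← smul_mul_assoc, hx, zero_mul]
        have e2 : t ^ r • (a * x) = 0 := by rw [← mul_smul_comm, hx, mul_zero]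
        rw [comm, smul_sub, e1, e2, sub_self]
      · rw [comm, comm, map_sub, map_mul, map_mul]
    · rintro _ ⟨x, ⟨r, hx⟩, rfl⟩ a
      obtain ⟨a, rfl⟩ := hθ a
      refine ⟨comm a x, ⟨r, ?_⟩, ?_⟩
      · have e1 : t ^ r • (x * a) = 0 := by rw [← smul_mul_assoc, hx, zero_mul]
        have e2 : t ^ r • (a * x) = 0 := by rw [← mul_smul_comm, hx, mul_zero]
        rw [comm, smul_sub, e1, e2, sub_self]
      · rw [comm, comm, map_sub, map_mul, map_mul]
    · rintro _ ⟨x, ⟨r, hx⟩, rfl⟩ c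
      obtain ⟨a, ha⟩ := hθ (algebraMap ℂ W c)
      refine ⟨a * x, ⟨r, ?_⟩, ?_⟩
      · rw [← mul_smul_comm, hx, mul_zero]
      · rw [map_mul, ha, Algebra.smul_def]
  obtain ⟨x, ⟨r, hx⟩, hx1⟩ := h1
  obtain ⟨y, hy⟩ := hker (x - 1) (by rw [map_sub, hx1, map_one, sub_self])
  have h2 : ψ x = 1 + t * ψ y := by
    rw [← sub_add_cancel x 1, hy, map_add, map_smul, hψ, smul_eq_mul, add_comm]
  have h3 : t ^ r * ψ x = 0 := by rw [← smul_eq_mul, ← map_smul, hx, map_zero]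
  have h4 : ψ x = 0 := (mul_eq_zero.mp h3).resolve_left (pow_ne_zero r ht0)
  refine ht (IsUnit.of_mul_eq_one (-ψ y) ?_)
  rw [h2] at h4
  linear_combination -h4

/-- If a specialization at `z` maps the elements `m s` to independent ones, then the coefficients of
a combination in its kernel are divisible by `q - z`. -/
lemma exists_eq_smul_of_map_eq_zero {D W ι : Type*} [Ring D] [Algebra ℂ[T;T⁻¹] D] [Ring W]
    [Algebra ℂ W] {z : ℂˣ} (θ : D →+* W)
    (hθ : ∀ f, θ (algebraMap ℂ[T;T⁻¹] D f) = algebraMap ℂ W (evalAt z f)) {m : ι → D} {w : ι → W}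
    (hm : ∀ s, θ (m s) = w s) (hw : LinearIndependent ℂ w) {c : ι →₀ ℂ[T;T⁻¹]}
    (hc : θ (Finsupp.linearCombination ℂ[T;T⁻¹] m c) = 0) :
    ∃ c', c = (LaurentPolynomial.T 1 - LaurentPolynomial.C (z : ℂ) : ℂ[T;T⁻¹]) • c' := by
  have h5 : ∀ s, evalAt z (c s) = 0 := by
    have h6 : θ (Finsupp.linearCombination ℂ[T;T⁻¹] m c) =
        ∑ s ∈ c.support, evalAt z (c s) • w s := by
      rw [Finsupp.linearCombination_apply, Finsupp.sum, map_sum]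
      refine Finset.sum_congr rfl fun s _ => ?_
      rw [Algebra.smul_def, map_mul, hθ, hm, ← Algebra.smul_def]
    rw [hc] at h6
    have := linearIndependent_iff'.mp hw _ _ h6.symm
    intro s
    by_cases hs : s ∈ c.support
    · exact this s hs
    · rw [Finsupp.notMem_support_iff.mp hs, map_zero]
  choose g hg using fun s => dvd_of_evalAt_eq_zero (h5 s)
  classical
  refine ⟨Finsupp.onFinset c.support (fun s => if s ∈ c.support then g s else 0)
    fun s hs => ?_, ?_⟩
  · by_contra h
    exact hs (if_neg h)
  · ext1 s
    rw [Finsupp.smul_apply, Finsupp.onFinset_apply]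
    split_ifs with hs
    · exact hg s
    · rw [Finsupp.notMem_support_iff.mp hs, smul_zero]

end Torsion

/-! ### The standard monomials are a basis -/

section Basis

variable {V E : Type*} [DecidableEq V] [LinearOrder E] [Finite E] (Q : EdgeQuiver V E) (d : V → ℕ)

open LaurentPolynomial

/-- The family of the split quiver over `ℂ[q, q⁻¹]`, specialized at `q = 1` to differential
operators: torsion elements are in the kernel, and the specialization is compatible with the
splitting of loops. -/
lemma exists_splitSpecial : ∃ θ : SplitDq Q d qUnit →+*
      Module.End ℂ (MvPolynomial (SplitCoord Q d) ℂ),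
    (∀ f, θ (algebraMap ℂ[T;T⁻¹] _ f) = algebraMap ℂ _ (evalAt 1 f)) ∧
    (∀ x (r : ℕ), (T 1 - C 1 : ℂ[T;T⁻¹]) ^ r • x = 0 → θ x = 0) ∧
    (∀ s, θ (splitHom Q d qUnit (stdMon Q d qUnit s)) =
      splitRep Q d (splitHom Q d (1 : ℂˣ) (stdMon Q d 1 s))) := by
  have hQ := splitQuiver_loopless Q
  obtain ⟨φ, h1, h2, h3, h4, h5⟩ := exists_fibre (splitQuiver Q) (splitDim Q d) (1 : ℂˣ)
  obtain ⟨ψ, hψ⟩ := exists_functional_of_loopless (splitQuiver Q) (splitDim Q d) qUnit hQ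
  have hli : LinearIndependent ℂ (stdMon (splitQuiver Q) (splitDim Q d) (1 : ℂˣ)) :=
    (linearIndependent_weylHom (d := splitDim Q d) hQ).of_comp (weylHom hQ).toLinearMap
  have hinj : Function.Injective (weylHom (d := splitDim Q d) hQ) :=
    injective_of_linearIndependent (weylHom hQ).toLinearMap (linearIndependent_weylHom hQ)
  let θ : SplitDq Q d qUnit →+* diffOps (SplitCoord Q d) := (weylHom hQ).toRingHom.comp φ
  have h1' : (T 1 - C 1 : ℂ[T;T⁻¹]) = T 1 - C ((1 : ℂˣ) : ℂ) := rfl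
  refine ⟨(splitRep Q d).toRingHom.comp φ, fun f => ?_, fun x r hx => ?_, fun s => ?_⟩
  · exact (congrArg (splitRep Q d) (h1 f)).trans ((splitRep Q d).commutes _)
  · suffices h : θ x = 0 from congrArg Subtype.val h
    refine map_eq_zero_of_torsion (θ := θ) (fun I a b c P hP => one_mem_of_ideal I a b c hP)
      ((weylHom_surjective hQ).comp h4) (t := (T 1 - C 1 : ℂ[T;T⁻¹])) ?_ ?_ (fun x hx => ?_) ψ hψ hx
    · intro h0
      have h00 := congrArg (evalAt (Units.mk0 2 two_ne_zero)) h0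
      rw [map_sub, map_zero, evalAt, eval₂_C, eval₂_T, zpow_one, RingHom.id_apply, Units.val_mk0]
        at h00
      norm_num at h00
    · intro hu
      have := hu.map (evalAt 1)
      rw [h1', evalAt_T_sub] at this
      exact not_isUnit_zero this
    · refine h5 hli x (hinj ?_)
      rw [map_zero]
      exact hx
  · have ha : ∀ e i j, φ (splitHom Q d qUnit (aGen Q d qUnit e i j)) =
        splitHom Q d (1 : ℂˣ) (aGen Q d 1 e i j) := by
      intro e i j
      by_cases he : Q.tail e = Q.head e
      · rw [splitHom_aGen_loop he, splitHom_aGen_loop he, map_sum]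
        refine Finset.sum_congr rfl fun m _ => ?_
        rw [map_mul]
        exact congrArg₂ _ (h2 (.outA e) i m) (h2 (.inA e) m j)
      · rw [splitHom_aGen_edge he, splitHom_aGen_edge he]
        exact h2 (.edge e he) i j
    have hd : ∀ e i j, φ (splitHom Q d qUnit (dGen Q d qUnit e i j)) =
        splitHom Q d (1 : ℂˣ) (dGen Q d 1 e i j) := by
      intro e i j
      by_cases he : Q.tail e = Q.head e
      · rw [splitHom_dGen_loop he, splitHom_dGen_loop he, map_sum]
        refine Finset.sum_congr rfl fun m _ => ?_
        rw [map_mul]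
        exact congrArg₂ _ (h2 (.outD e) i m) (h2 (.inD e) m j)
      · rw [splitHom_dGen_edge he, splitHom_dGen_edge he]
        exact h3 (.edge e he) i j
    have hs : φ (splitHom Q d qUnit (stdMon Q d qUnit s)) =
        splitHom Q d (1 : ℂˣ) (stdMon Q d 1 s) := by
      rw [← AlgHom.coe_toRingHom, ← RingHom.comp_apply, map_stdMon, map_stdMon]
      simp only [RingHom.comp_apply, AlgHom.coe_toRingHom, ha, hd]
    exact congrArg (splitRep Q d) hs

/-- The coefficients of a relation between the standard monomials are divisible by all powers of
`q - 1`, hence vanish: once they are divided by `(q - 1)^r`, the image of the relation in the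
algebra of the split quiver is still `(q - 1)`-torsion, hence zero at `q = 1`, where the images of
the standard monomials are independent. -/
theorem linearIndependent_stdMon : LinearIndependent ℂ[T;T⁻¹] (stdMon Q d qUnit) := by
  obtain ⟨θ, h1, h2, h3⟩ := exists_splitSpecial Q d
  refine linearIndependent_of_maps (fun _ : Unit => (splitHom Q d qUnit).toLinearMap) _
    fun c hc => ?_
  replace hc := hc ()
  set t : ℂ[T;T⁻¹] := T 1 - C 1 with ht
  let S : (StdIndex Q d →₀ ℂ[T;T⁻¹]) →ₗ[ℂ[T;T⁻¹]] SplitDq Q d qUnit :=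
    Finsupp.linearCombination _ fun s => splitHom Q d qUnit (stdMon Q d qUnit s)
  have hS0 : S c = 0 := hc
  have step : ∀ (c : StdIndex Q d →₀ ℂ[T;T⁻¹]) (r : ℕ), t ^ r • S c = 0 → ∃ c', c = t • c' := by
    intro c r hr
    exact exists_eq_smul_of_map_eq_zero (z := 1) θ h1 h3 (linearIndependent_split Q d) (h2 _ r hr)
  have key : ∀ n : ℕ, ∃ c', c = t ^ n • c' := by
    intro n
    induction n with
    | zero => exact ⟨c, by rw [pow_zero, one_smul]⟩
    | succ n ih =>
      obtain ⟨c', hc'⟩ := ih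
      obtain ⟨c'', rfl⟩ := step c' n (by rw [← map_smul, ← hc', hS0])
      exact ⟨c'', by rw [hc', smul_smul, pow_succ]⟩
  ext1 s
  refine eq_zero_of_forall_pow_dvd (z := 1) fun n => ?_
  obtain ⟨c', hc'⟩ := key n
  exact ⟨c' s, by rw [hc']; rfl⟩

end Basis

end QuiverDq

end

theorem mainTheorem1 {V E : Type*} [DecidableEq V] [LinearOrder E] [Finite E]
    (Q : QuiverDq.EdgeQuiver V E) (d : V → ℕ) :
    -- for every nonzero complex number q the standard monomials are a basis of D_q
    (∀ q : ℂˣ, ∃ b : Module.Basis (QuiverDq.StdIndex Q d) ℂ (QuiverDq.Dq Q d q),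
      ∀ s, b s = QuiverDq.stdMonomial Q d (QuiverDq.aGen Q d q) (QuiverDq.dGen Q d q) s) ∧
    -- the family over ℂ[q, q⁻¹] is free, with the standard monomials as a basis
    (∃ b : Module.Basis (QuiverDq.StdIndex Q d) ℂ[T;T⁻¹] (QuiverDq.Dq Q d QuiverDq.qUnit),
      ∀ s, b s = QuiverDq.stdMonomial Q d (QuiverDq.aGen Q d QuiverDq.qUnit)
        (QuiverDq.dGen Q d QuiverDq.qUnit) s) ∧
    -- its fibre at the point q₀ is the algebra D_q with q = q₀
    (∀ q₀ : ℂˣ, ∃ φ : QuiverDq.Dq Q d QuiverDq.qUnit →+* QuiverDq.Dq Q d q₀,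
      (∀ f : ℂ[T;T⁻¹], φ (algebraMap ℂ[T;T⁻¹] (QuiverDq.Dq Q d QuiverDq.qUnit) f) =
        algebraMap ℂ (QuiverDq.Dq Q d q₀)
          (LaurentPolynomial.eval₂ (RingHom.id ℂ) q₀ f)) ∧
      (∀ e i j, φ (QuiverDq.aGen Q d QuiverDq.qUnit e i j) = QuiverDq.aGen Q d q₀ e i j) ∧
      (∀ e i j, φ (QuiverDq.dGen Q d QuiverDq.qUnit e i j) = QuiverDq.dGen Q d q₀ e i j) ∧
      Function.Surjective φ ∧
      RingHom.ker φ = Ideal.span {algebraMap ℂ[T;T⁻¹] (QuiverDq.Dq Q d QuiverDq.qUnit)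
        (LaurentPolynomial.T 1 - LaurentPolynomial.C (q₀ : ℂ))}) ∧
    -- the standard monomials are a basis of the classical algebra D(Mat_d(Q))
    (∃ b : Module.Basis (QuiverDq.StdIndex Q d) ℂ
        (QuiverDq.diffOps (QuiverDq.Coord Q d)),
      ∀ s, b s = QuiverDq.stdMonomial Q d
        (fun e i j => QuiverDq.mulX (⟨e, i, j⟩ : QuiverDq.Coord Q d))
        (fun e i j => QuiverDq.partialX (⟨e, j, i⟩ : QuiverDq.Coord Q d)) s) ∧
    -- the fibre at q = 1 of a quiver without loops is D(Mat_d(Q))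
    ((∀ e, Q.tail e ≠ Q.head e) →
      ∃ φ : QuiverDq.Dq Q d (1 : ℂˣ) ≃ₐ[ℂ] QuiverDq.diffOps (QuiverDq.Coord Q d),
        (∀ e i j, φ (QuiverDq.aGen Q d 1 e i j) =
          QuiverDq.mulX (⟨e, i, j⟩ : QuiverDq.Coord Q d)) ∧
        (∀ e i j, φ (QuiverDq.dGen Q d 1 e i j) =
          QuiverDq.partialX (⟨e, j, i⟩ : QuiverDq.Coord Q d))) ∧
    -- the fibre at q = 1 of any quiver: the edges that are not loops contribute differential
    -- operators, the loops contribute functions on the cotangent bundle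
    (∃ φ : QuiverDq.Dq Q d (1 : ℂˣ) ≃ₐ[ℂ]
        QuiverDq.diffOps (QuiverDq.EdgeCoord Q d) ⊗[ℂ] QuiverDq.LoopCotangent Q d,
      (∀ e i j, ∀ h : Q.tail e ≠ Q.head e, φ (QuiverDq.aGen Q d 1 e i j) =
        QuiverDq.mulX (⟨⟨e, i, j⟩, h⟩ : QuiverDq.EdgeCoord Q d) ⊗ₜ[ℂ] 1) ∧
      (∀ e i j, ∀ h : Q.tail e ≠ Q.head e, φ (QuiverDq.dGen Q d 1 e i j) =
        QuiverDq.partialX (⟨⟨e, j, i⟩, h⟩ : QuiverDq.EdgeCoord Q d) ⊗ₜ[ℂ] 1) ∧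
      (∀ e i j, ∀ h : Q.tail e = Q.head e, φ (QuiverDq.aGen Q d 1 e i j) =
        1 ⊗ₜ[ℂ] MvPolynomial.X
          (Sum.inl (⟨⟨e, i, j⟩, h⟩ : QuiverDq.LoopCoord Q d))) ∧
      (∀ e i j, ∀ h : Q.tail e = Q.head e, φ (QuiverDq.dGen Q d 1 e i j) =
        1 ⊗ₜ[ℂ] MvPolynomial.X
          (Sum.inr (⟨⟨e, j, i⟩, h⟩ : QuiverDq.LoopCoord Q d)))) := by
  have hli := QuiverDq.linearIndependent_stdMon Q d
  have hfib := QuiverDq.linearIndependent_fibre Q d hli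
  refine ⟨fun q => ?_, ?_, fun q₀ => ?_, QuiverDq.exists_basis_diffOps,
    QuiverDq.exists_algEquiv_diffOps, QuiverDq.exists_algEquiv_classicalFibre Q d⟩
  · exact ⟨Module.Basis.mk (hfib q) (QuiverDq.span_stdMonomial Q d q).ge,
      fun s => Module.Basis.mk_apply _ _ s⟩
  · exact ⟨Module.Basis.mk hli (QuiverDq.span_stdMonomial Q d QuiverDq.qUnit).ge,
      fun s => Module.Basis.mk_apply _ _ s⟩
  · obtain ⟨φ, h1, h2, h3, h4, h5⟩ := QuiverDq.exists_fibre Q d q₀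
    refine ⟨φ, h1, h2, h3, h4, le_antisymm (fun x hx => ?_) ?_⟩
    · obtain ⟨y, rfl⟩ := h5 (hfib q₀) x hx
      rw [Ideal.mem_span_singleton', Algebra.smul_def]
      exact ⟨y, (Algebra.commutes _ _).symm⟩
    · rw [Ideal.span_singleton_le_iff_mem, RingHom.mem_ker, h1, QuiverDq.evalAt_T_sub, map_zero]
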